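/- **Setting.** Let $\mathbb F_q$ be a finite field, $C$ a smooth projective geometrically irreducible curve over $\mathbb F_q$, $\infty\in C(\mathbb F_q)$ a rational point, $A=\Gamma(C\smallsetminus\{\infty\},\mathcal O_C)$ and $Q=\mathbb F_q(C)=\operatorname{Frac}A$. Let $L=\mathbb F_s$ be a finite extension of $\mathbb F_q$ with $s=q^e$, let $c:\operatorname{Spec}L\to C$ be an $\mathbb F_q$-morphism with image the closed point $\varepsilon$ (the characteristic point), let $C_L=C\times\operatorname{Spec}L$, and let $\sigma=\mathrm{id}_C\times\operatorname{Spec}(\mathrm{Frob}_q)$ on $C_L$. An *abelian $\tau$-sheaf* $\mathcal F=(\mathcal F_i,\Pi_i,\tau_i)_{i\in\mathbb Z}$ of rank $r$, dimension $d$ and characteristic $c$ over $L$ consists of locally free sheaves $\mathcal F_i$ of rank $r$ on $C_L$ and injective homomorphisms $\Pi_i:\mathcal F_i\to\mathcal F_{i+1}$, $\tau_i:\sigma^*\mathcal F_i\to\mathcal F_{i+1}$ with $\Pi_{i+1}\circ\tau_i=\tau_{i+1}\circ\sigma^*\Pi_i$, such that (a) there are integers $k,l>0$ with $ld=kr$ such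 that $\Pi_{i+l-1}\circ\dots\circ\Pi_i$ identifies $\mathcal F_i$ with $\mathcal F_{i+l}(-k\cdot\infty)$ for all $i$; (b) $\dim_L\operatorname{coker}\Pi_i=d$; (c) $\dim_L\operatorname{coker}\tau_i=d$ and $\operatorname{coker}\tau_i$ is annihilated by $\mathcal I^d$, where $\mathcal I$ is the ideal sheaf of the graph of $c$. (The case $r=d=0$ is allowed.) Its *weight* is $d/r$ (and $0$ if $r=0$). A *morphism* $f:\mathcal F\to\mathcal F'$ is a family $f_i:\mathcal F_i\to\mathcal F'_i$ commuting with the $\Pi$'s and the $\tau$'s; $\mathcal F'$ is an *abelian quotient $\tau$-sheaf* of $\mathcal F$ if there is a morphism $\mathcal F\to\mathcal F'$ with all $f_i$ surjective. An *isogeny* is a morphism with all $f_i$ injective between abelian $\tau$-sheaves of the same rank and dimension. A *quasi-morphism* (resp. *quasi-isogeny*) from $\mathcal F$ to $\mathcal F'$ is a morphism (resp. isogeny) $\mathcal F\to\mathcal F'(D)$ for some effective divisor $D$ on $C$, and two quasi-morphisms are identified if they agree after enlarging $D$. The quasi-morphisms $\mathcal F\to\mathcal F$ form a $Q$-algebra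 $\operatorname{QEnd}(\mathcal F)$. The *$s$-Frobenius* $\pi\in\operatorname{QEnd}(\mathcal F)$ is induced by $\tau_{i+e-1}\circ\dots\circ(\sigma^*)^{e-1}\tau_i:\mathcal F_i=(\sigma^*)^e\mathcal F_i\to\mathcal F_{i+e}$, where $\mathcal F_{i+e}$ is regarded as a subsheaf of $\mathcal F_i(n\cdot\infty)$ for $n\gg0$ by means of the $\Pi$'s. Let $\mu_\pi\in Q[x]$ be its minimal polynomial over $Q$. Let $G=\operatorname{Gal}(L^{\rm sep}/L)$ and let $M(\mathcal F)=\bigl(\Gamma(C_L\smallsetminus\{\infty\},\mathcal F_0),\ \tau=\Pi_0^{-1}\circ\tau_0\bigr)$. For a place $v\ne\infty,\varepsilon$ of $C$ (a maximal ideal of $A$) let $A_v\subset Q_v$ be the completions at $v$, let $T_v\mathcal F=\varprojlim_n\bigl((M(\mathcal F)/v^nM(\mathcal F))\otimes_LL^{\rm sep}\bigr)^{\tau}$ (the invariants of $\tau\otimes\mathrm{Frob}_q$), and let $V_v\mathcal F=T_v\mathcal F\otimes_{A_v}Q_v$, a $Q_v$-vector space of dimension $r$ with an action of $G$. Let $\pi_v$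 be the endomorphism of $V_v\mathcal F$ induced by $\pi$ and $\chi_v$ its characteristic polynomial. Set $Z_{M(\mathcal F)}(t)=\prod_{0\le i\le r}\det\bigl(1-t\wedge^i\pi_v\bigr)^{(-1)^{i+1}}$, which may be formed with any place $v\ne\infty,\varepsilon$. **Theorem.** Let $\mathcal F,\mathcal F'$ be abelian $\tau$-sheaves of characteristic $c$ over $L=\mathbb F_s$, of ranks $r,r'$, and write $\pi',\pi'_v,\chi'_v,\dots$ for the objects attached to $\mathcal F'$. Let $v$ be a place of $C$ different from $\infty$ and $\varepsilon$. Assume that $\varepsilon\ne\infty$ or that $\mathcal F$ and $\mathcal F'$ have the same weight. 1. Consider the statements * (1.1) $\mathcal F'$ is quasi-isogenous to an abelian quotient $\tau$-sheaf of $\mathcal F$; * (1.2) $V_v\mathcal F'$ is $G$-isomorphic to a $G$-quotient space of $V_v\mathcal F$; * (1.3) $\chi'_v$ divides $\chi_v$ in $Q_v[x]$; * (1.4) $\mu_{\pi'}$ divides $\mu_\pi$ in $Q[x]$ and $r'\le r$. Then (1.1) $\Rightarrow$ (1.2), (1.2) $\Rightarrow$ (1.3) and (1.2) $\Rightarrow$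 (1.4) always. If $\pi_v$ and $\pi'_v$ are semisimple, then (1.3) $\Rightarrow$ (1.2). If $\mu_\pi$ is irreducible in $Q[x]$, then (1.4) $\Rightarrow$ (1.3) and (1.4) $\Rightarrow$ (1.2), and if moreover $\pi'_v$ is semisimple, then (1.3) $\Rightarrow$ (1.2). If $\varepsilon\neq\infty$, then (1.2) $\Rightarrow$ (1.1). 2. Consider the statements * (2.1) $\mathcal F$ and $\mathcal F'$ are quasi-isogenous; * (2.2) $V_v\mathcal F$ and $V_v\mathcal F'$ are $G$-isomorphic; * (2.3) $\chi_v=\chi'_v$; * (2.4) $\mu_\pi=\mu_{\pi'}$ and $r=r'$; * (2.5) there is an isomorphism of $Q$-algebras $\operatorname{QEnd}(\mathcal F)\cong\operatorname{QEnd}(\mathcal F')$ mapping $\pi$ to $\pi'$; * (2.6) there is an isomorphism of $Q_v$-algebras $\operatorname{QEnd}(\mathcal F)\otimes_QQ_v\cong\operatorname{QEnd}(\mathcal F')\otimes_QQ_v$ mapping $\pi\otimes1$ to $\pi'\otimes1$; * (2.7) (only if $\varepsilon\neq\infty$) $Z_{M(\mathcal F)}=Z_{M(\mathcal F')}$. Then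 (2.1) $\Leftrightarrow$ (2.2), (2.2) $\Rightarrow$ (2.3), (2.2) $\Rightarrow$ (2.4), (2.2) $\Rightarrow$ (2.5) and (2.5) $\Rightarrow$ (2.6) always. If $\varepsilon\ne\infty$, then (2.3) $\Leftrightarrow$ (2.7), whichever place $w\neq\infty,\varepsilon$ is used to form the two functions $Z$. If $\pi_v$ and $\pi'_v$ are semisimple, then (2.3) $\Rightarrow$ (2.2) and (2.6) $\Rightarrow$ (2.3). If $\mu_\pi$ and $\mu_{\pi'}$ are irreducible in $Q[x]$, then (2.3) $\Rightarrow$ (2.2), (2.4) $\Rightarrow$ (2.3) and (2.6) $\Rightarrow$ (2.4). -/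

import Mathlib

open scoped TensorProduct

set_option linter.unusedSectionVars false

noncomputable section

namespace TauSheaf

universe w

/-! ### The curve -/

/-- The point `∞` of the curve.  The smooth projective geometrically irreducible curve `C` over `𝔽_q`
with its rational point `∞` is encoded by its ring `A = Γ(C ∖ {∞}, 𝒪_C)` (a Dedekind domain of finite
type over `𝔽_q`), its function field `Q = Frac A` and the local ring `𝒪_{C,∞} ⊆ Q`, so that the closed
points of `C` are the maximal ideals of `A` together with `∞`.
The fields say that `O` is a discrete valuation ring of `Q / 𝔽_q`, that it is the one and only place of
`Q / 𝔽_q` which is not centred on `Spec A` (so `C = Spec A ∪ {∞}`), and that its residue field is `𝔽_q`.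
Since `C` has a rational point, `𝔽_q` is algebraically closed in `Q`, so that `C` is
geometrically irreducible. -/
structure InftyPoint (Fq A Q : Type*) [Field Fq] [CommRing A] [Field Q] [Algebra Fq Q]
    [Algebra A Q] where
  /-- the local ring of `C` at `∞` -/
  O : ValuationSubring Q
  algebraMap_mem : ∀ a : Fq, algebraMap Fq Q a ∈ O
  isDVR : IsDiscreteValuationRing O
  exists_notMem : ∃ a : A, algebraMap A Q a ∉ O
  eq_of_notMem : ∀ R : ValuationSubring Q, (∀ a : Fq, algebraMap Fq Q a ∈ R) →
    (∃ a : A, algebraMap A Q a ∉ R) → R = O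
  residue_eq : ∀ x ∈ O, ∃ a : Fq, O.valuation (x - algebraMap Fq Q a) < 1

/-- A morphism `c : Spec L → C` over `𝔽_q`: either it factors through `Spec A` and is given by an
`𝔽_q`-homomorphism `c^* : A → L`, or its image is the rational point `∞`. -/
inductive CharMap (Fq A L : Type*) [Field Fq] [CommRing A] [Field L] [Algebra Fq A] [Algebra Fq L]
  | affine (c : A →ₐ[Fq] L) : CharMap Fq A L
  | infty : CharMap Fq A L

/-- The characteristic point `c(Spec L)` is different from `∞`. -/
def CharMap.NeInfty {Fq A L : Type*} [Field Fq] [CommRing A] [Field L] [Algebra Fq A]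
    [Algebra Fq L] : CharMap Fq A L → Prop
  | .affine _ => True
  | .infty => False

/-- The maximal ideal `v` of `A`, as a closed point of `C`, is different from the characteristic
point `c(Spec L)`, which is `ker c^*` or `∞`. -/
def CharMap.NePlace {Fq A L : Type*} [Field Fq] [CommRing A] [Field L] [Algebra Fq A]
    [Algebra Fq L] : CharMap Fq A L → IsDedekindDomain.HeightOneSpectrum A → Prop
  | .affine c, v => RingHom.ker c ≠ v.asIdeal
  | .infty, _ => True

section Curve

variable (Fq A Q L : Type*) [Field Fq] [CommRing A] [Algebra Fq A] [Field Q]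
  [Algebra Fq Q] [Algebra A Q] [IsScalarTower Fq A Q] [Field L] [Algebra Fq L]

/-- The function field `Q_L = Q ⊗ L` of the curve `C_L`. -/
def QL (Fq Q L : Type*) [Field Fq] [Field Q] [Algebra Fq Q] [Field L] [Algebra Fq L] : Type _ :=
  Q ⊗[Fq] L

instance : CommRing (QL Fq Q L) := inferInstanceAs (CommRing (Q ⊗[Fq] L))

instance : Algebra Fq (QL Fq Q L) := inferInstanceAs (Algebra Fq (Q ⊗[Fq] L))

/-- The `Q`-algebra structure of `Q_L` is given by `a ↦ a ⊗ 1`. -/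
instance : Algebra Q (QL Fq Q L) := inferInstanceAs (Algebra Q (Q ⊗[Fq] L))

/-- The map `L → Q_L`, `l ↦ 1 ⊗ l`. -/
def LtoQL : L →+* QL Fq Q L :=
  (Algebra.TensorProduct.includeRight : L →ₐ[Fq] Q ⊗[Fq] L).toRingHom

/-- `A_L = A ⊗ L`, as a subring of `Q_L = Q ⊗ L`. -/
def AL : Subalgebra Fq (QL Fq Q L) :=
  (Algebra.TensorProduct.map (IsScalarTower.toAlgHom Fq A Q) (AlgHom.id Fq L)).range

/-- The endomorphism `a ↦ a ^ q` of `L`. -/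
def frobL [Fintype Fq] : L →+* L := (FiniteField.frobeniusAlgHom Fq L).toRingHom

/-- The endomorphism `σ^* = id ⊗ Frob_q` of `Q_L = Q ⊗ L`. -/
def sig [Fintype Fq] : QL Fq Q L →+* QL Fq Q L :=
  (Algebra.TensorProduct.map (AlgHom.id Fq Q) (FiniteField.frobeniusAlgHom Fq L)).toRingHom

variable {Fq A Q}

/-- The local ring of `C` at `∞`, as an `𝔽_q`-subalgebra of `Q`. -/
def InftyPoint.subalg (inf : InftyPoint Fq A Q) : Subalgebra Fq Q :=
  { inf.O.toSubring with algebraMap_mem' := inf.algebraMap_mem }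

/-- The local ring `𝒪_{C,∞} ⊗ L` of `C_L` at `∞`, as a subring of `Q_L = Q ⊗ L`.
(It is already local since `∞` is a rational point and `L` will be finite over `𝔽_q`.) -/
def OL (inf : InftyPoint Fq A Q) : Subalgebra Fq (QL Fq Q L) :=
  (Algebra.TensorProduct.map inf.subalg.val (AlgHom.id Fq L)).range

theorem LtoQL_mem_AL (l : L) : LtoQL Fq Q L l ∈ AL Fq A Q L :=
  ⟨(1 : A) ⊗ₜ l, by
    change Algebra.TensorProduct.map (IsScalarTower.toAlgHom Fq A Q) (AlgHom.id Fq L) _ = _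
    simp [LtoQL]; rfl⟩

theorem LtoQL_mem_OL (inf : InftyPoint Fq A Q) (l : L) : LtoQL Fq Q L l ∈ OL L inf :=
  ⟨(1 : inf.subalg) ⊗ₜ l, by
    change Algebra.TensorProduct.map inf.subalg.val (AlgHom.id Fq L) _ = _
    simp [LtoQL]; rfl⟩

theorem algebraMap_mem_AL (a : A) :
    algebraMap Q (QL Fq Q L) (algebraMap A Q a) ∈ AL Fq A Q L :=
  ⟨a ⊗ₜ (1 : L), by
    change Algebra.TensorProduct.map (IsScalarTower.toAlgHom Fq A Q) (AlgHom.id Fq L) _ = _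
    simp; rfl⟩

theorem algebraMap_mem_OL (inf : InftyPoint Fq A Q) (z : inf.O) :
    algebraMap Q (QL Fq Q L) z ∈ OL L inf :=
  ⟨(⟨z, z.2⟩ : inf.subalg) ⊗ₜ (1 : L), by
    change Algebra.TensorProduct.map inf.subalg.val (AlgHom.id Fq L) _ = _
    simp; rfl⟩

variable (Fq A Q) in
/-- The map `L → A_L`, `l ↦ 1 ⊗ l`. -/
def LtoAL : L →+* AL Fq A Q L :=
  (LtoQL Fq Q L).codRestrict (AL Fq A Q L) (LtoQL_mem_AL L)

/-- The map `L → 𝒪_{C,∞} ⊗ L`, `l ↦ 1 ⊗ l`. -/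
def LtoOL (inf : InftyPoint Fq A Q) : L →+* OL L inf :=
  (LtoQL Fq Q L).codRestrict (OL L inf) (LtoQL_mem_OL L inf)

variable (Fq A Q) in
/-- The map `A → A_L`, `a ↦ a ⊗ 1`. -/
def AtoAL : A →+* AL Fq A Q L :=
  ((algebraMap Q (QL Fq Q L)).comp (algebraMap A Q)).codRestrict
    (AL Fq A Q L) (algebraMap_mem_AL L)

/-- The map `𝒪_{C,∞} → 𝒪_{C,∞} ⊗ L`, `z ↦ z ⊗ 1`. -/
def OtoOL (inf : InftyPoint Fq A Q) : inf.O →+* OL L inf :=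
  ((algebraMap Q (QL Fq Q L)).comp inf.O.subtype).codRestrict
    (OL L inf) (algebraMap_mem_OL L inf)

/-- The maximal ideal of the local ring of `C_L` at `∞`: it is generated by the maximal
ideal of `𝒪_{C,∞}`. -/
def inftyIdeal (inf : InftyPoint Fq A Q) : Ideal (OL L inf) :=
  (IsLocalRing.maximalIdeal inf.O).map (OtoOL L inf)

variable (Q) {L} in
/-- The ideal of `A_L` of sections over `C_L ∖ {∞}` of the ideal sheaf of the graph of `c`. -/
def graphIdealAffine : CharMap Fq A L → Ideal (AL Fq A Q L)
  | .affine c => Ideal.span (Set.range fun a : A => AtoAL Fq A Q L a - LtoAL Fq A Q L (c a))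
  | .infty => ⊤

variable {L} in
/-- The stalk at `∞` of the ideal sheaf of the graph of `c`. -/
def graphIdealInfty (inf : InftyPoint Fq A Q) : CharMap Fq A L → Ideal (OL L inf)
  | .affine _ => ⊤
  | .infty => inftyIdeal L inf

end Curve

/-! ### Locally free sheaves on `C_L` -/

section Bundles

variable {Fq A Q : Type*} [Field Fq] [CommRing A] [Algebra Fq A] [Field Q]
  [Algebra Fq Q] [Algebra A Q] [IsScalarTower Fq A Q]

/-- A locally free sheaf of finite rank on `C_L`.  It is given by its fibre `V` at the generic point,
its sections `M ⊆ V` over the affine curve `C_L ∖ {∞} = Spec A_L`, and its stalk `N ⊆ V` at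
the point `∞`.  As `A_L` is a Dedekind domain and the local ring at `∞` is a discrete valuation ring,
both with fraction field `Q_L`, any such pair of lattices comes from exactly one such sheaf. -/
structure Bundle (L : Type*) [Field L] [Algebra Fq L] (inf : InftyPoint Fq A Q) where
  V : Type w
  [addCommGroup : AddCommGroup V]
  [module : Module (QL Fq Q L) V]
  M : Submodule (AL Fq A Q L) V
  N : Submodule (OL L inf) V
  M_fg : M.FG
  N_fg : N.FG
  span_M : Submodule.span (QL Fq Q L) (M : Set V) = ⊤
  span_N : Submodule.span (QL Fq Q L) (N : Set V) = ⊤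

attribute [instance] Bundle.addCommGroup Bundle.module

variable {L : Type*} [Field L] [Algebra Fq L] {inf : InftyPoint Fq A Q}

instance (E : Bundle.{w} L inf) : Module Q E.V :=
  Module.compHom E.V (algebraMap Q (QL Fq Q L))

instance (E : Bundle.{w} L inf) : IsScalarTower Q (QL Fq Q L) E.V where
  smul_assoc a b x := by
    rw [Algebra.smul_def, mul_smul]
    rfl

instance (E : Bundle.{w} L inf) : SMulCommClass (QL Fq Q L) Q E.V :=
  IsScalarTower.to_smulCommClass' 

theorem Bundle.smul_comm_AL (E : Bundle.{w} L inf) (a : Q) (b : AL Fq A Q L) (x : E.V) :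
    a • b • x = b • a • x := (smul_comm (b : QL Fq Q L) a x).symm

theorem Bundle.smul_comm_OL (E : Bundle.{w} L inf) (a : Q) (b : OL L inf) (x : E.V) :
    a • b • x = b • a • x := (smul_comm (b : QL Fq Q L) a x).symm

/-- The rank of a locally free sheaf. -/
def Bundle.rank (E : Bundle.{w} L inf) : ℕ := Module.finrank (QL Fq Q L) E.V

/-- The subsheaf of `E` with sections `M'` over `C_L ∖ {∞}` and stalk `N'` at `∞` has a
cokernel of dimension `δ` over `L`.  (The cokernel is then a skyscraper sheaf, the direct sum of its
part on `C_L ∖ {∞}` and its stalk at `∞`.) -/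
def Bundle.CokerDim (E : Bundle.{w} L inf) (M' : Submodule (AL Fq A Q L) E.V)
    (N' : Submodule (OL L inf) E.V) (δ : ℕ) : Prop :=
  letI : Module L (E.M ⧸ M'.submoduleOf E.M) := Module.compHom _ (LtoAL Fq A Q L)
  letI : Module L (E.N ⧸ N'.submoduleOf E.N) := Module.compHom _ (LtoOL L inf)
  Module.rank L (E.M ⧸ M'.submoduleOf E.M) + Module.rank L (E.N ⧸ N'.submoduleOf E.N) = δ

/-- An effective divisor on `C`: a non-zero ideal of the Dedekind domain `A`
and a multiplicity at `∞`. -/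
structure EffDivisor (A : Type*) [CommRing A] where
  ideal : Ideal A
  ideal_ne_bot : ideal ≠ ⊥
  mult : ℕ

/-- The sections over `C_L ∖ {∞}` of the sheaf `E(D)`. -/
def Bundle.twistM (E : Bundle.{w} L inf) (D : EffDivisor A) : Submodule (AL Fq A Q L) E.V where
  carrier := {x | ∀ a ∈ D.ideal, algebraMap A Q a • x ∈ E.M}
  add_mem' hx hy a ha := by rw [smul_add]; exact E.M.add_mem (hx a ha) (hy a ha)
  zero_mem' a _ := by simp
  smul_mem' b x hx a ha := by
    rw [Bundle.smul_comm_AL]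
    exact E.M.smul_mem _ (hx a ha)

/-- The stalk at `∞` of the sheaf `E(D)`. -/
def Bundle.twistN (E : Bundle.{w} L inf) (D : EffDivisor A) : Submodule (OL L inf) E.V where
  carrier := {x | ∀ z ∈ IsLocalRing.maximalIdeal inf.O ^ D.mult, (z : Q) • x ∈ E.N}
  add_mem' hx hy a ha := by rw [smul_add]; exact E.N.add_mem (hx a ha) (hy a ha)
  zero_mem' a _ := by simp
  smul_mem' b x hx a ha := by
    rw [Bundle.smul_comm_OL]
    exact E.N.smul_mem _ (hx a ha)

/-- The composite `P_{j-1} ∘ ⋯ ∘ P_i` of `n` maps of a sequence, where `j = i + n`. -/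
def chain (E : ℤ → Bundle.{w} L inf)
    (P : ∀ i, (E i).V →ₗ[QL Fq Q L] (E (i + 1)).V) :
    ∀ (n : ℕ) (i j : ℤ), j = i + n → ((E i).V →ₗ[QL Fq Q L] (E j).V)
  | 0, i, j, h => (show i = j by simp [h]) ▸ LinearMap.id
  | n + 1, i, j, h => chain E P n (i + 1) j (by rw [h]; push_cast; ring) ∘ₗ P i

/-! ### Abelian τ-sheaves -/

/-- An abelian `τ`-sheaf `(F_i, Π_i, τ_i)` of rank `r`, dimension `d` and characteristic `c` over `L`.
A homomorphism `σ^* F_i → F_{i+1}` is the same as a `σ^*`-semilinear map on generic fibres which is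
compatible with the lattices; its image is the submodule spanned by the image of the semilinear map. -/
structure AbelianTauSheaf [Fintype Fq] (inf : InftyPoint Fq A Q) (c : CharMap Fq A L) where
  r : ℕ
  d : ℕ
  E : ℤ → Bundle.{w} L inf
  rank_eq : ∀ i, (E i).rank = r
  Pi : ∀ i, (E i).V →ₗ[QL Fq Q L] (E (i + 1)).V
  tau : ∀ i, (E i).V →ₛₗ[sig Fq Q L] (E (i + 1)).V
  Pi_M : ∀ i, ∀ x ∈ (E i).M, Pi i x ∈ (E (i + 1)).M
  Pi_N : ∀ i, ∀ x ∈ (E i).N, Pi i x ∈ (E (i + 1)).N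
  tau_M : ∀ i, ∀ x ∈ (E i).M, tau i x ∈ (E (i + 1)).M
  tau_N : ∀ i, ∀ x ∈ (E i).N, tau i x ∈ (E (i + 1)).N
  Pi_injective : ∀ i, Function.Injective (Pi i)
  tau_injective : ∀ i, Function.Injective (tau i)
  /-- the diagram commutes -/
  comm : ∀ i x, Pi (i + 1) (tau i x) = tau (i + 1) (Pi i x)
  /-- `Π_{i+l-1} ∘ ⋯ ∘ Π_i` identifies `F_i` with the subsheaf `F_{i+l}(-k·∞)` of `F_{i+l}` -/
  periodic : ∃ k l : ℕ, 0 < k ∧ 0 < l ∧ l * d = k * r ∧ ∀ i : ℤ,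
    (E i).M.map ((chain E Pi l i (i + l) rfl).restrictScalars (AL Fq A Q L)) = (E (i + l)).M ∧
    (E i).N.map ((chain E Pi l i (i + l) rfl).restrictScalars (OL L inf))
      = inftyIdeal L inf ^ k • (E (i + l)).N
  coker_Pi : ∀ i, (E (i + 1)).CokerDim
    ((E i).M.map ((Pi i).restrictScalars (AL Fq A Q L)))
    ((E i).N.map ((Pi i).restrictScalars (OL L inf))) d
  coker_tau : ∀ i, (E (i + 1)).CokerDim
    (Submodule.span (AL Fq A Q L) (tau i '' (E i).M))
    (Submodule.span (OL L inf) (tau i '' (E i).N)) d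
  /-- `coker τ_i` is annihilated by the `d`-th power of the ideal sheaf of the graph of `c` -/
  graph_M : ∀ i, graphIdealAffine Q c ^ d • (E (i + 1)).M
    ≤ Submodule.span (AL Fq A Q L) (tau i '' (E i).M)
  graph_N : ∀ i, graphIdealInfty inf c ^ d • (E (i + 1)).N
    ≤ Submodule.span (OL L inf) (tau i '' (E i).N)

end Bundles

section Iota

variable {Fq A Q : Type*} [Field Fq] [CommRing A] [Algebra Fq A] [Field Q]
  [Algebra Fq Q] [Algebra A Q] [IsScalarTower Fq A Q] [IsDomain A]
  {L : Type*} [Field L] [Algebra Fq L] {inf : InftyPoint Fq A Q}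

/-! ### Quasi-morphisms -/

/-- The `Q`-linear map `f` on generic fibres maps the sheaf `E` into `E'(D)`. -/
def Bundle.BoundedBy (E E' : Bundle.{w} L inf) (f : E.V →ₗ[Q] E'.V) (D : EffDivisor A) : Prop :=
  (∀ x ∈ E.M, f x ∈ E'.twistM D) ∧ (∀ x ∈ E.N, f x ∈ E'.twistN D)

/-- The sum of two effective divisors. -/
instance : Add (EffDivisor A) where
  add D D' := ⟨D.ideal * D'.ideal, mul_ne_zero D.ideal_ne_bot D'.ideal_ne_bot, D.mult + D'.mult⟩

namespace Bundle

variable {E E' E'' : Bundle.{w} L inf}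

theorem smul_mem_M {b : A} {x : E.V} (hx : x ∈ E.M) : algebraMap A Q b • x ∈ E.M :=
  E.M.smul_mem (AtoAL Fq A Q L b) hx

theorem smul_mem_N {z : Q} (hz : z ∈ inf.O) {x : E.V} (hx : x ∈ E.N) : z • x ∈ E.N :=
  E.N.smul_mem (OtoOL L inf ⟨z, hz⟩) hx

theorem twistM_mono {D D' : EffDivisor A} (h : D'.ideal ≤ D.ideal) : E.twistM D ≤ E.twistM D' :=
  fun _ hx a ha => hx a (h ha)

theorem twistN_mono {D D' : EffDivisor A} (h : D.mult ≤ D'.mult) : E.twistN D ≤ E.twistN D' :=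
  fun _ hx a ha => hx a (Ideal.pow_le_pow_right h ha)

theorem BoundedBy.id : E.BoundedBy E LinearMap.id ⟨⊤, top_ne_bot, 0⟩ :=
  ⟨fun _ hx _ _ => smul_mem_M hx, fun _ hx z _ => smul_mem_N z.2 hx⟩

theorem BoundedBy.add {f g : E.V →ₗ[Q] E'.V} {D D' : EffDivisor A}
    (hf : E.BoundedBy E' f D) (hg : E.BoundedBy E' g D') : E.BoundedBy E' (f + g) (D + D') :=
  ⟨fun x hx => add_mem (twistM_mono (D := D) (D' := D + D') (fun _ h => (Ideal.mul_le_inf h).1) (hf.1 x hx))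
      (twistM_mono (D := D') (D' := D + D') (fun _ h => (Ideal.mul_le_inf h).2) (hg.1 x hx)),
    fun x hx => add_mem (twistN_mono (D := D) (D' := D + D') (Nat.le_add_right _ _) (hf.2 x hx))
      (twistN_mono (D := D') (D' := D + D') (Nat.le_add_left _ _) (hg.2 x hx))⟩

theorem BoundedBy.comp {g : E'.V →ₗ[Q] E''.V} {f : E.V →ₗ[Q] E'.V}
    {D D' : EffDivisor A} (hg : E'.BoundedBy E'' g D') (hf : E.BoundedBy E' f D) :
    E.BoundedBy E'' (g ∘ₗ f) (D' + D) := by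
  constructor
  · intro x hx a ha
    refine Submodule.mul_induction_on (C := fun a => algebraMap A Q a • g (f x) ∈ E''.M)
      (ha : a ∈ D'.ideal * D.ideal) ?_ ?_
    · intro b hb b' hb'
      rw [map_mul, mul_smul, ← map_smul]
      exact hg.1 _ (hf.1 x hx b' hb') b hb
    · intro b b' hb hb'
      rw [map_add, add_smul]
      exact add_mem hb hb'
  · intro x hx a ha
    have ha' : a ∈ IsLocalRing.maximalIdeal inf.O ^ D'.mult *
        IsLocalRing.maximalIdeal inf.O ^ D.mult := by
      rw [← pow_add]; exact ha
    refine Submodule.mul_induction_on (C := fun a : inf.O => (a : Q) • g (f x) ∈ E''.N) ha' ?_ ?_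
    · intro b hb b' hb'
      change ((b : Q) * (b' : Q)) • g (f x) ∈ _
      rw [mul_smul, ← map_smul]
      exact hg.2 _ (hf.2 x hx b' hb') b hb
    · intro b b' hb hb'
      change ((b : Q) + (b' : Q)) • g (f x) ∈ _
      rw [add_smul]
      exact add_mem hb hb'

theorem exists_boundedBy_smul [IsFractionRing A Q] (a : Q) :
    ∃ D : EffDivisor A, ∀ E : Bundle.{w} L inf, E.BoundedBy E (a • LinearMap.id) D := by
  have := inf.isDVR
  obtain ⟨x, y, hy, rfl⟩ := IsFractionRing.div_surjective (A := A) a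
  obtain ⟨u, t, ht, hut⟩ := IsFractionRing.div_surjective (A := inf.O)
    (algebraMap A Q x / algebraMap A Q y)
  have hy0 : algebraMap A Q y ≠ 0 := by
    simpa using nonZeroDivisors.ne_zero hy
  have ht0 : (t : Q) ≠ 0 := by
    simpa using nonZeroDivisors.ne_zero ht
  obtain ⟨ϖ, hϖ⟩ := IsDiscreteValuationRing.exists_irreducible inf.O
  obtain ⟨n, hn⟩ := IsDiscreteValuationRing.associated_pow_irreducible
    (nonZeroDivisors.ne_zero ht) hϖ
  refine ⟨⟨Ideal.span {y}, by simpa using nonZeroDivisors.ne_zero hy, n⟩, fun E => ⟨?_, ?_⟩⟩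
  · intro m hm b hb
    obtain ⟨b', rfl⟩ := Ideal.mem_span_singleton'.1 hb
    have : algebraMap A Q (b' * y) • ((algebraMap A Q x / algebraMap A Q y) • (LinearMap.id : E.V →ₗ[Q] E.V)) m
        = algebraMap A Q (b' * x) • m := by
      rw [LinearMap.smul_apply, LinearMap.id_apply, smul_smul, map_mul, map_mul]
      congr 1
      field_simp
    rw [this]
    exact smul_mem_M hm
  · intro m hm b hb
    have hb' : b ∈ Ideal.span {t} := by
      rw [Ideal.span_singleton_eq_span_singleton.2 hn, ← Ideal.span_singleton_pow,
        ← hϖ.maximalIdeal_eq]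
      exact hb
    obtain ⟨b', rfl⟩ := Ideal.mem_span_singleton'.1 hb'
    have : ((b' * t : inf.O) : Q) • ((algebraMap A Q x / algebraMap A Q y) • (LinearMap.id : E.V →ₗ[Q] E.V)) m
        = ((b' * u : inf.O) : Q) • m := by
      rw [← hut, LinearMap.smul_apply, LinearMap.id_apply, smul_smul]
      congr 1
      change (b' : Q) * (t : Q) * ((u : Q) / (t : Q)) = (b' : Q) * (u : Q)
      field_simp
    rw [this]
    exact smul_mem_N (b' * u).2 hm

end Bundle

variable [Fintype Fq] {c : CharMap Fq A L}

/-! ### Morphisms and quasi-morphisms -/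

namespace AbelianTauSheaf

variable (F F' : AbelianTauSheaf.{w} inf c)

/-- A family of maps on generic fibres which commute with `Π` and `τ`. -/
structure Commutes (f : ∀ i, (F.E i).V →ₗ[QL Fq Q L] (F'.E i).V) : Prop where
  comm_Pi : ∀ i x, f (i + 1) (F.Pi i x) = F'.Pi i (f i x)
  comm_tau : ∀ i x, f (i + 1) (F.tau i x) = F'.tau i (f i x)

/-- `f` is a surjective morphism `F → F'` of abelian `τ`-sheaves, i.e. every
`f_i : F_i → F'_i` is a surjective homomorphism of sheaves. -/
structure IsSurjectiveMorphism (f : ∀ i, (F.E i).V →ₗ[QL Fq Q L] (F'.E i).V) : Prop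
    extends Commutes F F' f where
  map_M : ∀ i, (F.E i).M.map ((f i).restrictScalars (AL Fq A Q L)) = (F'.E i).M
  map_N : ∀ i, (F.E i).N.map ((f i).restrictScalars (OL L inf)) = (F'.E i).N

/-- `f` is a quasi-morphism from `F` to `F'`, i.e. a morphism `F → F'(D)` for some effective divisor
`D` on `C`.  Since quasi-morphisms are identified when they agree in `F'(D)` for large `D`,
a quasi-morphism is the same as the family of its generic fibres. -/
structure IsQuasiMorphism (f : ∀ i, (F.E i).V →ₗ[QL Fq Q L] (F'.E i).V) : Prop
    extends Commutes F F' f where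
  bounded : ∃ D : EffDivisor A, ∀ i,
    (F.E i).BoundedBy (F'.E i) ((f i).restrictScalars Q) D

/-- `F` and `F'` are quasi-isogenous: there is a quasi-isogeny from `F` to `F'`, i.e. an isogeny
`F → F'(D)` for some effective divisor `D`.  An isogeny is an injective morphism between abelian
`τ`-sheaves of the same rank and dimension. -/
def QuasiIsogenous : Prop :=
  ∃ f : ∀ i, (F.E i).V →ₗ[QL Fq Q L] (F'.E i).V, IsQuasiMorphism F F' f ∧
    (∀ i, Function.Injective (f i)) ∧ F.r = F'.r ∧ F.d = F'.d

/-- `G` is an abelian quotient `τ`-sheaf of `F`. -/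
def IsQuotient (G : AbelianTauSheaf.{w} inf c) : Prop :=
  ∃ f, IsSurjectiveMorphism F G f

/-- The weight of an abelian `τ`-sheaf (it is `0` for the zero sheaf). -/
def weight : ℚ := (F.d : ℚ) / (F.r : ℚ)

theorem sig_algebraMap (a : Q) :
    sig Fq Q L (algebraMap Q (QL Fq Q L) a) = algebraMap Q (QL Fq Q L) a := by
  change Algebra.TensorProduct.map (AlgHom.id Fq Q) (FiniteField.frobeniusAlgHom Fq L)
    (a ⊗ₜ[Fq] (1 : L)) = a ⊗ₜ[Fq] (1 : L)
  simp

theorem tau_smul (i : ℤ) (a : Q) (x : (F.E i).V) : F.tau i (a • x) = a • F.tau i x := by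
  have := (F.tau i).map_smulₛₗ (algebraMap Q (QL Fq Q L) a) x
  rw [sig_algebraMap] at this
  rwa [algebraMap_smul, algebraMap_smul] at this

/-- The `Q`-algebra `QEnd(F)` of quasi-endomorphisms of `F`. -/
def QEnd [IsFractionRing A Q] : Subalgebra Q (∀ i, Module.End (QL Fq Q L) (F.E i).V) where
  carrier := {f | IsQuasiMorphism F F f}
  mul_mem' := by
    rintro f g ⟨⟨hf, hf'⟩, D, hD⟩ ⟨⟨hg, hg'⟩, D', hD'⟩
    exact ⟨⟨fun i x => by simp [hf, hg], fun i x => by simp [hf', hg']⟩, D + D',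
      fun i => (hD i).comp (hD' i)⟩
  add_mem' := by
    rintro f g ⟨⟨hf, hf'⟩, D, hD⟩ ⟨⟨hg, hg'⟩, D', hD'⟩
    exact ⟨⟨fun i x => by simp [hf, hg], fun i x => by simp [hf', hg']⟩, D + D',
      fun i => (hD i).add (hD' i)⟩
  algebraMap_mem' a := by
    obtain ⟨D, hD⟩ := Bundle.exists_boundedBy_smul (L := L) (inf := inf) a
    refine ⟨⟨fun i x => ?_, fun i x => ?_⟩, D, fun i => hD _⟩
    · change a • F.Pi i x = F.Pi i (a • x)
      exact (LinearMap.map_smul_of_tower (F.Pi i) a x).symm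
    · change a • F.tau i x = F.tau i (a • x)
      exact (tau_smul F i a x).symm

/-! ### The Frobenius -/

theorem chain_injective (P : ∀ i, (F.E i).V →ₗ[QL Fq Q L] (F.E (i + 1)).V)
    (hP : ∀ i, Function.Injective (P i)) :
    ∀ (n : ℕ) (i j : ℤ) (h : j = i + n), Function.Injective (chain F.E P n i j h)
  | 0, i, j, h => by
    obtain rfl : i = j := by simp [h]
    exact Function.injective_id
  | n + 1, i, j, h => by
    have := chain_injective P hP n (i + 1) j (by rw [h]; push_cast; ring)
    exact this.comp (hP i)

theorem chain_mem (n : ℕ) : ∀ (i j : ℤ) (h : j = i + n),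
    (∀ x ∈ (F.E i).M, chain F.E F.Pi n i j h x ∈ (F.E j).M) ∧
    (∀ x ∈ (F.E i).N, chain F.E F.Pi n i j h x ∈ (F.E j).N) := by
  induction n with
  | zero =>
    intro i j h
    obtain rfl : i = j := by simp [h]
    exact ⟨fun x hx => hx, fun x hx => hx⟩
  | succ n ih =>
    intro i j h
    have := ih (i + 1) j (by rw [h]; push_cast; ring)
    exact ⟨fun x hx => this.1 _ (F.Pi_M i x hx), fun x hx => this.2 _ (F.Pi_N i x hx)⟩

theorem OtoOL_mem_pow (k : ℕ) {z : inf.O} (hz : z ∈ IsLocalRing.maximalIdeal inf.O ^ k) :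
    OtoOL L inf z ∈ inftyIdeal L inf ^ k := by
  rw [inftyIdeal, ← Ideal.map_pow]
  exact Ideal.mem_map_of_mem _ hz

/-- The maps `Π_i` are isomorphisms on `C_L ∖ {∞}`, and the poles of their inverses at `∞` are
bounded. -/
theorem exists_pole : ∃ k : ℕ, ∀ i,
    (∀ y ∈ (F.E (i + 1)).M, ∃ x ∈ (F.E i).M, F.Pi i x = y) ∧
    (∀ y ∈ (F.E (i + 1)).N, ∀ z ∈ IsLocalRing.maximalIdeal inf.O ^ k,
      ∃ x ∈ (F.E i).N, F.Pi i x = (z : Q) • y) := by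
  obtain ⟨k, l, -, hl, -, h⟩ := F.periodic
  obtain ⟨n, rfl⟩ : ∃ n, l = n + 1 := ⟨l - 1, by omega⟩
  refine ⟨k, fun i => ?_⟩
  have hj : i + ((n + 1 : ℕ) : ℤ) = (i + 1) + n := by push_cast; ring
  obtain ⟨hM, hN⟩ := h i
  have hinj := chain_injective F F.Pi F.Pi_injective n (i + 1) _ hj
  obtain ⟨hM', hN'⟩ := chain_mem F n (i + 1) _ hj
  constructor
  · intro y hy
    have hy' := hM' y hy
    rw [← hM] at hy'
    obtain ⟨x, hx, hxy⟩ := hy'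
    exact ⟨x, hx, hinj hxy⟩
  · intro y hy z hz
    have hy' : (OtoOL L inf z) • chain F.E F.Pi n (i + 1) _ hj y ∈
        inftyIdeal L inf ^ k • (F.E (i + ((n + 1 : ℕ) : ℤ))).N :=
      Submodule.smul_mem_smul (OtoOL_mem_pow k hz) (hN' y hy)
    rw [← hN] at hy'
    obtain ⟨x, hx, hxy⟩ := hy'
    refine ⟨x, hx, hinj ?_⟩
    rw [LinearMap.map_smul_of_tower]
    exact hxy

theorem Pi_bijective (i : ℤ) : Function.Bijective (F.Pi i) := by
  refine ⟨F.Pi_injective i, ?_⟩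
  obtain ⟨k, hk⟩ := F.exists_pole
  rw [← LinearMap.range_eq_top, eq_top_iff, ← (F.E (i + 1)).span_M, Submodule.span_le]
  intro y hy
  obtain ⟨x, -, hx⟩ := (hk i).1 y hy
  exact ⟨x, hx⟩

/-- The isomorphism `Π_i` on generic fibres. -/
def PiEquiv (i : ℤ) : (F.E i).V ≃ₗ[QL Fq Q L] (F.E (i + 1)).V :=
  LinearEquiv.ofBijective (F.Pi i) (F.Pi_bijective i)

/-- The `σ^*`-semilinear map `Π_i⁻¹ ∘ τ_i` on the generic fibre of `F_i`. -/
def phi (i : ℤ) : (F.E i).V →ₛₗ[sig Fq Q L] (F.E i).V :=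
  (F.PiEquiv i).symm.toLinearMap.comp (F.tau i)

theorem Pi_phi (i : ℤ) (x : (F.E i).V) : F.Pi i (F.phi i x) = F.tau i x :=
  (F.PiEquiv i).apply_symm_apply _

theorem phi_Pi (i : ℤ) (x : (F.E i).V) : F.phi (i + 1) (F.Pi i x) = F.Pi i (F.phi i x) := by
  apply F.Pi_injective
  rw [Pi_phi, Pi_phi, F.comm]

theorem phi_tau (i : ℤ) (x : (F.E i).V) : F.phi (i + 1) (F.tau i x) = F.tau i (F.phi i x) := by
  rw [← Pi_phi, ← Pi_phi, phi_Pi]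

theorem phi_mem_M (i : ℤ) {x : (F.E i).V} (hx : x ∈ (F.E i).M) : F.phi i x ∈ (F.E i).M := by
  obtain ⟨k, hk⟩ := F.exists_pole
  obtain ⟨y, hy, h⟩ := (hk i).1 _ (F.tau_M i x hx)
  have : F.phi i x = y := F.Pi_injective i (by rw [Pi_phi, h])
  rwa [this]

theorem phi_smul (i : ℤ) (a : Q) (x : (F.E i).V) : F.phi i (a • x) = a • F.phi i x := by
  have := (F.phi i).map_smulₛₗ (algebraMap Q (QL Fq Q L) a) x
  rw [sig_algebraMap] at this
  rwa [algebraMap_smul, algebraMap_smul] at this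

/-- `Π_i⁻¹ ∘ τ_i` as a `Q`-linear map. -/
def phiQ (i : ℤ) : Module.End Q (F.E i).V where
  toFun := F.phi i
  map_add' := map_add _
  map_smul' a x := F.phi_smul i a x

theorem exists_boundedBy_phiQ : ∃ D : EffDivisor A, ∀ i, (F.E i).BoundedBy (F.E i) (F.phiQ i) D := by
  obtain ⟨k, hk⟩ := F.exists_pole
  refine ⟨⟨⊤, top_ne_bot, k⟩, fun i => ⟨fun x hx a _ => ?_, fun x hx z hz => ?_⟩⟩
  · exact Bundle.smul_mem_M (F.phi_mem_M i hx)
  · obtain ⟨y, hy, h⟩ := (hk i).2 _ (F.tau_N i x hx) z hz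
    have : (z : Q) • F.phi i x = y := F.Pi_injective i (by
      rw [LinearMap.map_smul_of_tower, Pi_phi, h])
    change (z : Q) • F.phi i x ∈ _
    rwa [this]

theorem exists_boundedBy_phiQ_pow (n : ℕ) :
    ∃ D : EffDivisor A, ∀ i, (F.E i).BoundedBy (F.E i) (F.phiQ i ^ n) D := by
  induction n with
  | zero => exact ⟨_, fun i => Bundle.BoundedBy.id⟩
  | succ n ih =>
    obtain ⟨D, hD⟩ := ih
    obtain ⟨D', hD'⟩ := F.exists_boundedBy_phiQ
    exact ⟨D + D', fun i => by rw [pow_succ]; exact (hD i).comp (hD' i)⟩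

theorem sig_iterate [Finite L] (x : QL Fq Q L) :
    (sig Fq Q L)^[Module.finrank Fq L] x = x := by
  have := Fintype.ofFinite L
  let t : Q → L → QL Fq Q L := fun a l => a ⊗ₜ[Fq] l
  have hs : ∀ a l, sig Fq Q L (t a l) = t a (l ^ Fintype.card Fq) := fun a l => by
    change Algebra.TensorProduct.map (AlgHom.id Fq Q) (FiniteField.frobeniusAlgHom Fq L)
      (a ⊗ₜ[Fq] l) = a ⊗ₜ[Fq] (l ^ Fintype.card Fq)
    simp
  have h : ∀ (n : ℕ) (a : Q) (l : L),
      (sig Fq Q L)^[n] (t a l) = t a (l ^ (Fintype.card Fq ^ n)) := by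
    intro n
    induction n with
    | zero => intro a l; simp
    | succ n ih =>
      intro a l
      rw [Function.iterate_succ_apply, hs, ih, ← pow_mul, pow_succ']
  have hadd : ∀ (x y : QL Fq Q L), (sig Fq Q L)^[Module.finrank Fq L] x = x →
      (sig Fq Q L)^[Module.finrank Fq L] y = y →
      (sig Fq Q L)^[Module.finrank Fq L] (x + y) = x + y := fun x y hx hy => by
    rw [iterate_map_add, hx, hy]
  refine TensorProduct.induction_on (motive := fun x : Q ⊗[Fq] L =>
    (sig Fq Q L)^[Module.finrank Fq L] (x : QL Fq Q L) = x) x ?_ ?_ ?_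
  · exact iterate_map_zero (sig Fq Q L) _
  · intro a l
    refine (h _ a l).trans ?_
    rw [← Module.card_eq_pow_finrank, FiniteField.pow_card]
  · exact hadd

theorem phiQ_pow_smul (i : ℤ) (n : ℕ) (b : QL Fq Q L) (x : (F.E i).V) :
    (F.phiQ i ^ n) (b • x) = ((sig Fq Q L)^[n] b) • (F.phiQ i ^ n) x := by
  induction n generalizing b x with
  | zero => rfl
  | succ n ih =>
    rw [pow_succ, Module.End.mul_apply, Module.End.mul_apply, Function.iterate_succ_apply, ← ih]
    congr 1
    exact (F.phi i).map_smulₛₗ b x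

/-- The `s`-Frobenius of `F`, where `s = q ^ e` is the cardinality of `L`.  It is the map
`τ_{i+e-1} ∘ ⋯ ∘ τ_i : F_i → F_{i+e}`, composed on generic fibres with the inverse of
`Π_{i+e-1} ∘ ⋯ ∘ Π_i`; as `Π` and `τ` commute this is the `e`-th iterate
of `Π_i⁻¹ ∘ τ_i`. -/
def frobeniusMap [Finite L] (i : ℤ) : Module.End (QL Fq Q L) (F.E i).V where
  toFun := (F.phiQ i ^ Module.finrank Fq L : Module.End Q (F.E i).V)
  map_add' := map_add _
  map_smul' b x := by
    rw [phiQ_pow_smul, sig_iterate]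
    rfl

/-- The `s`-Frobenius `π` of `F` as a quasi-endomorphism. -/
def frobenius [Finite L] [IsFractionRing A Q] : F.QEnd :=
  ⟨F.frobeniusMap, by
    refine ⟨⟨fun i x => ?_, fun i x => ?_⟩, F.exists_boundedBy_phiQ_pow (Module.finrank Fq L)⟩
    · change (F.phiQ (i + 1) ^ _) (F.Pi i x) = F.Pi i ((F.phiQ i ^ _) x)
      induction Module.finrank Fq L generalizing x with
      | zero => rfl
      | succ n ih =>
        rw [pow_succ, pow_succ, Module.End.mul_apply, Module.End.mul_apply, ← ih]
        exact congrArg _ (F.phi_Pi i x)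
    · change (F.phiQ (i + 1) ^ _) (F.tau i x) = F.tau i ((F.phiQ i ^ _) x)
      induction Module.finrank Fq L generalizing x with
      | zero => rfl
      | succ n ih =>
        rw [pow_succ, pow_succ, Module.End.mul_apply, Module.End.mul_apply, ← ih]
        exact congrArg _ (F.phi_tau i x)⟩

end AbelianTauSheaf

end Iota

/-! ### Completions -/

section Completion

variable (A : Type*) [CommRing A] (v : IsDedekindDomain.HeightOneSpectrum A)

/-- The completion `A_v` of `A` at the maximal ideal `v`. -/
abbrev Av : Type _ := AdicCompletion v.asIdeal A

theorem mem_pow_or_mem_pow [IsDedekindDomain A] {a b : A} {m n : ℕ}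
    (h : a * b ∈ v.asIdeal ^ (m + n)) : a ∈ v.asIdeal ^ m ∨ b ∈ v.asIdeal ^ n := by
  rw [← Ideal.dvd_span_singleton, ← Ideal.span_singleton_mul_span_singleton] at h
  rw [← Ideal.dvd_span_singleton, ← Ideal.dvd_span_singleton]
  have hp : Prime v.asIdeal := v.prime
  rw [pow_dvd_iff_le_emultiplicity, emultiplicity_mul hp] at h
  rw [pow_dvd_iff_le_emultiplicity, pow_dvd_iff_le_emultiplicity]
  by_contra! hcon
  exact absurd h (not_le.2 (by push_cast; exact WithTop.add_lt_add hcon.1 hcon.2))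

instance [IsDedekindDomain A] : IsDomain (Av A v) := by
  have : Nontrivial (Av A v) := by
    refine ⟨⟨0, 1, fun h => ?_⟩⟩
    have := congrArg (AdicCompletion.evalₐ v.asIdeal 1) h
    rw [map_zero, map_one, eq_comm, ← map_one (Ideal.Quotient.mk (v.asIdeal ^ 1)),
      Ideal.Quotient.eq_zero_iff_mem, pow_one] at this
    exact v.isPrime.ne_top ((Ideal.eq_top_iff_one _).2 this)
  have : NoZeroDivisors (Av A v) := by
    refine ⟨fun {x y} hxy => ?_⟩
    by_contra! hcon
    obtain ⟨hx, hy⟩ := hcon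
    have key : ∀ z : Av A v, z ≠ 0 → ∃ n, AdicCompletion.evalₐ v.asIdeal n z ≠ 0 := by
      intro z hz
      by_contra! h
      exact hz (AdicCompletion.ext_evalₐ fun n => by rw [h, map_zero])
    obtain ⟨m, hm⟩ := key x hx
    obtain ⟨n, hn⟩ := key y hy
    obtain ⟨f, rfl⟩ := AdicCompletion.mk_surjective v.asIdeal A x
    obtain ⟨g, rfl⟩ := AdicCompletion.mk_surjective v.asIdeal A y
    have hxy' := congrArg (AdicCompletion.evalₐ v.asIdeal (m + n)) hxy
    rw [map_mul, map_zero, AdicCompletion.evalₐ_mk, AdicCompletion.evalₐ_mk, ← map_mul,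
      Ideal.Quotient.eq_zero_iff_mem] at hxy'
    rw [AdicCompletion.evalₐ_mk, ← AdicCompletion.Ideal.mk_eq_mk _ (Nat.le_add_right m n),
      Ne, Ideal.Quotient.eq_zero_iff_mem] at hm
    rw [AdicCompletion.evalₐ_mk, ← AdicCompletion.Ideal.mk_eq_mk _ (Nat.le_add_left n m),
      Ne, Ideal.Quotient.eq_zero_iff_mem] at hn
    exact (mem_pow_or_mem_pow A v hxy').elim hm hn
  exact NoZeroDivisors.to_isDomain _

/-- The completion `Q_v` of `Q` at the place `v`, as the fraction field of `A_v`. -/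
def Qv : Type _ := FractionRing (Av A v)

variable [IsDedekindDomain A]

instance : Field (Qv A v) := inferInstanceAs (Field (FractionRing (Av A v)))

instance : Algebra (Av A v) (Qv A v) :=
  inferInstanceAs (Algebra (Av A v) (FractionRing (Av A v)))

instance : IsFractionRing (Av A v) (Qv A v) :=
  inferInstanceAs (IsFractionRing (Av A v) (FractionRing (Av A v)))

theorem algebraMap_Av_injective : Function.Injective (algebraMap A (Av A v)) := by
  have : IsHausdorff v.asIdeal A := IsHausdorff.of_isDomain _ v.isPrime.ne_top
  exact AdicCompletion.of_injective v.asIdeal A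

theorem toQv_injective :
    Function.Injective ((algebraMap (Av A v) (Qv A v)).comp (algebraMap A (Av A v))) :=
  (IsFractionRing.injective (Av A v) (Qv A v)).comp (algebraMap_Av_injective A v)

/-- The embedding of `Q` into `Q_v`. -/
instance (Q : Type*) [Field Q] [Algebra A Q] [IsFractionRing A Q] : Algebra Q (Qv A v) :=
  (IsFractionRing.lift (toQv_injective A v) : Q →+* Qv A v).toAlgebra

end Completion

/-! ### Tate modules -/

/-- A module over `A_L = A ⊗ L` (given by commuting actions of `A` and `L`) with a `σ^*`-semilinear
endomorphism `τ`. -/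
structure TauModule (Fq A L : Type*) [Field Fq] [Fintype Fq] [CommRing A] [Field L]
    [Algebra Fq L] where
  carrier : Type w
  [addCommGroup : AddCommGroup carrier]
  [moduleA : Module A carrier]
  [moduleL : Module L carrier]
  [smulCommClass : SMulCommClass L A carrier]
  tau : carrier →ₛₗ[frobL Fq L] carrier
  tau_smul : ∀ (a : A) x, tau (a • x) = a • tau x

attribute [instance] TauModule.addCommGroup TauModule.moduleA TauModule.moduleL
  TauModule.smulCommClass

section MapAux

variable {A L M S : Type*} [CommRing A] [Field L] [AddCommGroup M] [Module A M] [Module L M]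
  [SMulCommClass L A M] [AddCommGroup S] [Module L S] {ρ : L →+* L}

/-- The `A`-linear endomorphism `f ⊗ g` of `M ⊗ S`, for `ρ`-semilinear `f` and `g`, where `f`
commutes with `A`. -/
def tensorMap (f : M →ₛₗ[ρ] M) (hf : ∀ (a : A) x, f (a • x) = a • f x) (g : S →ₛₗ[ρ] S) :
    M ⊗[L] S →ₗ[A] M ⊗[L] S where
  toFun := TensorProduct.map f g
  map_add' := map_add _
  map_smul' a x := by
    induction x using TensorProduct.induction_on with
    | zero => simp
    | tmul x y => simp [TensorProduct.smul_tmul', hf]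
    | add x y hx hy => simp only [smul_add, map_add, hx, hy]

end MapAux

section Tate

variable {Fq A L : Type*} [Field Fq] [Fintype Fq] [CommRing A] [Field L] [Algebra Fq L]

/-- `a ↦ a ^ q` on the separable closure of `L`, as a semilinear map. -/
def frobSep (Fq L : Type*) [Field Fq] [Fintype Fq] [Field L] [Algebra Fq L] :
    SeparableClosure L →ₛₗ[frobL Fq L] SeparableClosure L where
  toFun x := x ^ Fintype.card Fq
  map_add' x y := by
    let : Algebra Fq (SeparableClosure L) := ((algebraMap L _).comp (algebraMap Fq L)).toAlgebra
    exact map_add (FiniteField.frobeniusAlgHom Fq (SeparableClosure L)) x y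
  map_smul' l x := by
    rw [Algebra.smul_def, mul_pow, Algebra.smul_def, ← map_pow]
    rfl

namespace TauModule

variable (M : TauModule.{w} Fq A L)

/-- The base change `M ⊗ L^sep` of `M` to the separable closure of `L`, as an `A`-module. -/
abbrev Msep : Type _ := M.carrier ⊗[L] SeparableClosure L

/-- `τ` on `M ⊗ L^sep`. -/
def tauSep : M.Msep →ₗ[A] M.Msep := tensorMap M.tau M.tau_smul (frobSep Fq L)

/-- The action of `Gal(L^sep / L)` on `M ⊗ L^sep`. -/
def galSep (g : SeparableClosure L ≃ₐ[L] SeparableClosure L) : M.Msep →ₗ[A] M.Msep :=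
  tensorMap LinearMap.id (fun _ _ => rfl) g.toLinearMap

/-- The Frobenius endomorphism `τ ^ e` of `M`, where `q ^ e` is the cardinality of `L`. -/
def frob [Finite L] : M.carrier →ₗ[L] M.carrier where
  toFun := M.tau^[Module.finrank Fq L]
  map_add' := iterate_map_add _ _
  map_smul' l x := by
    have := Fintype.ofFinite L
    have h : ∀ n, ∀ l : L, ∀ x, M.tau^[n] (l • x) = l ^ (Fintype.card Fq ^ n) • M.tau^[n] x := by
      intro n
      induction n with
      | zero => intro l x; simp
      | succ n ih =>
        intro l x
        rw [Function.iterate_succ_apply, M.tau.map_smulₛₗ, ih, Function.iterate_succ_apply,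
          pow_succ', pow_mul]
        rfl
    rw [h, ← Module.card_eq_pow_finrank, FiniteField.pow_card]
    rfl

theorem frob_smul [Finite L] (a : A) (x : M.carrier) : M.frob (a • x) = a • M.frob x := by
  change M.tau^[_] (a • x) = a • M.tau^[_] x
  induction Module.finrank Fq L generalizing x with
  | zero => rfl
  | succ n ih => rw [Function.iterate_succ_apply, M.tau_smul, ih, Function.iterate_succ_apply]

/-- The Frobenius endomorphism on `M ⊗ L^sep`. -/
def frobSepM [Finite L] : M.Msep →ₗ[A] M.Msep := tensorMap M.frob M.frob_smul LinearMap.id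

theorem tauSep_galSep (g : SeparableClosure L ≃ₐ[L] SeparableClosure L) :
    M.tauSep ∘ₗ M.galSep g = M.galSep g ∘ₗ M.tauSep := by
  ext x
  induction x using TensorProduct.induction_on with
  | zero => simp
  | tmul x y =>
    change M.tau x ⊗ₜ[L] ((g y) ^ Fintype.card Fq) = M.tau x ⊗ₜ[L] (g (y ^ Fintype.card Fq))
    rw [map_pow]
  | add x y hx hy => rw [map_add, map_add, hx, hy]

theorem tauSep_frobSepM [Finite L] :
    M.tauSep ∘ₗ M.frobSepM = M.frobSepM ∘ₗ M.tauSep := by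
  ext x
  induction x using TensorProduct.induction_on with
  | zero => simp
  | tmul x y =>
    change M.tau (M.tau^[_] x) ⊗ₜ[L] (y ^ Fintype.card Fq)
      = (M.tau^[_] (M.tau x)) ⊗ₜ[L] (y ^ Fintype.card Fq)
    exact congrArg (· ⊗ₜ[L] (y ^ Fintype.card Fq))
      ((Function.iterate_succ_apply' M.tau (Module.finrank Fq L) x).symm.trans
        (Function.iterate_succ_apply M.tau (Module.finrank Fq L) x))
  | add x y hx hy => rw [map_add, map_add, hx, hy]

variable (v : IsDedekindDomain.HeightOneSpectrum A)

/-- The Tate module `T_v M = (M ⊗ A_{v, L^sep})^τ`, where `M ⊗ A_{v, L^sep}` is the `v`-adic completion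
of `M ⊗ L^sep`. -/
def Tate : Submodule (Av A v) (AdicCompletion v.asIdeal M.Msep) :=
  LinearMap.eqLocus (AdicCompletion.map v.asIdeal M.tauSep) LinearMap.id

theorem map_mem_Tate {f : M.Msep →ₗ[A] M.Msep} (hf : M.tauSep ∘ₗ f = f ∘ₗ M.tauSep) :
    ∀ x ∈ M.Tate v, AdicCompletion.map v.asIdeal f x ∈ M.Tate v := by
  intro x hx
  have hx' : AdicCompletion.map v.asIdeal M.tauSep x = x := hx
  change AdicCompletion.map v.asIdeal M.tauSep (AdicCompletion.map v.asIdeal f x)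
    = AdicCompletion.map v.asIdeal f x
  rw [AdicCompletion.map_comp_apply, hf, ← AdicCompletion.map_comp_apply, hx']

variable [IsDedekindDomain A]

/-- The rational Tate module `V_v M = T_v M ⊗ Q_v`. -/
abbrev RatTate : Type _ := Qv A v ⊗[Av A v] M.Tate v

/-- The action of `Gal(L^sep / L)` on `V_v M`. -/
def galRatTate (g : SeparableClosure L ≃ₐ[L] SeparableClosure L) :
    Module.End (Qv A v) (M.RatTate v) :=
  ((AdicCompletion.map v.asIdeal (M.galSep g)).restrict
    (M.map_mem_Tate v (M.tauSep_galSep g))).baseChange (Qv A v)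

/-- The endomorphism `π_v` of `V_v M` induced by the Frobenius endomorphism. -/
def frobRatTate [Finite L] : Module.End (Qv A v) (M.RatTate v) :=
  ((AdicCompletion.map v.asIdeal M.frobSepM).restrict
    (M.map_mem_Tate v M.tauSep_frobSepM)).baseChange (Qv A v)

end TauModule

end Tate

/-! ### The invariants of an abelian τ-sheaf -/

namespace AbelianTauSheaf

section

variable {Fq A Q : Type*} [Field Fq] [Fintype Fq] [CommRing A] [Algebra Fq A] [Field Q]
  [Algebra Fq Q] [Algebra A Q] [IsScalarTower Fq A Q] [IsDedekindDomain A] [IsFractionRing A Q]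
  {L : Type*} [Field L] [Finite L] [Algebra Fq L] {inf : InftyPoint Fq A Q} {c : CharMap Fq A L}

theorem sig_LtoQL (l : L) : sig Fq Q L (LtoQL Fq Q L l) = LtoQL Fq Q L (frobL Fq L l) := by
  change Algebra.TensorProduct.map (AlgHom.id Fq Q) (FiniteField.frobeniusAlgHom Fq L)
    ((1 : Q) ⊗ₜ[Fq] l) = (1 : Q) ⊗ₜ[Fq] (FiniteField.frobeniusAlgHom Fq L l)
  simp

variable (F F' : AbelianTauSheaf.{w} inf c)

/-- The pair `M(F) = (Γ(C_L ∖ {∞}, F_0), Π_0⁻¹ ∘ τ_0)`. -/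
def tauModule : TauModule.{w} Fq A L :=
  letI : Module A (F.E 0).M := Module.compHom _ (AtoAL Fq A Q L)
  letI : Module L (F.E 0).M := Module.compHom _ (LtoAL Fq A Q L)
  { carrier := (F.E 0).M
    smulCommClass := ⟨fun l a x => smul_comm (LtoAL Fq A Q L l) (AtoAL Fq A Q L a) x⟩
    tau :=
      { toFun := fun x => ⟨F.phi 0 x, F.phi_mem_M 0 x.2⟩
        map_add' := fun x y => Subtype.ext (map_add (F.phi 0) (x : (F.E 0).V) y)
        map_smul' := fun l x => Subtype.ext (by
          refine ((F.phi 0).map_smulₛₗ (LtoQL Fq Q L l) (x : (F.E 0).V)).trans ?_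
          rw [sig_LtoQL]
          rfl) }
    tau_smul := fun a x => Subtype.ext (by
      refine ((F.phi 0).map_smulₛₗ (algebraMap Q (QL Fq Q L) (algebraMap A Q a))
        (x : (F.E 0).V)).trans ?_
      rw [sig_algebraMap]
      rfl) }

variable (v : IsDedekindDomain.HeightOneSpectrum A)

/-- The rational Tate module `V_v F`. -/
abbrev V : Type _ := F.tauModule.RatTate v

/-- The endomorphism `π_v` of `V_v F`. -/
abbrev piV : Module.End (Qv A v) (F.V v) := F.tauModule.frobRatTate v

/-- The action of `G = Gal(L^sep / L)` on `V_v F`. -/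
abbrev galV (g : SeparableClosure L ≃ₐ[L] SeparableClosure L) : Module.End (Qv A v) (F.V v) :=
  F.tauModule.galRatTate v g

open Classical in
/-- The characteristic polynomial `χ_v` of `π_v` (`V_v F` has finite dimension). -/
def chi : Polynomial (Qv A v) :=
  if _h : Module.Finite (Qv A v) (F.V v) then (F.piV v).charpoly else 0

/-- The Zeta function `∏_{0 ≤ i ≤ r} det(1 - t ⋀^i π_v) ^ ((-1) ^ (i + 1))`, as a
rational function over `Q_v`. -/
def zeta : RatFunc (Qv A v) :=
  ∏ i ∈ Finset.range (F.r + 1),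
    LinearMap.det (M := RatFunc (Qv A v) ⊗[Qv A v] (⋀[Qv A v]^i (F.V v)))
      (1 - (RatFunc.X : RatFunc (Qv A v)) •
        (exteriorPower.map i (F.piV v)).baseChange (RatFunc (Qv A v))) ^ ((-1 : ℤ) ^ (i + 1))

end

section Conditions

variable {Fq A Q : Type*} [Field Fq] [Fintype Fq] [CommRing A] [Algebra Fq A] [Field Q]
  [Algebra Fq Q] [Algebra A Q] [IsScalarTower Fq A Q] [IsDedekindDomain A] [IsFractionRing A Q]
  {L : Type*} [Field L] [Finite L] [Algebra Fq L] {inf : InftyPoint Fq A Q} {c : CharMap Fq A L}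
  (F F' : AbelianTauSheaf.{w} inf c) (v : IsDedekindDomain.HeightOneSpectrum A)

/-- `F'` is quasi-isogenous to an abelian quotient `τ`-sheaf of `F`. -/
def QuasiIsogenousToQuotient : Prop :=
  ∃ G : AbelianTauSheaf.{w} inf c, F.IsQuotient G ∧ F'.QuasiIsogenous G

/-- `V_v F'` is `G`-isomorphic to a `G`-quotient space of `V_v F`. -/
def TateIsoQuotient : Prop :=
  ∃ (W : Submodule (Qv A v) (F.V v)) (hW : ∀ g, W ≤ W.comap (F.galV v g))
    (e : F'.V v ≃ₗ[Qv A v] (F.V v ⧸ W)),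
    ∀ g x, e (F'.galV v g x) = W.mapQ W (F.galV v g) (hW g) (e x)

/-- `V_v F` and `V_v F'` are `G`-isomorphic. -/
def TateIso : Prop :=
  ∃ e : F.V v ≃ₗ[Qv A v] F'.V v, ∀ g x, e (F.galV v g x) = F'.galV v g (e x)

/-- There is an isomorphism of `Q`-algebras `QEnd(F) ≅ QEnd(F')` mapping `π` to `π'`. -/
def QEndIso : Prop :=
  ∃ φ : F.QEnd ≃ₐ[Q] F'.QEnd, φ F.frobenius = F'.frobenius

/-- There is an isomorphism of `Q_v`-algebras `QEnd(F) ⊗ Q_v ≅ QEnd(F') ⊗ Q_v` mapping `π` to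
`π'`. -/
def QEndIsoAt : Prop :=
  ∃ φ : (Qv A v ⊗[Q] F.QEnd) ≃ₐ[Qv A v] (Qv A v ⊗[Q] F'.QEnd),
    φ (1 ⊗ₜ[Q] F.frobenius) = 1 ⊗ₜ[Q] F'.frobenius

end Conditions

end AbelianTauSheaf

end TauSheaf

end

noncomputable section

namespace TauSheaf

section

open Module Matrix

/-! ### Fixed vectors of semilinear maps -/

section Fixed

variable {k W : Type*} [Field k] [AddCommGroup W] [Module k W]

theorem iterate_semilinear (σ : k →+* k) (τ : W →+ W) (hτ : ∀ (c : k) x, τ (c • x) = σ c • τ x)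
    (n : ℕ) (c : k) (x : W) : τ^[n] (c • x) = σ^[n] c • τ^[n] x := by
  induction n generalizing c x with
  | zero => rfl
  | succ n ih => rw [Function.iterate_succ_apply, hτ, ih]; rfl

/-- If the powers of `σ` are different on the image of `ι`, then a vector which
is fixed by `τ ^ N` is a linear combination of vectors which are fixed by `τ`. -/
theorem mem_span_fixed {G : Type*} [Monoid G] (ι : G →* k) (σ : k →+* k) (τ : W →+ W)
    (hτ : ∀ (c : k) x, τ (c • x) = σ c • τ x) (N : ℕ)
    (hdist : ∀ i < N, ∀ j < N, (∀ g, σ^[i] (ι g) = σ^[j] (ι g)) → i = j)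
    (hfix : ∀ g, σ^[N] (ι g) = ι g) (hN : 0 < N) (w : W) (hw : τ^[N] w = w) :
    w ∈ Submodule.span k {x | τ x = x} := by
  classical
  let ψ : Fin N → (G →* k) := fun i => ((σ ^ (i : ℕ) : k →+* k) : k →* k).comp ι
  have hψ : ∀ i g, ψ i g = σ^[(i : ℕ)] (ι g) := fun i g => by
    simp [ψ]
  have hinj : Function.Injective ψ := fun i j hij => by
    refine Fin.ext (hdist i i.2 j j.2 fun g => ?_)
    rw [← hψ, ← hψ, hij]
  have hind : LinearIndependent k (fun i => (ψ i : G → k)) :=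
    (linearIndependent_monoidHom G k).comp ψ hinj
  have hspan : Submodule.span k (Set.range fun g : G => fun i : Fin N => ψ i g) = ⊤ := by
    by_contra hne
    obtain ⟨f, hf0, hf⟩ := Submodule.exists_le_ker_of_lt_top _ (lt_top_iff_ne_top.2 hne)
    apply hf0
    have h := Fintype.linearIndependent_iff.1 hind (fun i => f (Pi.single i 1)) (by
      funext g
      have := hf (Submodule.subset_span ⟨g, rfl⟩)
      rw [LinearMap.mem_ker, LinearMap.pi_apply_eq_sum_univ] at this
      rw [Finset.sum_apply, Pi.zero_apply, ← this]
      refine Finset.sum_congr rfl fun i _ => ?_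
      rw [Pi.smul_apply, smul_eq_mul, smul_eq_mul, mul_comm]
      congr 2
      funext j
      simp [Pi.single_apply, eq_comm])
    refine LinearMap.pi_ext fun i x => ?_
    have : Pi.single i x = x • (Pi.single i 1 : Fin N → k) := by
      rw [← Pi.single_smul, smul_eq_mul, mul_one]
    rw [this, map_smul, h i]
    simp
  let T : (Fin N → k) →ₗ[k] W := Fintype.linearCombination k fun i : Fin N => τ^[(i : ℕ)] w
  have hT : ∀ g, T (fun i => ψ i g) ∈ {x | τ x = x} := by
    intro g
    obtain ⟨n, rfl⟩ : ∃ n, N = n + 1 := ⟨N - 1, by omega⟩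
    have h1 : T (fun i => ψ i g) = ∑ i ∈ Finset.range (n + 1), τ^[i] (ι g • w) := by
      rw [Fintype.linearCombination_apply, Finset.sum_range]
      exact Finset.sum_congr rfl fun i _ => by rw [hψ, iterate_semilinear σ τ hτ]
    change τ _ = _
    rw [h1, map_sum]
    have h2 : ∀ i, τ (τ^[i] (ι g • w)) = τ^[i + 1] (ι g • w) := fun i =>
      (Function.iterate_succ_apply' τ i _).symm
    simp_rw [h2]
    rw [Finset.sum_range_succ, Finset.sum_range_succ' (fun i => τ^[i] (ι g • w)),
      iterate_semilinear σ τ hτ, hfix, hw]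
    rfl
  have hw' : w = T (Pi.single ⟨0, hN⟩ 1) := by
    simp [T]
  rw [hw']
  have : Pi.single ⟨0, hN⟩ (1 : k) ∈ Submodule.span k (Set.range fun g : G => fun i : Fin N => ψ i g) := by
    rw [hspan]; trivial
  have := Submodule.mem_map_of_mem (f := T) this
  rw [Submodule.map_span] at this
  refine Submodule.span_mono ?_ this
  rintro _ ⟨_, ⟨g, rfl⟩, rfl⟩
  exact hT g

/-- A fixed vector in the `k`-span of a set of fixed vectors is in the span of
this set over the fixed field. -/
theorem mem_span_fixedField {F : Type*} [Field F] [Algebra F k] [Module F W] [IsScalarTower F k W]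
    (σ : k →+* k) (hσ : ∀ c, σ c = c → c ∈ Set.range (algebraMap F k)) (τ : W →+ W)
    (hτ : ∀ (c : k) x, τ (c • x) = σ c • τ x) (S : Set W) (hS : ∀ s ∈ S, τ s = s) (x : W)
    (hx : τ x = x) (hxS : x ∈ Submodule.span k S) : x ∈ Submodule.span F S := by
  obtain ⟨b, hbS, hbspan, hb⟩ := exists_linearIndependent k S
  rw [← hbspan, Finsupp.mem_span_iff_linearCombination] at hxS
  obtain ⟨c, rfl⟩ := hxS
  have h : ∀ i ∈ c.support, σ (c i) = c i := by
    have hs : ∑ i ∈ c.support, (σ (c i) - c i) • (i : W) = 0 := by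
      simp_rw [sub_smul, Finset.sum_sub_distrib]
      rw [Finsupp.linearCombination_apply, Finsupp.sum, map_sum] at hx
      rw [sub_eq_zero, ← hx]
      exact Finset.sum_congr rfl fun i _ => by rw [hτ, hS _ (hbS i.2)]
    intro i hi
    have := linearIndependent_iff'.1 hb c.support (fun i => σ (c i) - c i) hs i hi
    exact sub_eq_zero.1 this
  rw [Finsupp.linearCombination_apply, Finsupp.sum]
  refine Submodule.sum_mem _ fun i hi => ?_
  obtain ⟨a, ha⟩ := hσ _ (h i hi)
  rw [← ha, algebraMap_smul]
  exact Submodule.smul_mem _ _ (Submodule.subset_span (hbS i.2))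

/-- Fixed vectors which are independent over the fixed field are independent. -/
theorem linearIndependent_of_fixed {F : Type*} [Field F] [Algebra F k] [Module F W]
    [IsScalarTower F k W]
    (σ : k →+* k) (hσ : ∀ c, σ c = c → c ∈ Set.range (algebraMap F k)) (τ : W →+ W)
    (hτ : ∀ (c : k) x, τ (c • x) = σ c • τ x) {ι : Type*} (v : ι → W) (hv : ∀ i, τ (v i) = v i)
    (hind : LinearIndependent F v) : LinearIndependent k v := by
  rw [linearIndependent_iff_notMem_span] at hind ⊢
  intro i hi
  refine hind i (mem_span_fixedField σ hσ τ hτ _ ?_ _ (hv i) hi)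
  rintro _ ⟨j, -, rfl⟩
  exact hv j

end Fixed

/-! ### Intertwining matrices over extensions of fields -/

section Intertwine

theorem exists_isUnit_det_of_mem_span {B ι m n : Type*} [Field B] [Fintype ι] [Fintype m]
    [DecidableEq m] [Fintype n] (s : Set B) (hs : s.Infinite) (h : ι → Matrix m n B)
    (Z : Matrix m n B) (hZ : Z ∈ Submodule.span B (Set.range h)) (R : Matrix n m B)
    (hR : IsUnit (Z * R).det) :
    ∃ c : ι → B, (∀ i, c i ∈ s) ∧ IsUnit ((∑ i, c i • h i) * R).det := by
  classical
  obtain ⟨b, rfl⟩ := (Submodule.mem_span_range_iff_exists_fun B).1 hZ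
  let P : Matrix m m (MvPolynomial ι B) :=
    ∑ i : ι, (MvPolynomial.X i : MvPolynomial ι B) • (h i * R).map (MvPolynomial.C : B → MvPolynomial ι B)
  have hP : ∀ c : ι → B, MvPolynomial.eval c P.det = ((∑ i, c i • h i) * R).det := by
    intro c
    rw [RingHom.map_det]
    congr 1
    ext x y
    simp only [P, Matrix.sum_mul, Matrix.sum_apply, RingHom.mapMatrix_apply, Matrix.map_apply,
      Matrix.smul_apply, smul_eq_mul, map_sum, map_mul, MvPolynomial.eval_X, MvPolynomial.eval_C,
      Matrix.smul_mul]
  by_contra! hcon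
  have h0 : P.det = 0 := by
    refine MvPolynomial.funext_set (R := B) (fun _ : ι => s) (fun _ => hs) fun c hc => ?_
    rw [hP, map_zero]
    by_contra h0
    exact hcon c (fun i => hc i trivial) (isUnit_iff_ne_zero.2 h0)
  rw [← hP, h0, map_zero] at hR
  exact not_isUnit_zero hR

/-- The solutions over a field extension of a linear system are spanned by
the solutions over the ground field. -/
theorem intertwine_mem_span {K B m n : Type*} [Field K] [Field B] [Algebra K B] [Fintype m]
    [Fintype n] (X : Matrix n n K) (X' : Matrix m m K) (Z : Matrix m n B)
    (hZ : X'.map (algebraMap K B) * Z = Z * X.map (algebraMap K B)) :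
    Z ∈ Submodule.span B ((fun Y : Matrix m n K => Y.map (algebraMap K B)) ''
      {Y | X' * Y = Y * X}) := by
  classical
  let β := Basis.ofVectorSpace K B
  let S : Finset _ := Finset.univ.biUnion fun i : m => Finset.univ.biUnion fun j : n =>
    (β.repr (Z i j)).support
  have hsum : Z = ∑ s ∈ S, β s • (Matrix.of fun i j => β.repr (Z i j) s).map (algebraMap K B) := by
    ext i j
    rw [Matrix.sum_apply]
    conv_lhs => rw [← β.linearCombination_repr (Z i j), Finsupp.linearCombination_apply, Finsupp.sum]
    rw [Finset.sum_subset (s₂ := S)]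
    · refine Finset.sum_congr rfl fun s _ => ?_
      simp [Algebra.smul_def, mul_comm]
    · intro s hs
      simp only [S, Finset.mem_biUnion, Finset.mem_univ, true_and]
      exact ⟨i, j, hs⟩
    · intro s _ hs
      rw [Finsupp.notMem_support_iff.1 hs, zero_smul]
  rw [hsum]
  refine Submodule.sum_mem _ fun s _ => Submodule.smul_mem _ _ (Submodule.subset_span ⟨_, ?_, rfl⟩)
  ext i j
  have hij := congrArg (fun M : Matrix m n B => β.repr (M i j) s) hZ
  simp only [Matrix.mul_apply, Matrix.map_apply, map_sum, Finset.sum_apply'] at hij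
  simp only [Matrix.mul_apply, Matrix.of_apply]
  have h1 : ∀ x : m, β.repr (algebraMap K B (X' i x) * Z x j) s = X' i x * β.repr (Z x j) s :=
    fun x => by rw [← Algebra.smul_def, map_smul, Finsupp.smul_apply, smul_eq_mul]
  have h2 : ∀ x : n, β.repr (Z i x * algebraMap K B (X x j)) s = β.repr (Z i x) s * X x j :=
    fun x => by rw [mul_comm, ← Algebra.smul_def, map_smul, Finsupp.smul_apply, smul_eq_mul, mul_comm]
  simpa [h1, h2] using hij

/-- A finite family with the same span property. -/
theorem mem_span_finite {B M ι : Type*} [Semiring B] [AddCommMonoid M] [Module B M] (f : ι → M)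
    (S : Set ι) (Z : M) (hZ : Z ∈ Submodule.span B (f '' S)) :
    ∃ (t : Finset ι), (∀ i ∈ t, i ∈ S) ∧
      Z ∈ Submodule.span B (Set.range fun i : t => f i) := by
  classical
  obtain ⟨T, hT, hZT⟩ := Submodule.mem_span_finite_of_mem_span hZ
  obtain ⟨t, ht, rfl⟩ := Finset.subset_set_image_iff.1 hT
  refine ⟨t, fun i hi => ht hi, Submodule.span_mono ?_ hZT⟩
  intro x hx
  obtain ⟨i, hi, rfl⟩ := Finset.mem_image.1 hx
  exact ⟨⟨i, hi⟩, rfl⟩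

/-- If two matrices are intertwined by a surjective matrix over an extension field, then they are
so over the (infinite) ground field. -/
theorem exists_intertwine_of_extension {K B m n : Type*} [Field K] [Infinite K] [Field B]
    [Algebra K B] [Fintype m] [DecidableEq m] [Fintype n] (X : Matrix n n K) (X' : Matrix m m K)
    (Z : Matrix m n B) (hZ : X'.map (algebraMap K B) * Z = Z * X.map (algebraMap K B))
    (R : Matrix n m B) (hR : IsUnit (Z * R).det) :
    ∃ Y : Matrix m n K, X' * Y = Y * X ∧ IsUnit (Y.map (algebraMap K B) * R).det := by
  obtain ⟨t, ht, hZt⟩ := mem_span_finite _ _ _ (intertwine_mem_span X X' Z hZ)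
  obtain ⟨c, hc, hu⟩ := exists_isUnit_det_of_mem_span (Set.range (algebraMap K B))
    (Set.infinite_range_of_injective (algebraMap K B).injective) _ Z hZt R hR
  choose c' hc' using hc
  refine ⟨∑ i, c' i • (i.1 : Matrix m n K), ?_, ?_⟩
  · rw [Matrix.mul_sum, Matrix.sum_mul]
    refine Finset.sum_congr rfl fun i _ => ?_
    have : X' * (i.1 : Matrix m n K) = i.1 * X := ht i i.2
    rw [Matrix.mul_smul, Matrix.smul_mul, this]
  · convert hu using 3
    ext x y
    simp [Matrix.sum_apply, ← hc', Algebra.smul_def]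

end Intertwine

end

section

open Module Polynomial

section Charpoly

variable {K V V' : Type*} [Field K] [AddCommGroup V] [Module K V] [FiniteDimensional K V]
  [AddCommGroup V'] [Module K V'] [FiniteDimensional K V']

theorem charpoly_eq_mul_of_surjective (f : End K V) (f' : End K V') (h : V →ₗ[K] V')
    (hh : ∀ x, h (f x) = f' (h x)) (hs : Function.Surjective h) :
    f.charpoly = (f.restrict (p := LinearMap.ker h) (q := LinearMap.ker h) fun x hx => by
      rw [LinearMap.mem_ker] at hx ⊢; rw [hh, hx, map_zero]).charpoly * f'.charpoly := by
  obtain ⟨W, hW⟩ := Submodule.exists_isCompl (LinearMap.ker h)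
  set f₀ := f.restrict (p := LinearMap.ker h) (q := LinearMap.ker h) fun x hx => by
      rw [LinearMap.mem_ker] at hx ⊢; rw [hh, hx, map_zero]
  let e₁ : W ≃ₗ[K] V' := LinearEquiv.ofBijective (h.domRestrict W) (by
    constructor
    · rw [← LinearMap.ker_eq_bot, LinearMap.ker_eq_bot']
      intro w hw
      exact Subtype.ext (Submodule.disjoint_def.1 hW.disjoint w.1 hw w.2)
    · intro y
      obtain ⟨x, rfl⟩ := hs y
      obtain ⟨a, ha, b, hb, rfl⟩ := Submodule.mem_sup.1 (hW.sup_eq_top ▸ Submodule.mem_top : x ∈ _)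
      refine ⟨⟨b, hb⟩, ?_⟩
      change h b = _
      rw [map_add, LinearMap.mem_ker.1 ha, zero_add])
  let b₀ := finBasis K (LinearMap.ker h)
  let b₁ := finBasis K V'
  let B := (b₀.prod (b₁.map e₁.symm)).map (Submodule.prodEquivOfIsCompl _ _ hW)
  have hBl : ∀ i, B (Sum.inl i) = b₀ i := fun i => by simp [B]
  have hBr : ∀ i, B (Sum.inr i) = e₁.symm (b₁ i) := fun i => by simp [B]
  have hr₀ : ∀ x : LinearMap.ker h, ∀ i, B.repr x (Sum.inl i) = b₀.repr x i := fun x i => by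
    simp [B]
  have hr₁ : ∀ x : V, ∀ i, B.repr x (Sum.inr i) = b₁.repr (h x) i := fun x i => by
    have hx : h x = e₁ ((Submodule.prodEquivOfIsCompl _ _ hW).symm x).2 := by
      obtain ⟨⟨y, z⟩, rfl⟩ := (Submodule.prodEquivOfIsCompl _ _ hW).surjective x
      rw [LinearEquiv.symm_apply_apply, Submodule.coe_prodEquivOfIsCompl', map_add,
        LinearMap.mem_ker.1 y.2, zero_add]
      rfl
    simp [B, hx]
  rw [← LinearMap.charpoly_toMatrix f B, ← LinearMap.charpoly_toMatrix f₀ b₀,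
    ← LinearMap.charpoly_toMatrix f' b₁]
  have : LinearMap.toMatrix B B f = Matrix.fromBlocks (LinearMap.toMatrix b₀ b₀ f₀)
      (Matrix.of fun i j => LinearMap.toMatrix B B f (Sum.inl i) (Sum.inr j)) 0
      (LinearMap.toMatrix b₁ b₁ f') := by
    ext (i | i) (j | j)
    · rw [LinearMap.toMatrix_apply, hBl, Matrix.fromBlocks_apply₁₁, LinearMap.toMatrix_apply]
      exact hr₀ (f₀ (b₀ j)) i
    · rfl
    · rw [LinearMap.toMatrix_apply, hBl, Matrix.fromBlocks_apply₂₁, hr₁, hh,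
        LinearMap.mem_ker.1 (b₀ j).2]
      simp
    · rw [LinearMap.toMatrix_apply, hBr, Matrix.fromBlocks_apply₂₂, LinearMap.toMatrix_apply, hr₁,
        hh]
      have : h (e₁.symm (b₁ j)) = b₁ j := e₁.apply_symm_apply _
      rw [this]
  rw [this, Matrix.charpoly_fromBlocks_zero₂₁]

theorem charpoly_dvd_of_surjective (f : End K V) (f' : End K V') (h : V →ₗ[K] V')
    (hh : ∀ x, h (f x) = f' (h x)) (hs : Function.Surjective h) : f'.charpoly ∣ f.charpoly :=
  ⟨_, (charpoly_eq_mul_of_surjective f f' h hh hs).trans (mul_comm _ _)⟩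

theorem _root_.Matrix.charpoly_dvd_pow {n : Type*} [Fintype n] [DecidableEq n] (M : Matrix n n K) (p : K[X])
    (hp : aeval M p = 0) : M.charpoly ∣ p ^ Fintype.card n := by
  let ev : K[X][X] →ₐ[K[X]] Matrix n n K[X] := aeval (M.map C)
  have hd : (C X - X : K[X][X]) ∣ C p - p.map C := by
    have := Polynomial.sub_dvd_eval_sub (C X : K[X][X]) X (p.map (C.comp C))
    have h1 : eval (C X) (p.map (C.comp C : K →+* K[X][X])) = C p := by
      rw [eval_map, ← hom_eval₂, eval₂_C_X]
    have h2 : eval X (p.map (C.comp C : K →+* K[X][X])) = p.map C := by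
      rw [eval_map]; rfl
    rwa [h1, h2] at this
  obtain ⟨g, hg⟩ := hd
  have h1 := congrArg ev hg
  have h2 : ev (p.map C) = 0 := by
    have : ev (p.map C) = (aeval M p).map C := by
      change aeval (M.map C) (p.map (algebraMap K K[X])) = _
      rw [aeval_map_algebraMap]
      exact (aeval_algHom_apply (Algebra.ofId K K[X]).mapMatrix M p)
    rw [this, hp]
    ext; simp
  have h3 : ev (C p) = Matrix.scalar n p := by
    simp [ev, Matrix.algebraMap_eq_diagonal]
  have h4 : ev (C X - X) = M.charmatrix := by
    rw [map_sub, Matrix.charmatrix]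
    simp [ev, Matrix.algebraMap_eq_diagonal]
  rw [map_sub, map_mul, h2, h3, h4, sub_zero] at h1
  have h5 := congrArg Matrix.det h1
  rw [Matrix.det_mul, Matrix.scalar_apply, Matrix.det_diagonal] at h5
  rw [Finset.prod_const, Finset.card_univ] at h5
  exact ⟨_, h5⟩

theorem charpoly_dvd_pow (f : End K V) (p : K[X]) (hp : aeval f p = 0) :
    f.charpoly ∣ p ^ finrank K V := by
  rw [← LinearMap.charpoly_toMatrix f (finBasis K V)]
  have := Matrix.charpoly_dvd_pow (LinearMap.toMatrix (finBasis K V) (finBasis K V) f) p (by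
    have := aeval_algHom_apply (LinearMap.toMatrixAlgEquiv (finBasis K V)).toAlgHom f p
    erw [this, hp, map_zero])
  rwa [Fintype.card_fin] at this

end Charpoly

end

section

open Module Polynomial

section Irreducible

variable {K V V' : Type*} [Field K] [AddCommGroup V] [Module K V] [FiniteDimensional K V]
  [AddCommGroup V'] [Module K V'] [FiniteDimensional K V']

/-- The action of `K[X] / p` on a vector space with an endomorphism killed by `p`. -/
abbrev quotientModule (f : End K V) (p : K[X]) (hf : aeval f p = 0) :
    Module (K[X] ⧸ Ideal.span {p}) V :=
  Module.compHom V (Ideal.Quotient.lift (Ideal.span {p}) (aeval f).toRingHom (fun a ha => by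
    obtain ⟨b, rfl⟩ := Ideal.mem_span_singleton'.1 ha
    change aeval f (b * p) = 0
    rw [map_mul, hf, mul_zero]))

theorem quotientModule_tower (f : End K V) (p : K[X]) (hf : aeval f p = 0) :
    letI := quotientModule f p hf
    IsScalarTower K (K[X] ⧸ Ideal.span {p}) V := by
  let := quotientModule f p hf
  refine IsScalarTower.of_algebraMap_smul (R := K) (A := K[X] ⧸ Ideal.span {p}) (M := V)
    fun r x => ?_
  change (aeval f (C r)) x = _
  simp

theorem exists_split_of_irreducible (f : End K V) (f' : End K V') (p : K[X]) (hp : Irreducible p)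
    (hf : aeval f p = 0) (hf' : aeval f' p = 0) (hle : finrank K V' ≤ finrank K V) :
    ∃ (h : V →ₗ[K] V') (i : V' →ₗ[K] V), (∀ x, h (f x) = f' (h x)) ∧ (∀ x, i (f' x) = f (i x)) ∧
      ∀ x, h (i x) = x := by
  let R := K[X] ⧸ Ideal.span {p}
  have : (Ideal.span {p}).IsMaximal := PrincipalIdealRing.isMaximal_of_irreducible hp
  let : Field R := Ideal.Quotient.field _
  let : Module R V := quotientModule f p hf
  let : Module R V' := quotientModule f' p hf'
  have : IsScalarTower K R V := quotientModule_tower f p hf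
  have : IsScalarTower K R V' := quotientModule_tower f' p hf'
  have : Module.Finite R V := Module.Finite.of_restrictScalars_finite K R V
  have : Module.Finite R V' := Module.Finite.of_restrictScalars_finite K R V'
  have hd : finrank K R = p.natDegree := finrank_quotient_span_eq_natDegree
  have hd0 : 0 < finrank K R := by rw [hd]; exact hp.natDegree_pos
  have hle' : finrank R V' ≤ finrank R V := by
    rw [← finrank_mul_finrank K R V, ← finrank_mul_finrank K R V'] at hle
    exact Nat.le_of_mul_le_mul_left hle hd0
  let b := finBasis R V
  let b' := finBasis R V'
  let i : V' →ₗ[R] V := b'.constr R fun j => b (Fin.castLE hle' j)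
  let h : V →ₗ[R] V' := b.constr R fun j =>
    if hj : (j : ℕ) < finrank R V' then b' ⟨j, hj⟩ else 0
  have hi : h ∘ₗ i = LinearMap.id := b'.ext fun j => by
    rw [LinearMap.comp_apply, Basis.constr_basis, Basis.constr_basis]
    exact dif_pos j.2
  have hX : ∀ x : V, (Ideal.Quotient.mk (Ideal.span {p}) X : R) • x = f x := fun x => by
    change (aeval f X) x = _
    rw [aeval_X]
  have hX' : ∀ x : V', (Ideal.Quotient.mk (Ideal.span {p}) X : R) • x = f' x := fun x => by
    change (aeval f' X) x = _
    rw [aeval_X]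
  refine ⟨h.restrictScalars K, i.restrictScalars K, fun x => ?_, fun x => ?_, fun x => ?_⟩
  · rw [← hX, ← hX']; exact map_smul h _ _
  · rw [← hX, ← hX']; exact map_smul i _ _
  · exact LinearMap.congr_fun hi x

/-- The commutant of an endomorphism killed by an irreducible polynomial. -/
theorem finrank_commutant_of_irreducible (f : End K V) (p : K[X]) (hp : Irreducible p)
    (hf : aeval f p = 0) :
    finrank K (Subalgebra.centralizer K {f}) * p.natDegree = finrank K V ^ 2 := by
  let R := K[X] ⧸ Ideal.span {p}
  have : (Ideal.span {p}).IsMaximal := PrincipalIdealRing.isMaximal_of_irreducible hp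
  let : Field R := Ideal.Quotient.field _
  let : Module R V := quotientModule f p hf
  have : IsScalarTower K R V := quotientModule_tower f p hf
  have : Module.Finite R V := Module.Finite.of_restrictScalars_finite K R V
  have : SMulCommClass R K V := IsScalarTower.to_smulCommClass'
  have hd : finrank K R = p.natDegree := finrank_quotient_span_eq_natDegree
  have hX : ∀ x : V, (Ideal.Quotient.mk (Ideal.span {p}) X : R) • x = f x := fun x => by
    change (aeval f X) x = _
    rw [aeval_X]
  let e : Subalgebra.centralizer K {f} ≃ₗ[K] (V →ₗ[R] V) :=
    { toFun := fun g =>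
        { toFun := g.1
          map_add' := map_add _
          map_smul' := fun r x => by
            obtain ⟨q, rfl⟩ := Ideal.Quotient.mk_surjective r
            have hc : Commute (g : End K V) (aeval f q) := by
              have hg : Commute f g.1 := (Subalgebra.mem_centralizer_iff K).1 g.2 f rfl
              have : aeval f q ∈ Algebra.adjoin K {f} := aeval_mem_adjoin_singleton K f
              exact (Algebra.commute_of_mem_adjoin_singleton_of_commute this hg.symm)
            exact LinearMap.congr_fun hc x }
      map_add' := fun _ _ => rfl
      map_smul' := fun _ _ => rfl
      invFun := fun g => ⟨g.restrictScalars K, by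
        rw [Subalgebra.mem_centralizer_iff]
        rintro _ ⟨⟩
        ext x
        change f (g x) = g (f x)
        rw [← hX, ← hX, map_smul]⟩
      left_inv := fun _ => rfl
      right_inv := fun _ => rfl }
  rw [e.finrank_eq, ← finrank_mul_finrank K R (V →ₗ[R] V), Module.finrank_linearMap, hd,
    ← finrank_mul_finrank K R V, hd]
  ring

end Irreducible

end

section

open Module Polynomial

section Semisimple

variable {K V V' : Type*} [Field K] [AddCommGroup V] [Module K V] [FiniteDimensional K V]
  [AddCommGroup V'] [Module K V'] [FiniteDimensional K V']

theorem aeval_comm {f : End K V} {f' : End K V'} {h : V →ₗ[K] V'} (hh : ∀ x, h (f x) = f' (h x))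
    (p : K[X]) (x : V) : h (aeval f p x) = aeval f' p (h x) := by
  induction p using Polynomial.induction_on' generalizing x with
  | add p q hp hq => simp [hp, hq]
  | monomial n a =>
    simp only [aeval_monomial, Module.End.mul_apply, Module.algebraMap_end_apply, map_smul]
    congr 1
    induction n generalizing x with
    | zero => rfl
    | succ n ih => rw [pow_succ, pow_succ, Module.End.mul_apply, Module.End.mul_apply, ih, hh]

theorem aeval_apply_comm (f : End K V) (p q : K[X]) (x : V) :
    aeval f p (aeval f q x) = aeval f q (aeval f p x) := by
  rw [← Module.End.mul_apply, ← Module.End.mul_apply, ← map_mul, ← map_mul, mul_comm]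

/-- The restriction of `f` to the kernel of `p(f)`. -/
def resKer (f : End K V) (p : K[X]) : End K (LinearMap.ker (aeval f p)) :=
  f.restrict fun x hx => by
    rw [LinearMap.mem_ker] at hx ⊢
    have := aeval_apply_comm f p X x
    rw [aeval_X] at this
    rw [this, hx, map_zero]

theorem coe_resKer (f : End K V) (p : K[X]) (x : LinearMap.ker (aeval f p)) :
    (resKer f p x : V) = f x := rfl

theorem aeval_resKer (f : End K V) (p q : K[X]) (x : LinearMap.ker (aeval f p)) :
    (aeval (resKer f p) q x : V) = aeval f q x :=
  aeval_comm (h := (LinearMap.ker (aeval f p)).subtype) (fun _ => rfl) q x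

theorem aeval_resKer_self (f : End K V) (p : K[X]) : aeval (resKer f p) p = 0 := by
  ext x
  rw [aeval_resKer]
  exact x.2

/-- The idempotents of the Chinese remainder theorem. -/
theorem exists_idempotents {R : Type*} [CommRing R] [DecidableEq R] (P : Finset R)
    (hcop : (P : Set R).Pairwise IsCoprime) :
    ∃ ε : R → R, (∀ p ∈ P, p ∣ ε p - 1) ∧ (∀ p ∈ P, ∀ q ∈ P, q ≠ p → q ∣ ε p) ∧
      (∀ p ∈ P, (∏ q ∈ P.erase p, q) ∣ ε p) ∧ (∏ p ∈ P, p) ∣ ∑ p ∈ P, ε p - 1 := by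
  have hE : ∀ p ∈ P, ∃ ε : R, p ∣ ε - 1 ∧ (∏ q ∈ P.erase p, q) ∣ ε := by
    intro p hp
    have : IsCoprime p (∏ q ∈ P.erase p, q) := IsCoprime.prod_right fun q hq =>
      hcop hp (Finset.mem_of_mem_erase hq) (Finset.ne_of_mem_erase hq).symm
    obtain ⟨a, b, hab⟩ := this
    exact ⟨b * ∏ q ∈ P.erase p, q, ⟨-a, by rw [← hab]; ring⟩, dvd_mul_left _ _⟩
  choose! ε hε1 hε0 using hE
  have hεne : ∀ p ∈ P, ∀ q ∈ P, q ≠ p → q ∣ ε p := fun p hp q hq hqp =>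
    (Finset.dvd_prod_of_mem (fun q => q) (Finset.mem_erase.2 ⟨hqp, hq⟩)).trans (hε0 p hp)
  refine ⟨ε, hε1, hεne, hε0, Finset.prod_dvd_of_coprime (fun p hp q hq h => hcop hp hq h)
    fun p hp => ?_⟩
  rw [← Finset.add_sum_erase _ _ hp, add_sub_right_comm]
  exact dvd_add (hε1 p hp) (Finset.dvd_sum fun q hq =>
    hεne q (Finset.mem_of_mem_erase hq) p hp (Finset.ne_of_mem_erase hq).symm)

/-- Two endomorphisms killed by a product `P` of pairwise coprime irreducible polynomials are compared
through the dimensions of the kernels of the factors. -/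
theorem exists_split_of_prod (f : End K V) (f' : End K V') (P : Finset K[X])
    (hirr : ∀ p ∈ P, Irreducible p) (hcop : (P : Set K[X]).Pairwise IsCoprime)
    (hf : aeval f (∏ p ∈ P, p) = 0) (hf' : aeval f' (∏ p ∈ P, p) = 0)
    (hle : ∀ p ∈ P, finrank K (LinearMap.ker (aeval f' p)) ≤ finrank K (LinearMap.ker (aeval f p))) :
    ∃ (h : V →ₗ[K] V') (i : V' →ₗ[K] V), (∀ x, h (f x) = f' (h x)) ∧ (∀ x, i (f' x) = f (i x)) ∧
      ∀ x, h (i x) = x := by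
  classical
  obtain ⟨ε, hε1, hεne, hε0, hεsum⟩ := exists_idempotents P hcop
  have hεP : ∀ p ∈ P, (∏ p ∈ P, p) ∣ p * ε p := fun p hp => by
    rw [← Finset.mul_prod_erase _ _ hp]
    exact mul_dvd_mul_left _ (hε0 p hp)
  have hex : ∀ p : P, ∃ (h : LinearMap.ker (aeval f p.1) →ₗ[K] LinearMap.ker (aeval f' p.1))
      (i : LinearMap.ker (aeval f' p.1) →ₗ[K] LinearMap.ker (aeval f p.1)),
      (∀ x, h (resKer f p.1 x) = resKer f' p.1 (h x)) ∧
      (∀ x, i (resKer f' p.1 x) = resKer f p.1 (i x)) ∧ ∀ x, h (i x) = x := fun p =>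
    exists_split_of_irreducible _ _ p.1 (hirr _ p.2) (aeval_resKer_self f p.1)
      (aeval_resKer_self f' p.1) (hle _ p.2)
  choose h i hh hi hhi using hex
  have kill : ∀ {V : Type _} [AddCommGroup V] [Module K V] (f : End K V),
      aeval f (∏ p ∈ P, p) = 0 → ∀ a, (∏ p ∈ P, p) ∣ a → aeval f a = 0 := by
    rintro V _ _ f hf _ ⟨b, rfl⟩
    rw [map_mul, hf, zero_mul]
  have kill' : ∀ {V : Type _} [AddCommGroup V] [Module K V] (f : End K V),
      aeval f (∏ p ∈ P, p) = 0 → ∀ a, (∏ p ∈ P, p) ∣ a → aeval f a = 0 := by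
    rintro V _ _ f hf _ ⟨b, rfl⟩
    rw [map_mul, hf, zero_mul]
  let pr : ∀ p : P, V →ₗ[K] LinearMap.ker (aeval f p.1) := fun p =>
    (aeval f (ε p)).codRestrict _ fun x => by
      rw [LinearMap.mem_ker, ← Module.End.mul_apply, ← map_mul, kill f hf _ (hεP p p.2)]; rfl
  let pr' : ∀ p : P, V' →ₗ[K] LinearMap.ker (aeval f' p.1) := fun p =>
    (aeval f' (ε p)).codRestrict _ fun x => by
      rw [LinearMap.mem_ker, ← Module.End.mul_apply, ← map_mul, kill' f' hf' _ (hεP p p.2)]; rfl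
  let H : V →ₗ[K] V' := ∑ p : P, (LinearMap.ker (aeval f' p.1)).subtype ∘ₗ h p ∘ₗ pr p
  let I : V' →ₗ[K] V := ∑ p : P, (LinearMap.ker (aeval f p.1)).subtype ∘ₗ i p ∘ₗ pr' p
  have hH : ∀ x, H x = ∑ p : P, (h p (pr p x) : V') := fun x => by simp [H]
  have hI : ∀ x, I x = ∑ p : P, (i p (pr' p x) : V) := fun x => by simp [I]
  have hprf : ∀ p x, pr p (f x) = resKer f p.1 (pr p x) := fun p x => Subtype.ext (by
    have := aeval_apply_comm f (ε p) X x
    rw [aeval_X] at this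
    exact this)
  have hprf' : ∀ p x, pr' p (f' x) = resKer f' p.1 (pr' p x) := fun p x => Subtype.ext (by
    have := aeval_apply_comm f' (ε p) X x
    rw [aeval_X] at this
    exact this)
  have hpr_ne : ∀ p q : P, q ≠ p → ∀ x : LinearMap.ker (aeval f q.1), pr p x = 0 :=
    fun p q hqp x => Subtype.ext (by
      obtain ⟨b, hb⟩ := hεne p p.2 q q.2 (fun h => hqp (Subtype.ext h))
      change aeval f (ε p) x = 0
      rw [hb, mul_comm, map_mul, Module.End.mul_apply, LinearMap.mem_ker.1 x.2, map_zero])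
  have hpr_eq : ∀ (p : P) (x : LinearMap.ker (aeval f p.1)), pr p x = x :=
    fun p x => Subtype.ext (by
      obtain ⟨b, hb⟩ := hε1 p p.2
      change aeval f (ε p) x = x
      rw [sub_eq_iff_eq_add.1 hb, map_add, map_one, mul_comm, map_mul, LinearMap.add_apply,
        Module.End.mul_apply, LinearMap.mem_ker.1 x.2, map_zero, zero_add, Module.End.one_apply])
  refine ⟨H, I, fun x => ?_, fun x => ?_, fun x => ?_⟩
  · rw [hH, hH, map_sum]
    exact Finset.sum_congr rfl fun p _ => by rw [hprf, hh, coe_resKer]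
  · rw [hI, hI, map_sum]
    exact Finset.sum_congr rfl fun p _ => by rw [hprf', hi, coe_resKer]
  · have hpI : ∀ p, pr p (I x) = i p (pr' p x) := by
      intro p
      rw [hI, map_sum, Finset.sum_eq_single p]
      · rw [hpr_eq]
      · intro q _ hq
        rw [hpr_ne p q hq]
      · simp
    rw [hH]
    simp_rw [hpI, hhi]
    have := congrArg (fun g : End K V' => g x) (kill' f' hf' _ hεsum)
    simp only [map_sub, map_sum, map_one, LinearMap.sub_apply, LinearMap.sum_apply,
      Module.End.one_apply, LinearMap.zero_apply, sub_eq_zero] at this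
    rw [← Finset.sum_coe_sort] at this
    exact this

theorem exists_split_of_isSemisimple (f : End K V) (f' : End K V') (hf : f.IsSemisimple)
    (hf' : f'.IsSemisimple)
    (hle : ∀ p : K[X], Irreducible p →
      finrank K (LinearMap.ker (aeval f' p)) ≤ finrank K (LinearMap.ker (aeval f p))) :
    ∃ (h : V →ₗ[K] V') (i : V' →ₗ[K] V), (∀ x, h (f x) = f' (h x)) ∧ (∀ x, i (f' x) = f (i x)) ∧
      ∀ x, h (i x) = x := by
  classical
  have h0 : minpoly K f ≠ 0 := minpoly.ne_zero (Algebra.IsIntegral.isIntegral (R := K) f)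
  have h0' : minpoly K f' ≠ 0 := minpoly.ne_zero (Algebra.IsIntegral.isIntegral (R := K) f')
  set μ := minpoly K f * minpoly K f'
  have hμ0 : μ ≠ 0 := mul_ne_zero h0 h0'
  have hd : minpoly K f ∣ UniqueFactorizationMonoid.radical μ :=
    (UniqueFactorizationMonoid.dvd_radical_iff hf.minpoly_squarefree.isRadical hμ0).2
      (dvd_mul_right _ _)
  have hd' : minpoly K f' ∣ UniqueFactorizationMonoid.radical μ :=
    (UniqueFactorizationMonoid.dvd_radical_iff hf'.minpoly_squarefree.isRadical hμ0).2
      (dvd_mul_left _ _)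
  have hir : ∀ p ∈ UniqueFactorizationMonoid.primeFactors μ, Irreducible p := fun p hp =>
    UniqueFactorizationMonoid.irreducible_of_normalized_factor p
      (UniqueFactorizationMonoid.mem_primeFactors.1 hp)
  refine exists_split_of_prod f f' (UniqueFactorizationMonoid.primeFactors μ) hir ?_ ?_ ?_
    fun p hp => hle p (hir p hp)
  · intro p hp q hq hpq
    exact (UniqueFactorizationMonoid.pairwise_primeFactors_isRelPrime hp hq hpq).isCoprime
  · obtain ⟨b, hb⟩ := hd
    change aeval f (UniqueFactorizationMonoid.radical μ) = 0
    rw [hb, map_mul, minpoly.aeval, zero_mul]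
  · obtain ⟨b, hb⟩ := hd'
    change aeval f' (UniqueFactorizationMonoid.radical μ) = 0
    rw [hb, map_mul, minpoly.aeval, zero_mul]

/-- A semisimple endomorphism is killed by `p q` for some `q` prime to a given irreducible `p`. -/
theorem exists_coprime_of_isSemisimple (f : End K V) (hf : f.IsSemisimple) (p : K[X])
    (hp : Irreducible p) : ∃ q, IsCoprime p q ∧ aeval f (p * q) = 0 := by
  by_cases h : p ∣ minpoly K f
  · obtain ⟨q, hq⟩ := h
    refine ⟨q, (hp.coprime_iff_not_dvd).2 fun hpq => hp.not_isUnit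
      (hf.minpoly_squarefree p ?_), by rw [← hq, minpoly.aeval]⟩
    rw [hq]
    exact mul_dvd_mul_left p hpq
  · exact ⟨minpoly K f, (hp.coprime_iff_not_dvd).2 h, by rw [map_mul, minpoly.aeval, mul_zero]⟩

/-- The projection onto the kernel of `p(f)`. -/
theorem exists_proj (f : End K V) (p q : K[X]) (hpq : IsCoprime p q) (h0 : aeval f (p * q) = 0) :
    ∃ π : V →ₗ[K] LinearMap.ker (aeval f p), (∃ ε : K[X], ∀ x, (π x : V) = aeval f ε x) ∧
      (∀ x : LinearMap.ker (aeval f p), π x = x) ∧ ∀ x, π (f x) = resKer f p (π x) := by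
  obtain ⟨a, b, hab⟩ := hpq
  refine ⟨(aeval f (b * q)).codRestrict _ fun x => ?_, ⟨b * q, fun x => rfl⟩,
    fun x => Subtype.ext ?_, fun x => Subtype.ext ?_⟩
  · rw [LinearMap.mem_ker, ← Module.End.mul_apply, ← map_mul,
      show p * (b * q) = b * (p * q) by ring, map_mul, h0, mul_zero]; rfl
  · change aeval f (b * q) x = x
    rw [eq_sub_of_add_eq' hab, map_sub, map_mul, map_one, LinearMap.sub_apply, Module.End.mul_apply,
      LinearMap.mem_ker.1 x.2, map_zero, sub_zero, Module.End.one_apply]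
  · have := aeval_apply_comm f (b * q) X x
    rw [aeval_X] at this
    exact this

theorem charpoly_of_irreducible (f : End K V) (p : K[X]) (hp : Irreducible p)
    (hf : aeval f p = 0) :
    ∃ j, Associated f.charpoly (p ^ j) ∧ j * p.natDegree = finrank K V := by
  obtain ⟨j, -, hj⟩ := (dvd_prime_pow hp.prime _).1 (charpoly_dvd_pow f p hf)
  refine ⟨j, hj, ?_⟩
  rw [← LinearMap.charpoly_natDegree f, ← natDegree_pow]
  exact (natDegree_eq_of_degree_eq (degree_eq_degree_of_associated hj)).symm

theorem finrank_ker_le_of_charpoly_dvd (f : End K V) (f' : End K V') (hf : f.IsSemisimple)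
    (hf' : f'.IsSemisimple) (hd : f'.charpoly ∣ f.charpoly) (p : K[X]) (hp : Irreducible p) :
    finrank K (LinearMap.ker (aeval f' p)) ≤ finrank K (LinearMap.ker (aeval f p)) := by
  obtain ⟨q, hpq, hq⟩ := exists_coprime_of_isSemisimple f hf p hp
  obtain ⟨q', hpq', hq'⟩ := exists_coprime_of_isSemisimple f' hf' p hp
  obtain ⟨π, -, hπ, hπf⟩ := exists_proj f' p q' hpq' hq'
  have h1 := charpoly_dvd_of_surjective f' (resKer f' p) π hπf fun x => ⟨x, hπ x⟩
  obtain ⟨j', hj', hjd'⟩ := charpoly_of_irreducible (resKer f' p) p hp (aeval_resKer_self f' p)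
  obtain ⟨j, hj, hjd⟩ := charpoly_of_irreducible (resKer f p) p hp (aeval_resKer_self f p)
  let g : V →ₗ[K] LinearMap.ker (aeval f q) := (aeval f p).codRestrict _ fun x => by
    rw [LinearMap.mem_ker, ← Module.End.mul_apply, ← map_mul, mul_comm, hq]; rfl
  have hgs : Function.Surjective g := by
    obtain ⟨a, b, hab⟩ := hpq
    intro x
    refine ⟨aeval f a x, Subtype.ext ?_⟩
    change aeval f p (aeval f a x) = x
    rw [← Module.End.mul_apply, ← map_mul, mul_comm, eq_sub_of_add_eq hab, map_sub, map_mul, map_one,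
      LinearMap.sub_apply, Module.End.mul_apply, LinearMap.mem_ker.1 x.2, map_zero, sub_zero,
      Module.End.one_apply]
  have hgf : ∀ x, g (f x) = resKer f q (g x) := fun x => Subtype.ext (by
    have := aeval_apply_comm f p X x
    rw [aeval_X] at this
    exact this)
  have h2 := charpoly_eq_mul_of_surjective f (resKer f q) g hgf hgs
  have hker : LinearMap.ker g = LinearMap.ker (aeval f p) := LinearMap.ker_codRestrict _ _ _
  have h3 : (f.restrict (p := LinearMap.ker g) (q := LinearMap.ker g) fun x hx => by
      rw [LinearMap.mem_ker] at hx ⊢; rw [hgf, hx, map_zero]).charpoly = (resKer f p).charpoly := by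
    rw [← LinearEquiv.charpoly_conj (LinearEquiv.ofEq _ _ hker)]
    congr 1
  rw [h3] at h2
  have h4 : p ^ j' ∣ p ^ j * (resKer f q).charpoly :=
    (hj'.symm.dvd.trans (h1.trans (hd.trans h2.dvd))).trans (mul_dvd_mul_right hj.dvd _)
  have h5 : IsCoprime (p ^ j') (resKer f q).charpoly :=
    ((hpq.pow_left (m := j')).pow_right (n := finrank K (LinearMap.ker (aeval f q)))).of_isCoprime_of_dvd_right
      (charpoly_dvd_pow _ q (aeval_resKer_self f q))
  have h6 : p ^ j' ∣ p ^ j := h5.dvd_of_dvd_mul_right h4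
  have h7 : j' ≤ j := (pow_dvd_pow_iff hp.ne_zero hp.not_isUnit).1 h6
  rw [← hjd, ← hjd']
  exact Nat.mul_le_mul_right _ h7

/-- The elements of the commutant of `f` which are killed by `p(f)`. -/
def commutantKer (f : End K V) (p : K[X]) : Submodule K (End K V) where
  carrier := {g | (∀ x, g (f x) = f (g x)) ∧ ∀ x, aeval f p (g x) = 0}
  add_mem' h h' := ⟨fun x => by simp [h.1, h'.1], fun x => by simp [h.2, h'.2]⟩
  zero_mem' := ⟨fun x => by simp, fun x => by simp⟩
  smul_mem' c g h := ⟨fun x => by simp [h.1], fun x => by simp [h.2]⟩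

theorem finrank_commutantKer (f : End K V) (hf : f.IsSemisimple) (p : K[X])
    (hp : Irreducible p) :
    finrank K (commutantKer f p) * p.natDegree = finrank K (LinearMap.ker (aeval f p)) ^ 2 := by
  obtain ⟨q, hpq, hq⟩ := exists_coprime_of_isSemisimple f hf p hp
  obtain ⟨π, ⟨ε, hε⟩, hπ, hπf⟩ := exists_proj f p q hpq hq
  rw [← finrank_commutant_of_irreducible (resKer f p) p hp (aeval_resKer_self f p)]
  congr 1
  refine LinearEquiv.finrank_eq
    { toFun := fun g => ⟨(g.1.domRestrict _).codRestrict (LinearMap.ker (aeval f p)) fun x => g.2.2 x,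
        by
          rw [Subalgebra.mem_centralizer_iff]
          rintro _ ⟨⟩
          ext x
          exact (g.2.1 x).symm⟩
      map_add' := fun _ _ => rfl
      map_smul' := fun _ _ => rfl
      invFun := fun g => ⟨(LinearMap.ker (aeval f p)).subtype ∘ₗ g.1 ∘ₗ π, by
        constructor
        · intro x
          have := (Subalgebra.mem_centralizer_iff K).1 g.2 _ rfl
          have := congrArg Subtype.val (LinearMap.congr_fun this (π x))
          change (g.1 (π (f x)) : V) = f (g.1 (π x))
          rw [hπf]
          exact this.symm
        · intro x
          exact (g.1 (π x)).2⟩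
      left_inv := fun g => Subtype.ext (LinearMap.ext fun x => by
        change g.1 (π x : V) = g.1 x
        rw [hε, aeval_comm g.2.1, ← hε, hπ ⟨g.1 x, g.2.2 x⟩])
      right_inv := fun g => Subtype.ext (LinearMap.ext fun x => Subtype.ext (by
        change (g.1 (π x) : V) = g.1 x
        rw [hπ])) }

end Semisimple

end

section

open Module Polynomial

/-! ### Semilinear descent for cyclic extensions -/

/-- `σ` has order `e` and fixed field `Q`. -/
structure CyclicExt (Q : Type*) {K : Type*} [Field Q] [Field K] [Algebra Q K] (σ : K →+* K)
    (e : ℕ) : Prop where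
  pos : 0 < e
  iter : ∀ c, σ^[e] c = c
  dist : ∀ i < e, ∀ j < e, (∀ c, σ^[i] c = σ^[j] c) → i = j
  map : ∀ a : Q, σ (algebraMap Q K a) = algebraMap Q K a
  fixed : ∀ c, σ c = c → c ∈ Set.range (algebraMap Q K)

section PhiSpace

variable {Q K : Type*} [Field Q] [Field K] [Algebra Q K] {σ : K →+* K} {e : ℕ}
  {V V' : Type*} [AddCommGroup V] [Module K V] [FiniteDimensional K V]
  [AddCommGroup V'] [Module K V'] [FiniteDimensional K V']

theorem phi_bijective (hK : CyclicExt Q σ e) (φ : V →ₛₗ[σ] V) (hφ : Function.Injective φ)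
    (π : End K V) (hπ : ∀ x, π x = φ^[e] x) : Function.Bijective φ := by
  refine ⟨hφ, fun y => ?_⟩
  have hinj : Function.Injective π := by
    rw [show (π : V → V) = φ^[e] from funext hπ]
    exact hφ.iterate e
  obtain ⟨x, rfl⟩ := LinearMap.injective_iff_surjective.1 hinj y
  obtain ⟨n, rfl⟩ : ∃ n, e = n + 1 := ⟨e - 1, by have := hK.pos; omega⟩
  exact ⟨φ^[n] x, by rw [hπ, Function.iterate_succ_apply']⟩

theorem commute_iterate {V V' : Type*} {φ : V → V} {φ' : V' → V'} {f : V → V'}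
    (h : ∀ x, f (φ x) = φ' (f x)) (n : ℕ) (x : V) : f (φ^[n] x) = φ'^[n] (f x) := by
  induction n generalizing x with
  | zero => rfl
  | succ n ih => rw [Function.iterate_succ_apply, Function.iterate_succ_apply, ih, h]

/-- The semilinear action on homomorphisms. -/
theorem exists_hom_action (hK : CyclicExt Q σ e) (φ : V →ₛₗ[σ] V) (hφ : Function.Injective φ)
    (π : End K V) (hπ : ∀ x, π x = φ^[e] x) (φ' : V' →ₛₗ[σ] V') :
    ∃ τ : (V →ₗ[K] V') →+ (V →ₗ[K] V'), (∀ (c : K) f, τ (c • f) = σ c • τ f) ∧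
      (∀ f x, τ f (φ x) = φ' (f x)) := by
  let E : V ≃ V := Equiv.ofBijective φ (phi_bijective hK φ hφ π hπ)
  have hE : ∀ x, φ (E.symm x) = x := E.apply_symm_apply
  have hE' : ∀ x, E.symm (φ x) = x := E.symm_apply_apply
  have hadd : ∀ x y, E.symm (x + y) = E.symm x + E.symm y := fun x y => hφ (by simp [hE])
  obtain ⟨n, rfl⟩ : ∃ n, e = n + 1 := ⟨e - 1, by have := hK.pos; omega⟩
  have hsmul : ∀ (c : K) x, E.symm (c • x) = σ^[n] c • E.symm x := fun c x => hφ (by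
    rw [hE, φ.map_smulₛₗ, hE, ← Function.iterate_succ_apply' σ n, hK.iter])
  refine ⟨⟨⟨fun f => ⟨⟨fun x => φ' (f (E.symm x)), fun x y => by simp [hadd]⟩, fun c x => by
    change φ' (f (E.symm (c • x))) = c • φ' (f (E.symm x))
    rw [hsmul, map_smul, φ'.map_smulₛₗ, ← Function.iterate_succ_apply' σ n, hK.iter]⟩, ?_⟩, ?_⟩,
    fun c f => ?_, fun f x => ?_⟩
  · ext x; simp
  · intro f g; ext x; simp
  · ext x
    change φ' (c • f (E.symm x)) = σ c • φ' (f (E.symm x))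
    rw [φ'.map_smulₛₗ]
  · change φ' (f (E.symm (φ x))) = φ' (f x)
    rw [hE']

/-- Homomorphisms commuting with `π = φ ^ e` are linear combinations of homomorphisms
commuting with `φ`. -/
theorem mem_span_phiHom (hK : CyclicExt Q σ e) (φ : V →ₛₗ[σ] V) (hφ : Function.Injective φ)
    (π : End K V) (hπ : ∀ x, π x = φ^[e] x) (φ' : V' →ₛₗ[σ] V')
    (π' : End K V') (hπ' : ∀ x, π' x = φ'^[e] x) (f : V →ₗ[K] V') (hf : ∀ x, f (π x) = π' (f x)) :
    f ∈ Submodule.span K {g : V →ₗ[K] V' | ∀ x, g (φ x) = φ' (g x)} := by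
  obtain ⟨τ, hτ, hτφ⟩ := exists_hom_action hK φ hφ π hπ φ'
  have hsurj := (phi_bijective hK φ hφ π hπ).2
  have hset : {g : V →ₗ[K] V' | ∀ x, g (φ x) = φ' (g x)} = {g | τ g = g} := by
    ext g
    constructor
    · intro hg
      refine LinearMap.ext fun y => ?_
      obtain ⟨x, rfl⟩ := hsurj y
      rw [hτφ, hg]
    · intro hg x
      rw [← hτφ, show τ g = g from hg]
  rw [hset]
  refine mem_span_fixed (MonoidHom.id K) σ τ hτ e hK.dist hK.iter hK.pos f ?_
  have h1 : ∀ n x, (τ^[n] f) (φ^[n] x) = φ'^[n] (f x) := by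
    intro n
    induction n with
    | zero => intro x; rfl
    | succ n ih =>
      intro x
      rw [Function.iterate_succ_apply', Function.iterate_succ_apply', hτφ, ih,
        Function.iterate_succ_apply']
  refine LinearMap.ext fun y => ?_
  obtain ⟨x, rfl⟩ := hsurj.iterate e y
  rw [h1, ← hπ', ← hf, hπ]

/-- Homomorphisms commuting with `φ` which are independent over `Q` are independent over `K`. -/
theorem linearIndependent_phiHom (hK : CyclicExt Q σ e) (φ : V →ₛₗ[σ] V)
    (hφ : Function.Injective φ)
    (π : End K V) (hπ : ∀ x, π x = φ^[e] x) (φ' : V' →ₛₗ[σ] V') [Module Q V'] [IsScalarTower Q K V']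
    {ι : Type*} (h : ι → (V →ₗ[K] V')) (hh : ∀ i x, h i (φ x) = φ' (h i x))
    (hind : LinearIndependent Q h) : LinearIndependent K h := by
  obtain ⟨τ, hτ, hτφ⟩ := exists_hom_action hK φ hφ π hπ φ'
  refine linearIndependent_of_fixed σ hK.fixed τ hτ h (fun i => LinearMap.ext fun y => ?_) hind
  obtain ⟨x, rfl⟩ := (phi_bijective hK φ hφ π hπ).2 y
  rw [hτφ, hh]

end PhiSpace

/-! ### Transfer of surjective intertwiners -/

section Transfer

theorem exists_right_inverse_toMatrix {K V V' n m : Type*} [Field K] [AddCommGroup V] [Module K V]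
    [AddCommGroup V'] [Module K V'] [Fintype n] [DecidableEq n] [Fintype m] [DecidableEq m]
    (b : Basis n K V) (b' : Basis m K V') (f : V →ₗ[K] V') (hf : Function.Surjective f) :
    ∃ R : Matrix n m K, LinearMap.toMatrix b b' f * R = 1 := by
  obtain ⟨g, hg⟩ := f.exists_rightInverse_of_surjective (LinearMap.range_eq_top.2 hf)
  exact ⟨LinearMap.toMatrix b' b g, by rw [← LinearMap.toMatrix_comp, hg, LinearMap.toMatrix_id]⟩

theorem surjective_of_isUnit_det {K B V V' n m : Type*} [Field K] [Field B] [Algebra K B]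
    [AddCommGroup V] [Module K V]
    [AddCommGroup V'] [Module K V'] [Fintype n] [DecidableEq n] [Fintype m] [DecidableEq m]
    (b : Basis n K V) (b' : Basis m K V') (f : V →ₗ[K] V') (R : Matrix n m B)
    (hR : IsUnit ((LinearMap.toMatrix b b' f).map (algebraMap K B) * R).det) :
    Function.Surjective f := by
  rw [← LinearMap.range_eq_top]
  by_contra hne
  obtain ⟨l, hl0, hl⟩ := Submodule.exists_le_ker_of_lt_top _ (lt_top_iff_ne_top.2 hne)
  let u : m → B := fun j => algebraMap K B (l (b' j))
  have hu : Matrix.vecMul u ((LinearMap.toMatrix b b' f).map (algebraMap K B)) = 0 := by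
    funext j
    have := hl ⟨b j, rfl⟩
    rw [LinearMap.mem_ker, ← b'.sum_repr (f (b j)), map_sum] at this
    simp only [Matrix.vecMul, dotProduct, Matrix.map_apply, LinearMap.toMatrix_apply, Pi.zero_apply,
      u, ← map_mul, ← map_sum]
    rw [← map_zero (algebraMap K B), ← this]
    congr 1
    exact Finset.sum_congr rfl fun i _ => by rw [map_smul, smul_eq_mul, mul_comm]
  have hu0 : u = 0 := by
    refine (Matrix.isUnit_iff_isUnit_det _).2 hR |> fun h => ?_
    have := Matrix.vecMul_injective_iff_isUnit.2 h
    refine this ?_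
    change Matrix.vecMul u _ = Matrix.vecMul 0 _
    rw [← Matrix.vecMul_vecMul, hu, Matrix.zero_vecMul, Matrix.zero_vecMul]
  exact hl0 (b'.ext fun j => (algebraMap K B).injective (by
    rw [LinearMap.zero_apply, map_zero]; exact congrFun hu0 j))

variable {K₁ B n m : Type*} [Field K₁] [Field B] [Algebra K₁ B]
  [Fintype n] [DecidableEq n] [Fintype m] [DecidableEq m]
  {U U' : Type*} [AddCommGroup U] [Module K₁ U] [AddCommGroup U'] [Module K₁ U']

theorem toMatrix_intertwine {K V V' : Type*} [Field K] [AddCommGroup V] [Module K V]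
    [AddCommGroup V'] [Module K V'] (b : Basis n K V) (b' : Basis m K V') (π : End K V)
    (π' : End K V') (f : V →ₗ[K] V') :
    LinearMap.toMatrix b' b' π' * LinearMap.toMatrix b b' f =
      LinearMap.toMatrix b b' f * LinearMap.toMatrix b b π ↔ ∀ x, f (π x) = π' (f x) := by
  rw [← LinearMap.toMatrix_comp, ← LinearMap.toMatrix_comp, EmbeddingLike.apply_eq_iff_eq,
    LinearMap.ext_iff]
  exact forall_congr' fun x => eq_comm

/-- A surjective intertwiner over `B` gives a surjective intertwiner over the subfield `K₁`. -/
theorem exists_surjective_of_matrix [Infinite K₁] (b : Basis n K₁ U) (b' : Basis m K₁ U')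
    (f : End K₁ U) (f' : End K₁ U') (Z : Matrix m n B) (R : Matrix n m B)
    (hZ : (LinearMap.toMatrix b' b' f').map (algebraMap K₁ B) * Z
      = Z * (LinearMap.toMatrix b b f).map (algebraMap K₁ B)) (hR : IsUnit (Z * R).det) :
    ∃ h : U →ₗ[K₁] U', (∀ x, h (f x) = f' (h x)) ∧ Function.Surjective h := by
  obtain ⟨Y, hY, hYR⟩ := exists_intertwine_of_extension _ _ Z hZ R hR
  refine ⟨Matrix.toLin b b' Y, ?_, ?_⟩
  · rw [← toMatrix_intertwine b b', LinearMap.toMatrix_toLin, hY]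
  · refine surjective_of_isUnit_det b b' _ R ?_
    rwa [LinearMap.toMatrix_toLin]

/-- A surjective intertwiner over `B` of the endomorphisms `π` and `π'`
gives a surjective homomorphism commuting with `φ`. -/
theorem exists_surjective_phiHom_of_matrix {Q K : Type*} [Field Q] [Infinite Q] [Field K]
    [Algebra Q K] {σ : K →+* K} {e : ℕ} {V V' : Type*} [AddCommGroup V] [Module K V]
    [FiniteDimensional K V] [AddCommGroup V'] [Module K V'] [FiniteDimensional K V'] [Algebra K B]
    (hK : CyclicExt Q σ e) (φ : V →ₛₗ[σ] V) (hφ : Function.Injective φ)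
    (π : End K V) (hπ : ∀ x, π x = φ^[e] x) (φ' : V' →ₛₗ[σ] V')
    (π' : End K V') (hπ' : ∀ x, π' x = φ'^[e] x) (b : Basis n K V) (b' : Basis m K V')
    (Z : Matrix m n B) (R : Matrix n m B)
    (hZ : (LinearMap.toMatrix b' b' π').map (algebraMap K B) * Z
      = Z * (LinearMap.toMatrix b b π).map (algebraMap K B)) (hR : IsUnit (Z * R).det) :
    ∃ h : V →ₗ[K] V', (∀ x, h (φ x) = φ' (h x)) ∧ Function.Surjective h := by
  let T : (V →ₗ[K] V') → Matrix m n B := fun f =>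
    (LinearMap.toMatrix b b' f).map (algebraMap K B)
  have hTadd : ∀ f g, T (f + g) = T f + T g := fun f g => by ext; simp [T]
  have hTsmul : ∀ (c : K) f, T (c • f) = algebraMap K B c • T f := fun c f => by ext; simp [T]
  have hTzero : T 0 = 0 := by ext; simp [T]
  have hmem : Z ∈ Submodule.span B (T '' {g | ∀ x, g (φ x) = φ' (g x)}) := by
    refine Submodule.span_le.2 ?_ (intertwine_mem_span _ _ Z hZ)
    rintro _ ⟨Y, hY, rfl⟩
    have hY' : ∀ x, Matrix.toLin b b' Y (π x) = π' (Matrix.toLin b b' Y x) := by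
      rw [← toMatrix_intertwine b b', LinearMap.toMatrix_toLin]; exact hY
    have h1 := mem_span_phiHom hK φ hφ π hπ φ' π' hπ' _ hY'
    have h2 : T (Matrix.toLin b b' Y) = Y.map (algebraMap K B) := by
      simp only [T, LinearMap.toMatrix_toLin]
    change Y.map (algebraMap K B) ∈ _
    rw [← h2]
    refine Submodule.span_induction (p := fun g _ => T g ∈ Submodule.span B
      (T '' {g | ∀ x, g (φ x) = φ' (g x)})) ?_ ?_ ?_ ?_ h1
    · exact fun g hg => Submodule.subset_span ⟨g, hg, rfl⟩
    · rw [hTzero]; exact zero_mem _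
    · intro f g _ _ hf hg
      rw [hTadd]; exact add_mem hf hg
    · intro c f _ hf
      rw [hTsmul]; exact Submodule.smul_mem _ _ hf
  obtain ⟨t, ht, hZt⟩ := mem_span_finite _ _ _ hmem
  obtain ⟨c, hc, hu⟩ := exists_isUnit_det_of_mem_span
    (Set.range ((algebraMap K B).comp (algebraMap Q K)))
    (Set.infinite_range_of_injective (RingHom.injective _)) _ Z hZt R hR
  choose c' hc' using hc
  let H : V →ₗ[K] V' := ∑ i : t, algebraMap Q K (c' i) • i.1
  refine ⟨H, fun x => ?_, surjective_of_isUnit_det b b' H R ?_⟩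
  · simp only [H, LinearMap.sum_apply, LinearMap.smul_apply, map_sum, map_smulₛₗ, hK.map]
    refine Finset.sum_congr rfl fun i _ => ?_
    rw [ht i i.2]
  · convert hu using 3
    have hTsum : ∀ s : Finset t, T (∑ i ∈ s, algebraMap Q K (c' i) • i.1) = ∑ i ∈ s, c i • T i := by
      intro s
      classical
      induction s using Finset.induction_on with
      | empty => simpa using hTzero
      | insert a s ha ih =>
        rw [Finset.sum_insert ha, Finset.sum_insert ha, hTadd, hTsmul, ih, ← hc']
        rfl
    exact hTsum _

end Transfer

end

section

open Module Polynomial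
open scoped TensorProduct

section Commutant

variable {B n : Type*} [Field B] [Fintype n] [DecidableEq n]

/-- The commutant of a matrix. -/
def matComm (Y : Matrix n n B) : Submodule B (Matrix n n B) where
  carrier := {Z | Y * Z = Z * Y}
  add_mem' h h' := by
    simp only [Set.mem_ofPred_eq] at *
    rw [mul_add, add_mul, h, h']
  zero_mem' := by simp
  smul_mem' c Z h := by
    simp only [Set.mem_ofPred_eq] at *
    rw [Matrix.mul_smul, Matrix.smul_mul, h]

/-- Left multiplication by `Y` on its commutant. -/
def matCommMul (Y : Matrix n n B) : End B (matComm Y) where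
  toFun Z := ⟨Y * Z.1, by
    have hZ : Y * Z.1 = Z.1 * Y := Z.2
    change Y * (Y * Z.1) = Y * Z.1 * Y
    rw [hZ, ← mul_assoc, hZ]⟩
  map_add' _ _ := Subtype.ext (mul_add _ _ _)
  map_smul' _ _ := Subtype.ext (Matrix.mul_smul _ _ _)

theorem matComm_conj (X Y D D' : Matrix n n B) (hD : D * D' = 1) (h : X * D = D * Y) :
    ∃ e : matComm Y ≃ₗ[B] matComm X, ∀ Z, e (matCommMul Y Z) = matCommMul X (e Z) := by
  have hD' : D' * D = 1 := mul_eq_one_comm.1 hD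
  have h' : D' * X = Y * D' := by
    calc D' * X = D' * (X * D) * D' := by rw [mul_assoc, mul_assoc, hD, mul_one]
      _ = Y * D' := by rw [h, ← mul_assoc, hD', one_mul]
  refine ⟨{
    toFun := fun Z => ⟨D * Z.1 * D', by
      have hZ : Y * Z.1 = Z.1 * Y := Z.2
      change X * (D * Z.1 * D') = D * Z.1 * D' * X
      rw [mul_assoc (D * Z.1), h', ← mul_assoc, ← mul_assoc, h, mul_assoc D, hZ]
      simp only [mul_assoc]⟩
    map_add' := fun _ _ => Subtype.ext (by simp [mul_add, add_mul])
    map_smul' := fun _ _ => Subtype.ext (by simp)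
    invFun := fun Z => ⟨D' * Z.1 * D, by
      have hZ : X * Z.1 = Z.1 * X := Z.2
      change Y * (D' * Z.1 * D) = D' * Z.1 * D * Y
      rw [mul_assoc (D' * Z.1), ← h, ← mul_assoc, ← mul_assoc, ← h', mul_assoc D', hZ]
      simp only [mul_assoc]⟩
    left_inv := fun Z => Subtype.ext (by
      change D' * (D * Z.1 * D') * D = Z.1
      rw [show D' * (D * Z.1 * D') * D = (D' * D) * Z.1 * (D' * D) by simp only [mul_assoc], hD',
        one_mul, mul_one])
    right_inv := fun Z => Subtype.ext (by
      change D * (D' * Z.1 * D) * D' = Z.1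
      rw [show D * (D' * Z.1 * D) * D' = (D * D') * Z.1 * (D * D') by simp only [mul_assoc], hD,
        one_mul, mul_one]) }, fun Z => Subtype.ext ?_⟩
  change D * (Y * Z.1) * D' = X * (D * Z.1 * D')
  rw [← mul_assoc, ← mul_assoc, ← mul_assoc, h]

/-- A family of endomorphisms which is independent, spans the commutant of `π`, and is stable
under left multiplication by `π` gives a basis of the commutant over every extension field. -/
theorem exists_basis_matComm {K V ι : Type*} [Field K] [Algebra K B] [AddCommGroup V] [Module K V]
    [Fintype ι] [DecidableEq ι] (b : Basis n K V) (π : End K V) (h : ι → End K V)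
    (hcomm : ∀ i, h i * π = π * h i) (hind : LinearIndependent K h)
    (hspan : ∀ g : End K V, g * π = π * g → g ∈ Submodule.span K (Set.range h))
    (P : Matrix ι ι K) (hP : ∀ j, π * h j = ∑ i, P i j • h i) :
    ∃ β : Basis ι B (matComm ((LinearMap.toMatrix b b π).map (algebraMap K B))),
      LinearMap.toMatrix β β (matCommMul _) = P.map (algebraMap K B) := by
  set Y := (LinearMap.toMatrix b b π).map (algebraMap K B) with hY
  have hmul : ∀ f g : End K V, (LinearMap.toMatrix b b (f * g)).map (algebraMap K B) =
      (LinearMap.toMatrix b b f).map (algebraMap K B) * (LinearMap.toMatrix b b g).map (algebraMap K B) :=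
    fun f g => by rw [LinearMap.toMatrix_mul, Matrix.map_mul]
  let T : ι → matComm Y := fun i => ⟨(LinearMap.toMatrix b b (h i)).map (algebraMap K B), by
    change Y * _ = _ * Y
    rw [hY, ← hmul, ← hmul, hcomm]⟩
  have hT : LinearIndependent B T := by
    refine LinearIndependent.of_comp (matComm Y).subtype ?_
    have h1 : LinearIndependent K fun i => LinearMap.toMatrix b b (h i) :=
      hind.map' (LinearMap.toMatrix b b).toLinearMap (LinearEquiv.ker _)
    have h2 : LinearIndependent K fun i => fun p : n × n => LinearMap.toMatrix b b (h i) p.1 p.2 :=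
      h1.map' ((LinearEquiv.curry K K n n).symm.toLinearMap) (LinearEquiv.ker _)
    have h3 := (linearIndependent_algebraMap_comp_iff (S := B)).2 h2
    exact h3.map' ((LinearEquiv.curry B B n n).toLinearMap) (LinearEquiv.ker _)
  have hTspan : ⊤ ≤ Submodule.span B (Set.range T) := by
    rintro ⟨Z, hZ⟩ -
    have h1 := intertwine_mem_span _ _ Z hZ
    have h2 : Submodule.span B ((fun Y : Matrix n n K => Y.map (algebraMap K B)) ''
        {Z | LinearMap.toMatrix b b π * Z = Z * LinearMap.toMatrix b b π}) ≤
        (Submodule.span B (Set.range T)).map (matComm Y).subtype := by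
      rw [Submodule.span_le]
      rintro _ ⟨Z, hZ, rfl⟩
      have h3 : Matrix.toLin b b Z ∈ Submodule.span K (Set.range h) := by
        refine hspan _ ((LinearMap.toMatrix b b).injective ?_)
        rw [LinearMap.toMatrix_mul, LinearMap.toMatrix_mul, LinearMap.toMatrix_toLin]
        exact hZ.symm
      obtain ⟨c, hc⟩ := (Submodule.mem_span_range_iff_exists_fun K).1 h3
      refine ⟨∑ i, algebraMap K B (c i) • T i, Submodule.sum_mem _ fun i _ =>
        Submodule.smul_mem _ _ (Submodule.subset_span ⟨i, rfl⟩), ?_⟩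
      have h4 : Z = ∑ i, c i • LinearMap.toMatrix b b (h i) := by
        rw [← LinearMap.toMatrix_toLin b b Z, ← hc, map_sum]
        exact Finset.sum_congr rfl fun i _ => map_smul _ _ _
      rw [map_sum, h4]
      ext x y
      simp [T, Matrix.sum_apply, -algebraMap_smul]
    obtain ⟨⟨W, hW⟩, hW', rfl⟩ := h2 h1
    exact hW'
  refine ⟨Basis.mk hT hTspan, ?_⟩
  rw [← LinearMap.toMatrix_toLin (Basis.mk hT hTspan) (Basis.mk hT hTspan) (P.map (algebraMap K B))]
  congr 1
  refine (Basis.mk hT hTspan).ext fun j => ?_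
  rw [Matrix.toLin_self]
  simp only [Basis.mk_apply]
  refine Subtype.ext ?_
  change (LinearMap.toMatrix b b π).map (algebraMap K B) *
    (LinearMap.toMatrix b b (h j)).map (algebraMap K B) = _
  rw [← hmul, hP, map_sum, AddSubmonoidClass.coe_finsetSum]
  ext x y
  simp [T, Matrix.sum_apply, -algebraMap_smul]

/-- The commutant of `f` as a module over the polynomials. -/
def commMul {K V : Type*} [Field K] [AddCommGroup V] [Module K V] (f : End K V) :
    End K (commutantKer f 0) where
  toFun g := ⟨f * g.1, by
    refine ⟨fun x => ?_, by simp⟩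
    change f (g.1 (f x)) = f (f (g.1 x))
    rw [g.2.1]⟩
  map_add' _ _ := Subtype.ext (mul_add _ _ _)
  map_smul' _ _ := Subtype.ext (mul_smul_comm _ _ _)

theorem finrank_ker_commMul {K V : Type*} [Field K] [AddCommGroup V] [Module K V]
    [FiniteDimensional K V] (f : End K V)
    (p : K[X]) :
    finrank K (LinearMap.ker (aeval (commMul f) p)) = finrank K (commutantKer f p) := by
  have key : ∀ g : commutantKer f 0, (aeval (commMul f) p g : End K V) = aeval f p * g.1 := by
    intro g
    have := aeval_comm (f := commMul f) (f' := LinearMap.mulLeft K f)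
      (h := (commutantKer f 0).subtype) (fun _ => rfl) p g
    refine this.trans ?_
    have h2 := aeval_algHom_apply (Algebra.lmul K (End K V)) f p
    exact LinearMap.congr_fun h2 _
  refine LinearEquiv.finrank_eq
    { toFun := fun g => ⟨g.1.1, g.1.2.1, fun x => ?_⟩
      map_add' := fun _ _ => rfl
      map_smul' := fun _ _ => rfl
      invFun := fun g => ⟨⟨g.1, g.2.1, by simp⟩, ?_⟩
      left_inv := fun _ => rfl
      right_inv := fun _ => rfl }
  · have h1 := congrArg Subtype.val (LinearMap.mem_ker.1 g.2)
    rw [key] at h1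
    exact LinearMap.congr_fun h1 x
  · rw [LinearMap.mem_ker]
    refine Subtype.ext ?_
    rw [key]
    exact LinearMap.ext g.2.2

variable {Q K K₁ V U E : Type*} [Field Q] [Field K] [Field K₁] [Infinite K₁] [Algebra Q K]
  [Algebra Q K₁]
  [Algebra K B] [Algebra K₁ B] {σ : K →+* K} {e : ℕ} [AddCommGroup V] [Module K V]
  [FiniteDimensional K V] [Module Q V] [IsScalarTower Q K V]
  [AddCommGroup U] [Module K₁ U] [FiniteDimensional K₁ U]
  [AddCommGroup E] [Module Q E]

theorem finite_phiEnd (hK : CyclicExt Q σ e) (φ : V →ₛₗ[σ] V) (hφ : Function.Injective φ)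
    (π : End K V) (hπ : ∀ x, π x = φ^[e] x) (j : E →ₗ[Q] End K V) (hj : Function.Injective j)
    (hjφ : ∀ z x, j z (φ x) = φ (j z x)) : Module.Finite Q E := by
  have b := Basis.ofVectorSpace Q E
  have h1 : LinearIndependent Q (j ∘ b) := b.linearIndependent.map' j (LinearMap.ker_eq_bot.2 hj)
  have h2 := linearIndependent_phiHom hK φ hφ π hπ φ (j ∘ b) (fun i => hjφ _) h1
  have : Finite (Basis.ofVectorSpaceIndex Q E) := h2.finite
  exact Module.Finite.of_basis (Basis.ofVectorSpace Q E)

/-- The algebra of endomorphisms commuting with `φ` and the commutant of a conjugate of `π` are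
the same after base change, as modules over the polynomials. -/
theorem finrank_ker_baseChange (hK : CyclicExt Q σ e)
    (hQ : ∀ a : Q, algebraMap K B (algebraMap Q K a) = algebraMap K₁ B (algebraMap Q K₁ a))
    (φ : V →ₛₗ[σ] V) (hφ : Function.Injective φ)
    (π : End K V) (hπ : ∀ x, π x = φ^[e] x) (j : E →ₗ[Q] End K V) (hj : Function.Injective j)
    (hjφ : ∀ z x, j z (φ x) = φ (j z x))
    (hjs : ∀ g : End K V, (∀ x, g (φ x) = φ (g x)) → ∃ z, j z = g)
    (l : End Q E) (hl : ∀ z, j (l z) = π * j z)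
    (b : Basis n K V) (bU : Basis n K₁ U) (f : End K₁ U) (D D' : Matrix n n B) (hD : D * D' = 1)
    (hXY : (LinearMap.toMatrix bU bU f).map (algebraMap K₁ B) * D =
      D * (LinearMap.toMatrix b b π).map (algebraMap K B)) (p : K₁[X]) :
    finrank K₁ (LinearMap.ker (aeval (l.baseChange K₁) p)) = finrank K₁ (commutantKer f p) := by
  have hfin := finite_phiEnd hK φ hφ π hπ j hj hjφ
  let h := finBasis Q E
  obtain ⟨β, hβ⟩ := exists_basis_matComm (B := B) b π (fun i => j (h i))
    (fun i => LinearMap.ext fun x => by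
      change j (h i) (π x) = π (j (h i) x)
      rw [hπ, hπ, commute_iterate (hjφ _)])
    (linearIndependent_phiHom hK φ hφ π hπ φ _ (fun i => hjφ _)
      (h.linearIndependent.map' j (LinearMap.ker_eq_bot.2 hj)))
    (fun g hg => by
      have h1 := mem_span_phiHom hK φ hφ π hπ φ π hπ g (LinearMap.congr_fun hg)
      refine Submodule.span_le.2 ?_ h1
      intro g hg
      obtain ⟨z, rfl⟩ := hjs g hg
      rw [← h.sum_repr z, map_sum]
      refine Submodule.sum_mem _ fun i _ => ?_
      rw [map_smul, ← algebraMap_smul K]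
      exact Submodule.smul_mem _ _ (Submodule.subset_span ⟨i, rfl⟩))
    ((LinearMap.toMatrix h h l).map (algebraMap Q K)) (fun i => by
      rw [← hl, ← h.sum_repr (l (h i)), map_sum]
      refine Finset.sum_congr rfl fun k _ => ?_
      rw [map_smul, Matrix.map_apply, LinearMap.toMatrix_apply, algebraMap_smul])
  let g := finBasis K₁ (commutantKer f 0)
  obtain ⟨γ, hγ⟩ := exists_basis_matComm (B := B) bU f (fun i => (g i).1)
    (fun i => LinearMap.ext (g i).2.1)
    (g.linearIndependent.map' (Submodule.subtype _) (Submodule.ker_subtype _))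
    (fun k hk => by
      have : (⟨k, LinearMap.congr_fun hk, by simp⟩ : commutantKer f 0) ∈
        Submodule.span K₁ (Set.range g) := by rw [g.span_eq]; trivial
      have := Submodule.mem_map_of_mem (f := Submodule.subtype _) this
      rw [Submodule.map_span, ← Set.range_comp] at this
      exact this)
    (LinearMap.toMatrix g g (commMul f)) (fun i => by
      have := congrArg Subtype.val (g.sum_repr (commMul f (g i))).symm
      refine this.trans ?_
      rw [AddSubmonoidClass.coe_finsetSum]
      refine Finset.sum_congr rfl fun k _ => ?_
      rw [LinearMap.toMatrix_apply]
      rfl)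
  obtain ⟨ε, hε⟩ := matComm_conj _ _ D D' hD hXY
  let h₁ := Algebra.TensorProduct.basis K₁ h
  have hmat : (LinearMap.toMatrix h₁ h₁ (l.baseChange K₁)).map (algebraMap K₁ B) =
      LinearMap.toMatrix β β (matCommMul _) := by
    rw [hβ, LinearMap.toMatrix_baseChange]
    ext x y
    simp [hQ]
  obtain ⟨H, hH, hHs⟩ := exists_surjective_of_matrix h₁ g (l.baseChange K₁) (commMul f)
    (LinearMap.toMatrix β γ ε.toLinearMap) (LinearMap.toMatrix γ β ε.symm.toLinearMap)
    (by
      rw [hmat, ← hγ]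
      exact (toMatrix_intertwine β γ _ _ _).2 hε)
    (by
      rw [← LinearMap.toMatrix_comp, LinearEquiv.comp_symm, LinearMap.toMatrix_id]
      simp)
  have hdim : finrank K₁ (K₁ ⊗[Q] E) = finrank K₁ (commutantKer f 0) := by
    rw [finrank_eq_card_basis h₁, finrank_eq_card_basis g, ← finrank_eq_card_basis β,
      ← finrank_eq_card_basis γ]
    exact ε.finrank_eq
  have hHi : Function.Injective H :=
    (LinearMap.injective_iff_surjective_of_finrank_eq_finrank hdim).2 hHs
  rw [← finrank_ker_commMul]
  let H' := LinearEquiv.ofBijective H ⟨hHi, hHs⟩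
  refine LinearEquiv.finrank_eq (H'.submoduleMap _ ≪≫ₗ LinearEquiv.ofEq _ _ ?_)
  ext y
  constructor
  · rintro ⟨x, hx, rfl⟩
    have := aeval_comm hH p x
    rw [LinearMap.mem_ker]
    exact this.symm.trans (by rw [LinearMap.mem_ker.1 hx, map_zero])
  · intro hy
    obtain ⟨x, rfl⟩ := hHs y
    refine ⟨x, ?_, rfl⟩
    refine LinearMap.mem_ker.2 (hHi ?_)
    rw [aeval_comm hH, map_zero]
    exact hy

end Commutant

end

section

open Module Polynomial

section IrreducibleMinpoly

variable {Q K : Type*} [Field Q] [Field K] [Algebra Q K] {σ : K →+* K} {e : ℕ}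
  {V V' : Type*} [AddCommGroup V] [Module K V] [FiniteDimensional K V]
  [AddCommGroup V'] [Module K V'] [FiniteDimensional K V']

theorem phi_aeval (φ : V →ₛₗ[σ] V) (π : End K V)
    (hπ : ∀ x, π x = φ^[e] x) (p : K[X]) (x : V) :
    φ (aeval π p x) = aeval π (p.map σ) (φ x) := by
  have hc : ∀ x, φ (π x) = π (φ x) := fun x => by
    rw [hπ, hπ]; exact commute_iterate (fun _ => rfl) e x
  induction p using Polynomial.induction_on' with
  | add p q hp hq => simp [hp, hq]
  | monomial n a =>
    have h : ∀ n x, φ ((π ^ n) x) = (π ^ n) (φ x) := by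
      intro n
      induction n with
      | zero => intro x; rfl
      | succ n ih => intro x; rw [pow_succ, End.mul_apply, End.mul_apply, ih, hc]
    simp [aeval_monomial, h]

theorem finrank_ker_le_map (hK : CyclicExt Q σ e) (φ : V →ₛₗ[σ] V) (hφ : Function.Injective φ)
    (π : End K V) (hπ : ∀ x, π x = φ^[e] x) (p : K[X]) :
    finrank K (LinearMap.ker (aeval π p)) ≤ finrank K (LinearMap.ker (aeval π (p.map σ))) := by
  let j : LinearMap.ker (aeval π p) →+ LinearMap.ker (aeval π (p.map σ)) :=
    { toFun := fun x => ⟨φ x, by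
        rw [LinearMap.mem_ker, ← phi_aeval φ π hπ, LinearMap.mem_ker.1 x.2, map_zero]⟩
      map_zero' := Subtype.ext (map_zero φ)
      map_add' := fun x y => Subtype.ext (map_add φ _ _) }
  have hs : ∀ c, σ (σ^[e - 1] c) = c := fun c => by
    rw [← Function.iterate_succ_apply' σ, Nat.succ_eq_add_one, Nat.sub_add_cancel hK.pos, hK.iter]
  have h0 : ∀ c, σ^[e - 1] c = 0 → c = 0 := fun c hc => by
    rw [← hs c, hc, map_zero]
  have := rank_le_of_injective_injectiveₛ (fun c => σ^[e - 1] c)  j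
    (Function.LeftInverse.injective hs)
    (fun x y h => Subtype.ext (hφ (congrArg Subtype.val h)))
    (fun c x => Subtype.ext (by
      change φ (σ^[e - 1] c • (x : V)) = c • φ x
      rw [φ.map_smulₛₗ, hs]))
  rwa [← finrank_eq_rank, ← finrank_eq_rank, Nat.cast_le] at this

theorem finrank_ker_iterate_map (hK : CyclicExt Q σ e)
    (φ : V →ₛₗ[σ] V) (hφ : Function.Injective φ) (π : End K V) (hπ : ∀ x, π x = φ^[e] x)
    (ρ : K[X]) (hρ : (Polynomial.map σ)^[e] ρ = ρ) (i : ℕ) (hi : i < e) :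
    finrank K (LinearMap.ker (aeval π ((Polynomial.map σ)^[i] ρ))) =
      finrank K (LinearMap.ker (aeval π ρ)) := by
  let d : ℕ → ℕ := fun i => finrank K (LinearMap.ker (aeval π ((Polynomial.map σ)^[i] ρ)))
  have hmono : Monotone d := monotone_nat_of_le_succ fun i => by
    have := finrank_ker_le_map hK φ hφ π hπ ((Polynomial.map σ)^[i] ρ)
    rwa [← Function.iterate_succ_apply' (Polynomial.map σ)] at this
  have h0 : d 0 = finrank K (LinearMap.ker (aeval π ρ)) := rfl
  have he : d e = finrank K (LinearMap.ker (aeval π ρ)) :=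
    congrArg (fun p => finrank K (LinearMap.ker (aeval π p))) hρ
  have h1 := hmono hi.le
  have h2 := hmono (Nat.zero_le i)
  rw [he] at h1
  rw [h0] at h2
  exact le_antisymm h1 h2

theorem exists_split_of_minpoly_irreducible (hK : CyclicExt Q σ e)
    (φ : V →ₛₗ[σ] V) (hφ : Function.Injective φ) (π : End K V) (hπ : ∀ x, π x = φ^[e] x)
    (φ' : V' →ₛₗ[σ] V') (hφ' : Function.Injective φ') (π' : End K V')
    (hπ' : ∀ x, π' x = φ'^[e] x) (m : Q[X]) (hm : Irreducible m)
    (h : aeval π (m.map (algebraMap Q K)) = 0) (h' : aeval π' (m.map (algebraMap Q K)) = 0)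
    (hle : finrank K V' ≤ finrank K V) :
    ∃ (g : V →ₗ[K] V') (i : V' →ₗ[K] V), (∀ x, g (π x) = π' (g x)) ∧ (∀ x, i (π' x) = π (i x)) ∧
      ∀ x, g (i x) = x := by
  classical
  obtain ⟨ρ, hρ, hρirr, hρm⟩ := Polynomial.exists_monic_irreducible_factor
    (m.map (algebraMap Q K)) (by
      rw [Polynomial.isUnit_iff_degree_eq_zero, degree_map]
      exact hm.degree_pos.ne')
  let s : ℕ → K[X] := fun i => (Polynomial.map σ)^[i] ρ
  have hs0 : s 0 = ρ := rfl
  have hs1 : ∀ i, s (i + 1) = (s i).map σ := fun i => Function.iterate_succ_apply' _ _ _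
  have hcoeff : ∀ i k, (s i).coeff k = σ^[i] (ρ.coeff k) := by
    intro i k
    induction i with
    | zero => rfl
    | succ i ih => rw [hs1, coeff_map, ih, Function.iterate_succ_apply']
  have hse : s e = ρ := by
    ext k
    rw [hcoeff, hK.iter]
  have hmon : ∀ i, (s i).Monic := by
    intro i
    induction i with
    | zero => exact hρ
    | succ i ih => rw [hs1]; exact ih.map σ
  have hσ : Function.Bijective σ := by
    refine ⟨σ.injective, fun c => ⟨σ^[e - 1] c, ?_⟩⟩
    rw [← Function.iterate_succ_apply' σ, Nat.succ_eq_add_one, Nat.sub_add_cancel hK.pos, hK.iter]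
  have hirr : ∀ i, Irreducible (s i) := by
    intro i
    induction i with
    | zero => exact hρirr
    | succ i ih =>
      rw [hs1]
      exact (MulEquiv.irreducible_iff (mapEquiv (RingEquiv.ofBijective σ hσ))).2 ih
  let P : Finset K[X] := (Finset.range e).image s
  have hP : ∀ p ∈ P, ∃ i < e, s i = p := fun p hp => by
    simpa [P] using hp
  have hsP : ∀ i ≤ e, s i ∈ P := by
    intro i hi
    rcases hi.eq_or_lt with rfl | hi
    · rw [hse, ← hs0]
      exact Finset.mem_image_of_mem _ (Finset.mem_range.2 hK.pos)
    · exact Finset.mem_image_of_mem _ (Finset.mem_range.2 hi)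
  have hprod : (∏ p ∈ P, p).map σ = ∏ p ∈ P, p := by
    rw [Polynomial.map_prod]
    have hmapinj := Polynomial.map_injective σ σ.injective
    have himg : P.image (Polynomial.map σ) = P := by
      refine Finset.eq_of_subset_of_card_le ?_ (Finset.card_image_of_injective _ hmapinj).ge
      intro p hp
      obtain ⟨q, hq, rfl⟩ := Finset.mem_image.1 hp
      obtain ⟨i, hi, rfl⟩ := hP q hq
      rw [← hs1]
      exact hsP _ hi
    conv_rhs => rw [← himg, Finset.prod_image hmapinj.injOn]
  obtain ⟨n, hn⟩ : ∃ n : Q[X], n.map (algebraMap Q K) = ∏ p ∈ P, p := by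
    rw [← Polynomial.mem_lifts, Polynomial.lifts_iff_coeff_lifts]
    intro k
    refine hK.fixed _ ?_
    rw [← coeff_map, hprod]
  have hmn : m ∣ n := by
    by_contra hcon
    have hcop := ((hm.coprime_iff_not_dvd).2 hcon).map (mapRingHom (algebraMap Q K))
    rw [coe_mapRingHom, hn] at hcop
    exact hρirr.not_isUnit (hcop.isUnit_of_dvd' hρm
      (hs0 ▸ Finset.dvd_prod_of_mem _ (hsP 0 (Nat.zero_le _))))
  have hmn' : m.map (algebraMap Q K) ∣ ∏ p ∈ P, p := by
    rw [← hn]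
    exact Polynomial.map_dvd _ hmn
  have hPirr : ∀ p ∈ P, Irreducible p := fun p hp => by
    obtain ⟨i, -, rfl⟩ := hP p hp
    exact hirr i
  have hPcop : (P : Set K[X]).Pairwise IsCoprime := by
    intro p hp q hq hne
    obtain ⟨i, -, rfl⟩ := hP p hp
    obtain ⟨j, -, rfl⟩ := hP q hq
    refine (hirr i).coprime_iff_not_dvd.2 fun hd => hne ?_
    exact eq_of_monic_of_associated (hmon i) (hmon j) ((hirr i).associated_of_dvd (hirr j) hd)
  have hconst : ∀ p ∈ P, finrank K (LinearMap.ker (aeval π p)) = finrank K (LinearMap.ker (aeval π ρ)) ∧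
      finrank K (LinearMap.ker (aeval π' p)) = finrank K (LinearMap.ker (aeval π' ρ)) := by
    intro p hp
    obtain ⟨i, hi, rfl⟩ := hP p hp
    exact ⟨finrank_ker_iterate_map hK φ hφ π hπ ρ hse i hi,
      finrank_ker_iterate_map hK φ' hφ' π' hπ' ρ hse i hi⟩
  have haev : aeval π (∏ p ∈ P, p) = 0 := by
    obtain ⟨t, ht⟩ := hmn'
    rw [ht, map_mul, h, zero_mul]
  have haev' : aeval π' (∏ p ∈ P, p) = 0 := by
    obtain ⟨t, ht⟩ := hmn'
    rw [ht, map_mul, h', zero_mul]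
  rcases le_total (finrank K (LinearMap.ker (aeval π' ρ))) (finrank K (LinearMap.ker (aeval π ρ)))
    with hd | hd
  · exact exists_split_of_prod π π' P hPirr hPcop haev haev' fun p hp => by
      rw [(hconst p hp).1, (hconst p hp).2]
      exact hd
  · obtain ⟨g, i, hg, hi, hgi⟩ := exists_split_of_prod π' π P hPirr hPcop haev' haev fun p hp => by
      rw [(hconst p hp).1, (hconst p hp).2]
      exact hd
    have hgs : Function.Surjective g := fun x => ⟨i x, hgi x⟩
    have hginj : Function.Injective g := by
      refine (LinearMap.injective_iff_surjective_of_finrank_eq_finrank ?_).2 hgs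
      exact le_antisymm hle (LinearMap.finrank_le_finrank_of_surjective hgs)
    exact ⟨i, g, hi, hg, fun x => hginj (hgi (g x))⟩

end IrreducibleMinpoly

end

section

open Module

/-- The compatibilities between an endomorphism `σ` of the algebra `R`, generated by `A` and `k`,
and the endomorphism `σk` of `k` with fixed field `F`. -/
structure FrobData (F A : Type*) {k R : Type*} [Field F] [CommRing A] [Field k] [CommRing R]
    [Algebra F k] [Algebra A R] [Algebra k R] (σk : k →+* k) (σ : R →+* R) : Prop where
  fixed : ∀ c, σk c = c → c ∈ Set.range (algebraMap F k)
  map_k : ∀ c, σ (algebraMap k R c) = algebraMap k R (σk c)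
  map_A : ∀ a, σ (algebraMap A R a) = algebraMap A R a
  gen : ∀ c : R, c ∈ Submodule.span k (Set.range (algebraMap A R))

section Lattice

variable {F A k R W : Type*} [Field F] [CommRing A] [Field k] [CommRing R]
  [Algebra F A] [Algebra F k] [Algebra F R] [Algebra A R] [Algebra k R]
  [IsScalarTower F A R] [IsScalarTower F k R]
  [AddCommGroup W] [Module R W] [Module A W] [Module k W] [Module F W]
  [IsScalarTower A R W] [IsScalarTower k R W] [IsScalarTower F k W] [IsScalarTower F R W]
  [IsScalarTower F A W] {σk : k →+* k} {σ : R →+* R}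

/-- The submodule `I W` of the `R`-module `W`, for an ideal `I` of `A`. -/
def extSub (R W : Type*) [CommRing R] [Algebra A R] [AddCommGroup W] [Module R W] (I : Ideal A) :
    Submodule R W := I.map (algebraMap A R) • ⊤

theorem smul_mem_extSub {I : Ideal A} {a : A} (ha : a ∈ I) (w : W) : a • w ∈ extSub R W I := by
  rw [← algebraMap_smul R]
  exact Submodule.smul_mem_smul (Ideal.mem_map_of_mem _ ha) trivial

theorem extSub_mono {I J : Ideal A} (h : I ≤ J) : extSub R W I ≤ extSub R W J :=
  Submodule.smul_mono_left (Ideal.map_mono h)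

theorem restrictScalars_extSub (I : Ideal A) :
    (extSub R W I).restrictScalars A = I • (⊤ : Submodule A W) :=
  Ideal.smul_restrictScalars I ⊤

theorem mem_extSub {I : Ideal A} {w : W} : w ∈ extSub R W I ↔ w ∈ I • (⊤ : Submodule A W) := by
  rw [← restrictScalars_extSub (R := R)]
  rfl

theorem extSub_self (I : Ideal A) : extSub R R I = I.map (algebraMap A R) := by
  rw [extSub, smul_eq_mul, ← Ideal.one_eq_top, mul_one]

theorem extSub_le_comap (hF : FrobData F A σk σ) (τ : W →ₛₗ[σ] W) (I : Ideal A) :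
    extSub R W I ≤ (extSub R W I).comap τ := by
  refine Submodule.smul_le.2 fun r hr w _ => ?_
  rw [Submodule.mem_comap, τ.map_smulₛₗ]
  refine Submodule.smul_mem_smul ?_ trivial
  have : I.map (algebraMap A R) ≤ (I.map (algebraMap A R)).comap σ := by
    rw [Ideal.map_le_iff_le_comap]
    intro a ha
    rw [Ideal.mem_comap, Ideal.mem_comap, hF.map_A]
    exact Ideal.mem_map_of_mem _ ha
  exact this hr

theorem map_mem_extSub (f : W →ₗ[R] W) (I : Ideal A) {w : W} (hw : w ∈ extSub R W I) :
    f w ∈ extSub R W I := by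
  have : extSub R W I ≤ (extSub R W I).comap f := by
    refine Submodule.smul_le.2 fun r hr w _ => ?_
    rw [Submodule.mem_comap, map_smul]
    exact Submodule.smul_mem_smul hr trivial
  exact this hw

theorem map_mem_map_of_mem_extSub (f : W →ₗ[R] R) (I : Ideal A) {w : W} (hw : w ∈ extSub R W I) :
    f w ∈ I.map (algebraMap A R) := by
  have : extSub R W I ≤ Submodule.comap f (I.map (algebraMap A R)) := by
    refine Submodule.smul_le.2 fun r hr w _ => ?_
    rw [Submodule.mem_comap, map_smul, smul_eq_mul]
    exact Ideal.mul_mem_right _ _ hr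
  exact this hw

/-- `τ` on `W / I W`. -/
def quotTau (hF : FrobData F A σk σ) (τ : W →ₛₗ[σ] W) (I : Ideal A) :
    (W ⧸ extSub R W I) →ₛₗ[σ] (W ⧸ extSub R W I) :=
  Submodule.mapQ _ _ τ (extSub_le_comap hF τ I)

theorem quotTau_smul (hF : FrobData F A σk σ) (τ : W →ₛₗ[σ] W) (I : Ideal A) (c : k)
    (x : W ⧸ extSub R W I) : (quotTau hF τ I).toAddMonoidHom (c • x) =
      σk c • (quotTau hF τ I).toAddMonoidHom x := by
  change quotTau hF τ I (c • x) = σk c • quotTau hF τ I x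
  rw [← algebraMap_smul R c, (quotTau hF τ I).map_smulₛₗ, hF.map_k, algebraMap_smul]

/-- An element of `R` which is fixed modulo `I R` comes from `A` modulo `I R`. -/
theorem exists_of_fixed (hF : FrobData F A σk σ) (I : Ideal A) (c : R)
    (hc : σ c - c ∈ I.map (algebraMap A R)) :
    ∃ a : A, c - algebraMap A R a ∈ I.map (algebraMap A R) := by
  let s : R →ₛₗ[σ] R := { toFun := σ, map_add' := map_add σ, map_smul' := fun a b => map_mul σ a b }
  let S : Set (R ⧸ extSub R R I) := Set.range fun a : A => Submodule.Quotient.mk (algebraMap A R a)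
  have h1 := mem_span_fixedField σk hF.fixed (quotTau hF s I).toAddMonoidHom (quotTau_smul hF s I) S
    (by
      rintro _ ⟨a, rfl⟩
      exact congrArg _ (hF.map_A a)) (Submodule.Quotient.mk c) (by
      refine (Submodule.Quotient.eq _).2 ?_
      rw [extSub_self]
      exact hc) (by
      have := Submodule.mem_map_of_mem (f := ((extSub R R I).mkQ.restrictScalars k)) (hF.gen c)
      rw [Submodule.map_span] at this
      refine Submodule.span_mono ?_ this
      rintro _ ⟨_, ⟨a, rfl⟩, rfl⟩
      exact ⟨a, rfl⟩)
  have h2 : Submodule.span F S ≤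
      LinearMap.range (((extSub R R I).mkQ.restrictScalars F) ∘ₗ (IsScalarTower.toAlgHom F A R).toLinearMap) := by
    rw [Submodule.span_le]
    rintro _ ⟨a, rfl⟩
    exact ⟨a, rfl⟩
  obtain ⟨a, ha⟩ := h2 h1
  refine ⟨a, ?_⟩
  rw [← extSub_self]
  exact (Submodule.Quotient.eq _).1 ha.symm

/-- The vectors of `W / I W` which are fixed by `τ`. -/
def fixedSub (hF : FrobData F A σk σ) (τ : W →ₛₗ[σ] W) (I : Ideal A) :
    Submodule A (W ⧸ extSub R W I) where
  carrier := {x | quotTau hF τ I x = x}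
  add_mem' {x y} hx hy := by
    simp only [Set.mem_ofPred_eq] at *
    rw [map_add, hx, hy]
  zero_mem' := map_zero _
  smul_mem' a x hx := by
    simp only [Set.mem_ofPred_eq] at *
    rw [← algebraMap_smul R a, (quotTau hF τ I).map_smulₛₗ, hF.map_A, hx]

theorem mk_mem_fixedSub (hF : FrobData F A σk σ) (τ : W →ₛₗ[σ] W) (I : Ideal A) (w : W) :
    (Submodule.Quotient.mk w : W ⧸ extSub R W I) ∈ fixedSub hF τ I ↔ τ w - w ∈ extSub R W I :=
  Submodule.Quotient.eq _

/-- A vector which is fixed modulo `J W` lifts to a vector which is fixed modulo `I W`. -/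
theorem exists_fixed_lift (hF : FrobData F A σk σ) (τ : W →ₛₗ[σ] W) {I J : Ideal A} (hIJ : I ≤ J)
    (hspan : Submodule.span k (fixedSub hF τ I : Set (W ⧸ extSub R W I)) = ⊤) (w : W)
    (hw : τ w - w ∈ extSub R W J) :
    ∃ w', w' - w ∈ extSub R W J ∧ τ w' - w' ∈ extSub R W I := by
  let f : (W ⧸ extSub R W I) →ₗ[R] (W ⧸ extSub R W J) :=
    Submodule.factor (extSub_mono hIJ)
  have hfmk : ∀ w : W, f (Submodule.Quotient.mk w) = Submodule.Quotient.mk w := fun _ => rfl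
  let S : Set (W ⧸ extSub R W J) := f '' fixedSub hF τ I
  have h1 := mem_span_fixedField σk hF.fixed (quotTau hF τ J).toAddMonoidHom (quotTau_smul hF τ J) S
    (by
      rintro _ ⟨x, hx, rfl⟩
      obtain ⟨x, rfl⟩ := Submodule.Quotient.mk_surjective _ x
      exact (mk_mem_fixedSub hF τ J x).2 (extSub_mono hIJ ((mk_mem_fixedSub hF τ I x).1 hx))) (Submodule.Quotient.mk w) ((Submodule.Quotient.eq _).2 hw) (by
      have : (Submodule.Quotient.mk w : W ⧸ extSub R W I) ∈
        Submodule.span k (fixedSub hF τ I : Set (W ⧸ extSub R W I)) := by rw [hspan]; trivial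
      have := Submodule.mem_map_of_mem (f := (f.restrictScalars k)) this
      rw [Submodule.map_span] at this
      exact this)
  have h2 : Submodule.span F S ≤
      ((fixedSub hF τ I).restrictScalars F).map (f.restrictScalars F) := by
    rw [Submodule.span_le]
    rintro _ ⟨x, hx, rfl⟩
    exact ⟨x, hx, rfl⟩
  obtain ⟨x, hx, hxw⟩ := h2 h1
  obtain ⟨w', rfl⟩ := Submodule.Quotient.mk_surjective _ x
  exact ⟨w', (Submodule.Quotient.eq _).1 hxw, (mk_mem_fixedSub hF τ I w').1 hx⟩

end Lattice

end

section

open Module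

section TateBasis

variable {F A k R W : Type*} [Field F] [CommRing A] [Field k] [CommRing R]
  [Algebra F A] [Algebra F k] [Algebra F R] [Algebra A R] [Algebra k R]
  [IsScalarTower F A R] [IsScalarTower F k R]
  [AddCommGroup W] [Module R W] [Module A W] [Module k W] [Module F W]
  [IsScalarTower A R W] [IsScalarTower k R W] [IsScalarTower F k W] [IsScalarTower F R W]
  [IsScalarTower F A W] {σk : k →+* k} {σ : R →+* R}

/-- Vectors which are fixed and `A / I`-independent modulo `I W` are `R / I R`-independent. -/
theorem mem_map_of_sum_mem (hF : FrobData F A σk σ) (τ : W →ₛₗ[σ] W) (I : Ideal A)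
    [Module.Finite F (A ⧸ I)] {ι : Type*} [Fintype ι] (t : ι → W)
    (ht : ∀ i, τ (t i) - t i ∈ extSub R W I)
    (hA : ∀ a : ι → A, ∑ i, a i • t i ∈ extSub R W I → ∀ i, a i ∈ I)
    (c : ι → R) (hc : ∑ i, c i • t i ∈ extSub R W I) (i : ι) : c i ∈ I.map (algebraMap A R) := by
  let b := finBasis F (A ⧸ I)
  choose α hα using fun j => Ideal.Quotient.mk_surjective (b j)
  have hdec : ∀ c : R, ∃ κ : Fin (finrank F (A ⧸ I)) → k,
      c - ∑ j, κ j • algebraMap A R (α j) ∈ I.map (algebraMap A R) := by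
    intro c
    refine Submodule.span_induction (p := fun c _ => ∃ κ : Fin (finrank F (A ⧸ I)) → k,
      c - ∑ j, κ j • algebraMap A R (α j) ∈ I.map (algebraMap A R)) ?_ ?_ ?_ ?_ (hF.gen c)
    · rintro _ ⟨a, rfl⟩
      refine ⟨fun j => algebraMap F k (b.repr (Ideal.Quotient.mk I a) j), ?_⟩
      have h1 : a - ∑ j, b.repr (Ideal.Quotient.mk I a) j • α j ∈ I := by
        rw [← Ideal.Quotient.mk_eq_mk_iff_sub_mem, map_sum]
        conv_lhs => rw [← b.sum_repr (Ideal.Quotient.mk I a)]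
        refine Finset.sum_congr rfl fun j _ => ?_
        rw [← hα]
        rfl
      have h2 := Ideal.mem_map_of_mem (algebraMap A R) h1
      rw [map_sub, map_sum] at h2
      refine (congrArg (· ∈ I.map (algebraMap A R)) ?_).mp h2
      congr 1
      refine Finset.sum_congr rfl fun j _ => ?_
      rw [algebraMap_smul]
      exact map_smul (IsScalarTower.toAlgHom F A R) _ _
    · exact ⟨0, by simp⟩
    · rintro c c' - - ⟨κ, hκ⟩ ⟨κ', hκ'⟩
      refine ⟨κ + κ', ?_⟩
      have := add_mem hκ hκ'
      refine (congrArg (· ∈ I.map (algebraMap A R)) ?_).mp this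
      simp only [Pi.add_apply, add_smul, Finset.sum_add_distrib]
      ring
    · rintro a c - ⟨κ, hκ⟩
      refine ⟨a • κ, ?_⟩
      have := Ideal.mul_mem_left _ (algebraMap k R a) hκ
      refine (congrArg (· ∈ I.map (algebraMap A R)) ?_).mp this
      simp only [Pi.smul_apply, smul_eq_mul, Algebra.smul_def, map_mul, Finset.mul_sum, mul_assoc,
        mul_sub]
  choose κ hκ using fun i => hdec (c i)
  let u : ι × Fin (finrank F (A ⧸ I)) → W ⧸ extSub R W I :=
    fun p => Submodule.Quotient.mk (α p.2 • t p.1)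
  have hufix : ∀ p, (quotTau hF τ I).toAddMonoidHom (u p) = u p := fun p =>
    (fixedSub hF τ I).smul_mem (α p.2) ((mk_mem_fixedSub hF τ I (t p.1)).2 (ht p.1))
  have huF : LinearIndependent F u := by
    rw [Fintype.linearIndependent_iff]
    intro l hl
    have h1 : ∑ i, (∑ j, l (i, j) • α j) • t i ∈ extSub R W I := by
      rw [← Submodule.Quotient.mk_eq_zero, ← hl, Fintype.sum_prod_type]
      simp only [Finset.sum_smul]
      rw [← Submodule.mkQ_apply, map_sum]
      refine Finset.sum_congr rfl fun i _ => ?_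
      rw [map_sum]
      refine Finset.sum_congr rfl fun j _ => ?_
      rw [smul_assoc]
      rfl
    have h2 := hA _ h1
    rintro ⟨i, j⟩
    have h3 : ∑ j, l (i, j) • b j = 0 := by
      rw [← (Ideal.Quotient.eq_zero_iff_mem).2 (h2 i), map_sum]
      refine Finset.sum_congr rfl fun j _ => ?_
      rw [← hα]
      rfl
    exact Fintype.linearIndependent_iff.1 b.linearIndependent _ h3 j
  have huk := linearIndependent_of_fixed σk hF.fixed _ (quotTau_smul hF τ I) u hufix huF
  have hsum : ∑ p : ι × Fin (finrank F (A ⧸ I)), κ p.1 p.2 • u p = 0 := by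
    have h1 : ∑ i, (c i - ∑ j, κ i j • algebraMap A R (α j)) • t i ∈ extSub R W I :=
      Submodule.sum_mem _ fun i _ => Submodule.smul_mem_smul (hκ i) trivial
    have h2 := sub_mem hc h1
    rw [← Finset.sum_sub_distrib] at h2
    simp only [← sub_smul, sub_sub_cancel] at h2
    rw [← (Submodule.Quotient.mk_eq_zero _).2 h2, Fintype.sum_prod_type, ← Submodule.mkQ_apply, map_sum]
    refine Finset.sum_congr rfl fun i _ => ?_
    rw [Finset.sum_smul, map_sum]
    refine Finset.sum_congr rfl fun j _ => ?_
    rw [smul_assoc, algebraMap_smul]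
    rfl
  have hκ0 := Fintype.linearIndependent_iff.1 huk (fun p => κ p.1 p.2) hsum
  have := hκ i
  simpa [fun j => hκ0 (i, j)] using this

/-- If the powers of `v` are `n`, vectors which are `A / v`-independent modulo `v W`
are `A / v ^ n`-independent modulo `v ^ n W`. -/
theorem mem_pow_of_sum_mem [IsDedekindDomain A] (v : IsDedekindDomain.HeightOneSpectrum A)
    (htf : ∀ (a : A) (w : W), a • w = 0 → a = 0 ∨ w = 0) {ι : Type*} [Fintype ι] (t : ι → W)
    (h1 : ∀ a : ι → A, ∑ i, a i • t i ∈ extSub R W v.asIdeal → ∀ i, a i ∈ v.asIdeal) (n : ℕ)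
    (a : ι → A) (ha : ∑ i, a i • t i ∈ extSub R W (v.asIdeal ^ n)) (i : ι) :
    a i ∈ v.asIdeal ^ n := by
  obtain ⟨ϖ, hϖv, hϖ2⟩ : ∃ ϖ ∈ v.asIdeal, ϖ ∉ v.asIdeal ^ 2 := by
    refine SetLike.exists_of_lt ?_
    have := Ideal.pow_succ_lt_pow v.ne_bot 1
    simpa using this
  obtain ⟨J, hJ⟩ : v.asIdeal ∣ Ideal.span {ϖ} := by
    rw [Ideal.dvd_span_singleton]; exact hϖv
  have hϖ0 : ϖ ≠ 0 := fun h => hϖ2 (h ▸ zero_mem _)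
  obtain ⟨s, hsJ, hsv⟩ : ∃ s ∈ J, s ∉ v.asIdeal := by
    by_contra! hcon
    apply hϖ2
    have : ϖ ∈ v.asIdeal * J := hJ ▸ Ideal.mem_span_singleton_self ϖ
    rw [pow_two]
    exact Ideal.mul_mono_right hcon this
  have hsJ' : ∀ n, ∀ x ∈ v.asIdeal ^ n, ∃ y, s ^ n * x = ϖ ^ n * y := by
    intro n x hx
    have h : x * s ^ n ∈ v.asIdeal ^ n * J ^ n := Ideal.mul_mem_mul hx (Ideal.pow_mem_pow hsJ n)
    rw [← mul_pow, ← hJ, Ideal.span_singleton_pow, Ideal.mem_span_singleton'] at h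
    obtain ⟨y, hy⟩ := h
    exact ⟨y, by rw [mul_comm, ← hy, mul_comm]⟩
  have hsn : ∀ m : ℕ, s ^ m ∉ v.asIdeal := fun m h => hsv (v.isPrime.mem_of_pow_mem m h)
  have hw : ∀ w ∈ extSub R W (v.asIdeal ^ n), ∃ w', s ^ n • w = ϖ ^ n • w' := by
    intro w hw
    rw [mem_extSub] at hw
    refine Submodule.smul_induction_on hw ?_ ?_
    · intro x hx y _
      obtain ⟨z, hz⟩ := hsJ' n x hx
      exact ⟨z • y, by rw [smul_smul, hz, mul_smul]⟩
    · rintro x y ⟨x', hx⟩ ⟨y', hy⟩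
      exact ⟨x' + y', by rw [smul_add, smul_add, hx, hy]⟩
  obtain ⟨w', hw'⟩ := hw _ ha
  have key : ∀ j ≤ n, ∀ i, a i ∈ v.asIdeal ^ j := by
    intro j
    induction j with
    | zero => intro _ i; simp
    | succ j ih =>
      intro hj
      choose b hb using fun i => hsJ' j (a i) (ih (by omega) i)
      obtain ⟨m, rfl⟩ : ∃ m, n = j + (m + 1) := ⟨n - j - 1, by omega⟩
      have h2 : ϖ ^ j • (∑ i, (s ^ (m + 1) * b i) • t i - ϖ ^ (m + 1) • w') = 0 := by
        rw [smul_sub, smul_smul, ← pow_add, ← hw', sub_eq_zero, Finset.smul_sum, Finset.smul_sum]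
        refine Finset.sum_congr rfl fun i _ => ?_
        rw [smul_smul, smul_smul]
        congr 1
        linear_combination (-(s ^ (m + 1))) * hb i
      have h3 := (htf _ _ h2).resolve_left (pow_ne_zero _ hϖ0)
      have h4 := h1 (fun i => s ^ (m + 1) * b i) (by
        rw [sub_eq_zero.1 h3]
        exact smul_mem_extSub (Ideal.pow_mem_of_mem _ hϖv _ (Nat.succ_pos _)) _)
      intro i
      have h5 : b i ∈ v.asIdeal := (v.isPrime.mem_or_mem (h4 i)).resolve_left (hsn _)
      have h6 : s ^ j * a i ∈ v.asIdeal ^ (j + 1) := by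
        rw [hb, pow_succ]
        exact Ideal.mul_mem_mul (Ideal.pow_mem_pow hϖv j) h5
      have := v.isPrime
      exact (Ideal.IsPrime.mul_mem_pow v.asIdeal h6).resolve_left (hsn _)
  exact key n le_rfl i

end TateBasis

end

section

open Module

section TateBasis

variable {F A k R W : Type*} [Field F] [CommRing A] [Field k] [CommRing R]
  [Algebra F A] [Algebra F k] [Algebra F R] [Algebra A R] [Algebra k R]
  [IsScalarTower F A R] [IsScalarTower F k R]
  [AddCommGroup W] [Module R W] [Module A W] [Module k W] [Module F W]
  [IsScalarTower A R W] [IsScalarTower k R W] [IsScalarTower F k W] [IsScalarTower F R W]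
  [IsScalarTower F A W] {σk : k →+* k} {σ : R →+* R}

/-- The vectors of `W / v W` which are fixed by `τ` have a finite basis over `A / v`. -/
theorem exists_basis_fixedSub (hF : FrobData F A σk σ) (τ : W →ₛₗ[σ] W) (v : Ideal A)
    [hv : v.IsMaximal] [Module.Finite k (W ⧸ extSub R W v)] :
    ∃ (m : ℕ) (x : Fin m → W), (∀ i, τ (x i) - x i ∈ extSub R W v) ∧
      (∀ a : Fin m → A, ∑ i, a i • x i ∈ extSub R W v → ∀ i, a i ∈ v) ∧
      ∀ w, τ w - w ∈ extSub R W v → ∃ a : Fin m → A, w - ∑ i, a i • x i ∈ extSub R W v := by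
  let := Ideal.Quotient.field v
  have htors : Module.IsTorsionBySet A (fixedSub hF τ v) v := by
    rintro ⟨x, hx⟩ ⟨a, ha⟩
    obtain ⟨w, rfl⟩ := Submodule.Quotient.mk_surjective _ x
    refine Subtype.ext ?_
    exact (Submodule.Quotient.mk_eq_zero _).2 (smul_mem_extSub ha w)
  let : Module (A ⧸ v) (fixedSub hF τ v) := htors.module
  have hsm : ∀ (a : A) (x : fixedSub hF τ v), Ideal.Quotient.mk v a • x = a • x := fun _ _ => rfl
  have : IsScalarTower F (A ⧸ v) (fixedSub hF τ v) := ⟨fun c a x => by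
    obtain ⟨a, rfl⟩ := Ideal.Quotient.mk_surjective a
    change Ideal.Quotient.mk v (c • a) • x = _
    rw [hsm, hsm, smul_assoc]⟩
  let b := Basis.ofVectorSpace (A ⧸ v) (fixedSub hF τ v)
  have hbF : LinearIndependent F b := b.linearIndependent.restrict_scalars' F
  have hbF' : LinearIndependent F fun i => (b i : W ⧸ extSub R W v) :=
    hbF.map' ((fixedSub hF τ v).subtype.restrictScalars F)
      (LinearMap.ker_eq_bot.2 Subtype.val_injective)
  have hbk := linearIndependent_of_fixed σk hF.fixed _ (quotTau_smul hF τ v) _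
    (fun i => (b i).2) hbF'
  have hfin : Finite (Basis.ofVectorSpaceIndex (A ⧸ v) (fixedSub hF τ v)) := hbk.finite
  have := Fintype.ofFinite (Basis.ofVectorSpaceIndex (A ⧸ v) (fixedSub hF τ v))
  let b' := b.reindex (Fintype.equivFin _)
  choose x hx using fun i => Submodule.Quotient.mk_surjective _ (b' i : W ⧸ extSub R W v)
  have hsum : ∀ a : Fin _ → A, (Submodule.Quotient.mk (∑ i, a i • x i) : W ⧸ extSub R W v) =
      (∑ i, Ideal.Quotient.mk v (a i) • b' i : fixedSub hF τ v) := by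
    intro a
    rw [← Submodule.mkQ_apply, map_sum, AddSubmonoidClass.coe_finsetSum]
    refine Finset.sum_congr rfl fun i _ => ?_
    rw [hsm, Submodule.coe_smul, ← hx]
    rfl
  refine ⟨_, x, fun i => ?_, fun a ha i => ?_, fun w hw => ?_⟩
  · rw [← mk_mem_fixedSub hF τ v, hx]
    exact (b' i).2
  · rw [← Submodule.Quotient.mk_eq_zero, hsum, ZeroMemClass.coe_eq_zero] at ha
    exact Ideal.Quotient.eq_zero_iff_mem.1
      (Fintype.linearIndependent_iff.1 b'.linearIndependent _ ha i)
  · let y : fixedSub hF τ v := ⟨Submodule.Quotient.mk w, (mk_mem_fixedSub hF τ v w).2 hw⟩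
    choose a ha using fun i => Ideal.Quotient.mk_surjective (b'.repr y i)
    refine ⟨a, ?_⟩
    rw [← Submodule.Quotient.eq, hsum]
    simp only [ha]
    rw [b'.sum_repr]

/-- A vector which is fixed modulo `v W` lifts to a `v`-adic Cauchy sequence which is fixed by `τ`. -/
theorem exists_fixed_sequence (hF : FrobData F A σk σ) (τ : W →ₛₗ[σ] W) (v : Ideal A)
    (hspan : ∀ n, Submodule.span k
      (fixedSub hF τ (v ^ n) : Set (W ⧸ extSub R W (v ^ n))) = ⊤) (x : W)
    (hx : τ x - x ∈ extSub R W v) :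
    ∃ t : ℕ → W, (∀ n, t (n + 1) - t n ∈ extSub R W (v ^ n)) ∧
      (∀ n, τ (t n) - t n ∈ extSub R W (v ^ n)) ∧ t 1 = x := by
  choose g hg using fun (n : ℕ) (w : {w // τ w - w ∈ extSub R W (v ^ n)}) =>
    exists_fixed_lift hF τ (Ideal.pow_le_pow_right (Nat.le_succ n)) (hspan (n + 1)) w.1 w.2
  let s : ∀ n : ℕ, {w // τ w - w ∈ extSub R W (v ^ (n + 1))} := fun n =>
    Nat.rec ⟨x, by rwa [Nat.zero_eq, zero_add, pow_one]⟩ (fun n w => ⟨g (n + 1) w, (hg (n + 1) w).2⟩) n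
  have h0 : (s 0).1 = x := rfl
  refine ⟨fun n => (s (n - 1)).1, fun n => ?_, fun n => ?_, h0⟩
  · cases n with
    | zero => simp
    | succ n => exact (hg (n + 1) (s n)).1
  · cases n with
    | zero => exact extSub_mono (Ideal.pow_le_pow_right (Nat.zero_le _)) (s 0).2
    | succ n => exact (s n).2

theorem sub_mem_of_cauchy (v : Ideal A) (t : ℕ → W)
    (ht : ∀ n, t (n + 1) - t n ∈ extSub R W (v ^ n)) {m n : ℕ} (hmn : m ≤ n) :
    t n - t m ∈ extSub R W (v ^ m) := by
  induction n, hmn using Nat.le_induction with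
  | base => simp
  | succ n hmn ih =>
    have := add_mem (extSub_mono (Ideal.pow_le_pow_right hmn) (ht n)) ih
    rwa [sub_add_sub_cancel] at this

theorem sup_extSub_pow (v : Ideal A) (N : Submodule R W) (hN : N ⊔ extSub R W v = ⊤) (n : ℕ) :
    N ⊔ extSub R W (v ^ n) = ⊤ := by
  induction n with
  | zero =>
    rw [pow_zero, Ideal.one_eq_top, extSub, Ideal.map_top, Submodule.top_smul, sup_top_eq]
  | succ n ih =>
    rw [eq_top_iff, ← ih]
    refine sup_le le_sup_left ?_
    have h : extSub R W (v ^ n) = (v ^ n).map (algebraMap A R) • (N ⊔ extSub R W v) := by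
      rw [hN]; rfl
    rw [h, Submodule.smul_sup]
    refine sup_le (Submodule.smul_le_right.trans le_sup_left) (le_trans (le_of_eq ?_) le_sup_right)
    rw [extSub, extSub, ← Submodule.mul_smul, ← Ideal.map_mul, pow_succ]

/-- `τ`-fixed `v`-adic Cauchy sequences in `W` which are a basis of `W / v ^ n W` for all `n`. -/
structure TateBasis {ι : Type*} [Fintype ι] (R : Type*) [CommRing R] [Algebra A R] [Module R W]
    {σ : R →+* R} (τ : W →ₛₗ[σ] W) (v : Ideal A) (t : ι → ℕ → W) : Prop where
  cauchy : ∀ i n, t i (n + 1) - t i n ∈ extSub R W (v ^ n)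
  fixed : ∀ i n, τ (t i n) - t i n ∈ extSub R W (v ^ n)
  ind : ∀ n (c : ι → R), ∑ i, c i • t i n ∈ extSub R W (v ^ n) →
    ∀ i, c i ∈ (v ^ n).map (algebraMap A R)
  indA : ∀ n (a : ι → A), ∑ i, a i • t i n ∈ extSub R W (v ^ n) → ∀ i, a i ∈ v ^ n
  span : ∀ n w, ∃ c : ι → R, w - ∑ i, c i • t i n ∈ extSub R W (v ^ n)

theorem exists_tateBasis [IsDedekindDomain A] (hF : FrobData F A σk σ) (τ : W →ₛₗ[σ] W)
    (v : IsDedekindDomain.HeightOneSpectrum A)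
    (hspan : ∀ n, Submodule.span k
      (fixedSub hF τ (v.asIdeal ^ n) : Set (W ⧸ extSub R W (v.asIdeal ^ n))) = ⊤)
    (htf : ∀ (a : A) (w : W), a • w = 0 → a = 0 ∨ w = 0)
    (hfin : ∀ n, Module.Finite F (A ⧸ v.asIdeal ^ n))
    (hfin' : Module.Finite k (W ⧸ extSub R W v.asIdeal)) :
    ∃ (m : ℕ) (t : Fin m → ℕ → W), TateBasis R τ v.asIdeal t := by
  have := v.isMaximal
  obtain ⟨m, x, hx, hxind, hxspan⟩ := exists_basis_fixedSub hF τ v.asIdeal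
  choose t ht ht' ht1 using fun i => exists_fixed_sequence hF τ v.asIdeal hspan (x i) (hx i)
  have hcong : ∀ n, 1 ≤ n → ∀ i, t i n - x i ∈ extSub R W v.asIdeal := fun n hn i => by
    have := sub_mem_of_cauchy v.asIdeal (t i) (ht i) hn
    rwa [pow_one, ht1] at this
  have hindA : ∀ n (a : Fin m → A), ∑ i, a i • t i n ∈ extSub R W (v.asIdeal ^ n) →
      ∀ i, a i ∈ v.asIdeal ^ n := by
    intro n a ha
    rcases Nat.eq_zero_or_pos n with rfl | hn
    · intro i; simp
    · refine mem_pow_of_sum_mem v htf (fun i => t i n) (fun a ha => hxind a ?_) n a ha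
      have h1 : ∑ i, a i • (t i n - x i) ∈ extSub R W v.asIdeal :=
        Submodule.sum_mem _ fun i _ => by
          rw [← algebraMap_smul R]
          exact Submodule.smul_mem _ _ (hcong n hn i)
      have h2 := sub_mem ha h1
      rw [← Finset.sum_sub_distrib] at h2
      simpa only [← smul_sub, sub_sub_cancel] using h2
  refine ⟨m, t, ht, ht', fun n c hc => ?_, hindA, fun n w => ?_⟩
  · have := hfin n
    exact mem_map_of_sum_mem hF τ _ (fun i => t i n) (fun i => ht' i n) (hindA n) c hc
  · rcases Nat.eq_zero_or_pos n with rfl | hn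
    · refine ⟨0, ?_⟩
      rw [pow_zero, Ideal.one_eq_top, extSub, Ideal.map_top, Submodule.top_smul]
      trivial
    let N := Submodule.span R (Set.range fun i => t i n)
    have hN : N ⊔ extSub R W v.asIdeal = ⊤ := by
      have hmap : Submodule.map (extSub R W v.asIdeal).mkQ N = ⊤ := by
        have h1 := hspan 1
        rw [pow_one] at h1
        have h2 : Submodule.span k (fixedSub hF τ v.asIdeal : Set (W ⧸ extSub R W v.asIdeal)) ≤
            (Submodule.map (extSub R W v.asIdeal).mkQ N).restrictScalars k := by
          rw [Submodule.span_le]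
          intro y hy
          obtain ⟨w, rfl⟩ := Submodule.Quotient.mk_surjective _ y
          obtain ⟨a, ha⟩ := hxspan w ((mk_mem_fixedSub hF τ _ w).1 hy)
          refine ⟨∑ i, a i • t i n, Submodule.sum_mem _ fun i _ => ?_, ?_⟩
          · rw [← algebraMap_smul R]
            exact Submodule.smul_mem _ _ (Submodule.subset_span ⟨i, rfl⟩)
          · refine (Submodule.Quotient.eq _).2 ?_
            have h1 : ∑ i, a i • (t i n - x i) ∈ extSub R W v.asIdeal :=
              Submodule.sum_mem _ fun i _ => by
                rw [← algebraMap_smul R]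
                exact Submodule.smul_mem _ _ (hcong n hn i)
            have h2 := sub_mem h1 ha
            simp only [smul_sub, Finset.sum_sub_distrib] at h2
            convert h2 using 1
            abel
        rw [h1] at h2
        exact eq_top_iff.2 fun y _ => h2 (Submodule.mem_top (x := y))
      rw [sup_comm, ← Submodule.comap_map_mkQ, hmap, Submodule.comap_top]
    have hw : w ∈ N ⊔ extSub R W (v.asIdeal ^ n) := by
      rw [sup_extSub_pow _ N hN n]; trivial
    obtain ⟨y, hy, z, hz, rfl⟩ := Submodule.mem_sup.1 hw
    obtain ⟨c, rfl⟩ := (Submodule.mem_span_range_iff_exists_fun R).1 hy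
    exact ⟨c, by simpa using hz⟩

end TateBasis

end

section

open Module

section TateBasis

variable {F A k R W : Type*} [Field F] [CommRing A] [Field k] [CommRing R]
  [Algebra F A] [Algebra F k] [Algebra F R] [Algebra A R] [Algebra k R]
  [IsScalarTower F A R] [IsScalarTower F k R]
  [AddCommGroup W] [Module R W] [Module A W] [Module k W] [Module F W]
  [IsScalarTower A R W] [IsScalarTower k R W] [IsScalarTower F k W] [IsScalarTower F R W]
  [IsScalarTower F A W] {σk : k →+* k} {σ : R →+* R}

namespace TateBasis

variable {ι : Type*} [Fintype ι] {τ : W →ₛₗ[σ] W} {v : Ideal A} {t : ι → ℕ → W}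

theorem mk_eq_mk (ht : TateBasis R τ v t) {n : ℕ} {c c' : ι → R}
    (h : ∑ i, c i • t i n - ∑ i, c' i • t i n ∈ extSub R W (v ^ n)) (i : ι) :
    Ideal.Quotient.mk ((v ^ n).map (algebraMap A R)) (c i) = Ideal.Quotient.mk _ (c' i) := by
  rw [Ideal.Quotient.mk_eq_mk_iff_sub_mem]
  refine ht.ind n (fun i => c i - c' i) ?_ i
  simpa only [sub_smul, Finset.sum_sub_distrib] using h

/-- The Cauchy sequence of an element of a Tate basis. -/
def seq (ht : TateBasis R τ v t) (i : ι) : AdicCompletion.AdicCauchySequence v W :=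
  AdicCompletion.AdicCauchySequence.mk v W (t i) fun n => by
    rw [SModEq.comm, SModEq.sub_mem, ← mem_extSub (R := R)]
    exact ht.cauchy i n

theorem exists_coords (hF : FrobData F A σk σ) (ht : TateBasis R τ v t) (x : ℕ → W)
    (hx : ∀ n, x (n + 1) - x n ∈ extSub R W (v ^ n))
    (hτ : ∀ n, τ (x n) - x n ∈ extSub R W (v ^ n)) :
    ∃ a : ι → ℕ → A, (∀ i n, a i (n + 1) - a i n ∈ v ^ n) ∧
      ∀ n, x n - ∑ i, a i n • t i n ∈ extSub R W (v ^ n) := by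
  have h1 : ∀ n, ∃ a : ι → A, x n - ∑ i, a i • t i n ∈ extSub R W (v ^ n) := by
    intro n
    obtain ⟨c, hc⟩ := ht.span n (x n)
    have hfix : ∀ i, σ (c i) - c i ∈ (v ^ n).map (algebraMap A R) := by
      intro i
      rw [← Ideal.Quotient.mk_eq_mk_iff_sub_mem]
      refine ht.mk_eq_mk (c := fun i => σ (c i)) ?_ i
      have h2 : τ (x n - ∑ i, c i • t i n) ∈ extSub R W (v ^ n) := extSub_le_comap hF τ _ hc
      have h3 : ∑ i, σ (c i) • (τ (t i n) - t i n) ∈ extSub R W (v ^ n) :=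
        Submodule.sum_mem _ fun i _ => Submodule.smul_mem _ _ (ht.fixed i n)
      have h4 := sub_mem (sub_mem (add_mem (hτ n) hc) h2) h3
      simp only [map_sub, map_sum, τ.map_smulₛₗ, smul_sub, Finset.sum_sub_distrib] at h4
      convert h4 using 1
      abel
    choose a ha using fun i => exists_of_fixed hF (v ^ n) (c i) (hfix i)
    refine ⟨a, ?_⟩
    have h3 : ∑ i, (c i - algebraMap A R (a i)) • t i n ∈ extSub R W (v ^ n) :=
      Submodule.sum_mem _ fun i _ => Submodule.smul_mem_smul (ha i) trivial
    have h4 := add_mem hc h3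
    simpa only [sub_smul, Finset.sum_sub_distrib, algebraMap_smul, sub_add_sub_cancel] using h4
  choose a ha using h1
  refine ⟨fun i n => a n i, fun i n => ?_, ha⟩
  refine ht.indA n (fun i => a (n + 1) i - a n i) ?_ i
  have h2 : ∑ i, a (n + 1) i • (t i (n + 1) - t i n) ∈ extSub R W (v ^ n) :=
    Submodule.sum_mem _ fun i _ => by
      rw [← algebraMap_smul R]
      exact Submodule.smul_mem _ _ (ht.cauchy i n)
  have h3 := sub_mem (sub_mem (add_mem (hx n) (ha n)) (extSub_mono (Ideal.pow_le_pow_right (Nat.le_succ n)) (ha (n + 1)))) h2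
  simp only [smul_sub, Finset.sum_sub_distrib] at h3
  simp only [sub_smul, Finset.sum_sub_distrib]
  convert h3 using 1
  abel

end TateBasis

theorem val_mk_smul_mk (v : Ideal A) (a : AdicCompletion.AdicCauchySequence v A)
    (x : AdicCompletion.AdicCauchySequence v W) (n : ℕ) :
    (AdicCompletion.mk v A a • AdicCompletion.mk v W x).val n =
      Submodule.Quotient.mk (a n • x n) := by
  rfl

variable {v : Ideal A}

/-- The fixed elements of `τ` in the completion of `W`. -/
def tateSub (v : Ideal A) (τA : W →ₗ[A] W) :
    Submodule (AdicCompletion v A) (AdicCompletion v W) :=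
  LinearMap.eqLocus (AdicCompletion.map v τA) LinearMap.id

theorem mk_mem_tateSub (R : Type*) [CommRing R] [Algebra A R] [Module R W] [IsScalarTower A R W]
    (τA : W →ₗ[A] W) (x : AdicCompletion.AdicCauchySequence v W) :
    AdicCompletion.mk v W x ∈ tateSub v τA ↔ ∀ n, τA (x n) - x n ∈ extSub R W (v ^ n) := by
  have h : AdicCompletion.mk v W x ∈ tateSub v τA ↔
      AdicCompletion.map v τA (AdicCompletion.mk v W x) = AdicCompletion.mk v W x := Iff.rfl
  rw [h, AdicCompletion.map_mk]
  constructor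
  · intro h n
    rw [mem_extSub]
    exact (Submodule.Quotient.eq _).1 (congrArg (fun y => y.val n) h)
  · intro h
    refine AdicCompletion.ext fun n => (Submodule.Quotient.eq _).2 ?_
    rw [← mem_extSub (R := R)]
    exact h n

namespace TateBasis

variable {ι : Type*} [Fintype ι] {τ : W →ₛₗ[σ] W} {t : ι → ℕ → W}

theorem exists_basis (hF : FrobData F A σk σ) (ht : TateBasis R τ v t) (τA : W →ₗ[A] W)
    (hτ : ∀ w, τA w = τ w) :
    ∃ b : Basis ι (AdicCompletion v A) (tateSub v τA),
      ∀ i, (b i : AdicCompletion v W) = AdicCompletion.mk v W (ht.seq i) := by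
  let s : ι → tateSub v τA := fun i => ⟨AdicCompletion.mk v W (ht.seq i),
    (mk_mem_tateSub R τA _).2 fun n => by rw [hτ]; exact ht.fixed i n⟩
  have hsum : ∀ (a : ι → AdicCompletion.AdicCauchySequence v A) (n : ℕ),
      (∑ i, AdicCompletion.mk v A (a i) • s i : tateSub v τA).1.val n =
        Submodule.Quotient.mk (∑ i, a i n • t i n) := by
    intro a n
    rw [AddSubmonoidClass.coe_finsetSum, AdicCompletion.val_sum_apply, ← Submodule.mkQ_apply, map_sum]
    exact Finset.sum_congr rfl fun i _ => val_mk_smul_mk v (a i) (ht.seq i) n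
  have hind : LinearIndependent (AdicCompletion v A) s := by
    rw [Fintype.linearIndependent_iff]
    intro g hg i
    choose a ha using fun i => AdicCompletion.mk_surjective v A (g i)
    rw [← ha]
    refine AdicCompletion.ext_evalₐ fun n => ?_
    rw [map_zero, AdicCompletion.evalₐ_mk, Ideal.Quotient.eq_zero_iff_mem]
    refine ht.indA n (fun i => a i n) ?_ i
    rw [mem_extSub, ← Submodule.Quotient.mk_eq_zero, ← hsum a n]
    simp only [ha, hg]
    rfl
  have hspan : ⊤ ≤ Submodule.span (AdicCompletion v A) (Set.range s) := by
    rintro ⟨x, hx⟩ -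
    obtain ⟨x, rfl⟩ := AdicCompletion.mk_surjective v W x
    have hx' := (mk_mem_tateSub R τA x).1 hx
    obtain ⟨a, ha, hax⟩ := ht.exists_coords hF x (fun n => by
      rw [mem_extSub, ← SModEq.sub_mem]
      exact (x.2 (Nat.le_succ n)).symm) (fun n => by
      rw [← hτ]; exact hx' n)
    let a' : ι → AdicCompletion.AdicCauchySequence v A := fun i =>
      AdicCompletion.AdicCauchySequence.mk v A (a i) fun n => by
        rw [SModEq.comm, SModEq.sub_mem, smul_eq_mul, ← Ideal.one_eq_top, mul_one]
        exact ha i n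
    refine (Submodule.mem_span_range_iff_exists_fun _).2 ⟨fun i => AdicCompletion.mk v A (a' i), ?_⟩
    refine Subtype.ext (AdicCompletion.ext fun n => ?_)
    rw [hsum a' n]
    refine ((Submodule.Quotient.eq _).2 ?_).symm
    rw [← mem_extSub (R := R)]
    exact hax n
  exact ⟨Basis.mk hind hspan, fun i => by rw [Basis.mk_apply]⟩

/-- The matrix of an endomorphism of the Tate module describes the endomorphism of `W` modulo
all powers of `v`. -/
theorem map_sub_sum_mem [DecidableEq ι] (ht : TateBasis R τ v t) (τA : W →ₗ[A] W)
    (b : Basis ι (AdicCompletion v A) (tateSub v τA))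
    (hb : ∀ i, (b i : AdicCompletion v W) = AdicCompletion.mk v W (ht.seq i))
    (p : W →ₗ[A] W) (g : End (AdicCompletion v A) (tateSub v τA))
    (hg : ∀ x, (g x : AdicCompletion v W) = AdicCompletion.map v p x) (n : ℕ) (j : ι)
    (c : ι → R) (hc : ∀ i, Ideal.quotientMap ((v ^ n).map (algebraMap A R)) (algebraMap A R)
      Ideal.le_comap_map (AdicCompletion.evalₐ v n (LinearMap.toMatrix b b g i j)) =
        Ideal.Quotient.mk _ (c i)) :
    p (t j n) - ∑ i, c i • t i n ∈ extSub R W (v ^ n) := by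
  choose a ha using fun i => AdicCompletion.mk_surjective v A (LinearMap.toMatrix b b g i j)
  have h1 : (AdicCompletion.map v p (AdicCompletion.mk v W (ht.seq j))).val n =
      Submodule.Quotient.mk (∑ i, a i n • t i n) := by
    rw [← hb, ← hg, ← b.sum_repr (g (b j)), AddSubmonoidClass.coe_finsetSum, AdicCompletion.val_sum_apply,
      ← Submodule.mkQ_apply, map_sum]
    refine Finset.sum_congr rfl fun i _ => ?_
    rw [← LinearMap.toMatrix_apply, ← ha, Submodule.coe_smul, hb]
    exact val_mk_smul_mk v (a i) (ht.seq i) n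
  rw [AdicCompletion.map_mk] at h1
  have h2 : p (t j n) - ∑ i, a i n • t i n ∈ extSub R W (v ^ n) := by
    rw [mem_extSub]
    exact (Submodule.Quotient.eq _).1 h1
  have h3 : ∑ i, (algebraMap A R (a i n) - c i) • t i n ∈ extSub R W (v ^ n) :=
    Submodule.sum_mem _ fun i _ => by
      refine Submodule.smul_mem_smul ?_ trivial
      rw [← Ideal.Quotient.mk_eq_mk_iff_sub_mem, ← hc, ← ha, AdicCompletion.evalₐ_mk]
      rfl
  have h4 := add_mem h2 h3
  simpa only [sub_smul, Finset.sum_sub_distrib, algebraMap_smul, sub_add_sub_cancel] using h4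

end TateBasis

end TateBasis

end

section

open Module

universe u

section Comparison

variable {A R W : Type*} [CommRing A] [CommRing R] [Algebra A R]
  [AddCommGroup W] [Module R W] [Module A W] [IsScalarTower A R W] {σ : R →+* R}

/-- The product of the rings `R / v ^ n R`. -/
abbrev CompRing (R : Type*) [CommRing R] [Algebra A R] (v : Ideal A) : Type _ :=
  ∀ n : ℕ, R ⧸ (v ^ n).map (algebraMap A R)

/-- The map from the completion of `A` to the product of the rings `R / v ^ n R`. -/
def toCompRing (R : Type*) [CommRing R] [Algebra A R] (v : Ideal A) :
    AdicCompletion v A →+* CompRing R v :=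
  RingHom.pi fun n => (Ideal.quotientMap ((v ^ n).map (algebraMap A R)) (algebraMap A R)
      Ideal.le_comap_map).comp (AdicCompletion.evalₐ v n).toRingHom

/-- The map from `R` to the product of the rings `R / v ^ n R`. -/
def mkComp (R : Type*) [CommRing R] [Algebra A R] (v : Ideal A) : R →+* CompRing R v :=
  RingHom.pi fun _ => Ideal.Quotient.mk _

theorem mkComp_apply (v : Ideal A) (r : R) (n : ℕ) :
    mkComp R v r n = Ideal.Quotient.mk _ r := rfl

theorem toCompRing_algebraMap (v : Ideal A) (a : A) :
    toCompRing R v (algebraMap A _ a) = mkComp R v (algebraMap A R a) := by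
  funext n
  change Ideal.quotientMap _ (algebraMap A R) Ideal.le_comap_map (AdicCompletion.evalₐ v n (algebraMap A _ a)) = _
  rw [AlgHom.commutes]
  rfl

theorem toCompRing_injective (v : Ideal A)
    (hinj : ∀ n a, algebraMap A R a ∈ (v ^ n).map (algebraMap A R) → a ∈ v ^ n) :
    Function.Injective (toCompRing R v) := by
  rw [injective_iff_map_eq_zero]
  intro x hx
  obtain ⟨a, rfl⟩ := AdicCompletion.mk_surjective v A x
  refine AdicCompletion.ext_evalₐ fun n => ?_
  rw [map_zero, AdicCompletion.evalₐ_mk, Ideal.Quotient.eq_zero_iff_mem]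
  refine hinj n _ ?_
  have h : Ideal.quotientMap _ (algebraMap A R) Ideal.le_comap_map
    (AdicCompletion.evalₐ v n (AdicCompletion.mk v A a)) = 0 := congrFun hx n
  rw [AdicCompletion.evalₐ_mk] at h
  exact Ideal.Quotient.eq_zero_iff_mem.1 h

/-- A field which contains `Q_v` and a quotient of the product of the rings `R / v ^ n R`. -/
theorem exists_comparison_field {A : Type*} {R : Type u} [CommRing A] [CommRing R]
    [Algebra A R] [IsDedekindDomain A] (v : IsDedekindDomain.HeightOneSpectrum A)
    (hinj : ∀ n a, algebraMap A R a ∈ (v.asIdeal ^ n).map (algebraMap A R) → a ∈ v.asIdeal ^ n) :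
    ∃ (B : Type u) (_ : Field B) (f : Qv A v →+* B) (g : CompRing R v.asIdeal →+* B),
      ∀ x : Av A v, f (algebraMap _ _ x) = g (toCompRing R v.asIdeal x) := by
  have hi := toCompRing_injective v.asIdeal hinj
  let S := (nonZeroDivisors (Av A v)).map (toCompRing R v.asIdeal)
  have h0 : (0 : CompRing R v.asIdeal) ∉ S := by
    rintro ⟨x, hx, hx0⟩
    rw [← map_zero (toCompRing R v.asIdeal)] at hx0
    exact nonZeroDivisors.ne_zero hx (hi hx0)
  have : Nontrivial (Localization S) := by
    refine ⟨⟨0, 1, fun h => h0 ?_⟩⟩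
    have h1 : algebraMap (CompRing R v.asIdeal) (Localization S) 1 = 0 := by rw [map_one, h]
    obtain ⟨s, hs⟩ := (IsLocalization.map_eq_zero_iff S (Localization S) _).1 h1
    rw [mul_one] at hs
    exact hs ▸ s.2
  obtain ⟨m, hm⟩ := Ideal.exists_maximal (Localization S)
  let := Ideal.Quotient.field m
  let g : CompRing R v.asIdeal →+* Localization S ⧸ m :=
    (Ideal.Quotient.mk m).comp (algebraMap _ _)
  have hunit : ∀ x : nonZeroDivisors (Av A v), IsUnit (g.comp (toCompRing R v.asIdeal) x) :=
    fun x => (IsLocalization.map_units (Localization S)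
      (⟨_, x, x.2, rfl⟩ : S)).map (Ideal.Quotient.mk m)
  exact ⟨Localization S ⧸ m, inferInstance, IsLocalization.lift hunit, g, fun x =>
    IsLocalization.lift_eq hunit x⟩

namespace TateBasis

variable {v : Ideal A} {ι κ : Type*} [Fintype ι] [DecidableEq ι] [Fintype κ] [DecidableEq κ]
  {τ : W →ₛₗ[σ] W} {t : ι → ℕ → W}

theorem exists_matrices (ht : TateBasis R τ v t) (τA : W →ₗ[A] W)
    (b : Basis ι (AdicCompletion v A) (tateSub v τA))
    (hb : ∀ i, (b i : AdicCompletion v W) = AdicCompletion.mk v W (ht.seq i))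
    (p : W →ₗ[R] W) (g : End (AdicCompletion v A) (tateSub v τA))
    (hg : ∀ x, (g x : AdicCompletion v W) = AdicCompletion.map v (p.restrictScalars A) x)
    (m : κ → W) (μ : κ → (W →ₗ[R] R)) (a : A)
    (hμ : ∀ i j, μ i (m j) = if i = j then algebraMap A R a else 0)
    (hm : ∀ w, a • w = ∑ j, μ j w • m j) :
    ∃ (D : Matrix ι κ (CompRing R v)) (E : Matrix κ ι (CompRing R v)),
      D * E = mkComp R v (algebraMap A R a) • (1 : Matrix ι ι (CompRing R v)) ∧
      E * D = mkComp R v (algebraMap A R a) • (1 : Matrix κ κ (CompRing R v)) ∧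
      mkComp R v (algebraMap A R a) • ((LinearMap.toMatrix b b g).map (toCompRing R v) * D) =
        D * (Matrix.of fun l j => μ l (p (m j))).map (mkComp R v) := by
  choose c hc using fun n w => ht.span n w
  have hμU : ∀ n j i, Ideal.Quotient.mk ((v ^ n).map (algebraMap A R)) (μ j (∑ i', c n (m i) i' • t i' n)) =
      Ideal.Quotient.mk _ (μ j (m i)) := by
    intro n j i
    rw [eq_comm, Ideal.Quotient.mk_eq_mk_iff_sub_mem, ← map_sub]
    exact map_mem_map_of_mem_extSub _ _ (hc n (m i))
  refine ⟨Matrix.of fun i j n => Ideal.Quotient.mk _ (c n (m j) i),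
    Matrix.of fun j i n => Ideal.Quotient.mk _ (μ j (t i n)), ?_, ?_, ?_⟩
  · ext i i' n
    have h := ht.mk_eq_mk (n := n) (c := fun i => ∑ j, μ j (t i' n) * c n (m j) i)
      (c' := fun i => if i = i' then algebraMap A R a else 0) (by
        have h1 : ∑ j, μ j (t i' n) • (m j - ∑ i, c n (m j) i • t i n) ∈ extSub R W (v ^ n) :=
          Submodule.sum_mem _ fun j _ => Submodule.smul_mem _ _ (hc n (m j))
        have h2 := neg_mem h1
        convert h2 using 1
        simp only [ite_smul, zero_smul, Finset.sum_ite_eq', Finset.mem_univ, if_true, algebraMap_smul,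
          hm, smul_sub, Finset.sum_sub_distrib, neg_sub, Finset.sum_smul, Finset.smul_sum, smul_smul]
        rw [Finset.sum_comm]) i
    rw [Matrix.mul_apply, Finset.sum_apply]
    simp only [Matrix.of_apply, Pi.mul_apply, Matrix.smul_apply, Matrix.one_apply]
    refine Eq.trans ?_ (h.trans ?_)
    · rw [map_sum]
      exact Finset.sum_congr rfl fun j _ => by rw [map_mul, mul_comm]
    · split_ifs
      · simp [mkComp_apply]
      · simp
  · ext l j n
    rw [Matrix.mul_apply, Finset.sum_apply]
    simp only [Matrix.of_apply, Pi.mul_apply, Matrix.smul_apply, Matrix.one_apply]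
    refine Eq.trans ?_ ((hμU n l j).trans ?_)
    · rw [map_sum, map_sum]
      exact Finset.sum_congr rfl fun i _ => by rw [map_smul, smul_eq_mul, map_mul, mul_comm]
    · rw [hμ]
      split_ifs
      · simp [mkComp_apply]
      · simp
  · ext i j n
    choose x hx using fun i i' => Ideal.Quotient.mk_surjective
      (toCompRing R v (LinearMap.toMatrix b b g i i') n)
    have hp : ∀ j, p (t j n) - ∑ i, x i j • t i n ∈ extSub R W (v ^ n) := fun j =>
      ht.map_sub_sum_mem τA b hb (p.restrictScalars A) g hg n j (fun i => x i j)
        fun i => (hx i j).symm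
    have h := ht.mk_eq_mk (n := n)
      (c := fun i => algebraMap A R a * ∑ i', x i i' * c n (m j) i')
      (c' := fun i => ∑ l, c n (m l) i * μ l (p (m j))) (by
        have h1 := Submodule.smul_mem _ (algebraMap A R a)
          (map_mem_extSub p (v ^ n) (hc n (m j)))
        have h2 : algebraMap A R a • ∑ i', c n (m j) i' • (p (t i' n) - ∑ i, x i i' • t i n) ∈
            extSub R W (v ^ n) :=
          Submodule.smul_mem _ _ (Submodule.sum_mem _ fun i' _ => Submodule.smul_mem _ _ (hp i'))
        have h3 : ∑ l, μ l (p (m j)) • (m l - ∑ i, c n (m l) i • t i n) ∈ extSub R W (v ^ n) :=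
          Submodule.sum_mem _ fun l _ => Submodule.smul_mem _ _ (hc n (m l))
        have h4 := sub_mem h3 (add_mem h1 h2)
        convert h4 using 1
        have h5 := hm (p (m j))
        rw [← algebraMap_smul R] at h5
        simp only [map_sub, map_sum, map_smul, smul_sub, Finset.sum_sub_distrib, h5]
        simp only [Finset.smul_sum, Finset.sum_smul, Finset.mul_sum, smul_smul]
        rw [Finset.sum_comm, Finset.sum_comm (f := fun i l => (c n (m l) i * μ l (p (m j))) • t i n)]
        simp only [mul_comm (c _ _ _), mul_left_comm]
        abel) i
    change mkComp R v (algebraMap A R a) n * _ = _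
    rw [Matrix.mul_apply, Matrix.mul_apply, Finset.sum_apply, Finset.sum_apply]
    refine Eq.trans ?_ (h.trans ?_)
    · rw [mkComp_apply, map_mul, map_sum]
      congr 1
      exact Finset.sum_congr rfl fun i' _ => by
        rw [map_mul, hx]
        rfl
    · rw [map_sum]
      exact Finset.sum_congr rfl fun l _ => by
        rw [map_mul]
        rfl

end TateBasis

end Comparison

end

section

open Module
open scoped TensorProduct

section FiniteFieldAux

variable {Fq k : Type*} [Field Fq] [Fintype Fq] [Field k] [Algebra Fq k]

theorem mem_range_of_pow_card_eq (c : k) (hc : c ^ Fintype.card Fq = c) :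
    c ∈ Set.range (algebraMap Fq k) := by
  have hq : 1 < Fintype.card Fq := Fintype.one_lt_card
  have hmonic : (Polynomial.X ^ Fintype.card Fq - Polynomial.X : Polynomial Fq).Monic :=
    Polynomial.monic_X_pow_sub (by rw [Polynomial.degree_X]; exact_mod_cast hq)
  have h := Polynomial.prod_multiset_X_sub_C_of_monic_of_roots_card_eq hmonic (by
    rw [FiniteField.roots_X_pow_card_sub_X, FiniteField.X_pow_card_sub_X_natDegree_eq Fq hq]
    rfl)
  have h2 := congrArg (Polynomial.aeval c) h
  rw [FiniteField.roots_X_pow_card_sub_X, map_sub, map_pow, Polynomial.aeval_X, hc, sub_self,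
    map_multiset_prod, Multiset.prod_eq_zero_iff, Multiset.map_map, Multiset.mem_map] at h2
  obtain ⟨a, -, ha⟩ := h2
  refine ⟨a, ?_⟩
  have h3 : c - algebraMap Fq k a = 0 := by simpa using ha
  exact (sub_eq_zero.1 h3).symm

/-- In a separably closed field there are enough roots of unity to separate the first
powers of the Frobenius endomorphism. -/
theorem exists_separating [IsSepClosed k] (N : ℕ) (hN : 0 < N) :
    ∃ ι : Multiplicative ℕ →* k,
      (∀ i < N, ∀ j < N, (∀ g, (FiniteField.frobeniusAlgHom Fq k : k →+* k)^[i] (ι g) =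
        (FiniteField.frobeniusAlgHom Fq k : k →+* k)^[j] (ι g)) → i = j) ∧
      ∀ g, (FiniteField.frobeniusAlgHom Fq k : k →+* k)^[N] (ι g) = ι g := by
  set q := Fintype.card Fq with hqdef
  have hq : 1 < q := Fintype.one_lt_card
  have hfrob : ∀ i c, (FiniteField.frobeniusAlgHom Fq k : k →+* k)^[i] c = c ^ q ^ i := by
    intro i c
    induction i generalizing c with
    | zero => simp
    | succ i ih =>
      rw [Function.iterate_succ_apply, ih, pow_succ', pow_mul]
      rfl
  have hqN : 1 < q ^ N := Nat.one_lt_pow hN.ne' hq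
  have hne : NeZero ((q ^ N - 1 : ℕ) : k) := ⟨by
    rw [Nat.cast_sub hqN.le, Nat.cast_pow, ← map_natCast (algebraMap Fq k) q,
      FiniteField.cast_card_eq_zero, map_zero, zero_pow hN.ne', zero_sub, Nat.cast_one]
    exact neg_ne_zero.2 one_ne_zero⟩
  obtain ⟨ζ, hζ⟩ := HasEnoughRootsOfUnity.prim (M := k) (n := q ^ N - 1)
  refine ⟨powersHom k ζ, fun i hi j hj h => ?_, fun g => ?_⟩
  · have h1 := h (Multiplicative.ofAdd 1)
    rw [hfrob, hfrob] at h1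
    have h2 : (powersHom k ζ) (Multiplicative.ofAdd 1) = ζ := by simp
    rw [h2] at h1
    rcases Nat.lt_or_ge N 2 with hN2 | hN2
    · omega
    have hlt : ∀ i < N, q ^ i < q ^ N - 1 := by
      intro i hi
      have h3 : q ^ i ≤ q ^ (N - 1) := Nat.pow_le_pow_right (by omega) (by omega)
      have h4 : q ^ N = q ^ (N - 1) * q := by rw [← pow_succ]; congr 1; omega
      have h5 : q ^ 1 ≤ q ^ (N - 1) := Nat.pow_le_pow_right (by omega) (by omega)
      have h6 : q ^ (N - 1) * 2 ≤ q ^ (N - 1) * q := Nat.mul_le_mul_left _ hq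
      rw [pow_one] at h5
      omega
    exact Nat.pow_right_injective hq (hζ.pow_inj (hlt i hi) (hlt j hj) h1)
  · rw [hfrob]
    obtain ⟨n, rfl⟩ := Multiplicative.ofAdd.surjective g
    have h2 : (powersHom k ζ) (Multiplicative.ofAdd n) = ζ ^ n := by simp
    rw [h2, ← pow_mul, mul_comm, pow_mul]
    congr 1
    have h3 : q ^ N = (q ^ N - 1) + 1 := by omega
    rw [h3, pow_succ, hζ.pow_eq_one, one_mul]

end FiniteFieldAux

section RightModule

variable (E k : Type*) {L : Type*} [Field L] [AddCommGroup E] [Module L E] [Field k] [Algebra L k]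

/-- The action of `k` on `E ⊗ k`. -/
@[reducible] def rightModule : Module k (E ⊗[L] k) :=
  Module.compHom _ ((End.lTensorAlgHom L k E).comp (Algebra.lmul L k)).toRingHom

end RightModule

section SepModule

variable {Fq A L : Type*} [Field Fq] [Fintype Fq] [CommRing A] [Algebra Fq A] [Field L] [Algebra Fq L]

/-- The two actions of `𝔽_q` on a `τ`-module are the same. -/
class TauModule.FqCompat (M : TauModule.{w} Fq A L) : Prop where
  smul_eq : ∀ (c : Fq) (x : M.carrier), algebraMap Fq A c • x = algebraMap Fq L c • x

variable (M : TauModule.{w} Fq A L)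

instance : Module (SeparableClosure L) M.Msep := rightModule M.carrier (SeparableClosure L)

theorem sep_smul_tmul (c d : SeparableClosure L) (x : M.carrier) :
    (c • (x ⊗ₜ[L] d) : M.Msep) = x ⊗ₜ[L] (c * d) := rfl

instance : SMulCommClass A (SeparableClosure L) M.Msep where
  smul_comm a c x := by
    induction x using TensorProduct.induction_on with
    | zero => simp
    | tmul x d => rfl
    | add x y hx hy => simp only [smul_add, hx, hy]

instance : Module Fq M.Msep := Module.compHom _ (algebraMap Fq A)

instance : IsScalarTower Fq A M.Msep where
  smul_assoc c a x := by
    rw [Algebra.smul_def, mul_smul]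
    rfl

instance [M.FqCompat] : IsScalarTower Fq (SeparableClosure L) M.Msep where
  smul_assoc c a x := by
    rw [Algebra.smul_def, mul_smul]
    induction a • x using TensorProduct.induction_on with
    | zero => simp
    | tmul x d =>
      rw [sep_smul_tmul]
      change _ = (algebraMap Fq A c • x) ⊗ₜ[L] d
      rw [TauModule.FqCompat.smul_eq, TensorProduct.smul_tmul, Algebra.smul_def,
        ← IsScalarTower.algebraMap_apply]
    | add x y hx hy => rw [smul_add, smul_add, hx, hy]

/-- The ring `A ⊗ L^sep`. -/
def ASep (Fq A L : Type*) [Field Fq] [CommRing A] [Algebra Fq A] [Field L] [Algebra Fq L] :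
    Type _ := A ⊗[Fq] SeparableClosure L

instance : CommRing (ASep Fq A L) := inferInstanceAs (CommRing (A ⊗[Fq] SeparableClosure L))

instance : Algebra A (ASep Fq A L) := inferInstanceAs (Algebra A (A ⊗[Fq] SeparableClosure L))

instance : Algebra Fq (ASep Fq A L) := inferInstanceAs (Algebra Fq (A ⊗[Fq] SeparableClosure L))

instance : Algebra (SeparableClosure L) (ASep Fq A L) :=
  (Algebra.TensorProduct.includeRight : SeparableClosure L →ₐ[Fq] A ⊗[Fq] SeparableClosure L).toAlgebra

instance : IsScalarTower Fq A (ASep Fq A L) :=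
  inferInstanceAs (IsScalarTower Fq A (A ⊗[Fq] SeparableClosure L))

instance : IsScalarTower Fq (SeparableClosure L) (ASep Fq A L) :=
  IsScalarTower.of_algebraMap_eq fun c =>
    ((Algebra.TensorProduct.includeRight :
      SeparableClosure L →ₐ[Fq] A ⊗[Fq] SeparableClosure L).commutes c).symm

instance : Module.FaithfullyFlat A (ASep Fq A L) :=
  inferInstanceAs (Module.FaithfullyFlat A (A ⊗[Fq] SeparableClosure L))

/-- The element `a ⊗ c` of `A ⊗ L^sep`. -/
def ASep.mk (a : A) (c : SeparableClosure L) : ASep Fq A L := a ⊗ₜ[Fq] c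

theorem ASep.induction {P : ASep Fq A L → Prop} (h0 : P 0) (hmk : ∀ a c, P (ASep.mk a c))
    (hadd : ∀ r s, P r → P s → P (r + s)) (r : ASep Fq A L) : P r :=
  TensorProduct.induction_on (motive := P) r h0 hmk hadd

theorem ASep.mk_mul_mk (a b : A) (c d : SeparableClosure L) :
    (ASep.mk a c * ASep.mk b d : ASep Fq A L) = ASep.mk (a * b) (c * d) :=
  Algebra.TensorProduct.tmul_mul_tmul a b c d

theorem ASep.algebraMap_left (a : A) : algebraMap A (ASep Fq A L) a = ASep.mk a 1 := rfl

theorem ASep.algebraMap_right (c : SeparableClosure L) :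
    algebraMap (SeparableClosure L) (ASep Fq A L) c = ASep.mk 1 c := rfl

instance [M.FqCompat] : Module (ASep Fq A L) M.Msep := 
  TensorProduct.Algebra.module (R := Fq) (A := A) (B := SeparableClosure L)

theorem asep_smul_def [M.FqCompat] (a : A) (c : SeparableClosure L) (x : M.Msep) :
    (ASep.mk a c : ASep Fq A L) • x = a • c • x := TensorProduct.Algebra.smul_def a c x

instance [M.FqCompat] : IsScalarTower A (ASep Fq A L) M.Msep where
  smul_assoc a r x := by
    rw [Algebra.smul_def, mul_smul, ASep.algebraMap_left, asep_smul_def, one_smul]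

instance [M.FqCompat] : IsScalarTower (SeparableClosure L) (ASep Fq A L) M.Msep where
  smul_assoc d r x := by
    rw [Algebra.smul_def, mul_smul, ASep.algebraMap_right, asep_smul_def, one_smul]

instance [M.FqCompat] : IsScalarTower Fq (ASep Fq A L) M.Msep where
  smul_assoc c r x := by
    rw [← algebraMap_smul A c r, smul_assoc, ← algebraMap_smul A c (r • x)]

/-- The Frobenius endomorphism of `L^sep`. -/
abbrev frobK (Fq L : Type*) [Field Fq] [Fintype Fq] [Field L] [Algebra Fq L] :
    SeparableClosure L →+* SeparableClosure L :=
  (FiniteField.frobeniusAlgHom Fq (SeparableClosure L) : SeparableClosure L →+* SeparableClosure L)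

/-- The endomorphism `id ⊗ Frob_q` of `A ⊗ L^sep`. -/
def sigSep (Fq A L : Type*) [Field Fq] [Fintype Fq] [CommRing A] [Algebra Fq A] [Field L]
    [Algebra Fq L] : ASep Fq A L →+* ASep Fq A L :=
  (Algebra.TensorProduct.map (AlgHom.id Fq A)
    (FiniteField.frobeniusAlgHom Fq (SeparableClosure L))).toRingHom

theorem sigSep_mk (a : A) (c : SeparableClosure L) :
    sigSep Fq A L (ASep.mk a c) = ASep.mk a (frobK Fq L c) :=
  Algebra.TensorProduct.map_tmul (AlgHom.id Fq A)
    (FiniteField.frobeniusAlgHom Fq (SeparableClosure L)) a c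

theorem frobData : FrobData Fq A (frobK Fq L) (sigSep Fq A L) where
  fixed c hc := mem_range_of_pow_card_eq c hc
  map_k c := sigSep_mk 1 c
  map_A a := (sigSep_mk a 1).trans (by rw [map_one]; rfl)
  gen r := by
    induction r using ASep.induction with
    | h0 => exact zero_mem _
    | hmk a c =>
      have : (ASep.mk a c : ASep Fq A L) = c • algebraMap A (ASep Fq A L) a := by
        rw [Algebra.smul_def, ASep.algebraMap_left, ASep.algebraMap_right, ASep.mk_mul_mk, one_mul,
          mul_one]
      rw [this]
      exact Submodule.smul_mem _ _ (Submodule.subset_span ⟨a, rfl⟩)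
    | hadd r s hr hs => exact add_mem hr hs

theorem tauSep_smul (c : SeparableClosure L) (x : M.Msep) :
    M.tauSep (c • x) = frobK Fq L c • M.tauSep x := by
  induction x using TensorProduct.induction_on with
  | zero => simp
  | tmul x d =>
    change M.tau x ⊗ₜ[L] ((c * d) ^ Fintype.card Fq) =
      M.tau x ⊗ₜ[L] (c ^ Fintype.card Fq * d ^ Fintype.card Fq)
    rw [mul_pow]
  | add x y hx hy => rw [smul_add, map_add, map_add, hx, hy, smul_add]

/-- `τ` on `M ⊗ L^sep` as a semilinear map over `A ⊗ L^sep`. -/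
def tauSepR [M.FqCompat] : M.Msep →ₛₗ[sigSep Fq A L] M.Msep where
  toFun := M.tauSep
  map_add' := map_add _
  map_smul' r x := by
    induction r using ASep.induction with
    | h0 => rw [map_zero, zero_smul, zero_smul, map_zero]
    | hmk a c =>
      rw [sigSep_mk, asep_smul_def, asep_smul_def, map_smul, tauSep_smul]
    | hadd r s hr hs => rw [add_smul, map_add, hr, hs, map_add, add_smul]

theorem frobSepM_smul [Finite L] (c : SeparableClosure L) (x : M.Msep) :
    M.frobSepM (c • x) = c • M.frobSepM x := by
  induction x using TensorProduct.induction_on with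
  | zero => simp
  | tmul x d => rfl
  | add x y hx hy => rw [smul_add, map_add, map_add, hx, hy, smul_add]

/-- The Frobenius endomorphism on `M ⊗ L^sep` as a linear map over `A ⊗ L^sep`. -/
def frobSepR [Finite L] [M.FqCompat] : M.Msep →ₗ[ASep Fq A L] M.Msep where
  toFun := M.frobSepM
  map_add' := map_add _
  map_smul' r x := by
    induction r using ASep.induction with
    | h0 => rw [RingHom.id_apply, zero_smul, zero_smul, map_zero]
    | hmk a c =>
      rw [asep_smul_def, map_smul, frobSepM_smul, RingHom.id_apply, asep_smul_def]
    | hadd r s hr hs => rw [add_smul, map_add, hr, hs, RingHom.id_apply, RingHom.id_apply,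
        RingHom.id_apply, add_smul]

end SepModule

end

section

open Module
open scoped TensorProduct

section SepModule

variable {Fq A L : Type*} [Field Fq] [Fintype Fq] [CommRing A] [Algebra Fq A] [Field L] [Algebra Fq L]

theorem finite_quotient_of_maximal [Algebra.FiniteType Fq A] [IsNoetherianRing A] (v : Ideal A)
    [hv : v.IsMaximal] (n : ℕ) : Finite (A ⧸ v ^ n) := by
  let := Ideal.Quotient.field v
  have : Algebra.FiniteType Fq (A ⧸ v) := inferInstance
  have : Module.Finite Fq (A ⧸ v) := finite_of_finite_type_of_isJacobsonRing Fq (A ⧸ v)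
  have : Finite (A ⧸ v) := Module.finite_of_finite Fq
  exact Ideal.finite_quotient_pow (IsNoetherian.noetherian v) n

variable (M : TauModule.{w} Fq A L)

theorem tmul_mem_extSub [M.FqCompat] (I : Ideal A) {x : M.carrier} (hx : x ∈ I • (⊤ : Submodule A M.carrier))
    (c : SeparableClosure L) : (x ⊗ₜ[L] c : M.Msep) ∈ extSub (ASep Fq A L) M.Msep I := by
  refine Submodule.smul_induction_on hx ?_ ?_
  · intro a ha y _
    rw [← TensorProduct.smul_tmul']
    exact smul_mem_extSub ha _
  · intro y z hy hz
    rw [TensorProduct.add_tmul]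
    exact add_mem hy hz

theorem span_tmul_one [M.FqCompat] (I : Ideal A) :
    Submodule.span (SeparableClosure L) (Set.range fun x : M.carrier =>
      (Submodule.Quotient.mk (x ⊗ₜ[L] (1 : SeparableClosure L)) :
        M.Msep ⧸ extSub (ASep Fq A L) M.Msep I)) = ⊤ := by
  rw [eq_top_iff]
  rintro w -
  obtain ⟨w, rfl⟩ := Submodule.Quotient.mk_surjective _ w
  induction w using TensorProduct.induction_on with
  | zero => exact zero_mem _
  | tmul x c =>
    have : (x ⊗ₜ[L] c : M.Msep) = c • (x ⊗ₜ[L] (1 : SeparableClosure L)) := by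
      rw [sep_smul_tmul, mul_one]
    rw [this]
    have hx : (Submodule.Quotient.mk (x ⊗ₜ[L] (1 : SeparableClosure L)) :
        M.Msep ⧸ extSub (ASep Fq A L) M.Msep I) ∈ Submodule.span (SeparableClosure L)
          (Set.range fun x : M.carrier => (Submodule.Quotient.mk (x ⊗ₜ[L] (1 : SeparableClosure L)) :
            M.Msep ⧸ extSub (ASep Fq A L) M.Msep I)) := Submodule.subset_span ⟨x, rfl⟩
    exact Submodule.smul_mem _ c hx
  | add x y hx hy => exact add_mem hx hy

theorem finite_sep_quotient [M.FqCompat] [Module.Finite A M.carrier] (I : Ideal A) [Finite (A ⧸ I)] :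
    Module.Finite (SeparableClosure L) (M.Msep ⧸ extSub (ASep Fq A L) M.Msep I) := by
  have hfin : Finite (M.carrier ⧸ (I • ⊤ : Submodule A M.carrier)) :=
    Module.finite_of_finite (A ⧸ I)
  refine Module.Finite.of_fg_top (Submodule.fg_def.2 ⟨_, ?_, span_tmul_one M I⟩)
  refine (Set.finite_range fun x : M.carrier ⧸ (I • ⊤ : Submodule A M.carrier) =>
    (Submodule.Quotient.mk (x.out ⊗ₜ[L] (1 : SeparableClosure L)) :
        M.Msep ⧸ extSub (ASep Fq A L) M.Msep I)).subset ?_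
  rintro _ ⟨x, rfl⟩
  refine ⟨Submodule.Quotient.mk x, (Submodule.Quotient.eq _).2 ?_⟩
  rw [← TensorProduct.sub_tmul]
  refine tmul_mem_extSub M I ?_ _
  rw [← Submodule.Quotient.eq]
  exact Quotient.out_eq _

theorem span_fixedSub [M.FqCompat] [Module.Finite A M.carrier] (I : Ideal A) [Finite (A ⧸ I)]
    (hs : ∀ x : M.carrier, ∃ y, x - M.tau y ∈ (I • ⊤ : Submodule A M.carrier)) :
    Submodule.span (SeparableClosure L) (fixedSub frobData (tauSepR M) I :
      Set (M.Msep ⧸ extSub (ASep Fq A L) M.Msep I)) = ⊤ := by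
  have hfin : Finite (M.carrier ⧸ (I • ⊤ : Submodule A M.carrier)) :=
    Module.finite_of_finite (A ⧸ I)
  let τA : M.carrier →ₗ[A] M.carrier :=
    { toFun := M.tau, map_add' := map_add _, map_smul' := M.tau_smul }
  have hτA : ∀ x, τA x = M.tau x := fun _ => rfl
  let f : (M.carrier ⧸ (I • ⊤ : Submodule A M.carrier)) →ₗ[A] _ :=
    Submodule.mapQ _ _ τA (Submodule.smul_top_le_comap_smul_top I τA)
  have hf : Function.Surjective f := by
    intro x
    obtain ⟨x, rfl⟩ := Submodule.Quotient.mk_surjective _ x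
    obtain ⟨y, hy⟩ := hs x
    exact ⟨Submodule.Quotient.mk y, ((Submodule.Quotient.eq _).2 hy).symm⟩
  let e : Equiv.Perm (M.carrier ⧸ (I • ⊤ : Submodule A M.carrier)) :=
    Equiv.ofBijective f ⟨Finite.injective_iff_surjective.2 hf, hf⟩
  obtain ⟨N, hN, heN⟩ := (isOfFinOrder_of_finite e).exists_pow_eq_one
  have hit : ∀ x : M.carrier, M.tau^[N] x - x ∈ (I • ⊤ : Submodule A M.carrier) := by
    intro x
    have h1 : ∀ n, (e ^ n) (Submodule.Quotient.mk x) = Submodule.Quotient.mk (M.tau^[n] x) := by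
      intro n
      induction n with
      | zero => rfl
      | succ n ih =>
        rw [pow_succ', Equiv.Perm.mul_apply, ih, Function.iterate_succ_apply']
        rfl
    rw [← Submodule.Quotient.eq, ← h1, heN]
    rfl
  rw [eq_top_iff, ← span_tmul_one M I, Submodule.span_le]
  rintro _ ⟨x, rfl⟩
  obtain ⟨ι, hdist, hfix⟩ := exists_separating (Fq := Fq) (k := SeparableClosure L) N hN
  refine mem_span_fixed ι (frobK Fq L) (quotTau frobData (tauSepR M) I).toAddMonoidHom
    (quotTau_smul frobData (tauSepR M) I) N hdist hfix hN _ ?_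
  have h2 : ∀ n, (quotTau frobData (tauSepR M) I).toAddMonoidHom^[n]
      (Submodule.Quotient.mk (x ⊗ₜ[L] (1 : SeparableClosure L))) =
        Submodule.Quotient.mk (M.tau^[n] x ⊗ₜ[L] (1 : SeparableClosure L)) := by
    intro n
    induction n with
    | zero => rfl
    | succ n ih =>
      rw [Function.iterate_succ_apply', ih, Function.iterate_succ_apply']
      have h3 : M.tauSep (M.tau^[n] x ⊗ₜ[L] (1 : SeparableClosure L)) =
          M.tau (M.tau^[n] x) ⊗ₜ[L] (1 : SeparableClosure L) := by
        change M.tau (M.tau^[n] x) ⊗ₜ[L] ((1 : SeparableClosure L) ^ Fintype.card Fq) = _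
        rw [one_pow]
      exact congrArg Submodule.Quotient.mk h3
  rw [h2]
  refine (Submodule.Quotient.eq _).2 ?_
  rw [← TensorProduct.sub_tmul]
  exact tmul_mem_extSub M I (hit x) _

theorem sep_torsionFree (htf : ∀ (a : A) (x : M.carrier), a • x = 0 → a = 0 ∨ x = 0) (a : A)
    (w : M.Msep) (hw : a • w = 0) : a = 0 ∨ w = 0 := by
  refine or_iff_not_imp_left.2 fun ha => ?_
  let f : M.carrier →ₗ[L] M.carrier :=
    { toFun := fun x => a • x, map_add' := smul_add a, map_smul' := fun l x => (smul_comm l a x).symm }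
  have hf : Function.Injective f := by
    rw [injective_iff_map_eq_zero]
    exact fun x hx => (htf a x hx).resolve_left ha
  have h1 := Module.Flat.rTensor_preserves_injective_linearMap (M := SeparableClosure L) f hf
  have h2 : ∀ w : M.Msep, f.rTensor (SeparableClosure L) w = a • w := by
    intro w
    induction w using TensorProduct.induction_on with
    | zero => simp
    | tmul x c => rfl
    | add x y hx hy => rw [map_add, hx, hy, smul_add]
  exact h1 (by rw [h2, hw, map_zero])

/-- The Tate module of `M` has a basis which comes from a Tate basis of `M ⊗ L^sep`. -/
theorem exists_tateBasis_sep [IsDedekindDomain A] [Algebra.FiniteType Fq A] [M.FqCompat]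
    [Module.Finite A M.carrier] (v : IsDedekindDomain.HeightOneSpectrum A)
    (htf : ∀ (a : A) (x : M.carrier), a • x = 0 → a = 0 ∨ x = 0)
    (hs : ∀ n (x : M.carrier), ∃ y, x - M.tau y ∈ (v.asIdeal ^ n • ⊤ : Submodule A M.carrier)) :
    ∃ (m : ℕ) (t : Fin m → ℕ → M.Msep) (ht : TateBasis (ASep Fq A L) (tauSepR M) v.asIdeal t)
      (b : Basis (Fin m) (Av A v) (M.Tate v)),
      ∀ i, (b i : AdicCompletion v.asIdeal M.Msep) = AdicCompletion.mk v.asIdeal M.Msep (ht.seq i) := by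
  have := v.isMaximal
  have hfinite := finite_quotient_of_maximal (Fq := Fq) v.asIdeal
  have hfin1 : Finite (A ⧸ v.asIdeal) := by
    have := hfinite 1
    rwa [pow_one] at this
  obtain ⟨m, t, ht⟩ := exists_tateBasis (F := Fq) frobData (tauSepR M) v
    (fun n => have := hfinite n; span_fixedSub M _ (hs n)) (sep_torsionFree M htf)
    (fun n => have := hfinite n; inferInstance) (finite_sep_quotient M v.asIdeal)
  obtain ⟨b, hb⟩ := ht.exists_basis frobData M.tauSep fun _ => rfl
  exact ⟨m, t, ht, b, hb⟩

end SepModule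

end

section

open Module
open scoped TensorProduct

section FunctionField

variable {Fq A Q L : Type*} [Field Fq] [CommRing A] [Algebra Fq A] [Field Q]
  [Algebra Fq Q] [Algebra A Q] [IsScalarTower Fq A Q] [Field L] [Algebra Fq L]

/-- The element `a ⊗ l` of `Q_L`. -/
def QL.mk (Fq : Type*) {Q L : Type*} [Field Fq] [Field Q] [Algebra Fq Q] [Field L] [Algebra Fq L]
    (a : Q) (l : L) : QL Fq Q L := a ⊗ₜ[Fq] l

theorem QL.induction {P : QL Fq Q L → Prop} (h0 : P 0) (hmk : ∀ a c, P (QL.mk Fq a c))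
    (hadd : ∀ r s, P r → P s → P (r + s)) (r : QL Fq Q L) : P r :=
  TensorProduct.induction_on (motive := P) r h0 hmk hadd

theorem QL.mk_mul_mk (a b : Q) (c d : L) :
    QL.mk Fq a c * QL.mk Fq b d = QL.mk Fq (a * b) (c * d) :=
  Algebra.TensorProduct.tmul_mul_tmul a b c d

theorem QL.algebraMap_eq (a : Q) : algebraMap Q (QL Fq Q L) a = QL.mk Fq a 1 := rfl

theorem QL.LtoQL_eq (l : L) : LtoQL Fq Q L l = QL.mk Fq 1 l := rfl

theorem QL.smul_mk (a b : Q) (l : L) : a • QL.mk Fq b l = QL.mk Fq (a * b) l := by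
  rw [Algebra.smul_def, QL.algebraMap_eq, QL.mk_mul_mk, one_mul]

theorem QL.sig_mk [Fintype Fq] (a : Q) (l : L) :
    sig Fq Q L (QL.mk Fq a l) = QL.mk Fq a (frobL Fq L l) :=
  Algebra.TensorProduct.map_tmul (AlgHom.id Fq Q) (FiniteField.frobeniusAlgHom Fq L) a l

/-- An `𝔽_q`-basis of `L` as a `Q`-basis of `Q_L`. -/
def QL.basis {ι : Type*} (b : Basis ι Fq L) : Basis ι Q (QL Fq Q L) :=
  Algebra.TensorProduct.basis Q b

theorem QL.basis_apply {ι : Type*} (b : Basis ι Fq L) (i : ι) :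
    QL.basis (Q := Q) b i = QL.mk Fq 1 (b i) := Algebra.TensorProduct.basis_apply b i

instance [Finite L] : Module.Finite Q (QL Fq Q L) :=
  inferInstanceAs (Module.Finite Q (Q ⊗[Fq] L))

theorem QL.LtoQL_injective : Function.Injective (LtoQL Fq Q L) :=
  Algebra.TensorProduct.includeRight_injective (algebraMap Fq Q).injective


theorem InftyPoint.algebraMap_residue_bijective (inf : InftyPoint Fq A Q) : Function.Bijective
    ((IsLocalRing.residue inf.O).comp
      ((algebraMap Fq Q).codRestrict inf.O.toSubring inf.algebraMap_mem)) := by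
  refine ⟨RingHom.injective _, fun x => ?_⟩
  obtain ⟨x, rfl⟩ := IsLocalRing.residue_surjective x
  obtain ⟨a, ha⟩ := inf.residue_eq x x.2
  refine ⟨a, ?_⟩
  rw [← sub_eq_zero, RingHom.comp_apply, ← map_sub, IsLocalRing.residue_eq_zero_iff]
  have h := neg_mem ((inf.O.valuation_lt_one_iff
    (x - (algebraMap Fq Q).codRestrict inf.O.toSubring inf.algebraMap_mem a)).2 ha)
  rwa [neg_sub] at h

/-- The residue map `𝒪_{C,∞} → 𝔽_q`. -/
def InftyPoint.res (inf : InftyPoint Fq A Q) : inf.subalg →ₐ[Fq] Fq where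
  toRingHom := (RingEquiv.ofBijective _ inf.algebraMap_residue_bijective).symm.toRingHom.comp
    (IsLocalRing.residue inf.O)
  commutes' a := (RingEquiv.ofBijective _ inf.algebraMap_residue_bijective).symm_apply_apply a

variable (L) in
/-- The residue map `𝒪_{C,∞} ⊗ L → L`. -/
def InftyPoint.resL (inf : InftyPoint Fq A Q) : inf.subalg ⊗[Fq] L →ₐ[Fq] L :=
  Algebra.TensorProduct.lift ((Algebra.ofId Fq L).comp inf.res) (AlgHom.id Fq L)
    fun _ _ => Commute.all _ _

variable (L) in
/-- The map `𝒪_{C,∞} ⊗ L → Q_L`. -/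
def InftyPoint.toQL (inf : InftyPoint Fq A Q) : inf.subalg ⊗[Fq] L →ₐ[Fq] QL Fq Q L :=
  Algebra.TensorProduct.map inf.subalg.val (AlgHom.id Fq L)

theorem InftyPoint.toQL_injective (inf : InftyPoint Fq A Q) : Function.Injective (inf.toQL L) :=
  Module.Flat.rTensor_preserves_injective_linearMap (M := L) inf.subalg.val.toLinearMap
    Subtype.val_injective

theorem InftyPoint.exists_smul_eq [Finite L] (inf : InftyPoint Fq A Q) (x : QL Fq Q L) (hx : x ≠ 0) :
    ∃ y : Q, y ≠ 0 ∧ ∃ w, y • x = inf.toQL L w ∧ inf.resL L w ≠ 0 := by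
  classical
  have : Module.Finite Fq L := Module.Finite.of_finite
  let b := finBasis Fq L
  let β := QL.basis (Q := Q) b
  have hne : (Finset.univ.filter fun i => β.repr x i ≠ 0).Nonempty := by
    by_contra hcon
    rw [Finset.not_nonempty_iff_eq_empty, Finset.filter_eq_empty_iff] at hcon
    refine hx (β.ext_elem fun i => ?_)
    rw [map_zero]
    simpa using hcon (Finset.mem_univ i)
  obtain ⟨i₀, hi₀, hmax⟩ := Finset.exists_max_image _ (fun i => inf.O.valuation (β.repr x i)) hne
  have h0 : β.repr x i₀ ≠ 0 := (Finset.mem_filter.1 hi₀).2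
  have hmem : ∀ i, (β.repr x i₀)⁻¹ * β.repr x i ∈ inf.O := by
    intro i
    rw [← ValuationSubring.valuation_le_one_iff, map_mul, map_inv₀]
    by_cases hi : β.repr x i = 0
    · simp [hi]
    · have h1 := hmax i (Finset.mem_filter.2 ⟨Finset.mem_univ i, hi⟩)
      rw [← mul_inv_cancel₀ ((inf.O.valuation.ne_zero_iff).2 h0), mul_comm]
      gcongr
  refine ⟨(β.repr x i₀)⁻¹, inv_ne_zero h0, ∑ i, (⟨_, hmem i⟩ : inf.subalg) ⊗ₜ[Fq] b i, ?_, ?_⟩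
  · refine (congrArg ((β.repr x i₀)⁻¹ • ·) (β.sum_repr x).symm).trans ?_
    refine Finset.smul_sum.trans ?_
    refine (Finset.sum_congr rfl fun i _ => ?_).trans (map_sum (inf.toQL L) _ _).symm
    rw [smul_smul, QL.basis_apply, QL.smul_mk, mul_one]
    exact (Algebra.TensorProduct.map_tmul inf.subalg.val (AlgHom.id Fq L)
      ⟨_, hmem i⟩ (b i)).symm
  · rw [map_sum (inf.resL L)]
    have h1 : ∀ i, inf.resL L ((⟨_, hmem i⟩ : inf.subalg) ⊗ₜ[Fq] b i) =
        inf.res ⟨_, hmem i⟩ • b i := fun i => by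
      rw [InftyPoint.resL, Algebra.TensorProduct.lift_tmul, Algebra.smul_def]
      rfl
    simp only [h1]
    intro h2
    have h3 := Fintype.linearIndependent_iff.1 b.linearIndependent _ h2 i₀
    have h4 : (⟨(β.repr x i₀)⁻¹ * β.repr x i₀, hmem i₀⟩ : inf.subalg) = 1 :=
      Subtype.ext (inv_mul_cancel₀ h0)
    rw [h4, map_one] at h3
    exact one_ne_zero h3

theorem InftyPoint.noZeroDivisors [Finite L] (inf : InftyPoint Fq A Q) : IsDomain (QL Fq Q L) := by
  have : Nontrivial (QL Fq Q L) := ⟨⟨0, 1, fun h => by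
    have h1 : LtoQL Fq Q L 0 = LtoQL Fq Q L 1 := by rw [map_zero, map_one, h]
    exact zero_ne_one (QL.LtoQL_injective h1)⟩⟩
  have : NoZeroDivisors (QL Fq Q L) := by
    refine ⟨fun {x x'} hxx => ?_⟩
    by_contra! hcon
    obtain ⟨y, -, w, hw, hw0⟩ := inf.exists_smul_eq x hcon.1
    obtain ⟨y', -, w', hw', hw0'⟩ := inf.exists_smul_eq x' hcon.2
    have h1 : inf.toQL L (w * w') = 0 := by
      rw [map_mul, ← hw, ← hw', smul_mul_smul_comm, hxx, smul_zero]
    have h2 : w * w' = 0 := inf.toQL_injective (by rw [h1, map_zero])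
    have h3 := congrArg (inf.resL L) h2
    rw [map_mul, map_zero, mul_eq_zero] at h3
    exact h3.elim hw0 hw0'
  exact NoZeroDivisors.to_isDomain _

theorem InftyPoint.exists_mul_eq_one [Finite L] (inf : InftyPoint Fq A Q) (x : QL Fq Q L) (hx : x ≠ 0) : ∃ y, x * y = 1 := by
  have := inf.noZeroDivisors (L := L)
  have h := (LinearMap.injective_iff_surjective (f := LinearMap.mulLeft Q x)).1
    (fun a b hab => mul_left_cancel₀ hx hab)
  exact h 1

open Classical in
/-- The function field `Q_L` is a field. -/
@[reducible] def InftyPoint.fieldQL [Finite L] (inf : InftyPoint Fq A Q) : Field (QL Fq Q L) :=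
  { (inferInstance : CommRing (QL Fq Q L)) with
    inv := fun x => if h : x = 0 then 0 else (inf.exists_mul_eq_one x h).choose
    exists_pair_ne := (inf.noZeroDivisors (L := L)).toNontrivial.exists_pair_ne
    mul_inv_cancel := fun x hx => by
      change x * (if h : x = 0 then 0 else (inf.exists_mul_eq_one x h).choose) = 1
      rw [dif_neg hx]
      exact (inf.exists_mul_eq_one x hx).choose_spec
    inv_zero := dif_pos rfl
    nnqsmul := _
    nnqsmul_def := fun _ _ => rfl
    qsmul := _
    qsmul_def := fun _ _ => rfl }

theorem InftyPoint.cyclicExt [Fintype Fq] [Finite L] (inf : InftyPoint Fq A Q) :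
    letI := inf.fieldQL (L := L)
    CyclicExt Q (sig Fq Q L) (finrank Fq L) := by
  let := inf.fieldQL (L := L)
  have : Module.Finite Fq L := Module.Finite.of_finite
  have hit : ∀ i l, (sig Fq Q L)^[i] (LtoQL Fq Q L l) =
      LtoQL Fq Q L ((FiniteField.frobeniusAlgHom Fq L ^ i) l) := by
    intro i
    induction i with
    | zero => intro l; rfl
    | succ i ih =>
      intro l
      rw [Function.iterate_succ_apply, AbelianTauSheaf.sig_LtoQL, ih, pow_succ]
      rfl
  refine ⟨finrank_pos, AbelianTauSheaf.sig_iterate, fun i hi j hj h => ?_,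
    AbelianTauSheaf.sig_algebraMap, fun c hc => ?_⟩
  · have h1 : FiniteField.frobeniusAlgHom Fq L ^ i = FiniteField.frobeniusAlgHom Fq L ^ j := by
      ext l
      apply QL.LtoQL_injective (Fq := Fq) (Q := Q)
      rw [← hit, ← hit, h]
    have h2 := FiniteField.orderOf_frobeniusAlgHom Fq L
    exact pow_injOn_Iio_orderOf (by rwa [Set.mem_Iio, h2]) (by rwa [Set.mem_Iio, h2]) h1
  · let : Module L (QL Fq Q L) := Module.compHom _ (LtoQL Fq Q L)
    have hLmk : ∀ (l : L) (x : QL Fq Q L), l • x = LtoQL Fq Q L l * x := fun _ _ => rfl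
    have : IsScalarTower Fq L (QL Fq Q L) := ⟨fun a l x => by
      rw [hLmk, hLmk, Algebra.smul_def a (_ * x), ← mul_assoc, Algebra.smul_def, map_mul]
      congr 2
      exact (Algebra.TensorProduct.includeRight : L →ₐ[Fq] Q ⊗[Fq] L).commutes a⟩
    have h1 := mem_span_fixedField (F := Fq) (k := L) (FiniteField.frobeniusAlgHom Fq L : L →+* L)
      (fun c hc => mem_range_of_pow_card_eq c hc) (sig Fq Q L).toAddMonoidHom
      (fun l x => by
        change sig Fq Q L (LtoQL Fq Q L l * x) = _
        rw [map_mul, AbelianTauSheaf.sig_LtoQL]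
        rfl) (Set.range (algebraMap Q (QL Fq Q L))) (by
        rintro _ ⟨a, rfl⟩
        exact AbelianTauSheaf.sig_algebraMap a) c hc (by
        clear hc
        induction c using QL.induction with
        | h0 => exact zero_mem _
        | hmk a l =>
          have : QL.mk Fq a l = l • algebraMap Q (QL Fq Q L) a := by
            rw [hLmk, QL.LtoQL_eq, QL.algebraMap_eq, QL.mk_mul_mk, one_mul, mul_one]
          rw [this]
          exact Submodule.smul_mem _ _ (Submodule.subset_span ⟨a, rfl⟩)
        | hadd r s hr hs => exact add_mem hr hs)
    clear hc
    induction h1 using Submodule.span_induction with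
    | mem x hx => exact hx
    | zero => exact ⟨0, map_zero _⟩
    | add x y _ _ hx hy =>
      obtain ⟨a, rfl⟩ := hx
      obtain ⟨b, rfl⟩ := hy
      exact ⟨a + b, map_add _ _ _⟩
    | smul l x _ hx =>
      obtain ⟨a, rfl⟩ := hx
      refine ⟨l • a, ?_⟩
      rw [Algebra.smul_def, map_mul, Algebra.smul_def]
      rfl

end FunctionField

end

section

open Module
open scoped TensorProduct

section AffineRing

variable {Fq A Q L : Type*} [Field Fq] [CommRing A] [Algebra Fq A] [Field Q]
  [Algebra Fq Q] [Algebra A Q] [IsScalarTower Fq A Q] [Field L] [Algebra Fq L]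

theorem QL.mk_eq_mul (a : Q) (l : L) : QL.mk Fq a l = QL.mk Fq a 1 * QL.mk Fq 1 l := by
  rw [QL.mk_mul_mk, one_mul, mul_one]

theorem AL.induction {P : AL Fq A Q L → Prop} (h0 : P 0)
    (hmk : ∀ a l, P (AtoAL Fq A Q L a * LtoAL Fq A Q L l))
    (hadd : ∀ r s, P r → P s → P (r + s)) (r : AL Fq A Q L) : P r := by
  obtain ⟨_, x, rfl⟩ := r
  let g : A ⊗[Fq] L →ₐ[Fq] Q ⊗[Fq] L :=
    Algebra.TensorProduct.map (IsScalarTower.toAlgHom Fq A Q) (AlgHom.id Fq L)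
  have h : ∀ x : A ⊗[Fq] L, P ⟨g x, x, rfl⟩ := by
    intro x
    induction x using TensorProduct.induction_on with
    | zero =>
      convert h0 using 1
      exact Subtype.ext (map_zero g)
    | tmul a l =>
      convert hmk a l using 1
      refine Subtype.ext ?_
      change g (a ⊗ₜ l) = QL.mk Fq (algebraMap A Q a) 1 * QL.mk Fq 1 l
      exact (Algebra.TensorProduct.map_tmul _ _ _ _).trans (QL.mk_eq_mul _ _)
    | add x y hx hy =>
      convert hadd _ _ hx hy using 1
      exact Subtype.ext (map_add g x y)
  exact h x

theorem AtoAL_algebraMap (c : Fq) :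
    AtoAL Fq A Q L (algebraMap Fq A c) = LtoAL Fq A Q L (algebraMap Fq L c) := by
  refine Subtype.ext ?_
  change algebraMap Q (QL Fq Q L) (algebraMap A Q (algebraMap Fq A c)) = _
  rw [← IsScalarTower.algebraMap_apply Fq A Q]
  exact ((Algebra.TensorProduct.includeLeft : Q →ₐ[Fq] Q ⊗[Fq] L).commutes c).trans
    ((Algebra.TensorProduct.includeRight : L →ₐ[Fq] Q ⊗[Fq] L).commutes c).symm

theorem exists_smul_mem_AL [IsDomain A] [IsFractionRing A Q] (z : QL Fq Q L) :
    ∃ a : A, a ≠ 0 ∧ algebraMap Q (QL Fq Q L) (algebraMap A Q a) * z ∈ AL Fq A Q L := by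
  induction z using QL.induction with
  | h0 => exact ⟨1, one_ne_zero, by rw [mul_zero]; exact zero_mem _⟩
  | hmk q l =>
    obtain ⟨x, y, hy, rfl⟩ := IsFractionRing.div_surjective (A := A) q
    refine ⟨y, nonZeroDivisors.ne_zero hy, ?_⟩
    have h : algebraMap Q (QL Fq Q L) (algebraMap A Q y) *
        QL.mk Fq (algebraMap A Q x / algebraMap A Q y) l =
        algebraMap Q (QL Fq Q L) (algebraMap A Q x) * LtoQL Fq Q L l := by
      rw [QL.algebraMap_eq, QL.algebraMap_eq, QL.LtoQL_eq, QL.mk_mul_mk, QL.mk_mul_mk, one_mul,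
        mul_one, mul_div_cancel₀ _
          ((map_ne_zero_iff _ (IsFractionRing.injective A Q)).2 (nonZeroDivisors.ne_zero hy))]
    rw [h]
    exact mul_mem (algebraMap_mem_AL L x) (LtoQL_mem_AL L l)
  | hadd r s hr hs =>
    obtain ⟨a, ha, har⟩ := hr
    obtain ⟨b, hb, hbs⟩ := hs
    refine ⟨a * b, mul_ne_zero ha hb, ?_⟩
    rw [mul_add, map_mul, map_mul]
    refine add_mem ?_ ?_
    · rw [mul_comm (algebraMap Q (QL Fq Q L) _), mul_assoc]
      exact mul_mem (algebraMap_mem_AL L b) har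
    · rw [mul_assoc]
      exact mul_mem (algebraMap_mem_AL L a) hbs

/-- `A_L` is isomorphic to `A ⊗ L`. -/
def AL.equiv [IsDomain A] [IsFractionRing A Q] : A ⊗[Fq] L ≃ₐ[Fq] AL Fq A Q L :=
  AlgEquiv.ofInjective
    (Algebra.TensorProduct.map (IsScalarTower.toAlgHom Fq A Q) (AlgHom.id Fq L))
    (Module.Flat.rTensor_preserves_injective_linearMap (M := L)
      (IsScalarTower.toAlgHom Fq A Q).toLinearMap (IsFractionRing.injective A Q))

/-- The map from `A_L` to `A ⊗ L^sep`. -/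
def AL.toASep [IsDomain A] [IsFractionRing A Q] : AL Fq A Q L →+* ASep Fq A L :=
  ((Algebra.TensorProduct.map (AlgHom.id Fq A)
    (IsScalarTower.toAlgHom Fq L (SeparableClosure L))).comp
      (AL.equiv (Fq := Fq) (A := A) (Q := Q) (L := L)).symm.toAlgHom).toRingHom

theorem AL.equiv_tmul [IsDomain A] [IsFractionRing A Q] (a : A) (l : L) :
    AL.equiv (Fq := Fq) (Q := Q) (a ⊗ₜ l) = AtoAL Fq A Q L a * LtoAL Fq A Q L l := by
  refine Subtype.ext ?_
  change Algebra.TensorProduct.map (IsScalarTower.toAlgHom Fq A Q) (AlgHom.id Fq L) (a ⊗ₜ l) =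
    QL.mk Fq (algebraMap A Q a) 1 * QL.mk Fq 1 l
  exact (Algebra.TensorProduct.map_tmul _ _ _ _).trans (QL.mk_eq_mul _ _)

theorem AL.toASep_mul [IsDomain A] [IsFractionRing A Q] (a : A) (l : L) :
    AL.toASep (AtoAL Fq A Q L a * LtoAL Fq A Q L l) =
      ASep.mk a (algebraMap L (SeparableClosure L) l) := by
  rw [← AL.equiv_tmul]
  change Algebra.TensorProduct.map (AlgHom.id Fq A)
    (IsScalarTower.toAlgHom Fq L (SeparableClosure L)) (AL.equiv.symm (AL.equiv (a ⊗ₜ l))) = _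
  rw [AlgEquiv.symm_apply_apply]
  exact Algebra.TensorProduct.map_tmul _ _ _ _

theorem AL.toASep_AtoAL [IsDomain A] [IsFractionRing A Q] (a : A) :
    AL.toASep (AtoAL Fq A Q L a) = algebraMap A (ASep Fq A L) a := by
  have h := AL.toASep_mul (Fq := Fq) (Q := Q) (L := L) a 1
  rw [map_one, map_one, mul_one] at h
  exact h

theorem AL.finite [Finite L] :
    letI : Algebra A (AL Fq A Q L) := (AtoAL Fq A Q L).toAlgebra
    Module.Finite A (AL Fq A Q L) := by
  let : Algebra A (AL Fq A Q L) := (AtoAL Fq A Q L).toAlgebra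
  refine Module.Finite.of_fg_top (Submodule.fg_def.2
    ⟨Set.range (LtoAL Fq A Q L), Set.finite_range _, ?_⟩)
  rw [eq_top_iff]
  rintro z -
  induction z using AL.induction with
  | h0 => exact zero_mem _
  | hmk a l => exact Submodule.smul_mem _ a (Submodule.subset_span ⟨l, rfl⟩)
  | hadd r s hr hs => exact add_mem hr hs

theorem exists_sig_eq [Fintype Fq] [Finite L] (z : AL Fq A Q L) :
    ∃ z' : AL Fq A Q L, sig Fq Q L z' = z := by
  induction z using AL.induction with
  | h0 => exact ⟨0, map_zero _⟩
  | hmk a l =>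
    obtain ⟨l', rfl⟩ := Finite.surjective_of_injective (frobL Fq L).injective l
    refine ⟨AtoAL Fq A Q L a * LtoAL Fq A Q L l', ?_⟩
    change sig Fq Q L (QL.mk Fq (algebraMap A Q a) 1 * QL.mk Fq 1 l') =
      QL.mk Fq (algebraMap A Q a) 1 * QL.mk Fq 1 _
    rw [map_mul, QL.sig_mk, QL.sig_mk, map_one]
  | hadd r s hr hs =>
    obtain ⟨r', hr⟩ := hr
    obtain ⟨s', hs⟩ := hs
    exact ⟨r' + s', by
      change sig Fq Q L ((r' : QL Fq Q L) + s') = r + s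
      rw [map_add, hr, hs]⟩

theorem graph_sup_eq_top (c : CharMap Fq A L) (v : IsDedekindDomain.HeightOneSpectrum A)
    [IsDedekindDomain A] (hv : c.NePlace v) (d n : ℕ) :
    graphIdealAffine Q c ^ d ⊔ (v.asIdeal ^ n).map (AtoAL Fq A Q L) = ⊤ := by
  cases c with
  | infty =>
    change (⊤ : Ideal _) ^ d ⊔ _ = ⊤
    rw [← Ideal.one_eq_top, one_pow, Ideal.one_eq_top, top_sup_eq]
  | affine c =>
    rw [Ideal.map_pow, ← Ideal.isCoprime_iff_sup_eq]
    refine IsCoprime.pow ?_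
    rw [Ideal.isCoprime_iff_sup_eq]
    obtain ⟨a, ha, hca⟩ : ∃ a ∈ v.asIdeal, c a ≠ 0 := by
      by_contra! hcon
      refine hv (v.isMaximal.eq_of_le (RingHom.ker_ne_top c) fun a ha => hcon a ha).symm
    have h1 : AtoAL Fq A Q L a - LtoAL Fq A Q L (c a) ∈
        graphIdealAffine Q (CharMap.affine c) := Ideal.subset_span ⟨a, rfl⟩
    have h2 : AtoAL Fq A Q L a ∈ v.asIdeal.map (AtoAL Fq A Q L) := Ideal.mem_map_of_mem _ ha
    have h3 := sub_mem (Ideal.mem_sup_right (S := graphIdealAffine Q (CharMap.affine c)) h2)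
      (Ideal.mem_sup_left h1)
    rw [sub_sub_cancel] at h3
    exact Ideal.eq_top_of_isUnit_mem _ h3 ((isUnit_iff_ne_zero.2 hca).map _)

end AffineRing

namespace AbelianTauSheaf

variable {Fq A Q : Type*} [Field Fq] [Fintype Fq] [CommRing A] [Algebra Fq A] [Field Q]
  [Algebra Fq Q] [Algebra A Q] [IsScalarTower Fq A Q] [IsDedekindDomain A] [IsFractionRing A Q]
  {L : Type*} [Field L] [Finite L] [Algebra Fq L] {inf : InftyPoint Fq A Q} {c : CharMap Fq A L}

variable (F : AbelianTauSheaf.{w} inf c)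

instance : Module (AL Fq A Q L) F.tauModule.carrier :=
  inferInstanceAs (Module (AL Fq A Q L) (F.E 0).M)

theorem AtoAL_smul (a : A) (x : F.tauModule.carrier) : AtoAL Fq A Q L a • x = a • x := rfl

theorem LtoAL_smul (l : L) (x : F.tauModule.carrier) : LtoAL Fq A Q L l • x = l • x := rfl

instance : F.tauModule.FqCompat where
  smul_eq e x := by
    rw [← AtoAL_smul, ← LtoAL_smul, AtoAL_algebraMap]

/-- The inclusion of `M(F)` in the generic fibre of `F_0`. -/
def carrierVal : F.tauModule.carrier →ₗ[AL Fq A Q L] (F.E 0).V := (F.E 0).M.subtype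

theorem carrierVal_injective : Function.Injective F.carrierVal := Subtype.val_injective

theorem carrierVal_tau (x : F.tauModule.carrier) :
    F.carrierVal (F.tauModule.tau x) = F.phi 0 (F.carrierVal x) := rfl

theorem carrierVal_frob (x : F.tauModule.carrier) :
    F.carrierVal (F.tauModule.frob x) = F.frobeniusMap 0 (F.carrierVal x) := by
  have h : ∀ n, F.carrierVal (F.tauModule.tau^[n] x) = (F.phiQ 0 ^ n) (F.carrierVal x) := by
    intro n
    induction n with
    | zero => rfl
    | succ n ih =>
      rw [Function.iterate_succ_apply', carrierVal_tau, ih, pow_succ']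
      rfl
  exact h _

instance : Module.Finite A F.tauModule.carrier := by
  let : Algebra A (AL Fq A Q L) := (AtoAL Fq A Q L).toAlgebra
  have : Module.Finite A (AL Fq A Q L) := AL.finite
  have : Module.Finite (AL Fq A Q L) F.tauModule.carrier := Module.Finite.iff_fg.2 (F.E 0).M_fg
  have : IsScalarTower A (AL Fq A Q L) F.tauModule.carrier := ⟨fun a z x => by
    rw [Algebra.smul_def, mul_smul]
    rfl⟩
  exact Module.Finite.trans (AL Fq A Q L) F.tauModule.carrier

theorem carrier_torsionFree (a : A) (x : F.tauModule.carrier) (h : a • x = 0) : a = 0 ∨ x = 0 := by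
  have h1 : algebraMap A Q a • F.carrierVal x = 0 := congrArg F.carrierVal h
  rw [smul_eq_zero, map_eq_zero_iff _ (IsFractionRing.injective A Q)] at h1
  exact h1.imp_right fun h2 => F.carrierVal_injective (h2.trans (map_zero _).symm)

theorem exists_tau_eq_of_mem_span (i : ℤ) (y : (F.E (i + 1)).V)
    (hy : y ∈ Submodule.span (AL Fq A Q L) (F.tau i '' (F.E i).M)) : ∃ x ∈ (F.E i).M, F.tau i x = y := by
  induction hy using Submodule.span_induction with
  | mem x hx => exact hx
  | zero => exact ⟨0, zero_mem _, map_zero _⟩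
  | add x y _ _ hx hy =>
    obtain ⟨x', hx', rfl⟩ := hx
    obtain ⟨y', hy', rfl⟩ := hy
    exact ⟨x' + y', add_mem hx' hy', map_add _ _ _⟩
  | smul z y _ hy =>
    obtain ⟨y', hy', rfl⟩ := hy
    obtain ⟨z', hz'⟩ := exists_sig_eq z
    refine ⟨z' • y', Submodule.smul_mem _ _ hy', ?_⟩
    refine ((F.tau i).map_smulₛₗ (z' : QL Fq Q L) y').trans ?_
    rw [hz']
    rfl

theorem exists_sub_tau_mem (v : IsDedekindDomain.HeightOneSpectrum A) (hv : c.NePlace v) (n : ℕ)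
    (x : F.tauModule.carrier) : ∃ y, x - F.tauModule.tau y ∈
      (v.asIdeal ^ n • ⊤ : Submodule A F.tauModule.carrier) := by
  have h1 : (1 : AL Fq A Q L) ∈ graphIdealAffine Q c ^ F.d ⊔ (v.asIdeal ^ n).map (AtoAL Fq A Q L) := by
    rw [graph_sup_eq_top c v hv]
    exact Submodule.mem_top
  obtain ⟨g, hg, u, hu, hgu⟩ := Submodule.mem_sup.1 h1
  obtain ⟨y', hy', hgy⟩ := F.exists_tau_eq_of_mem_span 0 (g • F.Pi 0 (F.carrierVal x))
    (F.graph_M 0 (Submodule.smul_mem_smul hg (F.Pi_M 0 _ x.2)))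
  obtain ⟨y, rfl⟩ : ∃ y : F.tauModule.carrier, F.carrierVal y = y' := ⟨⟨y', hy'⟩, rfl⟩
  refine ⟨y, ?_⟩
  have h2 : x - F.tauModule.tau y = u • x := by
    have h3 : g • x = F.tauModule.tau y := by
      refine F.carrierVal_injective (F.Pi_injective 0 ?_)
      rw [carrierVal_tau, Pi_phi]
      refine Eq.trans ?_ hgy.symm
      rw [map_smul]
      exact LinearMap.map_smul_of_tower (F.Pi 0) g _
    rw [← h3, sub_eq_iff_eq_add, ← add_smul, add_comm, hgu, one_smul]
  rw [h2]
  clear h2 hgu h1 hgy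
  induction hu using Submodule.span_induction generalizing x with
  | mem u hu =>
    obtain ⟨a, ha, rfl⟩ := hu
    exact Submodule.smul_mem_smul ha Submodule.mem_top
  | zero => rw [zero_smul]; exact zero_mem _
  | add u u' _ _ hu hu' => rw [add_smul]; exact add_mem (hu x) (hu' x)
  | smul z u _ hu => rw [smul_eq_mul, mul_comm, mul_smul]; exact hu (z • x)

theorem toASep_smul_tmul (z : AL Fq A Q L) (x : F.tauModule.carrier) (e : SeparableClosure L) :
    AL.toASep z • (x ⊗ₜ[L] e : F.tauModule.Msep) = (z • x) ⊗ₜ[L] e := by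
  induction z using AL.induction with
  | h0 => rw [map_zero, zero_smul, zero_smul, TensorProduct.zero_tmul]
  | hmk a l =>
    rw [AL.toASep_mul, asep_smul_def, sep_smul_tmul, ← Algebra.smul_def, ← TensorProduct.smul_tmul,
      mul_smul, LtoAL_smul, AtoAL_smul]
    rfl
  | hadd r s hr hs => rw [map_add, add_smul, hr, hs, add_smul, TensorProduct.add_tmul]

/-- The extension of a functional on `M(F)` to `M(F) ⊗ L^sep`. -/
def extendFunctional (μ : F.tauModule.carrier →ₗ[AL Fq A Q L] AL Fq A Q L) :
    F.tauModule.Msep →ₗ[ASep Fq A L] ASep Fq A L :=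
  let g : F.tauModule.Msep →+ ASep Fq A L :=
    TensorProduct.liftAddHom
      (AddMonoidHom.mk' (fun x => AddMonoidHom.mk' (fun e => AL.toASep (μ x) * ASep.mk 1 e)
        fun e e' => by
          rw [← mul_add]
          congr 1
          exact TensorProduct.tmul_add _ _ _)
        fun x y => AddMonoidHom.ext fun e => by
          change AL.toASep (μ (x + y)) * ASep.mk 1 e = _ * _ + _ * _
          rw [map_add, map_add, add_mul])
      fun l x e => by
        change AL.toASep (μ (l • x)) * ASep.mk 1 e = AL.toASep (μ x) * ASep.mk 1 (l • e)
        have h := AL.toASep_mul (Fq := Fq) (A := A) (Q := Q) 1 l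
        rw [map_one, one_mul] at h
        rw [← LtoAL_smul, map_smul, smul_eq_mul, map_mul, h, Algebra.smul_def,
          mul_comm (ASep.mk 1 _), mul_assoc, ASep.mk_mul_mk, one_mul]
  have hg : ∀ x e, g (x ⊗ₜ e) = AL.toASep (μ x) * ASep.mk 1 e := fun _ _ => rfl
  { toFun := g
    map_add' := map_add g
    map_smul' := fun r w => by
      induction r using ASep.induction with
      | h0 => rw [zero_smul, map_zero, map_zero, zero_smul]
      | hmk a e' =>
        induction w using TensorProduct.induction_on with
        | zero => rw [smul_zero, map_zero, smul_zero]
        | tmul x e =>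
          rw [asep_smul_def, sep_smul_tmul, TensorProduct.smul_tmul', hg, hg, ← AtoAL_smul, map_smul,
            smul_eq_mul, map_mul, AL.toASep_AtoAL, ASep.algebraMap_left, RingHom.id_apply, smul_eq_mul]
          have h1 : (ASep.mk a e' : ASep Fq A L) = ASep.mk a 1 * ASep.mk 1 e' := by
            rw [ASep.mk_mul_mk, one_mul, mul_one]
          have h2 : (ASep.mk 1 (e' * e) : ASep Fq A L) = ASep.mk 1 e' * ASep.mk 1 e := by
            rw [ASep.mk_mul_mk, one_mul]
          rw [h1, h2]
          ring
        | add x y hx hy => rw [smul_add, map_add, map_add, hx, hy, smul_add]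
      | hadd r s hr hs =>
        rw [add_smul, map_add, hr, hs, RingHom.id_apply, RingHom.id_apply, RingHom.id_apply, add_smul] }

theorem extendFunctional_tmul (μ : F.tauModule.carrier →ₗ[AL Fq A Q L] AL Fq A Q L)
    (x : F.tauModule.carrier) (e : SeparableClosure L) :
    F.extendFunctional μ (x ⊗ₜ e) = AL.toASep (μ x) * ASep.mk 1 e := rfl

end AbelianTauSheaf

end

section

open Module
open scoped TensorProduct

universe uA uL

section Lattice

variable {Fq A Q L : Type*} [Field Fq] [CommRing A] [Algebra Fq A] [Field Q]
  [Algebra Fq Q] [Algebra A Q] [IsScalarTower Fq A Q] [Field L] [Algebra Fq L]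

theorem exists_smul_repr_mem [IsDomain A] [IsFractionRing A Q] {V : Type*} [AddCommGroup V]
    [Module (QL Fq Q L) V] {κ : Type*} [Finite κ] (b : Basis κ (QL Fq Q L) V)
    (M : Submodule (AL Fq A Q L) V) (hM : M.FG) :
    ∃ a : A, a ≠ 0 ∧ ∀ x ∈ M, ∀ j,
      algebraMap Q (QL Fq Q L) (algebraMap A Q a) * b.repr x j ∈ AL Fq A Q L := by
  cases nonempty_fintype κ
  obtain ⟨s, rfl⟩ := hM
  choose a ha hmem using fun z : QL Fq Q L => exists_smul_mem_AL (A := A) z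
  refine ⟨∏ x ∈ s, ∏ j, a (b.repr x j), Finset.prod_ne_zero_iff.2 fun x _ =>
    Finset.prod_ne_zero_iff.2 fun j _ => ha _, fun x hx => ?_⟩
  induction hx using Submodule.span_induction with
  | mem x hx =>
    intro j
    have h1 : a (b.repr x j) ∣ ∏ x ∈ s, ∏ j, a (b.repr x j) :=
      (Finset.dvd_prod_of_mem (fun j => a (b.repr x j)) (Finset.mem_univ j)).trans
        (Finset.dvd_prod_of_mem (fun x => ∏ j, a (b.repr x j)) hx)
    obtain ⟨y, hy⟩ := h1
    rw [hy, mul_comm (a _), map_mul, map_mul, mul_assoc]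
    exact mul_mem (algebraMap_mem_AL L y) (hmem _)
  | zero => intro j; simp
  | add x y _ _ hx hy =>
    intro j
    rw [map_add, Finsupp.add_apply, mul_add]
    exact add_mem (hx j) (hy j)
  | smul z x _ hx =>
    intro j
    have h1 : b.repr (z • x) j = (z : QL Fq Q L) * b.repr x j := by
      have : z • x = (z : QL Fq Q L) • x := rfl
      rw [this, map_smul, Finsupp.smul_apply, smul_eq_mul]
    rw [h1, mul_left_comm]
    exact mul_mem z.2 (hx j)

end Lattice

namespace AbelianTauSheaf

variable {Fq Q : Type*} {A : Type uA} {L : Type uL}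
  [Field Fq] [Fintype Fq] [CommRing A] [Algebra Fq A]
  [Field Q] [Algebra Fq Q] [Algebra A Q] [IsScalarTower Fq A Q] [IsDedekindDomain A]
  [IsFractionRing A Q] [Field L] [Finite L] [Algebra Fq L]

theorem exists_basis_mem {inf : InftyPoint Fq A Q} {c : CharMap Fq A L}
    (F : AbelianTauSheaf.{w} inf c) (i : ℤ) : ∃ b : Basis (Fin F.r) (QL Fq Q L) (F.E i).V,
      ∀ j, b j ∈ (F.E i).M := by
  let := inf.fieldQL (L := L)
  obtain ⟨s, hs, hspan, hind⟩ := exists_linearIndependent (QL Fq Q L) ((F.E i).M : Set (F.E i).V)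
  obtain ⟨S, hS⟩ := (F.E i).M_fg
  have hfin : Module.Finite (QL Fq Q L) (F.E i).V := by
    refine Module.Finite.of_fg_top ⟨S, ?_⟩
    rw [eq_top_iff, ← (F.E i).span_M, Submodule.span_le, ← hS]
    exact Submodule.span_le_restrictScalars _ _ _
  let b := Basis.mk hind (by
    rw [Subtype.range_coe, hspan, (F.E i).span_M])
  have : Finite s := hind.finite
  have := Fintype.ofFinite s
  have hcard : Fintype.card s = F.r := by
    rw [← finrank_eq_card_basis b]
    exact F.rank_eq i
  refine ⟨b.reindex (Fintype.equivFinOfCardEq hcard), fun j => ?_⟩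
  rw [Basis.reindex_apply, Basis.mk_apply]
  exact hs (Subtype.coe_prop _)

variable [Algebra.FiniteType Fq A]

/-- Over a suitable field which contains `Q_v` and `Q_L`, the endomorphisms `π_v` and `π`
become conjugate. -/
theorem exists_comparison (v : IsDedekindDomain.HeightOneSpectrum A) :
    ∃ (B : Type (max uL uA)) (_ : Field B) (f : Qv A v →+* B) (j : QL Fq Q L →+* B),
      (∀ a : Q, f (algebraMap Q _ a) = j (algebraMap Q _ a)) ∧
      ∀ (inf : InftyPoint Fq A Q) (c : CharMap Fq A L) (F : AbelianTauSheaf.{w} inf c),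
        c.NePlace v → ∃ (bU : Basis (Fin F.r) (Qv A v) (F.V v))
          (b : Basis (Fin F.r) (QL Fq Q L) (F.E 0).V) (D D' : Matrix (Fin F.r) (Fin F.r) B),
          D * D' = 1 ∧ D' * D = 1 ∧
          (LinearMap.toMatrix bU bU (F.piV v)).map f * D =
            D * (LinearMap.toMatrix b b (F.frobeniusMap 0)).map j := by
  obtain ⟨B, _, f, g, hfg⟩ := exists_comparison_field (R := ASep Fq A L) v fun n a ha => by
    rw [← Ideal.mem_comap, Ideal.comap_map_eq_self_of_faithfullyFlat] at ha
    exact ha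
  let G : ASep Fq A L →+* B := g.comp (mkComp (ASep Fq A L) v.asIdeal)
  have hG : ∀ a : A, G (algebraMap A _ a) = f (algebraMap Q (Qv A v) (algebraMap A Q a)) := by
    intro a
    have h1 : algebraMap Q (Qv A v) (algebraMap A Q a) =
        algebraMap (Av A v) (Qv A v) (algebraMap A (Av A v) a) :=
      IsFractionRing.lift_algebraMap (toQv_injective A v) a
    rw [h1, hfg, toCompRing_algebraMap]
    rfl
  let : Algebra Fq B := ((f.comp (algebraMap Q (Qv A v))).comp (algebraMap Fq Q)).toAlgebra
  let jQ : Q →ₐ[Fq] B := { f.comp (algebraMap Q (Qv A v)) with commutes' := fun _ => rfl }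
  let jL : L →ₐ[Fq] B := 
    { G.comp ((algebraMap (SeparableClosure L) (ASep Fq A L)).comp
        (algebraMap L (SeparableClosure L))) with
      commutes' := fun e => by
        change G (algebraMap (SeparableClosure L) (ASep Fq A L)
          (algebraMap L (SeparableClosure L) (algebraMap Fq L e))) =
            f (algebraMap Q (Qv A v) (algebraMap Fq Q e))
        rw [IsScalarTower.algebraMap_apply Fq A Q, ← hG, ← IsScalarTower.algebraMap_apply Fq L,
          ← IsScalarTower.algebraMap_apply Fq (SeparableClosure L),
          ← IsScalarTower.algebraMap_apply Fq A] }
  let j : QL Fq Q L →+* B :=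
    (Algebra.TensorProduct.lift jQ jL fun _ _ => Commute.all _ _ : Q ⊗[Fq] L →ₐ[Fq] B).toRingHom
  have hj : ∀ a l, j (QL.mk Fq a l) = jQ a * jL l := fun a l =>
    Algebra.TensorProduct.lift_tmul _ _ _ _ _
  have hjQ : ∀ a, j (algebraMap Q _ a) = jQ a := fun a => by
    rw [QL.algebraMap_eq, hj, map_one, mul_one]
  have hjAL : ∀ z : AL Fq A Q L, j z = G (AL.toASep z) := by
    intro z
    induction z using AL.induction with
    | h0 => rw [map_zero, map_zero]; exact map_zero j
    | hmk a l =>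
      have h1 : ((AtoAL Fq A Q L a * LtoAL Fq A Q L l : AL Fq A Q L) : QL Fq Q L) =
        QL.mk Fq (algebraMap A Q a) l := (QL.mk_eq_mul _ _).symm
      have h2 : (ASep.mk a (algebraMap L (SeparableClosure L) l) : ASep Fq A L) =
        ASep.mk a 1 * ASep.mk 1 (algebraMap L (SeparableClosure L) l) := by
          rw [ASep.mk_mul_mk, one_mul, mul_one]
      rw [h1, hj, AL.toASep_mul, h2, map_mul, ← ASep.algebraMap_left, hG]
      rfl
    | hadd r s hr hs => rw [map_add, map_add, ← hr, ← hs]; exact map_add j _ _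
  refine ⟨B, inferInstance, f, j, fun a => (hjQ a).symm, fun inf c F hv => ?_⟩
  obtain ⟨m, t, ht, b, hb⟩ := exists_tateBasis_sep F.tauModule v F.carrier_torsionFree
    (F.exists_sub_tau_mem v hv)
  obtain ⟨bV, hbV⟩ := F.exists_basis_mem 0
  obtain ⟨a, ha, hmem⟩ := exists_smul_repr_mem bV (F.E 0).M (F.E 0).M_fg
  let bM : Fin F.r → F.tauModule.carrier := fun i => ⟨bV i, hbV i⟩
  let μ : Fin F.r → F.tauModule.carrier →ₗ[AL Fq A Q L] AL Fq A Q L := fun i =>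
    { toFun := fun x => ⟨_, hmem _ x.2 i⟩
      map_add' := fun x y => Subtype.ext (by
        change _ * bV.repr (F.carrierVal (x + y)) i = _ * bV.repr (F.carrierVal x) i +
          _ * bV.repr (F.carrierVal y) i
        rw [map_add, map_add, Finsupp.add_apply, mul_add])
      map_smul' := fun z x => Subtype.ext (by
        change _ * bV.repr ((z : QL Fq Q L) • F.carrierVal x) i =
          (z : QL Fq Q L) * (_ * bV.repr (F.carrierVal x) i)
        rw [map_smul, Finsupp.smul_apply, smul_eq_mul, mul_left_comm]) }
  have hμval : ∀ i x, ((μ i x : AL Fq A Q L) : QL Fq Q L) =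
    algebraMap Q (QL Fq Q L) (algebraMap A Q a) * bV.repr (F.carrierVal x) i := fun _ _ => rfl
  have hbM : ∀ i, F.carrierVal (bM i) = bV i := fun _ => rfl
  have hμb : ∀ i l, μ i (bM l) = if i = l then AtoAL Fq A Q L a else 0 := by
    intro i l
    refine Subtype.ext ?_
    rw [hμval, hbM, Basis.repr_self, Finsupp.single_apply]
    by_cases h : i = l
    · rw [if_pos h.symm, if_pos h, mul_one]
      rfl
    · rw [if_neg (Ne.symm h), if_neg h, mul_zero]
      rfl
  have hsum : ∀ x, ∑ i, μ i x • bM i = a • x := by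
    intro x
    refine F.carrierVal_injective ?_
    rw [map_sum, ← AtoAL_smul, map_smul]
    change _ = algebraMap Q (QL Fq Q L) (algebraMap A Q a) • F.carrierVal x
    conv_rhs => rw [← bV.sum_repr (F.carrierVal x)]
    rw [Finset.smul_sum]
    refine Finset.sum_congr rfl fun i _ => ?_
    rw [map_smul, smul_smul, hbM]
    rfl
  obtain ⟨D, E, hDE, hED, hX⟩ := ht.exists_matrices F.tauModule.tauSep b hb
    (frobSepR F.tauModule) ((AdicCompletion.map v.asIdeal F.tauModule.frobSepM).restrict
      (F.tauModule.map_mem_Tate v F.tauModule.tauSep_frobSepM)) (fun x => rfl)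
    (fun i => bM i ⊗ₜ[L] (1 : SeparableClosure L)) (fun i => F.extendFunctional (μ i)) a
    (fun i l => by
      rw [extendFunctional_tmul, hμb]
      have h1 : (ASep.mk 1 1 : ASep Fq A L) = 1 := rfl
      rw [h1, mul_one]
      split_ifs
      · exact AL.toASep_AtoAL a
      · exact map_zero _)
    (fun w => by
      induction w using TensorProduct.induction_on with
      | zero => simp
      | tmul x e =>
        rw [TensorProduct.smul_tmul', ← hsum, TensorProduct.sum_tmul]
        refine Finset.sum_congr rfl fun i _ => ?_
        rw [extendFunctional_tmul, mul_smul, asep_smul_def, one_smul, sep_smul_tmul, mul_one,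
          toASep_smul_tmul]
      | add x y hx hy =>
        rw [smul_add, hx, hy, ← Finset.sum_add_distrib]
        refine Finset.sum_congr rfl fun i _ => ?_
        rw [map_add, add_smul])
  have ha0 : G (algebraMap A _ a) ≠ 0 := by
    rw [hG]
    exact (map_ne_zero_iff _ (f.comp (algebraMap Q (Qv A v))).injective).2
      ((map_ne_zero_iff _ (IsFractionRing.injective A Q)).2 ha)
  set α := G (algebraMap A _ a) with hα
  let X := LinearMap.toMatrix b b ((AdicCompletion.map v.asIdeal F.tauModule.frobSepM).restrict
      (F.tauModule.map_mem_Tate v F.tauModule.tauSep_frobSepM))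
  have h1 : D.map g * E.map g = α • 1 := by
    rw [← Matrix.map_mul, hDE]
    ext i i'
    rw [Matrix.map_apply, Matrix.smul_apply, Matrix.smul_apply, smul_eq_mul, map_mul,
      Matrix.one_apply, Matrix.one_apply]
    split_ifs <;> simp [hα, G]
  have h2 : E.map g * D.map g = α • 1 := by
    rw [← Matrix.map_mul, hED]
    ext i i'
    rw [Matrix.map_apply, Matrix.smul_apply, Matrix.smul_apply, smul_eq_mul, map_mul,
      Matrix.one_apply, Matrix.one_apply]
    split_ifs <;> simp [hα, G]
  have h1' : D.map g * (α⁻¹ • E.map g) = 1 := by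
    rw [Matrix.mul_smul, h1, smul_smul, inv_mul_cancel₀ ha0, one_smul]
  have h2' : (α⁻¹ • E.map g) * D.map g = 1 := by
    rw [Matrix.smul_mul, h2, smul_smul, inv_mul_cancel₀ ha0, one_smul]
  have hm : m = F.r := by
    simpa using Matrix.square_of_invertible _ _ h1' h2'
  subst hm
  refine ⟨Algebra.TensorProduct.basis (Qv A v) b, bV, D.map g, α⁻¹ • E.map g, h1', h2', ?_⟩
  have hXf : (LinearMap.toMatrix (Algebra.TensorProduct.basis (Qv A v) b)
      (Algebra.TensorProduct.basis (Qv A v) b) (F.piV v)).map f =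
      (X.map (toCompRing (ASep Fq A L) v.asIdeal)).map g := by
    rw [piV, TauModule.frobRatTate, LinearMap.toMatrix_baseChange]
    ext i i'
    exact hfg _
  have hY : ((Matrix.of fun l i => F.extendFunctional (μ l)
      (frobSepR F.tauModule (bM i ⊗ₜ[L] (1 : SeparableClosure L)))).map
        (mkComp (ASep Fq A L) v.asIdeal)).map g =
      α • (LinearMap.toMatrix bV bV (F.frobeniusMap 0)).map j := by
    ext l i
    rw [Matrix.map_apply, Matrix.map_apply, Matrix.of_apply, Matrix.smul_apply, Matrix.map_apply,
      LinearMap.toMatrix_apply, smul_eq_mul]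
    have h3 : frobSepR F.tauModule (bM i ⊗ₜ[L] (1 : SeparableClosure L)) =
      F.tauModule.frob (bM i) ⊗ₜ[L] (1 : SeparableClosure L) := rfl
    have h4 : (ASep.mk 1 1 : ASep Fq A L) = 1 := rfl
    rw [h3, extendFunctional_tmul, h4, mul_one]
    refine (hjAL _).symm.trans ?_
    rw [hμval, map_mul, hjQ, carrierVal_frob, hbM, hα, hG]
    rfl
  have h5 := congrArg (fun N => N.map g) hX
  rw [Matrix.map_mul, hY, Matrix.mul_smul] at h5
  rw [hXf]
  refine smul_right_injective _ ha0 (Eq.trans ?_ h5)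
  ext i i'
  change α * _ = _
  rw [Matrix.map_apply, Matrix.smul_apply, smul_eq_mul, map_mul, ← Matrix.map_mul]
  rfl

end AbelianTauSheaf

end

section

open Module Polynomial
open scoped TensorProduct

theorem infinite_of_heightOneSpectrum {A : Type*} [CommRing A] [IsDedekindDomain A]
    (v : IsDedekindDomain.HeightOneSpectrum A) : Infinite A := by
  by_contra h
  rw [not_infinite_iff_finite] at h
  have hf := Finite.isField_of_domain A
  let := hf.toField
  exact (Ideal.eq_bot_or_top v.asIdeal).elim v.ne_bot v.isPrime.ne_top

theorem infinite_fractionField {A : Type*} (Q : Type*) [CommRing A] [IsDedekindDomain A] [Field Q]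
    [Algebra A Q] [IsFractionRing A Q] (v : IsDedekindDomain.HeightOneSpectrum A) : Infinite Q :=
  have := infinite_of_heightOneSpectrum v
  Infinite.of_injective _ (IsFractionRing.injective A Q)

theorem infinite_Qv {A : Type*} [CommRing A] [IsDedekindDomain A]
    (v : IsDedekindDomain.HeightOneSpectrum A) : Infinite (Qv A v) :=
  have := infinite_of_heightOneSpectrum v
  Infinite.of_injective _ (toQv_injective A v)

theorem aeval_eq_zero_iff_of_conj {Q K K₁ B n V U : Type*} [Field Q] [Field K] [Field K₁] [Field B]
    [Algebra Q K] [Algebra Q K₁] [AddCommGroup V] [Module K V] [AddCommGroup U] [Module K₁ U]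
    [Fintype n] [DecidableEq n] (f : K₁ →+* B) (j : K →+* B)
    (hfj : ∀ a : Q, f (algebraMap Q K₁ a) = j (algebraMap Q K a))
    (bU : Basis n K₁ U) (b : Basis n K V) (g : End K₁ U) (π : End K V) (D D' : Matrix n n B)
    (hD : D * D' = 1) (hD' : D' * D = 1)
    (h : (LinearMap.toMatrix bU bU g).map f * D = D * (LinearMap.toMatrix b b π).map j) (p : Q[X]) :
    aeval g (p.map (algebraMap Q K₁)) = 0 ↔ aeval π (p.map (algebraMap Q K)) = 0 := by
  set X := (LinearMap.toMatrix bU bU g).map f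
  set Y := (LinearMap.toMatrix b b π).map j
  have hpow : ∀ n, X ^ n * D = D * Y ^ n := by
    intro n
    induction n with
    | zero => simp
    | succ n ih => rw [pow_succ, pow_succ, mul_assoc, h, ← mul_assoc, ih, mul_assoc]
  have hq' : (LinearMap.toMatrix bU bU (aeval g (p.map (algebraMap Q K₁)))).map f * D =
      D * (LinearMap.toMatrix b b (aeval π (p.map (algebraMap Q K)))).map j := by
    induction p using Polynomial.induction_on' with
    | add p q hp hq =>
      simp only [Polynomial.map_add, map_add, Matrix.map_add _ (map_add f),
        Matrix.map_add _ (map_add j), add_mul, mul_add, hp, hq]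
    | monomial m a =>
      have h1 : (LinearMap.toMatrix bU bU (aeval g ((monomial m a).map (algebraMap Q K₁)))).map f =
          f (algebraMap Q K₁ a) • X ^ m := by
        rw [Polynomial.map_monomial, aeval_monomial, ← Algebra.smul_def, map_smul,
          ← LinearMap.toMatrix_pow, Matrix.map_smul' f _ _ (map_mul f)]
        exact congrArg _ (map_pow f.mapMatrix _ _)
      have h2 : (LinearMap.toMatrix b b (aeval π ((monomial m a).map (algebraMap Q K)))).map j =
          j (algebraMap Q K a) • Y ^ m := by
        rw [Polynomial.map_monomial, aeval_monomial, ← Algebra.smul_def, map_smul,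
          ← LinearMap.toMatrix_pow, Matrix.map_smul' j _ _ (map_mul j)]
        exact congrArg _ (map_pow j.mapMatrix _ _)
      rw [h1, h2, hfj, Matrix.smul_mul, Matrix.mul_smul, hpow]
  have e1 : aeval g (p.map (algebraMap Q K₁)) = 0 ↔
      (LinearMap.toMatrix bU bU (aeval g (p.map (algebraMap Q K₁)))).map f = 0 := by
    rw [← (LinearMap.toMatrix bU bU).map_eq_zero_iff, ← (Matrix.map_injective f.injective).eq_iff,
      Matrix.map_zero _ (map_zero f)]
  have e2 : aeval π (p.map (algebraMap Q K)) = 0 ↔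
      (LinearMap.toMatrix b b (aeval π (p.map (algebraMap Q K)))).map j = 0 := by
    rw [← (LinearMap.toMatrix b b).map_eq_zero_iff, ← (Matrix.map_injective j.injective).eq_iff,
      Matrix.map_zero _ (map_zero j)]
  rw [e1, e2]
  constructor
  · intro h0
    rw [h0, zero_mul] at hq'
    rw [← one_mul (Matrix.map _ _), ← hD', mul_assoc, ← hq', mul_zero]
  · intro h0
    rw [h0, mul_zero] at hq'
    rw [← mul_one (Matrix.map _ _), ← hD, ← mul_assoc, hq', zero_mul]

section Conj

variable {B n m : Type*} [Field B] [Fintype n] [DecidableEq n] [Fintype m] [DecidableEq m]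

theorem conj_symm {X Y D E : Matrix n n B} (hD : D * E = 1) (h : X * D = D * Y) :
    Y * E = E * X := by
  rw [← mul_one (E * X), ← hD, ← mul_assoc, mul_assoc E, h, ← mul_assoc, mul_eq_one_comm.1 hD,
    one_mul]

theorem intertwine_conj {X D E Y : Matrix n n B} {X' D' E' Y' : Matrix m m B} (hD : D * E = 1)
    (h : X * D = D * Y) (hE' : E' * D' = 1) (h' : X' * D' = D' * Y')
    (Z : Matrix m n B) (hZ : X' * Z = Z * X) (R : Matrix n m B) (hR : Z * R = 1) :
    Y' * (E' * Z * D) = E' * Z * D * Y ∧ IsUnit (E' * Z * D * (E * R * D')).det := by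
  have hD' : D' * E' = 1 := mul_eq_one_comm.1 hE'
  have h1 : Y' * E' = E' * X' := conj_symm hD' h'
  constructor
  · rw [Matrix.mul_assoc, Matrix.mul_assoc, Matrix.mul_assoc, ← h,
      ← Matrix.mul_assoc Z, ← hZ, ← Matrix.mul_assoc Y', h1]
    simp only [Matrix.mul_assoc]
  · have h2 : E' * Z * D * (E * R * D') = 1 := by
      calc _ = E' * (Z * (D * E) * R) * D' := by simp only [Matrix.mul_assoc]
        _ = 1 := by rw [hD, Matrix.mul_one, hR, Matrix.mul_one, hE']
    rw [h2, Matrix.det_one]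
    exact isUnit_one

theorem exists_surjective_iff_of_conj {Q K K₁ V V' U U' : Type*} [Field Q] [Infinite Q]
    [Field K] [Field K₁] [Infinite K₁] [Algebra Q K] [AddCommGroup V] [Module K V]
    [FiniteDimensional K V] [AddCommGroup V'] [Module K V'] [FiniteDimensional K V']
    [AddCommGroup U] [Module K₁ U] [AddCommGroup U'] [Module K₁ U']
    (f : K₁ →+* B) (j : K →+* B) {σ : K →+* K} {e : ℕ} (hK : CyclicExt Q σ e)
    (φ : V →ₛₗ[σ] V) (hφ : Function.Injective φ) (π : End K V) (hπ : ∀ x, π x = φ^[e] x)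
    (φ' : V' →ₛₗ[σ] V') (π' : End K V') (hπ' : ∀ x, π' x = φ'^[e] x)
    (g : End K₁ U) (g' : End K₁ U')
    (bU : Basis n K₁ U) (b : Basis n K V) (bU' : Basis m K₁ U') (b' : Basis m K V')
    {D E : Matrix n n B} (hD : D * E = 1)
    (h : (LinearMap.toMatrix bU bU g).map f * D = D * (LinearMap.toMatrix b b π).map j)
    {D' E' : Matrix m m B} (hD' : D' * E' = 1)
    (h' : (LinearMap.toMatrix bU' bU' g').map f * D' = D' * (LinearMap.toMatrix b' b' π').map j) :
    (∃ s : U →ₗ[K₁] U', (∀ x, s (g x) = g' (s x)) ∧ Function.Surjective s) ↔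
      ∃ s : V →ₗ[K] V', (∀ x, s (φ x) = φ' (s x)) ∧ Function.Surjective s := by
  let : Algebra K₁ B := f.toAlgebra
  let : Algebra K B := j.toAlgebra
  have hE : E * D = 1 := mul_eq_one_comm.1 hD
  have hE' : E' * D' = 1 := mul_eq_one_comm.1 hD'
  constructor
  · rintro ⟨s, hs, hsurj⟩
    obtain ⟨R, hR⟩ := exists_right_inverse_toMatrix bU bU' s hsurj
    have h1 := (toMatrix_intertwine bU bU' _ _ s).2 hs
    obtain ⟨h2, h3⟩ := intertwine_conj hD h hE' h' ((LinearMap.toMatrix bU bU' s).map f)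
      (by rw [← Matrix.map_mul, ← Matrix.map_mul, h1]) (R.map f)
      (by rw [← Matrix.map_mul, hR, Matrix.map_one _ (map_zero f) (map_one f)])
    exact exists_surjective_phiHom_of_matrix (B := B) hK φ hφ π hπ φ' π' hπ' b b' _ _ h2 h3
  · rintro ⟨s, hs, hsurj⟩
    obtain ⟨R, hR⟩ := exists_right_inverse_toMatrix b b' s hsurj
    have h1 := (toMatrix_intertwine b b' π π' s).2 fun x => by rw [hπ, hπ', commute_iterate hs]
    obtain ⟨h2, h3⟩ := intertwine_conj hE (conj_symm hD h) hD' (conj_symm hD' h')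
      ((LinearMap.toMatrix b b' s).map j)
      (by rw [← Matrix.map_mul, ← Matrix.map_mul, h1]) (R.map j)
      (by rw [← Matrix.map_mul, hR, Matrix.map_one _ (map_zero j) (map_one j)])
    exact exists_surjective_of_matrix (B := B) bU bU' g g' _ _ h2 h3

end Conj

namespace AbelianTauSheaf

section

variable {Fq A Q L : Type*} 
  [Field Fq] [Fintype Fq] [CommRing A] [Algebra Fq A] [Algebra.FiniteType Fq A]
  [Field Q] [Algebra Fq Q] [Algebra A Q] [IsScalarTower Fq A Q] [IsDedekindDomain A]
  [IsFractionRing A Q] [Field L] [Finite L] [Algebra Fq L]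
  {inf : InftyPoint Fq A Q} {c : CharMap Fq A L}
  (F F' : AbelianTauSheaf.{w} inf c) (v : IsDedekindDomain.HeightOneSpectrum A)

/-- There is a surjective homomorphism between the generic fibres compatible with `Π⁻¹ ∘ τ`. -/
def PhiSurj : Prop :=
  ∃ g : (F.E 0).V →ₗ[QL Fq Q L] (F'.E 0).V,
    (∀ x, g (F.phi 0 x) = F'.phi 0 (g x)) ∧ Function.Surjective g

/-- There is a surjective homomorphism `V_v F → V_v F'` compatible with the Frobenius. -/
def TateSurj : Prop :=
  ∃ h : F.V v →ₗ[Qv A v] F'.V v,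
    (∀ x, h (F.piV v x) = F'.piV v (h x)) ∧ Function.Surjective h

theorem frobeniusMap_apply (i : ℤ) (x : (F.E i).V) :
    F.frobeniusMap i x = (F.phi i)^[finrank Fq L] x := by
  have h : ∀ n, (F.phiQ i ^ n) x = (F.phi i)^[n] x := by
    intro n
    induction n with
    | zero => rfl
    | succ n ih =>
      rw [pow_succ', Module.End.mul_apply, ih, Function.iterate_succ_apply']
      rfl
  exact h _

theorem phi_injective (i : ℤ) : Function.Injective (F.phi i) := fun x y h =>
  F.tau_injective i (by rw [← Pi_phi, ← Pi_phi, h])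

instance finite_E (i : ℤ) : Module.Finite (QL Fq Q L) (F.E i).V :=
  (F.exists_basis_mem i).elim fun b _ => Module.Finite.of_basis b

theorem finite_V (hv : c.NePlace v) : Module.Finite (Qv A v) (F.V v) := by
  obtain ⟨B, _, f, j, hfj, hcomp⟩ := exists_comparison (Fq := Fq) (Q := Q) (L := L) v
  obtain ⟨bU, -⟩ := hcomp inf c F hv
  exact Module.Finite.of_basis bU

theorem finrank_V (hv : c.NePlace v) : finrank (Qv A v) (F.V v) = F.r := by
  obtain ⟨B, _, f, j, hfj, hcomp⟩ := exists_comparison (Fq := Fq) (Q := Q) (L := L) v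
  obtain ⟨bU, -⟩ := hcomp inf c F hv
  rw [finrank_eq_card_basis bU, Fintype.card_fin]

theorem chi_eq (hv : c.NePlace v) :
    have := F.finite_V v hv
    F.chi v = (F.piV v).charpoly :=
  dif_pos (F.finite_V v hv)

theorem aeval_piV_eq_zero_iff (hv : c.NePlace v) (p : Q[X]) :
    aeval (F.piV v) (p.map (algebraMap Q (Qv A v))) = 0 ↔ aeval (F.frobeniusMap 0) p = 0 := by
  let := inf.fieldQL (L := L)
  obtain ⟨B, _, f, j, hfj, hcomp⟩ := exists_comparison (Fq := Fq) (Q := Q) (L := L) v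
  obtain ⟨bU, b, D, D', hD, hD', h⟩ := hcomp inf c F hv
  rw [aeval_eq_zero_iff_of_conj f j hfj bU b _ _ D D' hD hD' h, aeval_map_algebraMap]

theorem tateSurj_iff_phiSurj (hv : c.NePlace v) : F.TateSurj F' v ↔ F.PhiSurj F' := by
  let := inf.fieldQL (L := L)
  have := infinite_fractionField Q v
  have := infinite_Qv v
  obtain ⟨B, _, f, j, hfj, hcomp⟩ := exists_comparison (Fq := Fq) (Q := Q) (L := L) v
  obtain ⟨bU, b, D, E, hD, hE, h⟩ := hcomp inf c F hv
  obtain ⟨bU', b', D', E', hD', hE', h'⟩ := hcomp inf c F' hv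
  exact exists_surjective_iff_of_conj f j inf.cyclicExt (F.phi 0) (F.phi_injective 0)
    (F.frobeniusMap 0) (F.frobeniusMap_apply 0) (F'.phi 0) (F'.frobeniusMap 0)
    (F'.frobeniusMap_apply 0) (F.piV v) (F'.piV v) bU b bU' b' hD h hD' h'

end

end AbelianTauSheaf

end

section

open Module
open scoped TensorProduct

section Integrality

variable {R K T T' : Type*} [CommRing R] [IsDomain R] [Field K] [Algebra R K] [IsFractionRing R K]
  [AddCommGroup T] [Module R T] [AddCommGroup T'] [Module R T']

theorem exists_smul_eq_one_tmul (z : K ⊗[R] T) : ∃ a : R, a ≠ 0 ∧ ∃ t, a • z = 1 ⊗ₜ t := by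
  induction z using TensorProduct.induction_on with
  | zero => exact ⟨1, one_ne_zero, 0, by simp⟩
  | tmul q t =>
    obtain ⟨x, y, hy, rfl⟩ := IsFractionRing.div_surjective (A := R) q
    have hy0 : algebraMap R K y ≠ 0 :=
      (map_ne_zero_iff _ (IsFractionRing.injective R K)).2 (nonZeroDivisors.ne_zero hy)
    refine ⟨y, nonZeroDivisors.ne_zero hy, x • t, ?_⟩
    rw [TensorProduct.smul_tmul', Algebra.smul_def, mul_div_cancel₀ _ hy0, ← TensorProduct.smul_tmul,
      Algebra.smul_def, mul_one]
  | add z w hz hw =>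
    obtain ⟨a, ha, t, hat⟩ := hz
    obtain ⟨b, hb, u, hbu⟩ := hw
    refine ⟨a * b, mul_ne_zero ha hb, b • t + a • u, ?_⟩
    rw [smul_add, mul_comm a, mul_smul, hat, mul_comm b, mul_smul, hbu, TensorProduct.tmul_add,
      TensorProduct.tmul_smul, TensorProduct.tmul_smul]

theorem one_tmul_injective {ι : Type*} (b : Basis ι R T) :
    Function.Injective fun t : T => (1 : K) ⊗ₜ[R] t := by
  intro t u h
  refine b.ext_elem fun i => IsFractionRing.injective R K ?_
  have h1 := congrArg (fun z => (Algebra.TensorProduct.basis K b).repr z i) h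
  simpa using h1

theorem exists_integral_hom {ι : Type*} [Finite ι] (b : Basis ι R T)
    (h : K ⊗[R] T →ₗ[K] K ⊗[R] T') :
    ∃ (a : R) (h₀ : T →ₗ[R] T'), a ≠ 0 ∧ ∀ x, a • h (1 ⊗ₜ x) = 1 ⊗ₜ h₀ x := by
  classical
  cases nonempty_fintype ι
  choose a ha t hat using fun i => exists_smul_eq_one_tmul (h (1 ⊗ₜ b i))
  refine ⟨∏ i, a i, b.constr R fun i => (∏ j ∈ Finset.univ.erase i, a j) • t i,
    Finset.prod_ne_zero_iff.2 fun i _ => ha i, fun x => ?_⟩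
  have key : (∏ i, a i) • (h.restrictScalars R ∘ₗ TensorProduct.mk R K T 1) =
      TensorProduct.mk R K T' 1 ∘ₗ b.constr R fun i => (∏ j ∈ Finset.univ.erase i, a j) • t i := by
    refine b.ext fun i => ?_
    change (∏ i, a i) • h (1 ⊗ₜ b i) = 1 ⊗ₜ (b.constr R _ (b i))
    rw [b.constr_basis, ← Finset.prod_erase_mul _ _ (Finset.mem_univ i), mul_smul, hat,
      TensorProduct.tmul_smul]
  exact LinearMap.congr_fun key x

end Integrality

theorem exists_quotient_iff {K U U' G : Type*} [Field K] [AddCommGroup U] [Module K U]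
    [AddCommGroup U'] [Module K U'] (a : G → End K U) (a' : G → End K U') :
    (∃ (W : Submodule K U) (hW : ∀ g, W ≤ W.comap (a g)) (e : U' ≃ₗ[K] (U ⧸ W)),
      ∀ g x, e (a' g x) = W.mapQ W (a g) (hW g) (e x)) ↔
    ∃ h : U →ₗ[K] U', (∀ g x, h (a g x) = a' g (h x)) ∧ Function.Surjective h := by
  constructor
  · rintro ⟨W, hW, e, he⟩
    refine ⟨e.symm.toLinearMap ∘ₗ W.mkQ, fun g x => ?_, e.symm.surjective.comp W.mkQ_surjective⟩
    refine e.injective ?_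
    rw [LinearMap.comp_apply, LinearEquiv.coe_coe, LinearEquiv.apply_symm_apply, he,
      LinearMap.comp_apply, LinearEquiv.coe_coe, LinearEquiv.apply_symm_apply]
    rfl
  · rintro ⟨h, hg, hs⟩
    have hW : ∀ g, LinearMap.ker h ≤ (LinearMap.ker h).comap (a g) := fun g x hx => by
      rw [Submodule.mem_comap, LinearMap.mem_ker, hg, LinearMap.mem_ker.1 hx, map_zero]
    refine ⟨LinearMap.ker h, hW, (h.quotKerEquivOfSurjective hs).symm, fun g x => ?_⟩
    obtain ⟨y, rfl⟩ := hs x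
    rw [← hg, LinearMap.quotKerEquivOfSurjective_symm_apply,
      LinearMap.quotKerEquivOfSurjective_symm_apply, Submodule.mapQ_apply]

section Galois

variable {Fq A L : Type*} [Field Fq] [Fintype Fq] [CommRing A] [Field L] [Algebra Fq L]

/-- The Frobenius element of the Galois group of a finite field. -/
def galFrob (L : Type*) [Field L] [Finite L] : SeparableClosure L ≃ₐ[L] SeparableClosure L :=
  have := Fintype.ofFinite L
  FiniteField.frobeniusAlgEquivOfAlgebraic L (SeparableClosure L)

theorem galFrob_apply [Finite L] (c : SeparableClosure L) :
    galFrob L c = c ^ (Fintype.card Fq ^ finrank Fq L) := by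
  have := Fintype.ofFinite L
  rw [← Module.card_eq_pow_finrank (K := Fq) (V := L), galFrob,
    FiniteField.coe_frobeniusAlgEquivOfAlgebraic]
  congr!

theorem exists_galFrob_pow_eq [Finite L] (S : Finset (SeparableClosure L))
    (g : SeparableClosure L ≃ₐ[L] SeparableClosure L) :
    ∃ k : ℕ, ∀ c ∈ S, g c = (galFrob L ^ k) c := by
  have := Fintype.ofFinite L
  let E := IntermediateField.adjoin L (S : Set (SeparableClosure L))
  have hfin : FiniteDimensional L E := IntermediateField.finiteDimensional_adjoin fun x _ =>
    Algebra.IsIntegral.isIntegral x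
  have : Finite E := Module.finite_of_finite L
  obtain ⟨k, hk⟩ := (FiniteField.bijective_frobeniusAlgEquivOfAlgebraic_pow L E).2 (g.restrictNormal E)
  refine ⟨k, fun c hc => ?_⟩
  have h1 := AlgEquiv.restrictNormal_commutes g E ⟨c, IntermediateField.subset_adjoin L _ hc⟩
  refine h1.symm.trans ?_
  rw [← hk]
  change algebraMap E _ ((FiniteField.frobeniusAlgEquivOfAlgebraic L E ^ (k : ℕ)) _) = _
  rw [AlgEquiv.coe_pow, AlgEquiv.coe_pow, FiniteField.coe_frobeniusAlgEquivOfAlgebraic_iterate,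
    galFrob, FiniteField.coe_frobeniusAlgEquivOfAlgebraic_iterate]
  change algebraMap E (SeparableClosure L) (_ ^ _) = _
  rw [map_pow]
  congr!

namespace TauModule

variable (M : TauModule.{w} Fq A L)

theorem exists_finset_galSep (w : M.Msep) : ∃ S : Finset (SeparableClosure L),
    ∀ g g' : SeparableClosure L ≃ₐ[L] SeparableClosure L, (∀ c ∈ S, g c = g' c) →
      M.galSep g w = M.galSep g' w := by
  classical
  induction w using TensorProduct.induction_on with
  | zero => exact ⟨∅, fun g g' _ => by rw [map_zero, map_zero]⟩
  | tmul x c =>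
    refine ⟨{c}, fun g g' h => ?_⟩
    change x ⊗ₜ[L] g c = x ⊗ₜ[L] g' c
    rw [h c (Finset.mem_singleton_self c)]
  | add x y hx hy =>
    obtain ⟨S, hS⟩ := hx
    obtain ⟨S', hS'⟩ := hy
    refine ⟨S ∪ S', fun g g' h => ?_⟩
    rw [map_add, map_add, hS g g' fun c hc => h c (Finset.mem_union_left _ hc),
      hS' g g' fun c hc => h c (Finset.mem_union_right _ hc)]

theorem galSep_mul (g g' : SeparableClosure L ≃ₐ[L] SeparableClosure L) :
    M.galSep (g * g') = M.galSep g ∘ₗ M.galSep g' := by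
  ext w
  induction w using TensorProduct.induction_on with
  | zero => simp
  | tmul x c => rfl
  | add x y hx hy => rw [map_add, map_add, hx, hy]

theorem galSep_one : M.galSep 1 = LinearMap.id := by
  ext w
  induction w using TensorProduct.induction_on with
  | zero => simp
  | tmul x c => rfl
  | add x y hx hy => rw [map_add, map_add, hx, hy]

theorem galSep_frobSepM [Finite L] (g : SeparableClosure L ≃ₐ[L] SeparableClosure L) :
    M.galSep g ∘ₗ M.frobSepM = M.frobSepM ∘ₗ M.galSep g := by
  ext w
  induction w using TensorProduct.induction_on with
  | zero => simp
  | tmul x c => rfl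
  | add x y hx hy => rw [map_add, map_add, hx, hy]

theorem galSep_galFrob [Finite L] (w : M.Msep) :
    M.galSep (galFrob L) (M.frobSepM w) = M.tauSep^[finrank Fq L] w := by
  induction w using TensorProduct.induction_on with
  | zero => rw [map_zero, map_zero, iterate_map_zero]
  | tmul x c =>
    have h : ∀ n, M.tauSep^[n] (x ⊗ₜ[L] c) = M.tau^[n] x ⊗ₜ[L] (c ^ Fintype.card Fq ^ n) := by
      intro n
      induction n with
      | zero => simp
      | succ n ih =>
        rw [Function.iterate_succ_apply', ih, Function.iterate_succ_apply', pow_succ, pow_mul]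
        rfl
    rw [h, ← galFrob_apply]
    rfl
  | add x y hx hy => rw [map_add, map_add, hx, hy, iterate_map_add]

variable (v : IsDedekindDomain.HeightOneSpectrum A)

/-- The action of the Galois group on the Tate module. -/
def galTate (g : SeparableClosure L ≃ₐ[L] SeparableClosure L) : End (Av A v) (M.Tate v) :=
  (AdicCompletion.map v.asIdeal (M.galSep g)).restrict (M.map_mem_Tate v (M.tauSep_galSep g))

/-- The Frobenius endomorphism of the Tate module. -/
def frobTate [Finite L] : End (Av A v) (M.Tate v) :=
  (AdicCompletion.map v.asIdeal M.frobSepM).restrict (M.map_mem_Tate v M.tauSep_frobSepM)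

theorem galTate_mul (g g' : SeparableClosure L ≃ₐ[L] SeparableClosure L) :
    M.galTate v (g * g') = M.galTate v g * M.galTate v g' := by
  refine LinearMap.ext fun x => Subtype.ext ?_
  change AdicCompletion.map v.asIdeal (M.galSep (g * g')) x =
    AdicCompletion.map v.asIdeal (M.galSep g) (AdicCompletion.map v.asIdeal (M.galSep g') x)
  rw [galSep_mul, AdicCompletion.map_comp_apply]

theorem galTate_pow (g : SeparableClosure L ≃ₐ[L] SeparableClosure L) (n : ℕ) :
    M.galTate v (g ^ n) = M.galTate v g ^ n := by
  induction n with
  | zero =>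
    refine LinearMap.ext fun x => Subtype.ext ?_
    change AdicCompletion.map v.asIdeal (M.galSep 1) x = x
    rw [galSep_one, AdicCompletion.map_id]
    rfl
  | succ n ih => rw [pow_succ, galTate_mul, ih, pow_succ]

theorem galTate_galFrob_mul [Finite L] : M.galTate v (galFrob L) * M.frobTate v = 1 := by
  refine LinearMap.ext fun x => Subtype.ext ?_
  have hx : AdicCompletion.map v.asIdeal M.tauSep x = x := x.2
  have hit : ∀ n, AdicCompletion.map v.asIdeal (M.tauSep ^ n) x = x := by
    intro n
    induction n with
    | zero => exact LinearMap.congr_fun (AdicCompletion.map_id v.asIdeal _) _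
    | succ n ih =>
      rw [pow_succ, Module.End.mul_eq_comp, ← AdicCompletion.map_comp_apply, hx, ih]
  change AdicCompletion.map v.asIdeal (M.galSep (galFrob L))
    (AdicCompletion.map v.asIdeal M.frobSepM x) = x
  have h1 : M.galSep (galFrob L) ∘ₗ M.frobSepM = M.tauSep ^ finrank Fq L := LinearMap.ext fun w => by
    rw [LinearMap.comp_apply, galSep_galFrob, Module.End.pow_apply]
  rw [AdicCompletion.map_comp_apply, h1, hit]

theorem frobTate_mul_galTate [Finite L] (g : SeparableClosure L ≃ₐ[L] SeparableClosure L) :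
    M.frobTate v * M.galTate v g = M.galTate v g * M.frobTate v := by
  refine LinearMap.ext fun x => Subtype.ext ?_
  change AdicCompletion.map v.asIdeal M.frobSepM (AdicCompletion.map v.asIdeal (M.galSep g) x) =
    AdicCompletion.map v.asIdeal (M.galSep g) (AdicCompletion.map v.asIdeal M.frobSepM x)
  rw [AdicCompletion.map_comp_apply, AdicCompletion.map_comp_apply, galSep_frobSepM]

theorem galTate_val (g : SeparableClosure L ≃ₐ[L] SeparableClosure L)
    (y : AdicCompletion.AdicCauchySequence v.asIdeal M.Msep)
    (hy : AdicCompletion.mk v.asIdeal M.Msep y ∈ M.Tate v) (n : ℕ) :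
    (M.galTate v g ⟨_, hy⟩).1.val n =
      (v.asIdeal ^ n • ⊤ : Submodule A M.Msep).mkQ (M.galSep g (y n)) := rfl

theorem exists_pow_galTate [Finite L] {M M' : TauModule.{w} Fq A L} (x : M.Tate v) (x' : M'.Tate v)
    (n : ℕ) (g : SeparableClosure L ≃ₐ[L] SeparableClosure L) : ∃ k : ℕ,
      (M.galTate v g x).1.val n = ((M.galTate v (galFrob L) ^ k) x).1.val n ∧
      (M'.galTate v g x').1.val n = ((M'.galTate v (galFrob L) ^ k) x').1.val n := by
  classical
  obtain ⟨x, hx⟩ := x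
  obtain ⟨x', hx'⟩ := x'
  obtain ⟨y, rfl⟩ := AdicCompletion.mk_surjective v.asIdeal M.Msep x
  obtain ⟨y', rfl⟩ := AdicCompletion.mk_surjective v.asIdeal M'.Msep x'
  obtain ⟨S, hS⟩ := M.exists_finset_galSep (y n)
  obtain ⟨S', hS'⟩ := M'.exists_finset_galSep (y' n)
  obtain ⟨k, hk⟩ := exists_galFrob_pow_eq (S ∪ S') g
  refine ⟨k, ?_, ?_⟩
  · rw [← galTate_pow, galTate_val, galTate_val,
      hS g _ fun c hc => hk c (Finset.mem_union_left _ hc)]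
  · rw [← galTate_pow, galTate_val, galTate_val,
      hS' g _ fun c hc => hk c (Finset.mem_union_right _ hc)]

variable [Algebra Fq A] [IsDedekindDomain A] {M M' : TauModule.{w} Fq A L} 

/-- A basis of the Tate module which is a basis modulo all powers of `v`. -/
def IsGoodBasis {m : ℕ} (b : Basis (Fin m) (Av A v) (M.Tate v)) : Prop :=
  ∀ (y : M.Tate v) n, y.1.val n = 0 → ∀ i, AdicCompletion.evalₐ v.asIdeal n (b.repr y i) = 0

variable {v}

theorem val_map_eq_zero {m : ℕ} {b : Basis (Fin m) (Av A v) (M.Tate v)} (hb : IsGoodBasis v b)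
    (h : M.Tate v →ₗ[Av A v] M'.Tate v) (y : M.Tate v) (n : ℕ) (hy : y.1.val n = 0) :
    (h y).1.val n = 0 := by
  rw [← b.sum_repr y, map_sum, AddSubmonoidClass.coe_finsetSum, AdicCompletion.val_sum_apply]
  refine Finset.sum_eq_zero fun i _ => ?_
  rw [map_smul]
  have h1 := hb y n hy i
  obtain ⟨a, ha⟩ := AdicCompletion.mk_surjective v.asIdeal A (b.repr y i)
  obtain ⟨x, hx⟩ := AdicCompletion.mk_surjective v.asIdeal M'.Msep (h (b i)).1
  rw [← ha, AdicCompletion.evalₐ_mk, Ideal.Quotient.eq_zero_iff_mem] at h1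
  rw [← ha, Submodule.coe_smul, ← hx, val_mk_smul_mk]
  exact (Submodule.Quotient.mk_eq_zero _).2 (Submodule.smul_mem_smul h1 Submodule.mem_top)

theorem galTate_intertwine [Finite L] {m : ℕ} {b : Basis (Fin m) (Av A v) (M.Tate v)}
    (hb : IsGoodBasis v b) (h : M.Tate v →ₗ[Av A v] M'.Tate v)
    (hh : ∀ x, h (M.frobTate v x) = M'.frobTate v (h x))
    (g : SeparableClosure L ≃ₐ[L] SeparableClosure L) (x : M.Tate v) :
    h (M.galTate v g x) = M'.galTate v g (h x) := by
  have h1 : ∀ x, h (M.galTate v (galFrob L) x) = M'.galTate v (galFrob L) (h x) := by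
    intro x
    have e1 : ∀ y, M.frobTate v (M.galTate v (galFrob L) y) = y := fun y =>
      LinearMap.congr_fun ((M.frobTate_mul_galTate v _).trans (M.galTate_galFrob_mul v)) y
    have e2 : ∀ y, M'.galTate v (galFrob L) (M'.frobTate v y) = y := fun y =>
      LinearMap.congr_fun (M'.galTate_galFrob_mul v) y
    rw [← e2 (h (M.galTate v (galFrob L) x)), ← hh, e1]
  have h2 : ∀ k x, h ((M.galTate v (galFrob L) ^ k) x) = (M'.galTate v (galFrob L) ^ k) (h x) := by
    intro k
    induction k with
    | zero => intro x; rfl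
    | succ k ih => intro x; rw [pow_succ, pow_succ, Module.End.mul_apply, Module.End.mul_apply, ih, h1]
  refine Subtype.ext (AdicCompletion.ext fun n => ?_)
  obtain ⟨k, hk, hk'⟩ := exists_pow_galTate v x (h x) n g
  rw [hk', ← h2]
  have h3 := val_map_eq_zero hb h (M.galTate v g x - (M.galTate v (galFrob L) ^ k) x) n (by
    rw [Submodule.coe_sub, AdicCompletion.val_sub_apply, hk, sub_self])
  rw [map_sub, Submodule.coe_sub, AdicCompletion.val_sub_apply, sub_eq_zero] at h3
  exact h3

theorem isGoodBasis_of_tateBasis [M.FqCompat] {m : ℕ} {t : Fin m → ℕ → M.Msep}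
    (ht : TateBasis (ASep Fq A L) (tauSepR M) v.asIdeal t) (b : Basis (Fin m) (Av A v) (M.Tate v))
    (hb : ∀ i, (b i : AdicCompletion v.asIdeal M.Msep) =
      AdicCompletion.mk v.asIdeal M.Msep (ht.seq i)) : IsGoodBasis v b := by
  intro y n hy i
  choose a ha using fun i => AdicCompletion.mk_surjective v.asIdeal A (b.repr y i)
  rw [← ha, AdicCompletion.evalₐ_mk, Ideal.Quotient.eq_zero_iff_mem]
  refine ht.indA n (fun i => a i n) ?_ i
  rw [mem_extSub, ← Submodule.Quotient.mk_eq_zero, ← hy, ← b.sum_repr y, AddSubmonoidClass.coe_finsetSum,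
    AdicCompletion.val_sum_apply, ← Submodule.mkQ_apply, map_sum]
  refine Finset.sum_congr rfl fun i _ => ?_
  rw [← ha, Submodule.coe_smul, hb]
  exact (val_mk_smul_mk v.asIdeal (a i) (ht.seq i) n).symm

/-- A homomorphism of rational Tate modules is Galois equivariant if and only if it commutes with
the Frobenius. -/
theorem galRatTate_intertwine_iff [Finite L] {m m' : ℕ} {b : Basis (Fin m) (Av A v) (M.Tate v)}
    {b' : Basis (Fin m') (Av A v) (M'.Tate v)} (hb : IsGoodBasis v b)
    (h : M.RatTate v →ₗ[Qv A v] M'.RatTate v) :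
    (∀ g x, h (M.galRatTate v g x) = M'.galRatTate v g (h x)) ↔
      ∀ x, h (M.frobRatTate v x) = M'.frobRatTate v (h x) := by
  constructor
  · intro hg x
    have e1 : ∀ y, M'.frobRatTate v (M'.galRatTate v (galFrob L) y) = y := fun y => by
      change ((M'.frobTate v).baseChange (Qv A v) ∘ₗ (M'.galTate v (galFrob L)).baseChange (Qv A v)) y = y
      rw [← LinearMap.baseChange_comp, ← Module.End.mul_eq_comp, frobTate_mul_galTate,
        galTate_galFrob_mul, Module.End.one_eq_id, LinearMap.baseChange_id, LinearMap.id_apply]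
    have e2 : ∀ y, M.galRatTate v (galFrob L) (M.frobRatTate v y) = y := fun y => by
      change ((M.galTate v (galFrob L)).baseChange (Qv A v) ∘ₗ (M.frobTate v).baseChange (Qv A v)) y = y
      rw [← LinearMap.baseChange_comp, ← Module.End.mul_eq_comp,
        galTate_galFrob_mul, Module.End.one_eq_id, LinearMap.baseChange_id, LinearMap.id_apply]
    rw [← e1 (h _), ← hg, e2]
  · intro hπ g
    obtain ⟨a, h₀, ha, hh₀⟩ := exists_integral_hom b h
    have hcomm : ∀ x, h₀ (M.frobTate v x) = M'.frobTate v (h₀ x) := by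
      intro x
      refine one_tmul_injective (K := Qv A v) b' ?_
      have h1 : M.frobRatTate v (1 ⊗ₜ x) = 1 ⊗ₜ M.frobTate v x := LinearMap.baseChange_tmul _ _ _
      have h2 : ∀ y, M'.frobRatTate v (1 ⊗ₜ y) = 1 ⊗ₜ M'.frobTate v y := fun y =>
        LinearMap.baseChange_tmul _ _ _
      change (1 : Qv A v) ⊗ₜ[Av A v] h₀ (M.frobTate v x) = 1 ⊗ₜ[Av A v] M'.frobTate v (h₀ x)
      rw [← hh₀, ← h2, ← hh₀, ← h1, hπ, LinearMap.map_smul_of_tower]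
    have hgal := galTate_intertwine hb h₀ hcomm g
    have ha' : algebraMap (Av A v) (Qv A v) a ≠ 0 :=
      (map_ne_zero_iff _ (IsFractionRing.injective _ _)).2 ha
    intro x
    induction x using TensorProduct.induction_on with
    | zero => simp
    | tmul q x =>
      have h3 : (q ⊗ₜ[Av A v] x : M.RatTate v) = q • ((1 : Qv A v) ⊗ₜ x) := by
        rw [TensorProduct.smul_tmul', smul_eq_mul, mul_one]
      rw [h3, map_smul, map_smul, map_smul, map_smul]
      congr 1
      refine smul_right_injective _ ha' ?_
      have h1 : M.galRatTate v g (1 ⊗ₜ x) = 1 ⊗ₜ M.galTate v g x := LinearMap.baseChange_tmul _ _ _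
      have h2 : ∀ y, M'.galRatTate v g (1 ⊗ₜ y) = 1 ⊗ₜ M'.galTate v g y := fun y =>
        LinearMap.baseChange_tmul _ _ _
      change algebraMap (Av A v) (Qv A v) a • h _ = algebraMap (Av A v) (Qv A v) a • M'.galRatTate v g _
      rw [algebraMap_smul, algebraMap_smul, h1, hh₀, hgal, ← h2, ← hh₀, LinearMap.map_smul_of_tower]
    | add x y hx hy => simp only [map_add, hx, hy]

end TauModule

end Galois

namespace AbelianTauSheaf

variable {Fq A Q L : Type*}
  [Field Fq] [Fintype Fq] [CommRing A] [Algebra Fq A] [Algebra.FiniteType Fq A]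
  [Field Q] [Algebra Fq Q] [Algebra A Q] [IsScalarTower Fq A Q] [IsDedekindDomain A]
  [IsFractionRing A Q] [Field L] [Finite L] [Algebra Fq L]
  {inf : InftyPoint Fq A Q} {c : CharMap Fq A L}
  (F F' : AbelianTauSheaf.{w} inf c) (v : IsDedekindDomain.HeightOneSpectrum A)

theorem galV_intertwine_iff (hv : c.NePlace v) (h : F.V v →ₗ[Qv A v] F'.V v) :
    (∀ g x, h (F.galV v g x) = F'.galV v g (h x)) ↔ ∀ x, h (F.piV v x) = F'.piV v (h x) := by
  obtain ⟨m, t, ht, b, hb⟩ := exists_tateBasis_sep F.tauModule v F.carrier_torsionFree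
    (F.exists_sub_tau_mem v hv)
  obtain ⟨m', t', ht', b', hb'⟩ := exists_tateBasis_sep F'.tauModule v F'.carrier_torsionFree
    (F'.exists_sub_tau_mem v hv)
  exact TauModule.galRatTate_intertwine_iff (b' := b')
    (TauModule.isGoodBasis_of_tateBasis ht b hb) h

theorem tateIsoQuotient_iff (hv : c.NePlace v) : F.TateIsoQuotient F' v ↔ F.TateSurj F' v :=
  (exists_quotient_iff (F.galV v) (F'.galV v)).trans
    (exists_congr fun h => and_congr_left fun _ => F.galV_intertwine_iff F' v hv h)

theorem tateIso_iff (hv : c.NePlace v) : F.TateIso F' v ↔ F.TateSurj F' v ∧ F.r = F'.r := by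
  have := F.finite_V v hv
  have := F'.finite_V v hv
  constructor
  · rintro ⟨e, he⟩
    refine ⟨⟨e.toLinearMap, (F.galV_intertwine_iff F' v hv _).1 he, e.surjective⟩, ?_⟩
    rw [← F.finrank_V v hv, ← F'.finrank_V v hv, e.finrank_eq]
  · rintro ⟨⟨h, hh, hs⟩, hr⟩
    have hi : Function.Injective h := (LinearMap.injective_iff_surjective_of_finrank_eq_finrank (by
      rw [F.finrank_V v hv, F'.finrank_V v hv, hr])).2 hs
    exact ⟨LinearEquiv.ofBijective h ⟨hi, hs⟩, (F.galV_intertwine_iff F' v hv h).2 hh⟩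

end AbelianTauSheaf

end

section

open Module
open scoped TensorProduct

section IntFamily

/-- A family indexed by the integers can be defined by recursion in both directions. -/
theorem exists_int_family {P : ℤ → Type*} (e : ∀ i, P i ≃ P (i + 1)) (x : P 0) :
    ∃ s : ∀ i, P i, s 0 = x ∧ ∀ i, s (i + 1) = e i (s i) := by
  let s₁ : ∀ n : ℕ, P (Int.ofNat n) := fun n =>
    Nat.rec (motive := fun n => P (Int.ofNat n)) x (fun n y => e (Int.ofNat n) y) n
  let s₂ : ∀ n : ℕ, P (Int.negSucc n) := fun n =>
    Nat.rec (motive := fun n => P (Int.negSucc n)) ((e (Int.negSucc 0)).symm x)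
      (fun n y => (e (Int.negSucc (n + 1))).symm y) n
  let s : ∀ i, P i := fun i => match i with
    | Int.ofNat n => s₁ n
    | Int.negSucc n => s₂ n
  refine ⟨s, rfl, fun i => ?_⟩
  match i with
  | Int.ofNat n => rfl
  | Int.negSucc 0 => exact ((e (Int.negSucc 0)).apply_symm_apply x).symm
  | Int.negSucc (n + 1) => exact ((e (Int.negSucc (n + 1))).apply_symm_apply (s₂ n)).symm

theorem int_induction {P : ℤ → Prop} (h0 : P 0) (h : ∀ i, P i ↔ P (i + 1)) (i : ℤ) : P i := by
  induction i using Int.induction_on with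
  | zero => exact h0
  | succ n ih => exact (h _).1 ih
  | pred n ih => exact (h _).2 (by rwa [sub_add_cancel])

end IntFamily

section Uniformizer

variable {Fq A Q L : Type*} [Field Fq] [CommRing A] [Algebra Fq A] [Field Q]
  [Algebra Fq Q] [Algebra A Q] [IsScalarTower Fq A Q] [Field L] [Algebra Fq L]
  (inf : InftyPoint Fq A Q)

theorem InftyPoint.exists_unif : ∃ ϖ : inf.O, Irreducible ϖ :=
  have := inf.isDVR
  IsDiscreteValuationRing.exists_irreducible inf.O

/-- A uniformizer at `∞`. -/
def InftyPoint.unifO : inf.O := inf.exists_unif.choose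

/-- A uniformizer at `∞`, as an element of the function field. -/
def InftyPoint.unif : Q := inf.unifO

theorem InftyPoint.irreducible_unifO : Irreducible inf.unifO := inf.exists_unif.choose_spec

theorem InftyPoint.unif_ne_zero : inf.unif ≠ 0 := fun h =>
  inf.irreducible_unifO.ne_zero (Subtype.ext h)

theorem InftyPoint.maximalIdeal_pow (n : ℕ) :
    IsLocalRing.maximalIdeal inf.O ^ n = Ideal.span {inf.unifO ^ n} := by
  have := inf.isDVR
  rw [inf.irreducible_unifO.maximalIdeal_eq, Ideal.span_singleton_pow]

theorem InftyPoint.exists_eq_mul_zpow (q : Q) (hq : q ≠ 0) :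
    ∃ (n : ℤ) (u : inf.Oˣ), q = (u : inf.O) * inf.unif ^ n := by
  have := inf.isDVR
  have key : ∀ x : inf.O, x ≠ 0 → ∃ (n : ℕ) (u : inf.Oˣ), (x : Q) = (u : inf.O) * inf.unif ^ n := by
    intro x hx
    obtain ⟨n, u, hu⟩ := IsDiscreteValuationRing.associated_pow_irreducible hx inf.irreducible_unifO
    refine ⟨n, u⁻¹, ?_⟩
    have h1 : x = (u⁻¹ : inf.Oˣ) * inf.unifO ^ n := by rw [← hu, mul_comm, mul_assoc, u.mul_inv, mul_one]
    exact congrArg Subtype.val h1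
  rcases inf.O.mem_or_inv_mem q with h | h
  · obtain ⟨n, u, hu⟩ := key ⟨q, h⟩ fun h0 => hq (congrArg Subtype.val h0)
    exact ⟨n, u, by rw [zpow_natCast]; exact hu⟩
  · obtain ⟨n, u, hu⟩ := key ⟨q⁻¹, h⟩ fun h0 => inv_ne_zero hq (congrArg Subtype.val h0)
    refine ⟨-n, u⁻¹, ?_⟩
    have h1 : (((u⁻¹ : inf.Oˣ) : inf.O) : Q) = ((u : inf.O) : Q)⁻¹ := by
      refine eq_inv_of_mul_eq_one_left ?_
      exact congrArg Subtype.val u.inv_mul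
    rw [h1, zpow_neg, zpow_natCast, ← mul_inv, ← inv_inv q]
    exact congrArg _ hu

theorem InftyPoint.exists_pow_mul_mem (q : Q) : ∃ n : ℕ, inf.unif ^ n * q ∈ inf.O := by
  by_cases hq : q = 0
  · exact ⟨0, by rw [hq, mul_zero]; exact zero_mem _⟩
  obtain ⟨n, u, rfl⟩ := inf.exists_eq_mul_zpow q hq
  refine ⟨n.natAbs, ?_⟩
  have h1 : inf.unif ^ n.natAbs * (((u : inf.O) : Q) * inf.unif ^ n) =
      (u : inf.O) * inf.unif ^ ((n.natAbs : ℤ) + n).toNat := by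
    rw [mul_left_comm, ← zpow_natCast, ← zpow_add₀ inf.unif_ne_zero, ← zpow_natCast,
      Int.toNat_of_nonneg (by omega)]
  rw [h1]
  exact mul_mem (SetLike.coe_mem _) (pow_mem (SetLike.coe_mem _) _)

theorem exists_unif_pow_smul_mem_OL (x : QL Fq Q L) : ∃ n : ℕ, inf.unif ^ n • x ∈ OL L inf := by
  induction x using QL.induction with
  | h0 => exact ⟨0, by rw [smul_zero]; exact zero_mem _⟩
  | hmk q l =>
    obtain ⟨n, hn⟩ := inf.exists_pow_mul_mem q
    refine ⟨n, ?_⟩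
    rw [QL.smul_mk, QL.mk_eq_mul]
    exact mul_mem (algebraMap_mem_OL L inf ⟨_, hn⟩) (LtoQL_mem_OL L inf l)
  | hadd r s hr hs =>
    obtain ⟨n, hn⟩ := hr
    obtain ⟨m, hm⟩ := hs
    refine ⟨n + m, ?_⟩
    have hz : ∀ k (y : QL Fq Q L), y ∈ OL L inf → inf.unif ^ k • y ∈ OL L inf := fun k y hy => by
      rw [Algebra.smul_def]
      exact mul_mem (algebraMap_mem_OL L inf (inf.unifO ^ k)) hy
    rw [smul_add]
    refine add_mem ?_ ?_
    · rw [add_comm, pow_add, mul_smul]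
      exact hz _ _ hn
    · rw [pow_add, mul_smul]
      exact hz _ _ hm

theorem eq_zero_of_forall_zpow_smul_mem_OL [Finite L] (x : QL Fq Q L) (n₀ : ℤ)
    (h : ∀ n : ℕ, inf.unif ^ (n₀ - n) • x ∈ OL L inf) : x = 0 := by
  by_contra hx
  obtain ⟨y, hy, w, hw, hw0⟩ := inf.exists_smul_eq x hx
  obtain ⟨m, u, rfl⟩ := inf.exists_eq_mul_zpow y hy
  let n := (n₀ - m + 1).natAbs
  obtain ⟨w', hw'⟩ := h n
  have hw'' : inf.toQL L w' = inf.unif ^ (n₀ - n) • x := hw'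
  have hk : 0 ≤ m - n₀ + n - 1 := by omega
  let t : inf.subalg := ⟨inf.unif * (((u : inf.O) : Q) * inf.unif ^ (m - n₀ + n - 1).toNat),
    mul_mem (SetLike.coe_mem inf.unifO) (mul_mem (SetLike.coe_mem _) (pow_mem (SetLike.coe_mem inf.unifO) _))⟩
  have ht : (t : Q) = inf.unif * (((u : inf.O) : Q) * inf.unif ^ (m - n₀ + n - 1).toNat) := rfl
  have h1 : inf.toQL L (t ⊗ₜ 1 * w') = inf.toQL L w := by
    have h2 : inf.toQL L (t ⊗ₜ 1) = algebraMap Q (QL Fq Q L) t :=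
      (Algebra.TensorProduct.map_tmul inf.subalg.val (AlgHom.id Fq L) t 1)
    rw [map_mul, h2, ← Algebra.smul_def, hw'', ← hw, smul_smul]
    congr 1
    rw [ht, ← zpow_natCast, Int.toNat_of_nonneg hk, mul_left_comm, mul_assoc, ← zpow_one_add₀ inf.unif_ne_zero,
      ← zpow_add₀ inf.unif_ne_zero]
    congr 2
    ring
  have h3 : t ⊗ₜ 1 * w' = w := inf.toQL_injective h1
  refine hw0 ?_
  rw [← h3, map_mul]
  have h4 : inf.resL L (t ⊗ₜ 1) = 0 := by
    have h5 : inf.res t = 0 := by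
      have h6 : inf.res ⟨inf.unif, SetLike.coe_mem inf.unifO⟩ = 0 := by
        have h7 : IsLocalRing.residue inf.O inf.unifO = 0 :=
          (IsLocalRing.residue_eq_zero_iff _).2 inf.irreducible_unifO.not_isUnit
        exact (congrArg _ h7).trans
          (map_zero (RingEquiv.ofBijective _ inf.algebraMap_residue_bijective).symm)
      have h8 : t = ⟨inf.unif, SetLike.coe_mem inf.unifO⟩ *
        ⟨((u : inf.O) : Q) * inf.unif ^ (m - n₀ + n - 1).toNat,
          mul_mem (SetLike.coe_mem _) (pow_mem (SetLike.coe_mem inf.unifO) _)⟩ := rfl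
      rw [h8, map_mul, h6, zero_mul]
    have h9 : inf.resL L (t ⊗ₜ 1) = algebraMap Fq L (inf.res t) * 1 :=
      Algebra.TensorProduct.lift_tmul _ _ _ _ _
    rw [h9, h5, map_zero, zero_mul]
  rw [h4, zero_mul]

end Uniformizer

section BundleAux

variable {Fq A Q L : Type*} [Field Fq] [CommRing A] [Algebra Fq A] [Field Q]
  [Algebra Fq Q] [Algebra A Q] [IsScalarTower Fq A Q] [IsDomain A] [IsFractionRing A Q]
  [Field L] [Algebra Fq L] {inf : InftyPoint Fq A Q}

namespace Bundle

variable (E E' : Bundle.{w} L inf)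

theorem unif_pow_smul_mem_N {x : E.V} (hx : x ∈ E.N) (n : ℕ) : inf.unif ^ n • x ∈ E.N :=
  smul_mem_N (pow_mem (SetLike.coe_mem inf.unifO) n) hx

theorem mem_inftyIdeal_pow_smul (k : ℕ) (x : E.V) :
    x ∈ inftyIdeal L inf ^ k • E.N ↔ ∃ y ∈ E.N, inf.unif ^ k • y = x := by
  have h1 : inftyIdeal L inf ^ k = Ideal.span {OtoOL L inf (inf.unifO ^ k)} := by
    rw [inftyIdeal, ← Ideal.map_pow, inf.maximalIdeal_pow, Ideal.map_span, Set.image_singleton]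
  rw [h1, Submodule.ideal_span_singleton_smul, Submodule.mem_smul_pointwise_iff_exists]
  rfl

theorem mem_twistN_iff (D : EffDivisor A) (x : E.V) :
    x ∈ E.twistN D ↔ inf.unif ^ D.mult • x ∈ E.N := by
  constructor
  · intro h
    exact h (inf.unifO ^ D.mult) (by rw [inf.maximalIdeal_pow]; exact Ideal.mem_span_singleton_self _)
  · intro h z hz
    rw [inf.maximalIdeal_pow] at hz
    obtain ⟨y, rfl⟩ := Ideal.mem_span_singleton'.1 hz
    have : ((y * inf.unifO ^ D.mult : inf.O) : Q) • x = (y : Q) • inf.unif ^ D.mult • x := by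
      rw [smul_smul]
      rfl
    rw [this]
    exact smul_mem_N y.2 h

theorem exists_smul_mem_M (x : E.V) : ∃ a : A, a ≠ 0 ∧ algebraMap A Q a • x ∈ E.M := by
  have hx : x ∈ Submodule.span (QL Fq Q L) (E.M : Set E.V) := by rw [E.span_M]; trivial
  induction hx using Submodule.span_induction with
  | mem x hx => exact ⟨1, one_ne_zero, smul_mem_M hx⟩
  | zero => exact ⟨1, one_ne_zero, by rw [smul_zero]; exact zero_mem _⟩
  | add x y _ _ hx hy =>
    obtain ⟨a, ha, hax⟩ := hx
    obtain ⟨b, hb, hby⟩ := hy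
    refine ⟨a * b, mul_ne_zero ha hb, ?_⟩
    rw [smul_add]
    refine add_mem ?_ ?_
    · rw [mul_comm, map_mul, mul_smul]
      exact smul_mem_M hax
    · rw [map_mul, mul_smul]
      exact smul_mem_M hby
  | smul z x _ hx =>
    obtain ⟨a, ha, hax⟩ := hx
    obtain ⟨b, hb, hbz⟩ := exists_smul_mem_AL (A := A) z
    refine ⟨a * b, mul_ne_zero ha hb, ?_⟩
    have h1 : algebraMap A Q (a * b) • z • x =
        (⟨_, hbz⟩ : AL Fq A Q L) • algebraMap A Q a • x := by
      rw [← Bundle.smul_comm_AL, map_mul, mul_smul]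
      congr 1
      change _ = (algebraMap Q (QL Fq Q L) (algebraMap A Q b) * z) • x
      rw [mul_smul, algebraMap_smul (QL Fq Q L) (algebraMap A Q b)]
    rw [h1]
    exact Submodule.smul_mem _ _ hax

theorem exists_unif_pow_smul_mem_N (x : E.V) : ∃ n : ℕ, inf.unif ^ n • x ∈ E.N := by
  have hx : x ∈ Submodule.span (QL Fq Q L) (E.N : Set E.V) := by rw [E.span_N]; trivial
  induction hx using Submodule.span_induction with
  | mem x hx => exact ⟨0, by rwa [pow_zero, one_smul]⟩
  | zero => exact ⟨0, by rw [smul_zero]; exact zero_mem _⟩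
  | add x y _ _ hx hy =>
    obtain ⟨n, hn⟩ := hx
    obtain ⟨m, hm⟩ := hy
    refine ⟨n + m, ?_⟩
    rw [smul_add]
    refine add_mem ?_ ?_
    · rw [add_comm, pow_add, mul_smul]
      exact E.unif_pow_smul_mem_N hn _
    · rw [pow_add, mul_smul]
      exact E.unif_pow_smul_mem_N hm _
  | smul z x _ hx =>
    obtain ⟨n, hn⟩ := hx
    obtain ⟨m, hm⟩ := exists_unif_pow_smul_mem_OL inf z
    refine ⟨n + m, ?_⟩
    have h1 : inf.unif ^ (n + m) • z • x = (⟨_, hm⟩ : OL L inf) • inf.unif ^ n • x := by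
      rw [← Bundle.smul_comm_OL, pow_add, mul_smul]
      congr 1
      change _ = (inf.unif ^ m • z) • x
      rw [smul_assoc]
    rw [h1]
    exact Submodule.smul_mem _ _ hn

variable {E E'}

theorem exists_bound_M (f : E.V →ₗ[QL Fq Q L] E'.V) :
    ∃ a : A, a ≠ 0 ∧ ∀ x ∈ E.M, algebraMap A Q a • f x ∈ E'.M := by
  obtain ⟨s, hs⟩ := E.M_fg
  choose a ha hmem using fun x : E.V => E'.exists_smul_mem_M (f x)
  refine ⟨∏ x ∈ s, a x, Finset.prod_ne_zero_iff.2 fun x _ => ha x, fun x hx => ?_⟩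
  rw [← hs] at hx
  induction hx using Submodule.span_induction with
  | mem x hx =>
    obtain ⟨b, hb⟩ := Finset.dvd_prod_of_mem a hx
    rw [hb, mul_comm, map_mul, mul_smul]
    exact smul_mem_M (hmem x)
  | zero => rw [map_zero, smul_zero]; exact zero_mem _
  | add x y _ _ hx hy => rw [map_add, smul_add]; exact add_mem hx hy
  | smul z x _ hx =>
    have h1 : f (z • x) = z • f x := LinearMap.map_smul_of_tower f z x
    rw [h1, Bundle.smul_comm_AL]
    exact Submodule.smul_mem _ _ hx

theorem exists_bound_N (f : E.V →ₗ[QL Fq Q L] E'.V) :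
    ∃ n : ℕ, ∀ x ∈ E.N, inf.unif ^ n • f x ∈ E'.N := by
  obtain ⟨s, hs⟩ := E.N_fg
  choose a hmem using fun x : E.V => E'.exists_unif_pow_smul_mem_N (f x)
  refine ⟨∑ x ∈ s, a x, fun x hx => ?_⟩
  rw [← hs] at hx
  induction hx using Submodule.span_induction with
  | mem x hx =>
    obtain ⟨b, hb⟩ := Nat.exists_eq_add_of_le (Finset.single_le_sum (fun i _ => Nat.zero_le (a i)) hx)
    rw [hb, add_comm, pow_add, mul_smul]
    exact E'.unif_pow_smul_mem_N (hmem x) _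
  | zero => rw [map_zero, smul_zero]; exact zero_mem _
  | add x y _ _ hx hy => rw [map_add, smul_add]; exact add_mem hx hy
  | smul z x _ hx =>
    have h1 : f (z • x) = z • f x := LinearMap.map_smul_of_tower f z x
    rw [h1, Bundle.smul_comm_OL]
    exact Submodule.smul_mem _ _ hx

theorem eq_zero_of_forall_mem_N [Finite L] {n : Type*} [Finite n] (b : Basis n (QL Fq Q L) E.V) (x : E.V)
    (h : ∀ n : ℕ, inf.unif ^ (-(n : ℤ)) • x ∈ E.N) : x = 0 := by
  cases nonempty_fintype n
  obtain ⟨s, hs⟩ := E.N_fg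
  choose a ha using fun z : QL Fq Q L => exists_unif_pow_smul_mem_OL inf z
  have hz : ∀ k (y : QL Fq Q L), y ∈ OL L inf → inf.unif ^ k • y ∈ OL L inf := fun k y hy => by
    rw [Algebra.smul_def]
    exact mul_mem (algebraMap_mem_OL L inf (inf.unifO ^ k)) hy
  have hbound : ∀ j, ∃ m : ℕ, ∀ y ∈ E.N, inf.unif ^ m • b.repr y j ∈ OL L inf := by
    intro j
    refine ⟨∑ y ∈ s, a (b.repr y j), fun y hy => ?_⟩
    rw [← hs] at hy
    induction hy using Submodule.span_induction with
    | mem y hy =>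
      obtain ⟨c, hc⟩ := Nat.exists_eq_add_of_le
        (Finset.single_le_sum (fun i _ => Nat.zero_le (a (b.repr i j))) hy)
      rw [hc, add_comm, pow_add, mul_smul]
      exact hz _ _ (ha _)
    | zero => rw [map_zero, Finsupp.zero_apply, smul_zero]; exact zero_mem _
    | add x y _ _ hx hy => rw [map_add, Finsupp.add_apply, smul_add]; exact add_mem hx hy
    | smul z x _ hx =>
      have h1 : b.repr (z • x) j = (z : QL Fq Q L) * b.repr x j := by
        have : z • x = (z : QL Fq Q L) • x := rfl
        rw [this, map_smul, Finsupp.smul_apply, smul_eq_mul]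
      rw [h1, ← mul_smul_comm]
      exact mul_mem z.2 hx
  refine b.ext_elem fun j => ?_
  rw [map_zero, Finsupp.zero_apply]
  obtain ⟨m, hm⟩ := hbound j
  refine eq_zero_of_forall_zpow_smul_mem_OL inf _ m fun n => ?_
  have h1 := hm _ (h n)
  rw [← algebraMap_smul (QL Fq Q L) (inf.unif ^ (-(n : ℤ))) x, map_smul, Finsupp.smul_apply,
    smul_eq_mul, ← Algebra.smul_def, smul_smul, ← zpow_natCast, ← zpow_add₀ inf.unif_ne_zero] at h1
  exact h1

end Bundle

end BundleAux

end

section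

open Module
open scoped TensorProduct

namespace AbelianTauSheaf

variable {Fq A Q L : Type*}
  [Field Fq] [Fintype Fq] [CommRing A] [Algebra Fq A]
  [Field Q] [Algebra Fq Q] [Algebra A Q] [IsScalarTower Fq A Q] [IsDedekindDomain A]
  [IsFractionRing A Q] [Field L] [Finite L] [Algebra Fq L]
  {inf : InftyPoint Fq A Q} {c : CharMap Fq A L}
  (F F' : AbelianTauSheaf.{w} inf c)

theorem exists_theta : ∃ θ : ∀ i, (F.E 0).V ≃ₗ[QL Fq Q L] (F.E i).V,
    θ 0 = LinearEquiv.refl _ _ ∧ ∀ i, θ (i + 1) = (θ i).trans (F.PiEquiv i) :=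
  exists_int_family (P := fun i => (F.E 0).V ≃ₗ[QL Fq Q L] (F.E i).V)
    (fun i => ⟨fun θ => θ.trans (F.PiEquiv i), fun θ => θ.trans (F.PiEquiv i).symm,
      fun _ => LinearEquiv.ext fun _ => (F.PiEquiv i).symm_apply_apply _,
      fun _ => LinearEquiv.ext fun _ => (F.PiEquiv i).apply_symm_apply _⟩) _

/-- The identification of the generic fibres of `F_0` and `F_i` by means of the maps `Π`. -/
def theta (i : ℤ) : (F.E 0).V ≃ₗ[QL Fq Q L] (F.E i).V := F.exists_theta.choose i

theorem theta_zero (x : (F.E 0).V) : F.theta 0 x = x := by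
  rw [theta, F.exists_theta.choose_spec.1]
  rfl

theorem theta_succ (i : ℤ) (x : (F.E 0).V) : F.theta (i + 1) x = F.Pi i (F.theta i x) := by
  rw [theta, F.exists_theta.choose_spec.2]
  rfl

theorem theta_phi (i : ℤ) (x : (F.E 0).V) : F.theta i (F.phi 0 x) = F.phi i (F.theta i x) := by
  revert x
  refine int_induction (P := fun i => ∀ x, F.theta i (F.phi 0 x) = F.phi i (F.theta i x))
    (fun x => by rw [theta_zero, theta_zero]) (fun i => ?_) i
  refine forall_congr' fun x => ?_
  rw [theta_succ, theta_succ, phi_Pi, (F.Pi_injective i).eq_iff]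

theorem tau_theta (i : ℤ) (x : (F.E 0).V) : F.tau i (F.theta i x) = F.theta (i + 1) (F.phi 0 x) := by
  rw [theta_succ, theta_phi, Pi_phi]

theorem chain_theta (n : ℕ) : ∀ (i j : ℤ) (h : j = i + n) (x : (F.E 0).V),
    chain F.E F.Pi n i j h (F.theta i x) = F.theta j x := by
  induction n with
  | zero =>
    intro i j h x
    obtain rfl : i = j := by simp [h]
    rfl
  | succ n ih =>
    intro i j h x
    change chain F.E F.Pi n (i + 1) j _ (F.Pi i (F.theta i x)) = _
    rw [← theta_succ, ih]

theorem theta_mem_M (i : ℤ) (x : (F.E 0).V) : F.theta i x ∈ (F.E i).M ↔ x ∈ (F.E 0).M := by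
  refine int_induction (P := fun i => F.theta i x ∈ (F.E i).M ↔ x ∈ (F.E 0).M)
    (by rw [theta_zero]) (fun i => ?_) i
  have h : F.theta (i + 1) x ∈ (F.E (i + 1)).M ↔ F.theta i x ∈ (F.E i).M := by
    rw [theta_succ]
    refine ⟨fun h => ?_, F.Pi_M i _⟩
    obtain ⟨k, hk⟩ := F.exists_pole
    obtain ⟨y, hy, hxy⟩ := (hk i).1 _ h
    rwa [← F.Pi_injective i hxy]
  rw [h]

/-- The stalk of `F_i` at `∞`, as a lattice in the generic fibre of `F_0`. -/
def lattice (i : ℤ) : Submodule (OL L inf) (F.E 0).V :=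
  (F.E i).N.comap ((F.theta i).toLinearMap.restrictScalars (OL L inf))

theorem mem_lattice (i : ℤ) (x : (F.E 0).V) : x ∈ F.lattice i ↔ F.theta i x ∈ (F.E i).N := Iff.rfl

theorem theta_smul (i : ℤ) (q : Q) (x : (F.E 0).V) : F.theta i (q • x) = q • F.theta i x :=
  LinearMap.map_smul_of_tower (F.theta i).toLinearMap q x

theorem unif_pow_smul_mem_lattice (i : ℤ) {x : (F.E 0).V} (hx : x ∈ F.lattice i) (n : ℕ) :
    inf.unif ^ n • x ∈ F.lattice i := by
  rw [mem_lattice, theta_smul]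
  exact (F.E i).unif_pow_smul_mem_N hx n

theorem lattice_le_succ (i : ℤ) : F.lattice i ≤ F.lattice (i + 1) := fun x hx => by
  rw [mem_lattice, theta_succ]
  exact F.Pi_N i _ hx

theorem lattice_mono : Monotone F.lattice := monotone_int_of_le_succ F.lattice_le_succ

theorem phi_mem_lattice (i : ℤ) {x : (F.E 0).V} (hx : x ∈ F.lattice i) :
    F.phi 0 x ∈ F.lattice (i + 1) := by
  rw [mem_lattice, ← tau_theta]
  exact F.tau_N i _ hx

theorem exists_period : ∃ k l : ℕ, 0 < k ∧ 0 < l ∧ l * F.d = k * F.r ∧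
    ∀ (n i : ℤ) (x : (F.E 0).V),
      x ∈ F.lattice (i + n * l) ↔ inf.unif ^ (n * k) • x ∈ F.lattice i := by
  obtain ⟨k, l, hk, hl, hkl, h⟩ := F.periodic
  refine ⟨k, l, hk, hl, hkl, fun n i => ?_⟩
  have h1 : ∀ (i : ℤ) (x : (F.E 0).V),
      x ∈ F.lattice (i + l) ↔ inf.unif ^ k • x ∈ F.lattice i := by
    intro i x
    have hi := chain_injective F F.Pi F.Pi_injective l i (i + l) rfl
    constructor
    · intro hx
      have h2 : inf.unif ^ k • F.theta (i + l) x ∈ inftyIdeal L inf ^ k • (F.E (i + l)).N :=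
        ((F.E (i + l)).mem_inftyIdeal_pow_smul k _).2 ⟨_, hx, rfl⟩
      rw [← (h i).2] at h2
      obtain ⟨y, hy, hxy⟩ := h2
      rw [← F.theta_smul, ← F.chain_theta l i (i + l) rfl] at hxy
      rw [mem_lattice, ← hi hxy]
      exact hy
    · intro hx
      have h2 : F.theta (i + l) (inf.unif ^ k • x) ∈
          (F.E i).N.map ((chain F.E F.Pi l i (i + l) rfl).restrictScalars (OL L inf)) :=
        ⟨_, hx, F.chain_theta l i (i + l) rfl _⟩
      rw [(h i).2, Bundle.mem_inftyIdeal_pow_smul] at h2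
      obtain ⟨y, hy, hxy⟩ := h2
      rw [theta_smul] at hxy
      rw [mem_lattice, ← smul_right_injective _ (pow_ne_zero k inf.unif_ne_zero) hxy]
      exact hy
  refine int_induction (P := fun n => ∀ x, x ∈ F.lattice (i + n * l) ↔
    inf.unif ^ (n * k) • x ∈ F.lattice i) (fun x => by simp) (fun n => ?_) n
  have h2 : ∀ x : (F.E 0).V, inf.unif ^ ((n + 1) * k) • x =
      inf.unif ^ (n * k) • inf.unif ^ k • x := fun x => by
    rw [smul_smul, ← zpow_natCast inf.unif k, ← zpow_add₀ inf.unif_ne_zero, add_one_mul]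
  have h3 : i + (n + 1) * l = (i + n * l) + l := by ring
  constructor
  · intro h x
    rw [h3, h1, h, h2]
  · intro h x
    have h4 := h ((inf.unif ^ k)⁻¹ • x)
    rwa [h3, h1, h2, smul_inv_smul₀ (pow_ne_zero k inf.unif_ne_zero)] at h4

/-- The homomorphisms of generic fibres which extend a homomorphism `f` of
the generic fibres of `F_0` and `F'_0`. -/
def extendHom (f : (F.E 0).V →ₗ[QL Fq Q L] (F'.E 0).V) (i : ℤ) :
    (F.E i).V →ₗ[QL Fq Q L] (F'.E i).V :=
  (F'.theta i).toLinearMap ∘ₗ f ∘ₗ (F.theta i).symm.toLinearMap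

theorem extendHom_theta (f : (F.E 0).V →ₗ[QL Fq Q L] (F'.E 0).V) (i : ℤ) (x : (F.E 0).V) :
    F.extendHom F' f i (F.theta i x) = F'.theta i (f x) := by
  change F'.theta i (f ((F.theta i).symm (F.theta i x))) = _
  rw [LinearEquiv.symm_apply_apply]

theorem extendHom_zero (f : (F.E 0).V →ₗ[QL Fq Q L] (F'.E 0).V) : F.extendHom F' f 0 = f :=
  LinearMap.ext fun x => by
    conv_lhs => rw [← F.theta_zero x]
    rw [extendHom_theta, theta_zero]

variable {F F'}

theorem commutes_extendHom {f : (F.E 0).V →ₗ[QL Fq Q L] (F'.E 0).V}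
    (hf : ∀ x, f (F.phi 0 x) = F'.phi 0 (f x)) : Commutes F F' (F.extendHom F' f) where
  comm_Pi i x := by
    obtain ⟨x, rfl⟩ := (F.theta i).surjective x
    rw [← theta_succ, extendHom_theta, extendHom_theta, theta_succ]
  comm_tau i x := by
    obtain ⟨x, rfl⟩ := (F.theta i).surjective x
    rw [tau_theta, extendHom_theta, extendHom_theta, hf, tau_theta]

theorem Commutes.eq_extendHom {f : ∀ i, (F.E i).V →ₗ[QL Fq Q L] (F'.E i).V}
    (hf : Commutes F F' f) : f = F.extendHom F' (f 0) := by
  have h : ∀ i x, f i (F.theta i x) = F'.theta i (f 0 x) := by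
    intro i
    refine int_induction (P := fun i => ∀ x, f i (F.theta i x) = F'.theta i (f 0 x))
      (fun x => by rw [theta_zero, theta_zero]) (fun i => forall_congr' fun x => ?_) i
    rw [theta_succ, theta_succ, hf.comm_Pi, (F'.Pi_injective i).eq_iff]
  funext i
  refine LinearMap.ext fun x => ?_
  obtain ⟨x, rfl⟩ := (F.theta i).surjective x
  rw [h, extendHom_theta]

theorem Commutes.comm_phi {f : ∀ i, (F.E i).V →ₗ[QL Fq Q L] (F'.E i).V}
    (hf : Commutes F F' f) (x : (F.E 0).V) : f 0 (F.phi 0 x) = F'.phi 0 (f 0 x) := by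
  refine F'.Pi_injective 0 ?_
  rw [Pi_phi, ← hf.comm_Pi, Pi_phi, hf.comm_tau]

/-- Homomorphisms of the generic fibres have bounded poles if the weights agree. -/
theorem exists_bounded (hw : F.d * F'.r = F'.d * F.r) (f : (F.E 0).V →ₗ[QL Fq Q L] (F'.E 0).V) :
    ∃ D : EffDivisor A, ∀ i,
      (F.E i).BoundedBy (F'.E i) ((F.extendHom F' f i).restrictScalars Q) D := by
  obtain ⟨a, ha, hM⟩ := Bundle.exists_bound_M f
  have hN : ∃ m : ℕ, ∀ i, ∀ x ∈ F.lattice i, inf.unif ^ m • f x ∈ F'.lattice i := by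
    by_cases hr : F.r = 0 ∨ F'.r = 0
    · refine ⟨0, fun i x _ => ?_⟩
      have hf : f x = 0 := by
        rcases hr with hr | hr
        · obtain ⟨b, -⟩ := F.exists_basis_mem 0
          have : IsEmpty (Fin F.r) := by rw [hr]; infer_instance
          have hx : x = 0 := b.ext_elem fun j => isEmptyElim j
          rw [hx, map_zero]
        · obtain ⟨b, -⟩ := F'.exists_basis_mem 0
          have : IsEmpty (Fin F'.r) := by rw [hr]; infer_instance
          exact b.ext_elem fun j => isEmptyElim j
      rw [hf, smul_zero]
      exact zero_mem _
    obtain ⟨k, l, hk, hl, hkl, hper⟩ := F.exists_period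
    obtain ⟨k', l', hk', hl', hkl', hper'⟩ := F'.exists_period
    have hkk : l' * k = l * k' := by
      have h1 : (l' * k) * (F.r * F'.r) = (l * k') * (F.r * F'.r) := by
        calc (l' * k) * (F.r * F'.r) = (k * F.r) * (l' * F'.r) := by ring
          _ = l * l' * (F.d * F'.r) := by rw [← hkl]; ring
          _ = (l * F.r) * (l' * F'.d) := by rw [hw]; ring
          _ = _ := by rw [hkl']; ring
      exact Nat.eq_of_mul_eq_mul_right (Nat.pos_of_ne_zero (mul_ne_zero (fun h => hr (Or.inl h)) fun h => hr (Or.inr h))) h1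
    obtain ⟨m, hm⟩ := Bundle.exists_bound_N f
    refine ⟨m + l' * k, fun i x hx => ?_⟩
    have hP : (0 : ℤ) < l * l' := by positivity
    have hq0 : i / (l * l') * (l * l') ≤ i := Int.ediv_mul_le i hP.ne'
    have hq1 : i ≤ (i / (l * l') + 1) * (l * l') := (Int.lt_ediv_add_one_mul_self i hP).le
    generalize i / (l * l') = q at hq0 hq1
    have hx1 : x ∈ F.lattice (0 + (q + 1) * l' * l) :=
      F.lattice_mono (hq1.trans_eq (by ring)) hx
    rw [hper, mem_lattice, theta_zero] at hx1
    have hx2 := hm _ hx1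
    refine F'.lattice_mono (a := 0 + q * l * l') (by linarith) ?_
    rw [hper', mem_lattice, theta_zero]
    rw [LinearMap.map_smul_of_tower] at hx2
    have h5 : q * l * k' + (m + l' * k : ℕ) = (m : ℤ) + (q + 1) * l' * k := by
      have : (l' * k : ℤ) = l * k' := by exact_mod_cast hkk
      push_cast
      linear_combination (-q) * this
    rw [← zpow_natCast, smul_smul, ← zpow_add₀ inf.unif_ne_zero, h5, zpow_add₀ inf.unif_ne_zero,
      mul_smul, zpow_natCast]
    exact hx2
  obtain ⟨m, hN⟩ := hN
  refine ⟨⟨Ideal.span {a}, by simpa using ha, m⟩, fun i => ⟨fun x hx b hb => ?_, fun x hx => ?_⟩⟩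
  · obtain ⟨x, rfl⟩ := (F.theta i).surjective x
    obtain ⟨b, rfl⟩ := Ideal.mem_span_singleton'.1 hb
    change algebraMap A Q (b * a) • F.extendHom F' f i (F.theta i x) ∈ _
    rw [extendHom_theta, map_mul, mul_smul]
    refine Bundle.smul_mem_M ?_
    rw [← theta_smul, theta_mem_M]
    exact hM x ((F.theta_mem_M i x).1 hx)
  · obtain ⟨x, rfl⟩ := (F.theta i).surjective x
    rw [Bundle.mem_twistN_iff]
    change inf.unif ^ m • F.extendHom F' f i (F.theta i x) ∈ _
    rw [extendHom_theta, ← theta_smul]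
    exact hN i x hx

end AbelianTauSheaf

end

section

open Module
open scoped TensorProduct

section

variable {Fq A Q L : Type*} [Field Fq] [CommRing A] [Algebra Fq A] [Field Q]
  [Algebra Fq Q] [Algebra A Q] [IsScalarTower Fq A Q] [Field L] [Algebra Fq L]

theorem OL.induction {inf : InftyPoint Fq A Q} {P : OL L inf → Prop} (z : OL L inf) (h0 : P 0)
    (hmk : ∀ a l, P (OtoOL L inf a * LtoOL L inf l)) (hadd : ∀ r s, P r → P s → P (r + s)) :
    P z := by
  obtain ⟨_, t, rfl⟩ := z
  let g : inf.subalg ⊗[Fq] L →ₐ[Fq] Q ⊗[Fq] L :=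
    Algebra.TensorProduct.map inf.subalg.val (AlgHom.id Fq L)
  have h : ∀ t, P ⟨g t, t, rfl⟩ := by
    intro t
    induction t using TensorProduct.induction_on with
    | zero =>
      convert h0 using 1
      exact Subtype.ext (map_zero g)
    | tmul a l =>
      convert hmk ⟨a, a.2⟩ l using 1
      refine Subtype.ext ?_
      change g (a ⊗ₜ l) = QL.mk Fq (a : Q) 1 * QL.mk Fq 1 l
      exact (Algebra.TensorProduct.map_tmul _ _ _ _).trans (QL.mk_eq_mul _ _)
    | add x y hx hy =>
      convert hadd _ _ hx hy using 1
      exact Subtype.ext (map_add g x y)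
  exact h t

theorem OL.exists_sig_eq [Fintype Fq] [Finite L] {inf : InftyPoint Fq A Q} (z : OL L inf) :
    ∃ z' : OL L inf, sig Fq Q L z' = z := by
  induction z using OL.induction with
  | h0 => exact ⟨0, map_zero _⟩
  | hmk a l =>
    obtain ⟨l', rfl⟩ := Finite.surjective_of_injective (frobL Fq L).injective l
    refine ⟨OtoOL L inf a * LtoOL L inf l', ?_⟩
    change sig Fq Q L (QL.mk Fq (a : Q) 1 * QL.mk Fq 1 l') = QL.mk Fq (a : Q) 1 * QL.mk Fq 1 _
    rw [map_mul, QL.sig_mk, QL.sig_mk, map_one]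
  | hadd r s hr hs =>
    obtain ⟨r', hr⟩ := hr
    obtain ⟨s', hs⟩ := hs
    exact ⟨r' + s', by
      change sig Fq Q L ((r' : QL Fq Q L) + s') = r + s
      rw [map_add, hr, hs]⟩

end

theorem Bundle.nonneg_of_forall_mem_N {Fq A Q L : Type*} [Field Fq] [CommRing A] [Algebra Fq A]
    [Field Q] [Algebra Fq Q] [Algebra A Q] [IsScalarTower Fq A Q] [IsDedekindDomain A]
    [IsFractionRing A Q] [Field L] [Algebra Fq L]
    [Finite L] {inf : InftyPoint Fq A Q} (E : Bundle.{w} L inf) {n : Type*} [Finite n]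
    (b : Basis n (QL Fq Q L) E.V) {x : E.V} (hx : x ≠ 0) (m : ℕ) {t : ℤ}
    (h : ∀ n : ℕ, inf.unif ^ (m + n * t : ℤ) • x ∈ E.N) : 0 ≤ t := by
  by_contra! ht
  have hu := inf.unif_ne_zero
  refine hx ((smul_eq_zero.1 (E.eq_zero_of_forall_mem_N b (inf.unif ^ m • x) fun n => ?_)).resolve_left
    (pow_ne_zero m hu))
  have h1 : (0 : ℤ) ≤ n * (-t - 1) := mul_nonneg (Int.natCast_nonneg n) (by linarith)
  obtain ⟨k, hk⟩ := Int.eq_ofNat_of_zero_le h1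
  have h2 := E.unif_pow_smul_mem_N (h n) k
  rw [smul_smul, ← zpow_natCast, ← hk, ← zpow_add₀ hu] at h2
  rw [smul_smul, ← zpow_natCast, ← zpow_add₀ hu]
  convert h2 using 3
  ring

namespace AbelianTauSheaf

variable {Fq Q : Type*} {A : Type uA} {L : Type uL}
  [Field Fq] [Fintype Fq] [CommRing A] [Algebra Fq A] [Algebra.FiniteType Fq A]
  [Field Q] [Algebra Fq Q] [Algebra A Q] [IsScalarTower Fq A Q] [IsDedekindDomain A]
  [IsFractionRing A Q] [Field L] [Finite L] [Algebra Fq L]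
  {inf : InftyPoint Fq A Q} {c : CharMap Fq A L}
  (F F' : AbelianTauSheaf.{w} inf c)

/-! ### Quasi-endomorphisms and the generic fibre -/

/-- A quasi-endomorphism is determined by its generic fibre in degree `0`. -/
def QEnd.eval : F.QEnd →ₐ[Q] Module.End (QL Fq Q L) (F.E 0).V :=
  (Pi.evalAlgHom Q (fun i => Module.End (QL Fq Q L) (F.E i).V) 0).comp F.QEnd.val

theorem QEnd.eval_injective : Function.Injective (QEnd.eval F) := fun f g h => by
  refine Subtype.ext ?_
  rw [(f.2 : IsQuasiMorphism F F f.1).toCommutes.eq_extendHom,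
    (g.2 : IsQuasiMorphism F F g.1).toCommutes.eq_extendHom]
  exact congrArg _ h

theorem QEnd.comm_phi (f : F.QEnd) (x : (F.E 0).V) :
    QEnd.eval F f (F.phi 0 x) = F.phi 0 (QEnd.eval F f x) :=
  (f.2 : IsQuasiMorphism F F f.1).toCommutes.comm_phi x

theorem QEnd.mem_range_eval (f : Module.End (QL Fq Q L) (F.E 0).V) :
    f ∈ (QEnd.eval F).range ↔ ∀ x, f (F.phi 0 x) = F.phi 0 (f x) :=
  ⟨by rintro ⟨f, rfl⟩; exact QEnd.comm_phi F f, fun hf =>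
    ⟨⟨F.extendHom F f, commutes_extendHom hf, exists_bounded rfl f⟩, F.extendHom_zero F f⟩⟩

theorem QEnd.eval_frobenius : QEnd.eval F F.frobenius = F.frobeniusMap 0 := rfl

instance QEnd.finite : Module.Finite Q F.QEnd := by
  let := inf.fieldQL (L := L)
  exact finite_phiEnd inf.cyclicExt (F.phi 0) (F.phi_injective 0) (F.frobeniusMap 0)
    (F.frobeniusMap_apply 0) (QEnd.eval F).toLinearMap (QEnd.eval_injective F) (QEnd.comm_phi F)

variable {F F'}

theorem comm_frobeniusMap {g : (F.E 0).V →ₗ[QL Fq Q L] (F'.E 0).V}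
    (hg : ∀ x, g (F.phi 0 x) = F'.phi 0 (g x)) (x : (F.E 0).V) :
    g (F.frobeniusMap 0 x) = F'.frobeniusMap 0 (g x) := by
  rw [frobeniusMap_apply, frobeniusMap_apply]
  exact (Function.Semiconj.iterate_right hg _) x

theorem qendIso_of_equiv (g : (F.E 0).V ≃ₗ[QL Fq Q L] (F'.E 0).V)
    (hg : ∀ x, g (F.phi 0 x) = F'.phi 0 (g x)) : F.QEndIso F' := by
  have hg' : ∀ x, g.symm (F'.phi 0 x) = F.phi 0 (g.symm x) := fun x => by
    rw [LinearEquiv.symm_apply_eq, hg, LinearEquiv.apply_symm_apply]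
  let a : F.QEnd →ₐ[Q] Module.End (QL Fq Q L) (F'.E 0).V :=
    (g.conjAlgEquiv Q).toAlgHom.comp (QEnd.eval F)
  have ha : ∀ f x, a f x = g (QEnd.eval F f (g.symm x)) := fun f x => rfl
  have hinj : Function.Injective a := (g.conjAlgEquiv Q).injective.comp (QEnd.eval_injective F)
  have hr : a.range = (QEnd.eval F').range := by
    ext f
    rw [QEnd.mem_range_eval]
    constructor
    · rintro ⟨f, rfl⟩ x
      change a f _ = F'.phi 0 (a f _)
      rw [ha, hg', QEnd.comm_phi, hg, ha]
    · intro hf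
      obtain ⟨f', hf'⟩ := (QEnd.mem_range_eval F ((g.conjAlgEquiv Q).symm f)).2 fun x => by
        change g.symm (f (g (F.phi 0 x))) = F.phi 0 (g.symm (f (g x)))
        rw [hg, hf, hg']
      refine ⟨f', ?_⟩
      change g.conjAlgEquiv Q (QEnd.eval F f') = f
      erw [hf']
      exact (g.conjAlgEquiv Q).apply_symm_apply f
  refine ⟨(AlgEquiv.ofInjective a hinj).trans ((Subalgebra.equivOfEq _ _ hr).trans
    (AlgEquiv.ofInjective (QEnd.eval F') (QEnd.eval_injective F')).symm), ?_⟩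
  refine QEnd.eval_injective F' ?_
  have h1 : ∀ y : (QEnd.eval F').range, QEnd.eval F'
      ((AlgEquiv.ofInjective (QEnd.eval F') (QEnd.eval_injective F')).symm y) = y := fun y =>
    congrArg Subtype.val
      ((AlgEquiv.ofInjective (QEnd.eval F') (QEnd.eval_injective F')).apply_symm_apply y)
  refine (h1 _).trans ?_
  refine LinearMap.ext fun x => ?_
  change g (F.frobeniusMap 0 (g.symm x)) = F'.frobeniusMap 0 x
  refine (comm_frobeniusMap (g := g.toLinearMap) hg _).trans ?_
  exact congrArg (F'.frobeniusMap 0) (g.apply_symm_apply x)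

variable (F F')

theorem finrank_E : finrank (QL Fq Q L) (F.E 0).V = F.r := F.rank_eq 0

theorem bijective_of_surjective {g : (F.E 0).V →ₗ[QL Fq Q L] (F'.E 0).V}
    (hg : Function.Surjective g) (hr : F.r = F'.r) : Function.Bijective g := by
  let := inf.fieldQL (L := L)
  exact ⟨(LinearMap.injective_iff_surjective_of_finrank_eq_finrank
    ((F.finrank_E.trans hr).trans F'.finrank_E.symm)).2 hg, hg⟩

theorem surjective_of_injective {g : (F.E 0).V →ₗ[QL Fq Q L] (F'.E 0).V}
    (hg : Function.Injective g) (hr : F.r = F'.r) : Function.Surjective g := by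
  let := inf.fieldQL (L := L)
  exact (LinearMap.injective_iff_surjective_of_finrank_eq_finrank
    ((F.finrank_E.trans hr).trans F'.finrank_E.symm)).1 hg

/-! ### Quasi-isogenies -/

theorem quasiIsogenous_iff :
    F.QuasiIsogenous F' ↔ F.PhiSurj F' ∧ F.r = F'.r ∧ F.d = F'.d := by
  constructor
  · rintro ⟨f, hf, hinj, hr, hd⟩
    exact ⟨⟨f 0, hf.toCommutes.comm_phi, F.surjective_of_injective F' (hinj 0) hr⟩, hr, hd⟩
  · rintro ⟨⟨g, hg, hs⟩, hr, hd⟩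
    refine ⟨F.extendHom F' g, ⟨commutes_extendHom hg, exists_bounded (by rw [hr, hd]) g⟩,
      fun i x y h => ?_, hr, hd⟩
    obtain ⟨x, rfl⟩ := (F.theta i).surjective x
    obtain ⟨y, rfl⟩ := (F.theta i).surjective y
    rw [extendHom_theta, extendHom_theta] at h
    rw [(F.bijective_of_surjective F' hs hr).1 ((F'.theta i).injective h)]

theorem IsSurjectiveMorphism.surjective {F F' : AbelianTauSheaf.{w} inf c}
    {f : ∀ i, (F.E i).V →ₗ[QL Fq Q L] (F'.E i).V} (hf : F.IsSurjectiveMorphism F' f) (i : ℤ) :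
    Function.Surjective (f i) := by
  rw [← LinearMap.range_eq_top, eq_top_iff, ← (F'.E i).span_M, Submodule.span_le, ← hf.map_M i]
  rintro _ ⟨x, -, rfl⟩
  exact ⟨x, rfl⟩

theorem PhiSurj.trans {F F' F'' : AbelianTauSheaf.{w} inf c} (h : F.PhiSurj F')
    (h' : F'.PhiSurj F'') : F.PhiSurj F'' := by
  obtain ⟨g, hg, hs⟩ := h
  obtain ⟨g', hg', hs'⟩ := h'
  refine ⟨g' ∘ₗ g, fun x => ?_, hs'.comp hs⟩
  change g' (g _) = F''.phi 0 (g' (g x))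
  rw [hg, hg']

theorem PhiSurj.symm {F F' : AbelianTauSheaf.{w} inf c} (h : F.PhiSurj F') (hr : F.r = F'.r) :
    F'.PhiSurj F := by
  obtain ⟨g, hg, hs⟩ := h
  let e := LinearEquiv.ofBijective g (F.bijective_of_surjective F' hs hr)
  have he : ∀ x, e x = g x := fun x => rfl
  refine ⟨e.symm.toLinearMap, fun x => ?_, e.symm.surjective⟩
  change e.symm (F'.phi 0 x) = F.phi 0 (e.symm x)
  rw [LinearEquiv.symm_apply_eq, he, hg, ← he, LinearEquiv.apply_symm_apply]

theorem phiSurj_of_quasiIsogenousToQuotient (h : F.QuasiIsogenousToQuotient F') :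
    F.PhiSurj F' := by
  obtain ⟨G, ⟨f, hf⟩, hG⟩ := h
  rw [quasiIsogenous_iff] at hG
  have h1 : F.PhiSurj G := ⟨f 0, hf.toCommutes.comm_phi, hf.surjective 0⟩
  exact h1.trans (hG.1.symm hG.2.1)

theorem PhiSurj.qendIso {F F' : AbelianTauSheaf.{w} inf c} (h : F.PhiSurj F')
    (hr : F.r = F'.r) : F.QEndIso F' := by
  obtain ⟨g, hg, hs⟩ := h
  exact qendIso_of_equiv (LinearEquiv.ofBijective g (F.bijective_of_surjective F' hs hr)) hg

/-! ### Purity -/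

theorem exists_tau_eq_of_mem_span_N (i : ℤ) (y : (F.E (i + 1)).V)
    (hy : y ∈ Submodule.span (OL L inf) (F.tau i '' (F.E i).N)) :
    ∃ x ∈ (F.E i).N, F.tau i x = y := by
  induction hy using Submodule.span_induction with
  | mem x hx => exact hx
  | zero => exact ⟨0, zero_mem _, map_zero _⟩
  | add x y _ _ hx hy =>
    obtain ⟨x', hx', rfl⟩ := hx
    obtain ⟨y', hy', rfl⟩ := hy
    exact ⟨x' + y', add_mem hx' hy', map_add _ _ _⟩
  | smul z y _ hy =>
    obtain ⟨y', hy', rfl⟩ := hy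
    obtain ⟨z', hz'⟩ := OL.exists_sig_eq z
    refine ⟨z' • y', Submodule.smul_mem _ _ hy', ?_⟩
    refine ((F.tau i).map_smulₛₗ (z' : QL Fq Q L) y').trans ?_
    rw [hz']
    rfl

variable {F F'}

theorem phi_mem_lattice_iff (hc : c.NeInfty) (i : ℤ) (x : (F.E 0).V) :
    F.phi 0 x ∈ F.lattice (i + 1) ↔ x ∈ F.lattice i := by
  refine ⟨fun h => ?_, F.phi_mem_lattice i⟩
  rw [mem_lattice, ← tau_theta] at h
  have h1 : graphIdealInfty inf c = ⊤ := by
    cases c with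
    | affine c => rfl
    | infty => exact hc.elim
  have h2 : F.tau i (F.theta i x) ∈ graphIdealInfty inf c ^ F.d • (F.E (i + 1)).N := by
    rw [h1, ← Ideal.one_eq_top, one_pow, Ideal.one_eq_top, Submodule.top_smul]
    exact h
  obtain ⟨y, hy, hxy⟩ := F.exists_tau_eq_of_mem_span_N i _ (F.graph_N i h2)
  rw [mem_lattice, ← F.tau_injective i hxy]
  exact hy

theorem phi_iterate_mem_lattice_iff (hc : c.NeInfty) (n : ℕ) : ∀ (i : ℤ) (x : (F.E 0).V),
    (F.phi 0)^[n] x ∈ F.lattice (i + n) ↔ x ∈ F.lattice i := by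
  induction n with
  | zero => intro i x; simp
  | succ n ih =>
    intro i x
    rw [Function.iterate_succ_apply, ← phi_mem_lattice_iff hc i x, ← ih (i + 1)]
    push_cast
    rw [add_right_comm, add_assoc]

theorem phi_iterate_smul (n : ℕ) (q : Q) (x : (F.E 0).V) :
    (F.phi 0)^[n] (q • x) = q • (F.phi 0)^[n] x := by
  induction n generalizing x with
  | zero => rfl
  | succ n ih => rw [Function.iterate_succ_apply, phi_smul, ih, Function.iterate_succ_apply]

theorem phi_surjective (F : AbelianTauSheaf.{w} inf c) : Function.Surjective (F.phi 0) := by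
  let := inf.fieldQL (L := L)
  exact (phi_bijective inf.cyclicExt (F.phi 0) (F.phi_injective 0) (F.frobeniusMap 0)
    (F.frobeniusMap_apply 0)).2

/-- If the characteristic is different from `∞`, sheaves with a non-zero homomorphism between
their generic fibres have the same weight. -/
theorem weight_eq_of_hom (hc : c.NeInfty) (f : (F.E 0).V →ₗ[QL Fq Q L] (F'.E 0).V)
    (hf : ∀ x, f (F.phi 0 x) = F'.phi 0 (f x)) (hf0 : f ≠ 0) : F.d * F'.r = F'.d * F.r := by
  obtain ⟨k, l, hk, hl, hkl, hper⟩ := F.exists_period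
  obtain ⟨k', l', hk', hl', hkl', hper'⟩ := F'.exists_period
  obtain ⟨m, hm⟩ := Bundle.exists_bound_N f
  have hN : ∀ x, x ∈ F.lattice 0 ↔ x ∈ (F.E 0).N := fun x => by rw [mem_lattice, theta_zero]
  have hN' : ∀ x, x ∈ F'.lattice 0 ↔ x ∈ (F'.E 0).N := fun x => by rw [mem_lattice, theta_zero]
  have key : ∀ n : ℕ, ∀ x, x ∈ F.lattice 0 ↔
      (F.phi 0)^[n * (l * l')] (inf.unif ^ (n * (l' * k) : ℤ) • x) ∈ F.lattice 0 := fun n x => by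
    rw [phi_iterate_smul, ← phi_iterate_mem_lattice_iff hc (n * (l * l')),
      show (0 : ℤ) + (n * (l * l') : ℕ) = 0 + (n * l' : ℤ) * l by push_cast; ring, hper, mul_assoc]
  have key' : ∀ n : ℕ, ∀ x, x ∈ F'.lattice 0 ↔
      (F'.phi 0)^[n * (l * l')] (inf.unif ^ (n * (l * k') : ℤ) • x) ∈ F'.lattice 0 := fun n x => by
    rw [phi_iterate_smul, ← phi_iterate_mem_lattice_iff hc (n * (l * l')),
      show (0 : ℤ) + (n * (l * l') : ℕ) = 0 + (n * l : ℤ) * l' by push_cast; ring, hper', mul_assoc]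
  have hfi : ∀ n x, f ((F.phi 0)^[n] x) = (F'.phi 0)^[n] (f x) := fun n x =>
    (Function.Semiconj.iterate_right hf n) x
  have hu := inf.unif_ne_zero
  obtain ⟨x, hx, hfx⟩ : ∃ x ∈ (F.E 0).N, f x ≠ 0 := by
    by_contra! h
    refine hf0 (LinearMap.ext fun y => ?_)
    obtain ⟨n, hn⟩ := (F.E 0).exists_unif_pow_smul_mem_N y
    have h1 := h _ hn
    rw [LinearMap.map_smul_of_tower] at h1
    exact (smul_eq_zero.1 h1).resolve_left (pow_ne_zero n hu)
  have h1 : (0 : ℤ) ≤ l' * k - l * k' := by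
    refine (F'.E 0).nonneg_of_forall_mem_N (F'.exists_basis_mem 0).choose hfx m fun n => ?_
    have h2 := hm _ ((hN _).1 ((key n x).1 ((hN x).2 hx)))
    rw [hfi, LinearMap.map_smul_of_tower, ← phi_iterate_smul, ← hN', smul_smul,
      ← zpow_natCast, ← zpow_add₀ hu] at h2
    rw [← hN', key' n, smul_smul, ← zpow_add₀ hu]
    convert h2 using 4
    ring
  have h2 : (0 : ℤ) ≤ l * k' - l' * k := by
    refine (F'.E 0).nonneg_of_forall_mem_N (F'.exists_basis_mem 0).choose hfx m fun n => ?_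
    obtain ⟨y, hy⟩ := (phi_surjective F).iterate (n * (l * l')) x
    have h3 : inf.unif ^ (-(n * (l' * k) : ℤ)) • y ∈ F.lattice 0 := by
      rw [key n, smul_smul, ← zpow_add₀ hu, add_neg_cancel, zpow_zero, one_smul, hy, hN]
      exact hx
    have h4 := hm _ ((hN _).1 h3)
    rw [LinearMap.map_smul_of_tower, ← hN', smul_smul, ← zpow_natCast, ← zpow_add₀ hu, key' n,
      smul_smul, ← zpow_add₀ hu, phi_iterate_smul, ← hfi, hy, hN'] at h4
    convert h4 using 3
    ring
  have h3 : l' * k = l * k' := by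
    have : (l' * k : ℤ) = l * k' := by linarith
    exact_mod_cast this
  refine Nat.eq_of_mul_eq_mul_left (Nat.mul_pos hl hl') ?_
  calc l * l' * (F.d * F'.r) = (l * F.d) * (l' * F'.r) := by ring
    _ = (l' * k) * F.r * F'.r := by rw [hkl]; ring
    _ = l * (k' * F'.r) * F.r := by rw [h3]; ring
    _ = l * l' * (F'.d * F.r) := by rw [← hkl']; ring

theorem d_eq_zero (hr : F.r = 0) : F.d = 0 := by
  obtain ⟨k, l, -, hl, hkl, -⟩ := F.periodic
  rw [hr, mul_zero] at hkl
  exact (Nat.mul_eq_zero.1 hkl).resolve_left hl.ne'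

theorem PhiSurj.d_eq (h : F.PhiSurj F') (hr : F.r = F'.r)
    (hw : c.NeInfty ∨ F.weight = F'.weight) : F.d = F'.d := by
  by_cases hr0 : F.r = 0
  · rw [d_eq_zero hr0, d_eq_zero (hr.symm.trans hr0)]
  rcases hw with hc | hw
  · obtain ⟨g, hg, hs⟩ := h
    have h1 := weight_eq_of_hom hc g hg fun h0 => hr0 (by
      let := inf.fieldQL (L := L)
      have : Subsingleton (F'.E 0).V := ⟨fun x y => by
        obtain ⟨x, rfl⟩ := hs x
        obtain ⟨y, rfl⟩ := hs y
        rw [h0, LinearMap.zero_apply, LinearMap.zero_apply]⟩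
      rw [hr, ← F'.finrank_E]
      exact finrank_zero_of_subsingleton)
    rw [hr] at h1 hr0
    exact Nat.eq_of_mul_eq_mul_right (Nat.pos_of_ne_zero hr0) h1
  · rw [weight, weight, ← hr] at hw
    have : (F.r : ℚ) ≠ 0 := by exact_mod_cast hr0
    have h1 := (div_left_inj' this).1 hw
    exact_mod_cast h1

end AbelianTauSheaf

end

section

universe u

open Module
open scoped TensorProduct

/-! ### Indices of lattices -/

theorem finite_quotient_span_singleton {k A : Type*} [Field k] [Finite k] [CommRing A]
    [IsDedekindDomain A] [Algebra k A] [Algebra.FiniteType k A] {a : A} (ha : a ≠ 0) :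
    Finite (A ⧸ Ideal.span {a}) := by
  have : Ring.KrullDimLE 0 (A ⧸ Ideal.span {a}) := by
    refine Ring.KrullDimLE.mk₀ fun P hP => ?_
    have hle : Ideal.span {a} ≤ P.comap (Ideal.Quotient.mk (Ideal.span {a})) := by
      intro x hx
      rw [Ideal.mem_comap, Ideal.Quotient.eq_zero_iff_mem.2 hx]
      exact zero_mem _
    have hm : (P.comap (Ideal.Quotient.mk (Ideal.span {a}))).IsMaximal := by
      refine Ideal.IsPrime.isMaximal inferInstance fun h0 => ha ?_
      rw [h0] at hle
      simpa using hle (Ideal.mem_span_singleton_self a)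
    have h1 := Ideal.map_comap_of_surjective _ (Ideal.Quotient.mk_surjective (I := Ideal.span {a})) P
    have h2 := Ideal.map_eq_top_or_isMaximal_of_surjective _
      (Ideal.Quotient.mk_surjective (I := Ideal.span {a})) hm
    rw [h1] at h2
    exact h2.resolve_left hP.ne_top
  have : Module.Finite k (A ⧸ Ideal.span {a}) := (Module.finite_iff_krullDimLE_zero k _).2 this
  exact Module.finite_of_finite k

theorem rank_add_rank_eq_iff {L : Type*} {X Y : Type u} [Field L] [Finite L] [AddCommGroup X]
    [Module L X] [AddCommGroup Y] [Module L Y] (d : ℕ) :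
    Module.rank L X + Module.rank L Y = d ↔ Nat.card X * Nat.card Y = Nat.card L ^ d := by
  have hL : 1 < Nat.card L := Finite.one_lt_card
  have h1 : ∀ [Module.Finite L X] [Module.Finite L Y], Module.rank L X + Module.rank L Y = d ↔
      Nat.card X * Nat.card Y = Nat.card L ^ d := by
    intro _ _
    rw [Module.natCard_eq_pow_finrank (K := L) (V := X),
      Module.natCard_eq_pow_finrank (K := L) (V := Y), ← pow_add,
      (Nat.pow_right_injective hL).eq_iff, ← finrank_eq_rank, ← finrank_eq_rank]
    exact_mod_cast Iff.rfl
  constructor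
  · intro h
    have h2 : Module.rank L X + Module.rank L Y < Cardinal.aleph0 := h ▸ Cardinal.natCast_lt_aleph0
    have := Module.rank_lt_aleph0_iff.1 (lt_of_le_of_lt (self_le_add_right _ _) h2)
    have := Module.rank_lt_aleph0_iff.1 (lt_of_le_of_lt (self_le_add_left _ _) h2)
    exact h1.1 h
  · intro h
    have h2 : Nat.card X * Nat.card Y ≠ 0 := h ▸ pow_ne_zero d (by omega)
    have : Finite X := Nat.finite_of_card_ne_zero (left_ne_zero_of_mul h2)
    have : Finite Y := Nat.finite_of_card_ne_zero (right_ne_zero_of_mul h2)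
    exact h1.2 h

theorem relIndex_eq_of_le_map {V : Type*} [AddCommGroup V] {φ : V →+ V}
    (hφ : Function.Injective φ) {X Y : AddSubgroup V} (hXY : X ≤ Y) (hX : X ≤ X.map φ)
    (hY : Y ≤ Y.map φ) (h : X.relIndex Y ≠ 0) : Y.relIndex (Y.map φ) = X.relIndex (X.map φ) := by
  have h1 := AddSubgroup.relIndex_mul_relIndex X Y (Y.map φ) hXY hY
  have h2 := AddSubgroup.relIndex_mul_relIndex X (X.map φ) (Y.map φ) hX (AddSubgroup.map_mono hXY)
  rw [AddSubgroup.relIndex_map_map_of_injective _ _ hφ, mul_comm] at h2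
  exact Nat.eq_of_mul_eq_mul_left (Nat.pos_of_ne_zero h) (h1.trans h2.symm)

theorem relIndex_eq_of_map_le {V : Type*} [AddCommGroup V] {φ : V →+ V}
    (hφ : Function.Injective φ) {X Y : AddSubgroup V} (hXY : X ≤ Y) (hX : X.map φ ≤ X)
    (hY : Y.map φ ≤ Y) (h : X.relIndex Y ≠ 0) : (Y.map φ).relIndex Y = (X.map φ).relIndex X := by
  have h1 := AddSubgroup.relIndex_mul_relIndex (X.map φ) X Y hX hXY
  have h2 := AddSubgroup.relIndex_mul_relIndex (X.map φ) (Y.map φ) Y (AddSubgroup.map_mono hXY) hY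
  rw [AddSubgroup.relIndex_map_map_of_injective _ _ hφ, mul_comm] at h2
  exact Nat.eq_of_mul_eq_mul_right (Nat.pos_of_ne_zero h) (by rw [h1, ← h2, mul_comm])

/-- A module of length `d` over a field which is killed by some power of an ideal is killed by
its `d`-th power. -/
theorem pow_smul_top_eq_bot {L R W : Type*} [Field L] [CommRing R] [Algebra L R] [AddCommGroup W]
    [Module L W] [Module R W] [IsScalarTower L R W] [FiniteDimensional L W] (I : Ideal R) {n : ℕ}
    (h : I ^ n • (⊤ : Submodule R W) = ⊥) : I ^ finrank L W • (⊤ : Submodule R W) = ⊥ := by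
  let S : ℕ → Submodule L W := fun j => (I ^ j • (⊤ : Submodule R W)).restrictScalars L
  have hanti : ∀ j, I ^ (j + 1) • (⊤ : Submodule R W) ≤ I ^ j • ⊤ := fun j =>
    Submodule.smul_mono_left (Ideal.pow_le_pow_right (Nat.le_succ j))
  have h1 : ∀ j, I ^ j • (⊤ : Submodule R W) = ⊥ ∨ finrank L (S j) + j ≤ finrank L W := by
    intro j
    induction j with
    | zero => exact Or.inr (by rw [add_zero]; exact Submodule.finrank_le _)
    | succ j ih =>
      rcases ih with ih | ih
      · exact Or.inl (le_bot_iff.1 (ih ▸ hanti j))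
      · by_cases heq : I ^ (j + 1) • (⊤ : Submodule R W) = I ^ j • ⊤
        · left
          have h2 : ∀ m, I ^ (j + m) • (⊤ : Submodule R W) = I ^ j • ⊤ := by
            intro m
            induction m with
            | zero => rfl
            | succ m ih =>
              rw [← add_assoc, pow_succ', mul_smul, ih, ← mul_smul, ← pow_succ', heq]
          rw [heq, ← h2 n, pow_add, mul_smul, h, Submodule.smul_bot]
        · right
          have hlt : S (j + 1) < S j := lt_of_le_of_ne (hanti j) fun h =>
            heq (Submodule.restrictScalars_injective L R W h)
          have := Submodule.finrank_lt_finrank_of_lt hlt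
          omega
  rcases h1 (finrank L W) with h2 | h2
  · exact h2
  · have h3 : S (finrank L W) = ⊥ := Submodule.finrank_eq_zero.1 (by omega)
    exact Submodule.restrictScalars_injective L R W h3

namespace Bundle

variable {Fq A Q L : Type*} [Field Fq] [CommRing A] [Algebra Fq A] [Field Q]
  [Algebra Fq Q] [Algebra A Q] [IsScalarTower Fq A Q] [IsDedekindDomain A] [IsFractionRing A Q]
  [Field L] [Algebra Fq L] {inf : InftyPoint Fq A Q} (E : Bundle.{w} L inf)

theorem cokerDim_iff [Finite L] (M' : Submodule (AL Fq A Q L) E.V) (N' : Submodule (OL L inf) E.V)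
    (d : ℕ) : E.CokerDim M' N' d ↔ M'.toAddSubgroup.relIndex E.M.toAddSubgroup *
      N'.toAddSubgroup.relIndex E.N.toAddSubgroup = Nat.card L ^ d := by
  let : Module L (E.M ⧸ M'.submoduleOf E.M) := Module.compHom _ (LtoAL Fq A Q L)
  let : Module L (E.N ⧸ N'.submoduleOf E.N) := Module.compHom _ (LtoOL L inf)
  exact rank_add_rank_eq_iff (L := L) (X := E.M ⧸ M'.submoduleOf E.M)
    (Y := E.N ⧸ N'.submoduleOf E.N) d

/-- The lattices of `E` have finite index in each other. -/
theorem relIndex_M_ne_zero [Finite Fq] [Algebra.FiniteType Fq A] [Finite L] (a b : A) (ha : a ≠ 0) (hb : b ≠ 0)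
    {X Y : AddSubgroup E.V}
    (hX : ∀ x ∈ E.M, algebraMap A Q a • x ∈ X) (hY : ∀ x ∈ Y, algebraMap A Q b • x ∈ E.M) :
    X.relIndex Y ≠ 0 := by
  have hinj : ∀ q : Q, q ≠ 0 → Function.Injective (DistribSMul.toAddMonoidHom E.V q) :=
    fun q hq => smul_right_injective _ hq
  have hne : ∀ {a : A}, a ≠ 0 → algebraMap A Q a ≠ 0 := fun h =>
    (map_ne_zero_iff _ (IsFractionRing.injective A Q)).2 h
  let g := DistribSMul.toAddMonoidHom E.V (algebraMap A Q (a * b))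
  have h1 : (E.M.toAddSubgroup.map g).relIndex E.M.toAddSubgroup ≠ 0 := by
    let : Module A E.M := Module.compHom _ (AtoAL Fq A Q L)
    let : Algebra A (AL Fq A Q L) := (AtoAL Fq A Q L).toAlgebra
    have : Module.Finite A (AL Fq A Q L) := AL.finite
    have : Module.Finite (AL Fq A Q L) E.M := Module.Finite.iff_fg.2 E.M_fg
    have : IsScalarTower A (AL Fq A Q L) E.M := ⟨fun a z x => by
      rw [Algebra.smul_def, mul_smul]
      rfl⟩
    have : Module.Finite A E.M := Module.Finite.trans (AL Fq A Q L) _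
    have : Finite (A ⧸ Ideal.span {a * b}) :=
      finite_quotient_span_singleton (k := Fq) (mul_ne_zero ha hb)
    have hfin : Finite (E.M ⧸ (Ideal.span {a * b} • ⊤ : Submodule A E.M)) :=
      Module.finite_of_finite (A ⧸ Ideal.span {a * b})
    have h2 : ((E.M.toAddSubgroup.map g).addSubgroupOf E.M.toAddSubgroup) =
        (Ideal.span {a * b} • ⊤ : Submodule A E.M).toAddSubgroup := by
      ext ⟨x, hx⟩
      rw [AddSubgroup.mem_addSubgroupOf]
      change _ ↔ _ ∈ (Ideal.span {a * b} • ⊤ : Submodule A E.M)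
      rw [Submodule.ideal_span_singleton_smul]
      constructor
      · rintro ⟨y, hy, hxy⟩
        exact ⟨⟨y, hy⟩, trivial, Subtype.ext hxy⟩
      · rintro ⟨y, -, hxy⟩
        exact ⟨y, y.2, congrArg Subtype.val hxy⟩
    rw [AddSubgroup.relIndex, h2]
    exact (Nat.card_pos (α := E.M ⧸ (Ideal.span {a * b} • ⊤ : Submodule A E.M))).ne'
  have h2 : (E.M.toAddSubgroup.map g).relIndex (Y.map (DistribSMul.toAddMonoidHom E.V (algebraMap A Q b))) ≠ 0 := by
    intro h0
    refine h1 (AddSubgroup.relIndex_eq_zero_of_le_right ?_ h0)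
    rintro _ ⟨y, hy, rfl⟩
    exact hY y hy
  intro h0
  rw [← AddSubgroup.relIndex_map_map_of_injective _ _ (hinj _ (hne hb))] at h0
  refine h2 (AddSubgroup.relIndex_eq_zero_of_le_left ?_ h0)
  rintro _ ⟨y, hy, rfl⟩
  refine ⟨_, hX y hy, ?_⟩
  change algebraMap A Q b • algebraMap A Q a • y = algebraMap A Q (a * b) • y
  rw [smul_smul, ← map_mul, mul_comm]

end Bundle

end

section

open Module
open scoped TensorProduct

variable {Fq Q : Type*} {A : Type uA} {L : Type uL}
  [Field Fq] [Fintype Fq] [CommRing A] [Algebra Fq A] [Algebra.FiniteType Fq A]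
  [Field Q] [Algebra Fq Q] [Algebra A Q] [IsScalarTower Fq A Q] [IsDedekindDomain A]
  [IsFractionRing A Q] [Field L] [Finite L] [Algebra Fq L]
  {inf : InftyPoint Fq A Q} {c : CharMap Fq A L}

theorem comp_chain {E E' : ℤ → Bundle.{w} L inf}
    {P : ∀ i, (E i).V →ₗ[QL Fq Q L] (E (i + 1)).V} {P' : ∀ i, (E' i).V →ₗ[QL Fq Q L] (E' (i + 1)).V}
    (f : ∀ i, (E i).V →ₗ[QL Fq Q L] (E' i).V) (hf : ∀ i x, f (i + 1) (P i x) = P' i (f i x)) (n : ℕ) :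
    ∀ (i j : ℤ) (h : j = i + n) (x : (E i).V), f j (chain E P n i j h x) = chain E' P' n i j h (f i x) := by
  induction n with
  | zero =>
    intro i j h x
    obtain rfl : i = j := by simp [h]
    rfl
  | succ n ih =>
    intro i j h x
    change f j (chain E P n (i + 1) j _ (P i x)) = chain E' P' n (i + 1) j _ (P' i (f i x))
    rw [ih, hf]

/-- The image of a locally free sheaf under a surjective map of generic fibres. -/
def Bundle.image (E E' : Bundle.{w} L inf) (f : E.V →ₗ[QL Fq Q L] E'.V)
    (hf : Function.Surjective f) : Bundle.{w} L inf where
  V := E'.V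
  M := E.M.map (f.restrictScalars (AL Fq A Q L))
  N := E.N.map (f.restrictScalars (OL L inf))
  M_fg := E.M_fg.map _
  N_fg := E.N_fg.map _
  span_M := by
    have : ((E.M.map (f.restrictScalars (AL Fq A Q L)) : Submodule _ _) : Set E'.V) = f '' E.M := rfl
    rw [this, ← Submodule.map_span, E.span_M, Submodule.map_top, LinearMap.range_eq_top.2 hf]
  span_N := by
    have : ((E.N.map (f.restrictScalars (OL L inf)) : Submodule _ _) : Set E'.V) = f '' E.N := rfl
    rw [this, ← Submodule.map_span, E.span_N, Submodule.map_top, LinearMap.range_eq_top.2 hf]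

namespace AbelianTauSheaf

variable (F F' : AbelianTauSheaf.{w} inf c)

theorem extendHom_surjective {f : (F.E 0).V →ₗ[QL Fq Q L] (F'.E 0).V} (hs : Function.Surjective f)
    (i : ℤ) : Function.Surjective (F.extendHom F' f i) :=
  (F'.theta i).surjective.comp (hs.comp (F.theta i).symm.surjective)

/-! #### The image lattices, in coordinates of the generic fibre in degree `0` -/

/-- The image of `Γ(C_L ∖ {∞}, F_0)`. -/
def imM (f : (F.E 0).V →ₗ[QL Fq Q L] (F'.E 0).V) : AddSubgroup (F'.E 0).V :=
  (F.E 0).M.toAddSubgroup.map f.toAddMonoidHom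

/-- The image of the stalk of `F_i` at `∞`. -/
def imN (f : (F.E 0).V →ₗ[QL Fq Q L] (F'.E 0).V) (i : ℤ) : AddSubgroup (F'.E 0).V :=
  (F.lattice i).toAddSubgroup.map f.toAddMonoidHom

/-- `theta` as a homomorphism of groups. -/
def thetaHom (i : ℤ) : (F.E 0).V →+ (F.E i).V := (F.theta i).toLinearMap.toAddMonoidHom

/-- `phi` as a homomorphism of groups. -/
def phiHom : (F.E 0).V →+ (F.E 0).V := (F.phi 0).toAddMonoidHom

variable {F F'} (f : (F.E 0).V →ₗ[QL Fq Q L] (F'.E 0).V)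

theorem map_extendHom_M (i : ℤ) :
    ((F.E i).M.map ((F.extendHom F' f i).restrictScalars (AL Fq A Q L))).toAddSubgroup =
      (F.imM F' f).map (F'.thetaHom i) := by
  ext y
  constructor
  · rintro ⟨x, hx, rfl⟩
    obtain ⟨x, rfl⟩ := (F.theta i).surjective x
    exact ⟨_, ⟨x, (F.theta_mem_M i x).1 hx, rfl⟩, (F.extendHom_theta F' f i x).symm⟩
  · rintro ⟨_, ⟨x, hx, rfl⟩, rfl⟩
    exact ⟨_, (F.theta_mem_M i x).2 hx, F.extendHom_theta F' f i x⟩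

theorem map_extendHom_N (i : ℤ) :
    ((F.E i).N.map ((F.extendHom F' f i).restrictScalars (OL L inf))).toAddSubgroup =
      (F.imN F' f i).map (F'.thetaHom i) := by
  ext y
  constructor
  · rintro ⟨x, hx, rfl⟩
    obtain ⟨x, rfl⟩ := (F.theta i).surjective x
    exact ⟨_, ⟨x, hx, rfl⟩, (F.extendHom_theta F' f i x).symm⟩
  · rintro ⟨_, ⟨x, hx, rfl⟩, rfl⟩
    exact ⟨_, hx, F.extendHom_theta F' f i x⟩

variable {i : ℤ} {R : Subalgebra Fq (QL Fq Q L)} {S : Submodule R (F.E i).V} {H : AddSubgroup (F.E 0).V}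

theorem toAddSubgroup_map_Pi (hS : S.toAddSubgroup = H.map (F.thetaHom i)) :
    (S.map ((F.Pi i).restrictScalars R)).toAddSubgroup = H.map (F.thetaHom (i + 1)) := by
  ext y
  constructor
  · rintro ⟨x, hx, rfl⟩
    obtain ⟨x, hx', rfl⟩ : x ∈ H.map (F.thetaHom i) := hS ▸ hx
    exact ⟨x, hx', F.theta_succ i x⟩
  · rintro ⟨x, hx, rfl⟩
    have h1 : F.theta i x ∈ S.toAddSubgroup := by
      rw [hS]
      exact ⟨x, hx, rfl⟩
    exact ⟨_, h1, (F.theta_succ i x).symm⟩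

theorem toAddSubgroup_span_tau (hR : ∀ z : R, ∃ z' : R, sig Fq Q L z' = z)
    (hS : S.toAddSubgroup = H.map (F.thetaHom i)) :
    (Submodule.span R (F.tau i '' S)).toAddSubgroup = (H.map F.phiHom).map (F.thetaHom (i + 1)) := by
  have h1 : ∀ y ∈ Submodule.span R (F.tau i '' S), ∃ x ∈ S, F.tau i x = y := by
    intro y hy
    induction hy using Submodule.span_induction with
    | mem x hx => exact hx
    | zero => exact ⟨0, zero_mem _, map_zero _⟩
    | add x y _ _ hx hy =>
      obtain ⟨x', hx', rfl⟩ := hx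
      obtain ⟨y', hy', rfl⟩ := hy
      exact ⟨x' + y', add_mem hx' hy', map_add _ _ _⟩
    | smul z y _ hy =>
      obtain ⟨y', hy', rfl⟩ := hy
      obtain ⟨z', hz'⟩ := hR z
      refine ⟨z' • y', Submodule.smul_mem _ _ hy', ?_⟩
      refine ((F.tau i).map_smulₛₗ (z' : QL Fq Q L) y').trans ?_
      rw [hz']
      rfl
  ext y
  constructor
  · intro hy
    obtain ⟨x, hx, rfl⟩ := h1 y hy
    obtain ⟨x, hx', rfl⟩ : x ∈ H.map (F.thetaHom i) := hS ▸ hx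
    exact ⟨_, ⟨x, hx', rfl⟩, (F.tau_theta i x).symm⟩
  · rintro ⟨_, ⟨x, hx, rfl⟩, rfl⟩
    have h2 : F.theta i x ∈ S.toAddSubgroup := by
      rw [hS]
      exact ⟨x, hx, rfl⟩
    exact Submodule.subset_span ⟨_, h2, F.tau_theta i x⟩

theorem thetaHom_injective (i : ℤ) : Function.Injective (F.thetaHom i) := (F.theta i).injective

theorem phiHom_injective : Function.Injective F.phiHom := F.phi_injective 0

theorem M_eq_map_thetaHom (i : ℤ) :
    (F.E i).M.toAddSubgroup = (F.E 0).M.toAddSubgroup.map (F.thetaHom i) := by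
  ext y
  constructor
  · intro hy
    obtain ⟨x, rfl⟩ := (F.theta i).surjective y
    exact ⟨x, (F.theta_mem_M i x).1 hy, rfl⟩
  · rintro ⟨x, hx, rfl⟩
    exact (F.theta_mem_M i x).2 hx

theorem N_eq_map_thetaHom (i : ℤ) :
    (F.E i).N.toAddSubgroup = (F.lattice i).toAddSubgroup.map (F.thetaHom i) := by
  ext y
  constructor
  · intro hy
    obtain ⟨x, rfl⟩ := (F.theta i).surjective y
    exact ⟨x, hy, rfl⟩
  · rintro ⟨x, hx, rfl⟩
    exact hx

theorem relIndex_lattice (F : AbelianTauSheaf.{w} inf c) (i : ℤ) :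
    (F.lattice i).toAddSubgroup.relIndex (F.lattice (i + 1)).toAddSubgroup = Nat.card L ^ F.d := by
  have h := ((F.E (i + 1)).cokerDim_iff _ _ _).1 (F.coker_Pi i)
  rw [toAddSubgroup_map_Pi (M_eq_map_thetaHom i), toAddSubgroup_map_Pi (N_eq_map_thetaHom i),
    M_eq_map_thetaHom (i + 1), N_eq_map_thetaHom (i + 1), AddSubgroup.relIndex_self, one_mul,
    AddSubgroup.relIndex_map_map_of_injective _ _ (thetaHom_injective _)] at h
  exact h

theorem map_phiHom_lattice (hc : c.NeInfty) (F : AbelianTauSheaf.{w} inf c) (i : ℤ) :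
    (F.lattice i).toAddSubgroup.map F.phiHom = (F.lattice (i + 1)).toAddSubgroup := by
  ext y
  constructor
  · rintro ⟨x, hx, rfl⟩
    exact F.phi_mem_lattice i hx
  · intro hy
    obtain ⟨x, rfl⟩ := F.phi_surjective y
    exact ⟨x, (phi_mem_lattice_iff hc i x).1 hy, rfl⟩

theorem relIndex_map_phiHom_M (hc : c.NeInfty) (F : AbelianTauSheaf.{w} inf c) :
    ((F.E 0).M.toAddSubgroup.map F.phiHom).relIndex (F.E 0).M.toAddSubgroup = Nat.card L ^ F.d := by
  have h := ((F.E (0 + 1)).cokerDim_iff _ _ _).1 (F.coker_tau 0)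
  rw [toAddSubgroup_span_tau exists_sig_eq (M_eq_map_thetaHom 0),
    toAddSubgroup_span_tau OL.exists_sig_eq (N_eq_map_thetaHom 0), map_phiHom_lattice hc,
    M_eq_map_thetaHom (0 + 1), N_eq_map_thetaHom (0 + 1), AddSubgroup.relIndex_self, mul_one,
    AddSubgroup.relIndex_map_map_of_injective _ _ (thetaHom_injective _)] at h
  exact h

theorem relIndex_lattice_ne_zero (F : AbelianTauSheaf.{w} inf c) (i : ℤ) (n : ℕ) :
    (F.lattice i).toAddSubgroup.relIndex (F.lattice (i + n)).toAddSubgroup ≠ 0 := by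
  induction n with
  | zero => rw [Nat.cast_zero, add_zero, AddSubgroup.relIndex_self]; exact one_ne_zero
  | succ n ih =>
    refine AddSubgroup.relIndex_ne_zero_trans ih ?_
    rw [Nat.cast_succ, ← add_assoc, relIndex_lattice]
    exact pow_ne_zero _ Nat.card_pos.ne'

/-! #### Indices of the image lattices -/

variable {f : (F.E 0).V →ₗ[QL Fq Q L] (F'.E 0).V}

theorem map_phiHom_imN (hc : c.NeInfty) (hf : ∀ x, f (F.phi 0 x) = F'.phi 0 (f x)) (i : ℤ) :
    (F.imN F' f i).map F'.phiHom = F.imN F' f (i + 1) := by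
  rw [imN, imN, ← map_phiHom_lattice hc, AddSubgroup.map_map, AddSubgroup.map_map]
  congr 1
  exact AddMonoidHom.ext fun x => (hf x).symm

theorem imN_le_succ (i : ℤ) : F.imN F' f i ≤ F.imN F' f (i + 1) :=
  AddSubgroup.map_mono (F.lattice_le_succ i)

theorem unif_pow_smul_mem_imN {i : ℤ} {x : (F'.E 0).V} (hx : x ∈ F.imN F' f i) (n : ℕ) :
    inf.unif ^ n • x ∈ F.imN F' f i := by
  obtain ⟨y, hy, rfl⟩ := hx
  exact ⟨_, F.unif_pow_smul_mem_lattice i hy n, LinearMap.map_smul_of_tower f _ y⟩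

theorem relIndex_imN (hc : c.NeInfty) (hf : ∀ x, f (F.phi 0 x) = F'.phi 0 (f x))
    (hs : Function.Surjective f) (i : ℤ) :
    (F.imN F' f i).relIndex (F.imN F' f (i + 1)) = Nat.card L ^ F'.d := by
  obtain ⟨k, l, hk, -, -, hper⟩ := F'.exists_period
  have hsi := F.extendHom_surjective F' hs i
  let G := (F.E i).image (F'.E i) (F.extendHom F' f i) hsi
  have hG : G.N.toAddSubgroup = (F.imN F' f i).map (F'.thetaHom i) := map_extendHom_N f i
  obtain ⟨m, hm⟩ := Bundle.exists_bound_N (E := F'.E i) (E' := G) LinearMap.id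
  obtain ⟨m', hm'⟩ := Bundle.exists_bound_N (E := G) (E' := F'.E i) LinearMap.id
  have hmem : ∀ x, x ∈ F.imN F' f i ↔ F'.theta i x ∈ G.N := fun x => by
    change _ ↔ F'.theta i x ∈ G.N.toAddSubgroup
    rw [hG]
    exact (AddSubgroup.mem_map_iff_mem (thetaHom_injective i)).symm
  replace hm : ∀ x, F'.theta i x ∈ (F'.E i).N → inf.unif ^ m • x ∈ F.imN F' f i := fun x hx => by
    rw [hmem, theta_smul]
    exact hm _ hx
  replace hm' : ∀ x ∈ F.imN F' f i, F'.theta i (inf.unif ^ m' • x) ∈ (F'.E i).N := fun x hx => by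
    rw [theta_smul]
    exact hm' _ ((hmem x).1 hx)
  have hu := inf.unif_ne_zero
  have hX : (F'.lattice (i - m * l)).toAddSubgroup ≤ F.imN F' f i := by
    intro x hx
    have h1 : x ∈ F'.lattice (i + (-m : ℤ) * l) := by rwa [neg_mul, ← sub_eq_add_neg]
    rw [hper, mem_lattice] at h1
    have h2 := unif_pow_smul_mem_imN (hm _ h1) (m * (k - 1))
    rw [smul_smul, smul_smul, ← zpow_natCast, ← zpow_natCast,
      ← zpow_add₀ hu, ← zpow_add₀ hu] at h2
    rwa [show ((m * (k - 1) : ℕ) : ℤ) + m + -m * k = 0 by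
      push_cast [Nat.cast_sub hk]
      ring, zpow_zero, one_smul] at h2
  have hY : F.imN F' f i ≤ (F'.lattice (i + m' * l)).toAddSubgroup := by
    intro x hx
    change x ∈ F'.lattice (i + (m' : ℤ) * l)
    rw [hper, mem_lattice]
    have h2 := (F'.E i).unif_pow_smul_mem_N (hm' x hx) (m' * (k - 1))
    rw [theta_smul, smul_smul, ← pow_add] at h2
    rw [theta_smul, ← Nat.cast_mul, zpow_natCast]
    convert h2 using 3
    obtain ⟨k, rfl⟩ : ∃ n, k = n + 1 := ⟨k - 1, by omega⟩
    rw [Nat.add_sub_cancel]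
    ring
  have hne : (F'.lattice (i - m * l)).toAddSubgroup.relIndex (F.imN F' f i) ≠ 0 := by
    intro h0
    refine F'.relIndex_lattice_ne_zero (i - m * l) (m * l + m' * l)
      (AddSubgroup.relIndex_eq_zero_of_le_right ?_ h0)
    convert hY using 3
    push_cast
    ring
  have h1 := relIndex_eq_of_le_map (φ := F'.phiHom) phiHom_injective hX
    (by rw [map_phiHom_lattice hc]; exact F'.lattice_le_succ _)
    (by rw [map_phiHom_imN hc hf]; exact imN_le_succ i) hne
  rw [map_phiHom_lattice hc, map_phiHom_imN hc hf, relIndex_lattice] at h1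
  exact h1

theorem map_phiHom_imM_le (hf : ∀ x, f (F.phi 0 x) = F'.phi 0 (f x)) :
    (F.imM F' f).map F'.phiHom ≤ F.imM F' f := by
  rintro _ ⟨_, ⟨x, hx, rfl⟩, rfl⟩
  exact ⟨F.phi 0 x, F.phi_mem_M 0 hx, hf x⟩

theorem relIndex_imM (hc : c.NeInfty) (hf : ∀ x, f (F.phi 0 x) = F'.phi 0 (f x))
    (hs : Function.Surjective f) :
    ((F.imM F' f).map F'.phiHom).relIndex (F.imM F' f) = Nat.card L ^ F'.d := by
  let G := (F.E 0).image (F'.E 0) f hs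
  obtain ⟨a, ha, hm⟩ := Bundle.exists_bound_M (E := F'.E 0) (E' := G) LinearMap.id
  obtain ⟨b, hb, hm'⟩ := Bundle.exists_bound_M (E := G) (E' := F'.E 0) LinearMap.id
  let g := DistribSMul.toAddMonoidHom (F'.E 0).V (algebraMap A Q a)
  have hg : Function.Injective g :=
    smul_right_injective _ ((map_ne_zero_iff _ (IsFractionRing.injective A Q)).2 ha)
  have hX : (F'.E 0).M.toAddSubgroup.map g ≤ F.imM F' f := by
    rintro _ ⟨x, hx, rfl⟩
    exact hm x hx
  have hne : ((F'.E 0).M.toAddSubgroup.map g).relIndex (F.imM F' f) ≠ 0 :=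
    (F'.E 0).relIndex_M_ne_zero a b ha hb (fun x hx => ⟨x, hx, rfl⟩) fun x hx => hm' x hx
  have hcomm : ((F'.E 0).M.toAddSubgroup.map g).map F'.phiHom =
      ((F'.E 0).M.toAddSubgroup.map F'.phiHom).map g := by
    rw [AddSubgroup.map_map, AddSubgroup.map_map]
    congr 1
    exact AddMonoidHom.ext fun x => F'.phi_smul 0 _ x
  have hle : (F'.E 0).M.toAddSubgroup.map F'.phiHom ≤ (F'.E 0).M.toAddSubgroup := by
    rintro _ ⟨x, hx, rfl⟩
    exact F'.phi_mem_M 0 hx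
  rw [relIndex_eq_of_map_le (φ := F'.phiHom) phiHom_injective hX
    (by rw [hcomm]; exact AddSubgroup.map_mono hle) (map_phiHom_imM_le hf) hne, hcomm,
    AddSubgroup.relIndex_map_map_of_injective _ _ hg, relIndex_map_phiHom_M hc]

end AbelianTauSheaf

end

section

open Module
open scoped TensorProduct

variable {Fq Q : Type*} {A : Type uA} {L : Type uL}
  [Field Fq] [Fintype Fq] [CommRing A] [Algebra Fq A] [Algebra.FiniteType Fq A]
  [Field Q] [Algebra Fq Q] [Algebra A Q] [IsScalarTower Fq A Q] [IsDedekindDomain A]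
  [IsFractionRing A Q] [Field L] [Finite L] [Algebra Fq L]
  {inf : InftyPoint Fq A Q} {c : CharMap Fq A L}

theorem pow_smul_le_of_rank_le {L R V : Type*} [Field L] [CommRing R] [Algebra L R] [AddCommGroup V]
    [Module R V] (E T : Submodule R V) [Module L (E ⧸ T.submoduleOf E)]
    [IsScalarTower L R (E ⧸ T.submoduleOf E)] {d n : ℕ}
    (hle : Module.rank L (E ⧸ T.submoduleOf E) ≤ d) {I : Ideal R} (hI : I ^ n • E ≤ T) :
    I ^ d • E ≤ T := by
  have : FiniteDimensional L (E ⧸ T.submoduleOf E) :=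
    Module.rank_lt_aleph0_iff.1 (lt_of_le_of_lt hle Cardinal.natCast_lt_aleph0)
  have hfin : finrank L (E ⧸ T.submoduleOf E) ≤ d := finrank_le_of_rank_le hle
  have key : ∀ m, I ^ m • (⊤ : Submodule R (E ⧸ T.submoduleOf E)) = ⊥ ↔ I ^ m • E ≤ T := by
    intro m
    have h1 : (⊤ : Submodule R (E ⧸ T.submoduleOf E)) =
        (⊤ : Submodule R E).map (T.submoduleOf E).mkQ := by
      rw [Submodule.map_top, Submodule.range_mkQ]
    rw [h1, ← Submodule.map_smul'', ← le_bot_iff, Submodule.map_le_iff_le_comap, Submodule.comap_bot,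
      Submodule.ker_mkQ,
      Submodule.submoduleOf, ← Submodule.map_le_iff_le_comap, Submodule.map_smul'',
      Submodule.map_top, Submodule.range_subtype]
  rw [← key] at hI ⊢
  have h2 := pow_smul_top_eq_bot (L := L) I hI
  rw [← le_bot_iff, ← h2]
  exact Submodule.smul_mono_left (Ideal.pow_le_pow_right hfin)

theorem Bundle.smul_le_of_cokerDim (E : Bundle.{w} L inf) {T : Submodule (AL Fq A Q L) E.V}
    {T' : Submodule (OL L inf) E.V} {d n : ℕ} (h : E.CokerDim T T' d) {I : Ideal (AL Fq A Q L)}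
    (hI : I ^ n • E.M ≤ T) : I ^ d • E.M ≤ T := by
  let : Algebra L (AL Fq A Q L) := (LtoAL Fq A Q L).toAlgebra
  let : Module L (E.M ⧸ T.submoduleOf E.M) := Module.compHom _ (LtoAL Fq A Q L)
  let : Module L (E.N ⧸ T'.submoduleOf E.N) := Module.compHom _ (LtoOL L inf)
  have h' : Module.rank L (E.M ⧸ T.submoduleOf E.M) +
    Module.rank L (E.N ⧸ T'.submoduleOf E.N) = d := h
  have : IsScalarTower L (AL Fq A Q L) (E.M ⧸ T.submoduleOf E.M) := ⟨fun a z x => by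
    rw [Algebra.smul_def, mul_smul]
    rfl⟩
  exact pow_smul_le_of_rank_le (L := L) E.M T (h' ▸ self_le_add_right _ _) hI

namespace AbelianTauSheaf

variable {F F' : AbelianTauSheaf.{w} inf c}

theorem graphIdealInfty_eq_top (hc : c.NeInfty) : graphIdealInfty inf c = ⊤ := by
  cases c with
  | affine c => rfl
  | infty => exact hc.elim

theorem exists_period_of_hom (hw : F.d * F'.r = F'.d * F.r) (hr : F'.r ≤ F.r) :
    ∃ k l : ℕ, 0 < k ∧ 0 < l ∧ l * F'.d = k * F'.r ∧ ∀ i : ℤ,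
    (F.E i).M.map ((chain F.E F.Pi l i (i + l) rfl).restrictScalars (AL Fq A Q L)) = (F.E (i + l)).M ∧
    (F.E i).N.map ((chain F.E F.Pi l i (i + l) rfl).restrictScalars (OL L inf))
      = inftyIdeal L inf ^ k • (F.E (i + l)).N := by
  obtain ⟨k, l, hk, hl, hkl, h⟩ := F.periodic
  refine ⟨k, l, hk, hl, ?_, h⟩
  rcases Nat.eq_zero_or_pos F.r with h0 | h0
  · have h1 : F'.r = 0 := by omega
    rw [d_eq_zero h1, h1, mul_zero, mul_zero]
  · refine Nat.eq_of_mul_eq_mul_right h0 ?_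
    calc l * F'.d * F.r = l * (F.d * F'.r) := by rw [hw]; ring
      _ = k * F'.r * F.r := by rw [← mul_assoc, hkl]; ring

variable {f : (F.E 0).V →ₗ[QL Fq Q L] (F'.E 0).V}

/-- The image of `Γ(C_L ∖ {∞}, F_i)`. -/
abbrev quotientM (f : (F.E 0).V →ₗ[QL Fq Q L] (F'.E 0).V) (i : ℤ) :
    Submodule (AL Fq A Q L) (F'.E i).V :=
  (F.E i).M.map ((F.extendHom F' f i).restrictScalars (AL Fq A Q L))

/-- The image of the stalk of `F_i` at `∞`. -/
abbrev quotientN (f : (F.E 0).V →ₗ[QL Fq Q L] (F'.E 0).V) (i : ℤ) :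
    Submodule (OL L inf) (F'.E i).V :=
  (F.E i).N.map ((F.extendHom F' f i).restrictScalars (OL L inf))

/-- The image of `F_i`. -/
abbrev quotientE (hs : Function.Surjective f) (i : ℤ) : Bundle.{w} L inf :=
  (F.E i).image (F'.E i) (F.extendHom F' f i) (F.extendHom_surjective F' hs i)

theorem quotient_coker_Pi (hc : c.NeInfty) (hf : ∀ x, f (F.phi 0 x) = F'.phi 0 (f x))
    (hs : Function.Surjective f) (i : ℤ) : (quotientE hs (i + 1)).CokerDim
      ((quotientM f i).map ((F'.Pi i).restrictScalars (AL Fq A Q L)))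
      ((quotientN f i).map ((F'.Pi i).restrictScalars (OL L inf))) F'.d := by
  refine ((quotientE hs (i + 1)).cokerDim_iff _ _ _).2 ?_
  have h1 := toAddSubgroup_map_Pi (map_extendHom_M f i)
  have h2 := toAddSubgroup_map_Pi (map_extendHom_N f i)
  refine (congrArg₂ (· * ·) (congrArg₂ AddSubgroup.relIndex h1 (map_extendHom_M f (i + 1)))
    (congrArg₂ AddSubgroup.relIndex h2 (map_extendHom_N f (i + 1)))).trans ?_
  rw [AddSubgroup.relIndex_self, one_mul,
    AddSubgroup.relIndex_map_map_of_injective _ _ (thetaHom_injective _), relIndex_imN hc hf hs]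

theorem quotient_coker_tau (hc : c.NeInfty) (hf : ∀ x, f (F.phi 0 x) = F'.phi 0 (f x))
    (hs : Function.Surjective f) (i : ℤ) : (quotientE hs (i + 1)).CokerDim
      (Submodule.span (AL Fq A Q L) (F'.tau i '' quotientM f i))
      (Submodule.span (OL L inf) (F'.tau i '' quotientN f i)) F'.d := by
  refine ((quotientE hs (i + 1)).cokerDim_iff _ _ _).2 ?_
  have h1 := toAddSubgroup_span_tau exists_sig_eq (map_extendHom_M f i)
  have h2 := toAddSubgroup_span_tau OL.exists_sig_eq (map_extendHom_N f i)
  refine (congrArg₂ (· * ·) (congrArg₂ AddSubgroup.relIndex h1 (map_extendHom_M f (i + 1)))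
    (congrArg₂ AddSubgroup.relIndex h2 (map_extendHom_N f (i + 1)))).trans ?_
  rw [map_phiHom_imN hc hf, AddSubgroup.relIndex_self, mul_one,
    AddSubgroup.relIndex_map_map_of_injective _ _ (thetaHom_injective _), relIndex_imM hc hf hs]

theorem quotient_graph_M (hf : ∀ x, f (F.phi 0 x) = F'.phi 0 (f x)) (i : ℤ) :
    graphIdealAffine Q c ^ F.d • quotientM f (i + 1) ≤
      Submodule.span (AL Fq A Q L) (F'.tau i '' quotientM f i) := by
  rw [← Submodule.map_smul'']
  refine (Submodule.map_mono (F.graph_M i)).trans ?_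
  rw [Submodule.map_span, Submodule.span_le]
  rintro _ ⟨_, ⟨x, hx, rfl⟩, rfl⟩
  exact Submodule.subset_span ⟨_, ⟨x, hx, rfl⟩, ((commutes_extendHom hf).comm_tau i x).symm⟩

theorem quotient_graph_N (hc : c.NeInfty) (hf : ∀ x, f (F.phi 0 x) = F'.phi 0 (f x)) (n : ℕ) (i : ℤ) :
    graphIdealInfty inf c ^ n • quotientN f (i + 1) ≤
      Submodule.span (OL L inf) (F'.tau i '' quotientN f i) := by
  have h0 : ∀ n, graphIdealInfty inf c ^ n = ⊤ := fun n => by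
    rw [graphIdealInfty_eq_top hc, ← Ideal.one_eq_top, one_pow]
  have h2 := F.graph_N i
  rw [h0, Submodule.top_smul] at h2
  rw [h0, Submodule.top_smul]
  refine (Submodule.map_mono h2).trans ?_
  rw [Submodule.map_span, Submodule.span_le]
  rintro _ ⟨_, ⟨x, hx, rfl⟩, rfl⟩
  exact Submodule.subset_span ⟨_, ⟨x, hx, rfl⟩, ((commutes_extendHom hf).comm_tau i x).symm⟩

theorem comp_chain_quotient (hf : ∀ x, f (F.phi 0 x) = F'.phi 0 (f x)) (l : ℕ) (i : ℤ) :
    chain F'.E F'.Pi l i (i + l) rfl ∘ₗ F.extendHom F' f i =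
      F.extendHom F' f (i + l) ∘ₗ chain F.E F.Pi l i (i + l) rfl :=
  LinearMap.ext fun x => (comp_chain (F.extendHom F' f) (commutes_extendHom hf).comm_Pi l i _ rfl x).symm

theorem chain_quotientE (hs : Function.Surjective f) (n : ℕ) (i j : ℤ) (h : j = i + n) (x : (F'.E i).V) :
    chain (quotientE hs) F'.Pi n i j h x = chain F'.E F'.Pi n i j h x :=
  (comp_chain (E := F'.E) (E' := quotientE hs) (P := F'.Pi) (P' := F'.Pi) (fun _ => LinearMap.id)
    (fun _ _ => rfl) n i j h x).symm

/-- The abelian quotient `τ`-sheaf of `F` given by a surjective homomorphism of generic fibres. -/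
def quotient (hc : c.NeInfty) (hw : F.d * F'.r = F'.d * F.r) (hr : F'.r ≤ F.r)
    (hf : ∀ x, f (F.phi 0 x) = F'.phi 0 (f x)) (hs : Function.Surjective f) :
    AbelianTauSheaf.{w} inf c where
  r := F'.r
  d := F'.d
  E := quotientE hs
  rank_eq := F'.rank_eq
  Pi := F'.Pi
  tau := F'.tau
  Pi_M := by
    rintro i _ ⟨x, hx, rfl⟩
    exact ⟨_, F.Pi_M i x hx, (commutes_extendHom hf).comm_Pi i x⟩
  Pi_N := by
    rintro i _ ⟨x, hx, rfl⟩
    exact ⟨_, F.Pi_N i x hx, (commutes_extendHom hf).comm_Pi i x⟩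
  tau_M := by
    rintro i _ ⟨x, hx, rfl⟩
    exact ⟨_, F.tau_M i x hx, (commutes_extendHom hf).comm_tau i x⟩
  tau_N := by
    rintro i _ ⟨x, hx, rfl⟩
    exact ⟨_, F.tau_N i x hx, (commutes_extendHom hf).comm_tau i x⟩
  Pi_injective := F'.Pi_injective
  tau_injective := F'.tau_injective
  comm := F'.comm
  periodic := by
    obtain ⟨k, l, hk, hl, hkl, h⟩ := exists_period_of_hom hw hr
    refine ⟨k, l, hk, hl, hkl, fun i => ?_⟩
    have hch := chain_quotientE (F := F) hs l i (i + l) rfl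
    have hM : (quotientM f i).map ((chain F'.E F'.Pi l i (i + l) rfl).restrictScalars (AL Fq A Q L)) =
        quotientM f (i + l) := by
      rw [quotientM, quotientM, ← (h i).1, ← Submodule.map_comp, ← Submodule.map_comp]
      exact congrArg (fun g => (F.E i).M.map (g.restrictScalars (AL Fq A Q L)))
        (comp_chain_quotient hf l i)
    have hN : (quotientN f i).map ((chain F'.E F'.Pi l i (i + l) rfl).restrictScalars (OL L inf)) =
        inftyIdeal L inf ^ k • quotientN f (i + l) := by
      rw [quotientN, quotientN, ← Submodule.map_smul'', ← (h i).2, ← Submodule.map_comp,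
        ← Submodule.map_comp]
      exact congrArg (fun g => (F.E i).N.map (g.restrictScalars (OL L inf)))
        (comp_chain_quotient hf l i)
    constructor
    · refine Eq.trans (b := (quotientM f i).map
        ((chain F'.E F'.Pi l i (i + l) rfl).restrictScalars (AL Fq A Q L))) (SetLike.coe_injective ?_) hM
      exact Set.image_congr fun x _ => hch x
    · refine Eq.trans (b := (quotientN f i).map
        ((chain F'.E F'.Pi l i (i + l) rfl).restrictScalars (OL L inf))) (SetLike.coe_injective ?_) hN
      exact Set.image_congr fun x _ => hch x
  coker_Pi := quotient_coker_Pi hc hf hs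
  coker_tau := quotient_coker_tau hc hf hs
  graph_M := fun i => (quotientE hs (i + 1)).smul_le_of_cokerDim (quotient_coker_tau hc hf hs i)
    (quotient_graph_M hf i)
  graph_N := quotient_graph_N hc hf F'.d

theorem isQuotient_quotient (hc : c.NeInfty) (hw : F.d * F'.r = F'.d * F.r) (hr : F'.r ≤ F.r)
    (hf : ∀ x, f (F.phi 0 x) = F'.phi 0 (f x)) (hs : Function.Surjective f) :
    F.IsQuotient (quotient hc hw hr hf hs) :=
  ⟨F.extendHom F' f, ⟨(commutes_extendHom hf).comm_Pi, (commutes_extendHom hf).comm_tau⟩,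
    fun _ => rfl, fun _ => rfl⟩

theorem PhiSurj.r_le (h : F.PhiSurj F') : F'.r ≤ F.r := by
  let := inf.fieldQL (L := L)
  obtain ⟨g, -, hs⟩ := h
  rw [← F.finrank_E, ← F'.finrank_E]
  exact LinearMap.finrank_le_finrank_of_surjective hs

theorem PhiSurj.weight_eq (hc : c.NeInfty) (h : F.PhiSurj F') : F.d * F'.r = F'.d * F.r := by
  let := inf.fieldQL (L := L)
  obtain ⟨g, hg, hs⟩ := h
  by_cases h0 : g = 0
  · have : Subsingleton (F'.E 0).V := ⟨fun x y => by
      obtain ⟨x, rfl⟩ := hs x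
      obtain ⟨y, rfl⟩ := hs y
      rw [h0, LinearMap.zero_apply, LinearMap.zero_apply]⟩
    have h1 : F'.r = 0 := F'.finrank_E.symm.trans finrank_zero_of_subsingleton
    rw [d_eq_zero h1, h1, mul_zero, zero_mul]
  · exact weight_eq_of_hom hc g hg h0

theorem PhiSurj.quasiIsogenousToQuotient (hc : c.NeInfty) (h : F.PhiSurj F') :
    F.QuasiIsogenousToQuotient F' := by
  have hw := h.weight_eq hc
  have hr := h.r_le
  obtain ⟨g, hg, hs⟩ := h
  refine ⟨_, isQuotient_quotient hc hw hr hg hs, (F'.quasiIsogenous_iff _).2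
    ⟨⟨LinearMap.id, fun x => ?_, Function.surjective_id⟩, rfl, rfl⟩⟩
  refine F'.Pi_injective 0 ?_
  exact (F'.Pi_phi 0 x).trans ((quotient hc hw hr hg hs).Pi_phi 0 x).symm

end AbelianTauSheaf

end

section

open Module Polynomial
open scoped TensorProduct

theorem eq_charpoly_of_dvd_dvd {K V V' : Type*} [Field K] [AddCommGroup V] [Module K V]
    [FiniteDimensional K V] [AddCommGroup V'] [Module K V'] [FiniteDimensional K V'] {f : End K V}
    {f' : End K V'} (h : f.charpoly ∣ f'.charpoly) (h' : f'.charpoly ∣ f.charpoly) :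
    f.charpoly = f'.charpoly :=
  eq_of_monic_of_associated f.charpoly_monic f'.charpoly_monic (associated_of_dvd_dvd h h')

theorem finrank_le_of_charpoly_dvd {K V V' : Type*} [Field K] [AddCommGroup V] [Module K V]
    [FiniteDimensional K V] [AddCommGroup V'] [Module K V'] [FiniteDimensional K V'] {f : End K V}
    {f' : End K V'} (h : f'.charpoly ∣ f.charpoly) : finrank K V' ≤ finrank K V := by
  rw [← f.charpoly_natDegree, ← f'.charpoly_natDegree]
  exact natDegree_le_of_dvd h f.charpoly_monic.ne_zero

theorem finrank_commutantKer_lt {K V V' : Type*} [Field K] [AddCommGroup V] [Module K V]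
    [FiniteDimensional K V] [AddCommGroup V'] [Module K V'] [FiniteDimensional K V'] {f : End K V}
    {f' : End K V'} (g : V →ₗ[K] V') (i : V' →ₗ[K] V) (hg : ∀ x, g (f x) = f' (g x))
    (hi : ∀ x, i (f' x) = f (i x)) (hgi : ∀ x, g (i x) = x) (hlt : finrank K V' < finrank K V) :
    finrank K (commutantKer f' 0) < finrank K (commutantKer f 0) := by
  have hz : ∀ {W : Type _} [AddCommGroup W] [Module K W] (f h : End K W),
      h ∈ commutantKer f 0 ↔ ∀ x, h (f x) = f (h x) :=
    fun f h => ⟨fun h => h.1, fun h => ⟨h, fun x => by simp⟩⟩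
  let a : commutantKer f' 0 →ₗ[K] commutantKer f 0 :=
    { toFun := fun h => ⟨i ∘ₗ h.1 ∘ₗ g, (hz _ _).2 fun x => by
        change i (h.1 (g (f x))) = f (i (h.1 (g x)))
        rw [hg, h.2.1, hi]⟩
      map_add' := fun h h' => Subtype.ext (LinearMap.ext fun x => map_add i _ _)
      map_smul' := fun c h => Subtype.ext (LinearMap.ext fun x => map_smul i c _) }
  have ha : Function.Injective a := fun h h' hh => by
    refine Subtype.ext (LinearMap.ext fun x => ?_)
    have h1 := congrArg g (LinearMap.congr_fun (congrArg Subtype.val hh) (i x))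
    change g (i (h.1 (g (i x)))) = g (i (h'.1 (g (i x)))) at h1
    rwa [hgi, hgi, hgi] at h1
  refine lt_of_le_of_ne (LinearMap.finrank_le_finrank_of_injective ha) fun heq => ?_
  obtain ⟨h, hh⟩ := (LinearMap.injective_iff_surjective_of_finrank_eq_finrank heq).1 ha
    ⟨LinearMap.id, (hz _ _).2 fun x => rfl⟩
  have hs : Function.Surjective i := fun x =>
    ⟨h.1 (g x), LinearMap.congr_fun (congrArg Subtype.val hh) x⟩
  exact absurd (LinearMap.finrank_le_finrank_of_surjective hs) (not_le.2 hlt)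

namespace AbelianTauSheaf

variable {Fq Q : Type*} {A : Type uA} {L : Type uL}
  [Field Fq] [Fintype Fq] [CommRing A] [Algebra Fq A] [Algebra.FiniteType Fq A]
  [Field Q] [Algebra Fq Q] [Algebra A Q] [IsScalarTower Fq A Q] [IsDedekindDomain A]
  [IsFractionRing A Q] [Field L] [Finite L] [Algebra Fq L]
  {inf : InftyPoint Fq A Q} {c : CharMap Fq A L}
  {F F' : AbelianTauSheaf.{w} inf c} {v : IsDedekindDomain.HeightOneSpectrum A}

/-! ### Minimal polynomials -/

theorem aeval_frobenius_eq_zero_iff (p : Q[X]) :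
    aeval F.frobenius p = 0 ↔ aeval (F.frobeniusMap 0) p = 0 := by
  rw [← QEnd.eval_frobenius, aeval_algHom_apply, map_eq_zero_iff _ (QEnd.eval_injective F)]

theorem aeval_piV_iff (hv : c.NePlace v) (p : Q[X]) :
    aeval (F.piV v) (p.map (algebraMap Q (Qv A v))) = 0 ↔ minpoly Q F.frobenius ∣ p := by
  rw [aeval_piV_eq_zero_iff F v hv, ← aeval_frobenius_eq_zero_iff, minpoly.dvd_iff]

theorem TateSurj.minpoly_dvd (hv : c.NePlace v) (h : F.TateSurj F' v) :
    minpoly Q F'.frobenius ∣ minpoly Q F.frobenius := by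
  have := F.finite_V v hv
  have := F'.finite_V v hv
  obtain ⟨g, hg, hs⟩ := h
  rw [← aeval_piV_iff hv]
  have h1 := (aeval_piV_iff (F := F) hv _).2 dvd_rfl
  refine LinearMap.ext fun y => ?_
  obtain ⟨x, rfl⟩ := hs y
  rw [← aeval_comm hg, h1]
  exact map_zero g

theorem TateSurj.chi_dvd (hv : c.NePlace v) (h : F.TateSurj F' v) : F'.chi v ∣ F.chi v := by
  have := F.finite_V v hv
  have := F'.finite_V v hv
  obtain ⟨g, hg, hs⟩ := h
  rw [chi_eq F v hv, chi_eq F' v hv]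
  exact charpoly_dvd_of_surjective _ _ g hg hs

theorem r_le_of_chi_dvd (hv : c.NePlace v) (h : F'.chi v ∣ F.chi v) : F'.r ≤ F.r := by
  have := F.finite_V v hv
  have := F'.finite_V v hv
  rw [chi_eq F v hv, chi_eq F' v hv] at h
  rw [← finrank_V F v hv, ← finrank_V F' v hv]
  exact finrank_le_of_charpoly_dvd h

theorem TateSurj.symm (hv : c.NePlace v) (h : F.TateSurj F' v) (hr : F.r = F'.r) :
    F'.TateSurj F v := by
  rw [tateSurj_iff_phiSurj _ _ v hv] at h ⊢
  exact h.symm hr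

theorem chi_eq_of_tateSurj (hv : c.NePlace v) (h : F.TateSurj F' v) (hr : F.r = F'.r) :
    F.chi v = F'.chi v := by
  have h1 := h.chi_dvd hv
  have h2 := (h.symm hv hr).chi_dvd hv
  have := F.finite_V v hv
  have := F'.finite_V v hv
  rw [chi_eq F v hv, chi_eq F' v hv] at h1 h2 ⊢
  exact eq_charpoly_of_dvd_dvd h2 h1

/-! ### Semisimple Frobenius -/

theorem tateSurj_of_chi_dvd (hv : c.NePlace v) (hs : (F.piV v).IsSemisimple)
    (hs' : (F'.piV v).IsSemisimple) (h : F'.chi v ∣ F.chi v) : F.TateSurj F' v := by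
  have := F.finite_V v hv
  have := F'.finite_V v hv
  rw [chi_eq F v hv, chi_eq F' v hv] at h
  obtain ⟨g, i, hg, -, hgi⟩ := exists_split_of_isSemisimple _ _ hs hs'
    (finrank_ker_le_of_charpoly_dvd _ _ hs hs' h)
  exact ⟨g, hg, fun x => ⟨i x, hgi x⟩⟩

/-! ### Irreducible minimal polynomials -/

theorem exists_split (hm : Irreducible (minpoly Q F.frobenius))
    (hd : minpoly Q F'.frobenius ∣ minpoly Q F.frobenius) (hr : F'.r ≤ F.r) :
    ∃ (g : (F.E 0).V →ₗ[QL Fq Q L] (F'.E 0).V) (i : (F'.E 0).V →ₗ[QL Fq Q L] (F.E 0).V),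
      (∀ x, g (F.frobeniusMap 0 x) = F'.frobeniusMap 0 (g x)) ∧
      (∀ x, i (F'.frobeniusMap 0 x) = F.frobeniusMap 0 (i x)) ∧ ∀ x, g (i x) = x := by
  let := inf.fieldQL (L := L)
  refine exists_split_of_minpoly_irreducible inf.cyclicExt (F.phi 0) (F.phi_injective 0) _
    (F.frobeniusMap_apply 0) (F'.phi 0) (F'.phi_injective 0) _ (F'.frobeniusMap_apply 0) _ hm ?_ ?_
    (by rw [finrank_E, finrank_E]; exact hr)
  · rw [aeval_map_algebraMap, ← aeval_frobenius_eq_zero_iff, minpoly.aeval]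
  · rw [aeval_map_algebraMap, ← aeval_frobenius_eq_zero_iff, ← minpoly.dvd_iff]
    exact hd

theorem phiSurj_of_surjective (v : IsDedekindDomain.HeightOneSpectrum A)
    (g : (F.E 0).V →ₗ[QL Fq Q L] (F'.E 0).V)
    (hg : ∀ x, g (F.frobeniusMap 0 x) = F'.frobeniusMap 0 (g x)) (hs : Function.Surjective g) :
    F.PhiSurj F' := by
  let := inf.fieldQL (L := L)
  have := infinite_fractionField Q v
  have : Infinite (QL Fq Q L) := Infinite.of_injective _ (algebraMap Q (QL Fq Q L)).injective
  obtain ⟨b, -⟩ := F.exists_basis_mem 0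
  obtain ⟨b', -⟩ := F'.exists_basis_mem 0
  exact (exists_surjective_iff_of_conj (RingHom.id (QL Fq Q L)) (RingHom.id (QL Fq Q L))
    inf.cyclicExt (F.phi 0) (F.phi_injective 0) (F.frobeniusMap 0) (F.frobeniusMap_apply 0)
    (F'.phi 0) (F'.frobeniusMap 0) (F'.frobeniusMap_apply 0) (F.frobeniusMap 0) (F'.frobeniusMap 0)
    b b b' b' (D := 1) (E := 1) (mul_one 1) ((mul_one _).trans (one_mul _).symm) (D' := 1) (E' := 1)
    (mul_one 1) ((mul_one _).trans (one_mul _).symm)).1 ⟨g, hg, hs⟩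

theorem tateSurj_of_minpoly_dvd (hv : c.NePlace v) (hm : Irreducible (minpoly Q F.frobenius))
    (hd : minpoly Q F'.frobenius ∣ minpoly Q F.frobenius) (hr : F'.r ≤ F.r) : F.TateSurj F' v := by
  obtain ⟨g, i, hg, -, hgi⟩ := exists_split hm hd hr
  exact (tateSurj_iff_phiSurj _ _ v hv).2 (phiSurj_of_surjective v g hg fun x => ⟨i x, hgi x⟩)

theorem aeval_pow_eq_zero_of_chi_dvd (hv : c.NePlace v) (h : F'.chi v ∣ F.chi v) :
    aeval (F'.piV v) ((minpoly Q F.frobenius ^ F.r).map (algebraMap Q (Qv A v))) = 0 := by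
  have := F.finite_V v hv
  have := F'.finite_V v hv
  have h1 := charpoly_dvd_pow (F.piV v) _ ((aeval_piV_iff hv _).2 dvd_rfl)
  rw [finrank_V F v hv, ← chi_eq F v hv] at h1
  obtain ⟨q, hq⟩ := h.trans h1
  rw [Polynomial.map_pow, hq, map_mul, chi_eq F' v hv, LinearMap.aeval_self_charpoly, zero_mul]

theorem minpoly_dvd_of_chi_dvd (hv : c.NePlace v) (hs' : (F'.piV v).IsSemisimple)
    (h : F'.chi v ∣ F.chi v) : minpoly Q F'.frobenius ∣ minpoly Q F.frobenius := by
  have := F'.finite_V v hv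
  have h1 := aeval_pow_eq_zero_of_chi_dvd hv h
  rw [Polynomial.map_pow, map_pow] at h1
  rw [← aeval_piV_iff hv]
  exact Module.End.eq_zero_of_isNilpotent_isSemisimple ⟨_, h1⟩ (hs'.aeval _)

theorem minpoly_dvd_of_chi_dvd_of_irreducible (hv : c.NePlace v)
    (hm' : Irreducible (minpoly Q F'.frobenius)) (h : F'.chi v ∣ F.chi v) :
    minpoly Q F'.frobenius ∣ minpoly Q F.frobenius :=
  hm'.prime.dvd_of_dvd_pow ((aeval_piV_iff hv _).1 (aeval_pow_eq_zero_of_chi_dvd hv h))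

/-! ### The algebra of quasi-endomorphisms -/

/-- Multiplication by the Frobenius. -/
def QEnd.mulFrob (F : AbelianTauSheaf.{w} inf c) : End Q F.QEnd := LinearMap.mulLeft Q F.frobenius

theorem QEnd.finrank_ker (F : AbelianTauSheaf.{w} inf c) (hv : c.NePlace v) (p : (Qv A v)[X]) :
    finrank (Qv A v) (LinearMap.ker (aeval ((QEnd.mulFrob F).baseChange (Qv A v)) p)) =
      finrank (Qv A v) (commutantKer (F.piV v) p) := by
  let := inf.fieldQL (L := L)
  have := infinite_Qv v
  have := F.finite_V v hv
  obtain ⟨B, _, f, j, hfj, hcomp⟩ := exists_comparison (Fq := Fq) (Q := Q) (L := L) v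
  obtain ⟨bU, b, D, D', hD, -, h⟩ := hcomp inf c F hv
  let : Algebra (Qv A v) B := f.toAlgebra
  let : Algebra (QL Fq Q L) B := j.toAlgebra
  exact finrank_ker_baseChange (B := B) inf.cyclicExt (fun a => (hfj a).symm) (F.phi 0)
    (F.phi_injective 0) (F.frobeniusMap 0) (F.frobeniusMap_apply 0) (QEnd.eval F).toLinearMap
    (QEnd.eval_injective F) (QEnd.comm_phi F) (fun g hg => (QEnd.mem_range_eval F g).2 hg)
    (QEnd.mulFrob F) (fun z => map_mul (QEnd.eval F) _ _) b bU (F.piV v) D D' hD h p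

theorem QEnd.finrank_eq (v : IsDedekindDomain.HeightOneSpectrum A) (F : AbelianTauSheaf.{w} inf c) :
    letI := inf.fieldQL (L := L)
    finrank Q F.QEnd = finrank (QL Fq Q L) (commutantKer (F.frobeniusMap 0) 0) := by
  let := inf.fieldQL (L := L)
  have := infinite_fractionField Q v
  have : Infinite (QL Fq Q L) := Infinite.of_injective _ (algebraMap Q (QL Fq Q L)).injective
  obtain ⟨b, -⟩ := F.exists_basis_mem 0
  have h1 := finrank_ker_baseChange (B := QL Fq Q L) (K₁ := QL Fq Q L) inf.cyclicExt (fun a => rfl)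
    (F.phi 0) (F.phi_injective 0) (F.frobeniusMap 0) (F.frobeniusMap_apply 0)
    (QEnd.eval F).toLinearMap (QEnd.eval_injective F) (QEnd.comm_phi F)
    (fun g hg => (QEnd.mem_range_eval F g).2 hg)
    (QEnd.mulFrob F) (fun z => map_mul (QEnd.eval F) _ _) b b (F.frobeniusMap 0) 1 1 (mul_one 1)
    ((mul_one _).trans (one_mul _).symm) 0
  rw [← h1, map_zero, LinearMap.ker_zero, finrank_top, finrank_baseChange]

theorem QEndIso.at (h : F.QEndIso F') : F.QEndIsoAt F' v := by
  obtain ⟨φ, hφ⟩ := h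
  refine ⟨Algebra.TensorProduct.congr AlgEquiv.refl φ, ?_⟩
  change (1 : Qv A v) ⊗ₜ φ F.frobenius = _
  rw [hφ]

theorem minpoly_tmul_frobenius (F : AbelianTauSheaf.{w} inf c) :
    minpoly Q ((1 : Qv A v) ⊗ₜ[Q] F.frobenius) = minpoly Q F.frobenius :=
  minpoly.algHom_eq (Algebra.TensorProduct.includeRight : F.QEnd →ₐ[Q] Qv A v ⊗[Q] F.QEnd)
    (Algebra.TensorProduct.includeRight_injective (algebraMap Q (Qv A v)).injective) F.frobenius

theorem QEndIsoAt.minpoly_eq (h : F.QEndIsoAt F' v) :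
    minpoly Q F.frobenius = minpoly Q F'.frobenius := by
  obtain ⟨φ, hφ⟩ := h
  rw [← minpoly_tmul_frobenius (v := v) F, ← minpoly_tmul_frobenius (v := v) F', ← hφ]
  exact (minpoly.algEquiv_eq (φ.restrictScalars Q) _).symm

theorem QEndIsoAt.finrank_eq (h : F.QEndIsoAt F' v) : finrank Q F.QEnd = finrank Q F'.QEnd := by
  obtain ⟨φ, -⟩ := h
  rw [← finrank_baseChange (R := Qv A v) (M' := F.QEnd),
    ← finrank_baseChange (R := Qv A v) (M' := F'.QEnd)]
  exact φ.toLinearEquiv.finrank_eq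

theorem QEndIsoAt.symm (h : F.QEndIsoAt F' v) : F'.QEndIsoAt F v := by
  obtain ⟨φ, hφ⟩ := h
  exact ⟨φ.symm, by rw [AlgEquiv.symm_apply_eq, hφ]⟩

theorem QEndIsoAt.r_le (h : F.QEndIsoAt F' v) (hm : Irreducible (minpoly Q F.frobenius)) :
    F.r ≤ F'.r := by
  by_contra! hlt
  let := inf.fieldQL (L := L)
  obtain ⟨g, i, hg, hi, hgi⟩ := exists_split hm h.minpoly_eq.symm.dvd hlt.le
  have h1 := finrank_commutantKer_lt g i hg hi hgi (by rw [finrank_E, finrank_E]; exact hlt)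
  have h2 := QEnd.finrank_eq v F
  have h3 := QEnd.finrank_eq v F'
  have h4 := h.finrank_eq
  exact absurd (h2.symm.trans (h4.trans h3)) h1.ne'

theorem QEndIsoAt.finrank_ker_le (hv : c.NePlace v) (h : F.QEndIsoAt F' v) (p : (Qv A v)[X]) :
    finrank (Qv A v) (commutantKer (F'.piV v) p) ≤ finrank (Qv A v) (commutantKer (F.piV v) p) := by
  rw [← QEnd.finrank_ker F hv, ← QEnd.finrank_ker F' hv]
  obtain ⟨φ, hφ⟩ := h.symm
  have hb : ∀ (F : AbelianTauSheaf.{w} inf c) (z : Qv A v ⊗[Q] F.QEnd),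
      (QEnd.mulFrob F).baseChange (Qv A v) z = (1 ⊗ₜ[Q] F.frobenius) * z := by
    intro F z
    induction z using TensorProduct.induction_on with
    | zero => rw [map_zero, mul_zero]
    | tmul a y =>
      rw [Algebra.TensorProduct.tmul_mul_tmul, one_mul]
      rfl
    | add x y hx hy => rw [map_add, hx, hy, mul_add]
  have hc : ∀ z, φ.toLinearMap ((QEnd.mulFrob F').baseChange (Qv A v) z) =
      (QEnd.mulFrob F).baseChange (Qv A v) (φ.toLinearMap z) := fun z => by
    rw [hb, hb]
    change φ _ = _ * φ z
    rw [map_mul, hφ]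
  refine LinearMap.finrank_le_finrank_of_injective (f := (φ.toLinearMap.domRestrict _).codRestrict
    (LinearMap.ker (aeval ((QEnd.mulFrob F).baseChange (Qv A v)) p)) fun z => ?_) fun x y hxy =>
      Subtype.ext (φ.injective (congrArg Subtype.val hxy))
  rw [LinearMap.mem_ker, LinearMap.domRestrict_apply, ← aeval_comm hc, LinearMap.mem_ker.1 z.2,
    map_zero]

theorem QEndIsoAt.tateSurj (hv : c.NePlace v) (hs : (F.piV v).IsSemisimple)
    (hs' : (F'.piV v).IsSemisimple) (h : F.QEndIsoAt F' v) : F.TateSurj F' v := by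
  have := F.finite_V v hv
  have := F'.finite_V v hv
  obtain ⟨g, i, hg, -, hgi⟩ := exists_split_of_isSemisimple _ _ hs hs' fun p hp => by
    rw [← Nat.pow_le_pow_iff_left two_ne_zero, ← finrank_commutantKer _ hs p hp,
      ← finrank_commutantKer _ hs' p hp]
    exact Nat.mul_le_mul_right _ (h.finrank_ker_le hv p)
  exact ⟨g, hg, fun x => ⟨i x, hgi x⟩⟩

theorem TateSurj.r_le (hv : c.NePlace v) (h : F.TateSurj F' v) : F'.r ≤ F.r :=
  r_le_of_chi_dvd hv (h.chi_dvd hv)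

end AbelianTauSheaf

end

section
open Module Polynomial

section DetExterior

theorem charpoly_pow_char_pow {K : Type*} [Field K] (p k : ℕ) [Fact p.Prime] [CharP K p]
    {ι : Type*} [Fintype ι] [DecidableEq ι] (M : Matrix ι ι K) :
    expand K (p ^ k) (M ^ p ^ k).charpoly = M.charpoly ^ p ^ k := by
  cases isEmpty_or_nonempty ι
  · simp [Matrix.charpoly]
  · unfold Matrix.charpoly
    rw [AlgHom.map_det, ← Matrix.coe_detMonoidHom,
      ← (Matrix.detMonoidHom : Matrix ι ι K[X] →* K[X]).map_pow]
    apply congr_arg Matrix.det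
    refine matPolyEquiv.injective ?_
    rw [map_pow, Matrix.matPolyEquiv_charmatrix, sub_pow_char_pow_of_commute, ← C_pow]
    · exact (id (matPolyEquiv_eq_X_pow_sub_C (p ^ k) M) :)
    · exact (C M).commute_X

theorem charpoly_eq_of_charpoly_pow {K : Type*} [Field K] (p k : ℕ) [Fact p.Prime] [CharP K p]
    {V : Type*} [AddCommGroup V] [Module K V] [FiniteDimensional K V] (f : End K V)
    {κ : Type*} (t : Finset κ) (β : κ → K)
    (h : (f ^ p ^ k).charpoly = ∏ j ∈ t, (X - C (β j ^ p ^ k))) :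
    f.charpoly = ∏ j ∈ t, (X - C (β j)) := by
  have b := finBasis K V
  have h1 := charpoly_pow_char_pow p k (LinearMap.toMatrix b b f)
  rw [LinearMap.toMatrix_pow, LinearMap.charpoly_toMatrix, LinearMap.charpoly_toMatrix, h,
    map_prod] at h1
  have h2 : ∀ j ∈ t, expand K (p ^ k) (X - C (β j ^ p ^ k)) = (X - C (β j)) ^ p ^ k := by
    intro j _
    rw [map_sub, expand_X, expand_C, sub_pow_char_pow, C_pow]
  rw [Finset.prod_congr rfl h2, Finset.prod_pow] at h1
  refine (frobenius_inj K[X] p).iterate k ?_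
  rw [iterate_frobenius, iterate_frobenius, h1]

theorem charpoly_of_basis_eigenvectors {K : Type*} [Field K] {V : Type*} [AddCommGroup V]
    [Module K V] [FiniteDimensional K V] (f : End K V) {ι : Type*} [Fintype ι]
    (b : Basis ι K V) (a : ι → K) (h : ∀ j, f (b j) = a j • b j) :
    f.charpoly = ∏ j, (X - C (a j)) := by
  classical
  rw [← LinearMap.charpoly_toMatrix f b, ← Matrix.charpoly_diagonal]
  congr 1
  ext i j
  rw [LinearMap.toMatrix_apply, h, map_smul, Basis.repr_self, Finsupp.smul_single, smul_eq_mul,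
    mul_one, Matrix.diagonal_apply, Finsupp.single_apply]
  by_cases hij : i = j
  · subst hij
    rw [if_pos rfl]
  · rw [if_neg (Ne.symm hij), if_neg hij]

theorem exists_basis_eigenvectors_pow {K : Type*} [Field K] [IsAlgClosed K] (p : ℕ)
    [Fact p.Prime] [CharP K p] {V : Type*} [AddCommGroup V] [Module K V] [FiniteDimensional K V]
    (f : End K V) : ∃ (k : ℕ) (b : Basis (Fin (finrank K V)) K V) (β : Fin (finrank K V) → K),
      ∀ j, (f ^ p ^ k) (b j) = β j ^ p ^ k • b j := by
  obtain ⟨n, hn, s, hs, ⟨m, hm⟩, hss, hf⟩ := f.exists_isNilpotent_isSemisimple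
  have hcomm : Commute n s := by
    obtain ⟨P, rfl⟩ := Algebra.adjoin_singleton_eq_range_aeval K f ▸ hn
    obtain ⟨R, rfl⟩ := Algebra.adjoin_singleton_eq_range_aeval K f ▸ hs
    exact (Commute.all P R).map (aeval f)
  obtain ⟨k, hk⟩ : ∃ k, m ≤ p ^ k := 
    ⟨m, (Nat.lt_pow_self (Fact.out : p.Prime).one_lt).le⟩
  have hcp : ∀ x y : End K V, Commute x y → (x + y) ^ p ^ k = x ^ p ^ k + y ^ p ^ k := by
    intro x y hxy
    cases subsingleton_or_nontrivial V
    · exact Subsingleton.elim _ _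
    · have : CharP (End K V) p := charP_of_injective_algebraMap (algebraMap K (End K V)).injective p
      exact add_pow_char_pow_of_commute p k hxy
  have hg : (f ^ p ^ k).IsSemisimple := by
    rw [hf, hcp n s hcomm, pow_eq_zero_of_le hk hm, zero_add]
    exact hss.pow _
  have htop : ⨆ μ, (f ^ p ^ k).eigenspace μ = ⊤ := by
    rw [← End.iSup_maxGenEigenspace_eq_top (f ^ p ^ k)]
    exact iSup_congr fun μ =>
      ((End.isFinitelySemisimple_iff_isSemisimple.2 hg).maxGenEigenspace_eq_eigenspace μ).symm
  obtain ⟨t, ht, hspan, hind⟩ := exists_linearIndependent K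
    {x : V | ∃ μ : K, (f ^ p ^ k) x = μ • x}
  have hspan' : Submodule.span K t = ⊤ := by
    rw [hspan, eq_top_iff, ← htop]
    exact iSup_le fun μ x hx => Submodule.subset_span ⟨μ, End.mem_eigenspace_iff.1 hx⟩
  let b := Basis.mk hind (by rw [Subtype.range_coe, hspan'])
  have : Finite t := hind.finite
  have := Fintype.ofFinite t
  have hcard : Fintype.card t = finrank K V := (finrank_eq_card_basis b).symm
  have hb : ∀ j, ∃ β : K, (f ^ p ^ k) (b.reindex (Fintype.equivFinOfCardEq hcard) j) =
      β ^ p ^ k • b.reindex (Fintype.equivFinOfCardEq hcard) j := by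
    intro j
    rw [Basis.reindex_apply, Basis.mk_apply]
    obtain ⟨μ, hμ⟩ := ht (Subtype.coe_prop ((Fintype.equivFinOfCardEq hcard).symm j))
    obtain ⟨β, hβ⟩ := IsAlgClosed.exists_pow_nat_eq μ
      (pow_pos (Fact.out : p.Prime).pos k)
    exact ⟨β, by rw [hβ, hμ]⟩
  choose β hβ using hb
  exact ⟨k, _, β, hβ⟩

theorem exteriorPower_map_pow {R V : Type*} [CommRing R] [AddCommGroup V] [Module R V] (n : ℕ)
    (f : End R V) (k : ℕ) : exteriorPower.map n (f ^ k) = (exteriorPower.map n f) ^ k := by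
  induction k with
  | zero => exact exteriorPower.map_id
  | succ k ih =>
    rw [pow_succ, pow_succ, ← ih]
    exact exteriorPower.map_comp _ _

/-- The eigenvalues of `Λⁿ f` are the products of `n` of the eigenvalues of `f`. -/
theorem charpoly_exteriorPower_map {K : Type*} [Field K] [IsAlgClosed K] (p : ℕ)
    [Fact p.Prime] [CharP K p] {V : Type*} [AddCommGroup V] [Module K V] [FiniteDimensional K V]
    (f : End K V) (n : ℕ) :
    (exteriorPower.map n f).charpoly =
      ((f.charpoly.roots.powersetCard n).map fun s => X - C s.prod).prod := by
  classical
  obtain ⟨k, b, β, hb⟩ := exists_basis_eigenvectors_pow p f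
  have h1 := charpoly_eq_of_charpoly_pow p k f Finset.univ β
    (charpoly_of_basis_eigenvectors _ b _ hb)
  have : Fintype (Set.powersetCard (Fin (finrank K V)) n) := Fintype.ofFinite _
  have h2 : (exteriorPower.map n f).charpoly =
      ∏ S : Set.powersetCard (Fin (finrank K V)) n, (X - C (∏ j ∈ S.1, β j)) := by
    refine charpoly_eq_of_charpoly_pow p k _ _ _ ?_
    rw [← exteriorPower_map_pow]
    refine charpoly_of_basis_eigenvectors _ (b.exteriorPower n) _ fun S => ?_
    rw [exteriorPower.basis_apply, exteriorPower.map_apply_ιMulti_family]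
    have h3 : (⇑(f ^ p ^ k) ∘ b) = fun j => β j ^ p ^ k • b j := funext hb
    rw [h3, exteriorPower.ιMulti_family, exteriorPower.ιMulti_family]
    change exteriorPower.ιMulti K n (fun i => _ • _) = _
    rw [AlternatingMap.map_smul_univ]
    congr 1
    rw [← Finset.prod_pow]
    change ∏ i, (fun j => β j ^ p ^ k) (Set.powersetCard.ofFinEmbEquiv.symm S i) = _
    rw [Set.powersetCard.ofFinEmbEquiv_symm_apply]
    refine (Finset.prod_map Finset.univ (S.1.orderEmbOfFin S.2).toEmbedding
      (fun j => β j ^ p ^ k)).symm.trans ?_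
    exact congrArg (fun s : Finset _ => ∏ x ∈ s, β x ^ p ^ k)
      (Finset.map_orderEmbOfFin_univ S.1 S.2)
  have h3 : (∏ j, (X - C (β j))).roots = Finset.univ.val.map β := by
    rw [← roots_multiset_prod_X_sub_C (Finset.univ.val.map β), Multiset.map_map]
    rfl
  rw [h1, h3, h2, Multiset.powersetCard_map, Multiset.map_map, ← Finset.map_val_val_powersetCard,
    Multiset.map_map]
  refine Finset.prod_bij (t := Finset.powersetCard n Finset.univ)
    (g := fun s => X - C ((s.1.map β).prod)) (fun S _ => S.1)
    (fun S _ => Finset.mem_powersetCard_univ.2 S.2) (fun S _ T _ h => Subtype.ext h)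
    (fun s hs => ⟨⟨s, Finset.mem_powersetCard_univ.1 hs⟩, Finset.mem_univ _, rfl⟩)
    (fun S _ => rfl)

end DetExterior

end

section
open Module Polynomial TensorProduct

section ZetaFactor

/-- The matrix of the `n`-rowed minors of a square matrix. -/
def compoundMatrix {R ι : Type*} [CommRing R] [LinearOrder ι] (n : ℕ) (M : Matrix ι ι R) :
    Matrix (Set.powersetCard ι n) (Set.powersetCard ι n) R :=
  Matrix.of fun s t => (Matrix.of fun i j => M (Set.powersetCard.ofFinEmbEquiv.symm s j)
    (Set.powersetCard.ofFinEmbEquiv.symm t i)).det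

theorem compoundMatrix_map {R S ι : Type*} [CommRing R] [CommRing S] [LinearOrder ι] (n : ℕ)
    (M : Matrix ι ι R) (φ : R →+* S) :
    compoundMatrix n (M.map φ) = (compoundMatrix n M).map φ := by
  ext s t
  rw [Matrix.map_apply, compoundMatrix, compoundMatrix, Matrix.of_apply, Matrix.of_apply,
    RingHom.map_det]
  rfl

theorem toMatrix_exteriorPower_map {R ι V : Type*} [CommRing R] [LinearOrder ι] [Fintype ι]
    [AddCommGroup V] [Module R V] (b : Basis ι R V) (n : ℕ) (f : End R V)
    [Fintype (Set.powersetCard ι n)] [DecidableEq (Set.powersetCard ι n)] :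
    LinearMap.toMatrix (b.exteriorPower n) (b.exteriorPower n) (exteriorPower.map n f) =
      compoundMatrix n (LinearMap.toMatrix b b f) := by
  ext s t
  rw [LinearMap.toMatrix_apply, exteriorPower.basis_apply, exteriorPower.basis_repr_apply,
    exteriorPower.map_apply_ιMulti_family, exteriorPower.ιMulti_family,
    exteriorPower.ιMultiDual_apply_ιMulti, compoundMatrix, Matrix.of_apply]
  congr 1
  ext i j
  exact (LinearMap.toMatrix_apply _ _ _ _ _).symm

theorem charpoly_exteriorPower_map_map {K E : Type*} [Field K] [Field E] [IsAlgClosed E]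
    (p : ℕ) [Fact p.Prime] [CharP E p] (φ : K →+* E) {V : Type*} [AddCommGroup V] [Module K V]
    [FiniteDimensional K V] (f : End K V) (n : ℕ) :
    (exteriorPower.map n f).charpoly.map φ =
      (((f.charpoly.map φ).roots.powersetCard n).map fun s => X - C s.prod).prod := by
  classical
  have b := finBasis K V
  have : Fintype (Set.powersetCard (Fin (finrank K V)) n) := Fintype.ofFinite _
  have e := Pi.basisFun E (Fin (finrank K V))
  let g := Matrix.toLin e e ((LinearMap.toMatrix b b f).map φ)
  have hg : LinearMap.toMatrix e e g = (LinearMap.toMatrix b b f).map φ :=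
    LinearMap.toMatrix_toLin _ _ _
  have h1 : g.charpoly = f.charpoly.map φ := by
    rw [← LinearMap.charpoly_toMatrix g e, hg, Matrix.charpoly_map, LinearMap.charpoly_toMatrix]
  rw [← h1, ← charpoly_exteriorPower_map p g n,
    ← LinearMap.charpoly_toMatrix _ (e.exteriorPower n),
    ← LinearMap.charpoly_toMatrix _ (b.exteriorPower n), toMatrix_exteriorPower_map,
    toMatrix_exteriorPower_map, hg, compoundMatrix_map, Matrix.charpoly_map]

theorem det_one_sub_smul_baseChange {K W : Type*} [Field K] [AddCommGroup W] [Module K W]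
    [FiniteDimensional K W] (g : End K W) :
    LinearMap.det (M := RatFunc K ⊗[K] W)
      (1 - (RatFunc.X : RatFunc K) • g.baseChange (RatFunc K)) =
        algebraMap K[X] (RatFunc K) g.charpoly.reverse := by
  have b := finBasis K W
  rw [← LinearMap.charpoly_toMatrix g b, Matrix.reverse_charpoly, Matrix.charpolyRev,
    RingHom.map_det, ← LinearMap.det_toMatrix (Algebra.TensorProduct.basis (RatFunc K) b), map_sub, map_smul,
    LinearMap.toMatrix_baseChange, LinearMap.toMatrix_one, map_sub, map_one]
  congr 2
  ext i j
  rw [RingHom.mapMatrix_apply, Matrix.map_apply, Matrix.smul_apply, Matrix.smul_apply,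
    Matrix.map_apply, Matrix.map_apply, smul_eq_mul, smul_eq_mul, map_mul, RatFunc.algebraMap_X,
    RatFunc.algebraMap_C]
  rfl

/-- The polynomial `∏ (1 - c X)` with `c` running through a multiset. -/
def revPoly {E : Type*} [Field E] (s : Multiset E) : E[X] := (s.map fun c => 1 - C c * X).prod

theorem revPoly_add {E : Type*} [Field E] (s t : Multiset E) :
    revPoly (s + t) = revPoly s * revPoly t := by
  rw [revPoly, Multiset.map_add, Multiset.prod_add, revPoly, revPoly]

theorem revPoly_sum {E ι : Type*} [Field E] (t : Finset ι) (s : ι → Multiset E) :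
    revPoly (∑ i ∈ t, s i) = ∏ i ∈ t, revPoly (s i) := by
  classical
  induction t using Finset.induction_on with
  | empty => rw [Finset.sum_empty, Finset.prod_empty, revPoly, Multiset.map_zero, Multiset.prod_zero]
  | insert a t ha ih => rw [Finset.sum_insert ha, Finset.prod_insert ha, revPoly_add, ih]

theorem reverse_X_sub_C {E : Type*} [Field E] (c : E) : (X - C c).reverse = 1 - C c * X := by
  rw [reverse, natDegree_X_sub_C, reflect_sub, reflect_one_X, reflect_C, pow_one]

theorem reverse_prod_X_sub_C {E : Type*} [Field E] (s : Multiset E) :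
    ((s.map fun c => X - C c).prod).reverse = revPoly s := by
  induction s using Multiset.induction_on with
  | empty =>
    rw [revPoly, Multiset.map_zero, Multiset.map_zero, Multiset.prod_zero, ← C_1, reverse_C]
  | cons a s ih =>
    rw [Multiset.map_cons, Multiset.prod_cons, reverse_mul_of_domain, ih, reverse_X_sub_C, revPoly,
      revPoly, Multiset.map_cons, Multiset.prod_cons]

theorem roots_revPoly {E : Type*} [Field E] {s : Multiset E} (hs : ∀ c ∈ s, c ≠ 0) :
    (revPoly s).roots = s.map fun c => c⁻¹ := by
  have h : revPoly s = C (s.map fun c => -c).prod *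
      ((s.map fun c => c⁻¹).map fun c => X - C c).prod := by
    rw [map_multiset_prod, Multiset.map_map, Multiset.map_map, ← Multiset.prod_map_mul,
      revPoly]
    congr 1
    refine Multiset.map_congr rfl fun c hc => ?_
    simp only [Function.comp_apply, mul_sub, ← C_mul, neg_mul, mul_inv_cancel₀ (hs c hc)]
    simp
    ring
  rw [h, roots_C_mul, roots_multiset_prod_X_sub_C]
  rw [Ne, Multiset.prod_eq_zero_iff, Multiset.mem_map]
  rintro ⟨c, hc, h0⟩
  exact hs c hc (neg_eq_zero.1 h0)

theorem revPoly_injective {E : Type*} [Field E] {s t : Multiset E} (hs : ∀ c ∈ s, c ≠ 0)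
    (ht : ∀ c ∈ t, c ≠ 0) (h : revPoly s = revPoly t) : s = t := by
  have h1 := congrArg roots h
  rw [roots_revPoly hs, roots_revPoly ht] at h1
  exact Multiset.map_injective inv_injective h1

/-- The products of `i` elements of a multiset, where `i` runs through a set. -/
def subProducts {E : Type*} [Field E] (s : Multiset E) (I : Finset ℕ) : Multiset E :=
  ∑ i ∈ I, (s.powersetCard i).map Multiset.prod

theorem reverse_charpoly_exteriorPower_map {K E : Type*} [Field K] [Field E] [IsAlgClosed E]
    (p : ℕ) [Fact p.Prime] [CharP E p] (φ : K →+* E) {V : Type*} [AddCommGroup V] [Module K V]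
    [FiniteDimensional K V] (f : End K V) (n : ℕ) :
    (exteriorPower.map n f).charpoly.reverse.map φ =
      revPoly (((f.charpoly.map φ).roots.powersetCard n).map Multiset.prod) := by
  rw [← reverse_prod_X_sub_C, Multiset.map_map]
  refine Eq.trans ?_ (congrArg reverse (charpoly_exteriorPower_map_map p φ f n))
  rw [reverse, reverse, reflect_map, natDegree_map]

/-- The alternating product of the polynomials `det (1 - t Λⁱ f)`. -/
def alternatingZeta {K V : Type*} [Field K] [AddCommGroup V] [Module K V] (f : End K V) (r : ℕ) :
    RatFunc K :=
  ∏ i ∈ Finset.range (r + 1),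
    LinearMap.det (M := RatFunc K ⊗[K] (⋀[K]^i V))
      (1 - (RatFunc.X : RatFunc K) • (exteriorPower.map i f).baseChange (RatFunc K)) ^
        ((-1 : ℤ) ^ (i + 1))

variable {K V V' : Type*} [Field K] [AddCommGroup V] [Module K V] [FiniteDimensional K V]
  [AddCommGroup V'] [Module K V'] [FiniteDimensional K V'] {f : End K V} {f' : End K V'}

theorem alternatingZeta_eq (f : End K V) (r : ℕ) : alternatingZeta f r =
    algebraMap K[X] (RatFunc K) (∏ i ∈ Finset.range (r + 1) with Odd i,
      (exteriorPower.map i f).charpoly.reverse) /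
    algebraMap K[X] (RatFunc K) (∏ i ∈ Finset.range (r + 1) with ¬ Odd i,
      (exteriorPower.map i f).charpoly.reverse) := by
  rw [alternatingZeta, ← Finset.prod_filter_mul_prod_filter_not _ (fun i => Odd i), div_eq_mul_inv,
    map_prod, map_prod, ← Finset.prod_inv_distrib]
  congr 1
  · refine Finset.prod_congr rfl fun i hi => ?_
    rw [(Finset.mem_filter.1 hi).2.add_one.neg_one_pow, zpow_one]
    exact det_one_sub_smul_baseChange _
  · refine Finset.prod_congr rfl fun i hi => ?_
    rw [(Nat.not_odd_iff_even.1 (Finset.mem_filter.1 hi).2).add_one.neg_one_pow, zpow_neg_one]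
    exact congrArg _ (det_one_sub_smul_baseChange _)

theorem alternatingZeta_congr (p : ℕ) [Fact p.Prime] [CharP K p] (h : f.charpoly = f'.charpoly)
    (r : ℕ) : alternatingZeta f r = alternatingZeta f' r := by
  have : CharP (AlgebraicClosure K) p :=
    charP_of_injective_algebraMap (algebraMap K (AlgebraicClosure K)).injective p
  have h1 : ∀ i, (exteriorPower.map i f).charpoly.reverse =
      (exteriorPower.map i f').charpoly.reverse := fun i =>
    map_injective _ (algebraMap K (AlgebraicClosure K)).injective (by
      rw [reverse_charpoly_exteriorPower_map p, reverse_charpoly_exteriorPower_map p, h])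
  rw [alternatingZeta_eq, alternatingZeta_eq]
  simp only [h1]

theorem algebraMap_prod_ne_zero (f : End K V) (I : Finset ℕ) : algebraMap K[X] (RatFunc K)
    (∏ i ∈ I, (exteriorPower.map i f).charpoly.reverse) ≠ 0 := by
  rw [Ne, FaithfulSMul.algebraMap_eq_zero_iff, Finset.prod_eq_zero_iff]
  rintro ⟨i, -, hi⟩
  exact (LinearMap.charpoly_monic _).ne_zero (reverse_eq_zero.1 hi)

theorem map_prod_eq_revPoly (p : ℕ) [Fact p.Prime] {E : Type*} [Field E] [IsAlgClosed E]
    [CharP E p] (φ : K →+* E) (f : End K V) (I : Finset ℕ) :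
    (∏ i ∈ I, (exteriorPower.map i f).charpoly.reverse).map φ =
      revPoly (subProducts (f.charpoly.map φ).roots I) := by
  rw [Polynomial.map_prod, subProducts, revPoly_sum]
  exact Finset.prod_congr rfl fun i _ => reverse_charpoly_exteriorPower_map p φ f i

theorem subProducts_add_eq (p : ℕ) [Fact p.Prime] {E : Type*} [Field E] [IsAlgClosed E]
    [CharP E p] (φ : K →+* E) {r r' : ℕ} (h : alternatingZeta f r = alternatingZeta f' r')
    (h0 : ∀ b ∈ (f.charpoly.map φ).roots, b ≠ 0) (h0' : ∀ b ∈ (f'.charpoly.map φ).roots, b ≠ 0) :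
    subProducts (f.charpoly.map φ).roots {i ∈ Finset.range (r + 1) | Odd i} +
      subProducts (f'.charpoly.map φ).roots {i ∈ Finset.range (r' + 1) | ¬ Odd i} =
    subProducts (f'.charpoly.map φ).roots {i ∈ Finset.range (r' + 1) | Odd i} +
      subProducts (f.charpoly.map φ).roots {i ∈ Finset.range (r + 1) | ¬ Odd i} := by
  have hne : ∀ {s : Multiset E} (I : Finset ℕ), (∀ b ∈ s, b ≠ 0) →
      ∀ b ∈ subProducts s I, b ≠ 0 := by
    intro s I hs b hb
    obtain ⟨i, -, hi⟩ := Multiset.mem_sum.1 hb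
    obtain ⟨t, ht, rfl⟩ := Multiset.mem_map.1 hi
    exact Multiset.prod_ne_zero fun h => 
      hs _ (Multiset.mem_of_le (Multiset.mem_powersetCard.1 ht).1 h) rfl
  rw [alternatingZeta_eq, alternatingZeta_eq, div_eq_div_iff (algebraMap_prod_ne_zero _ _)
    (algebraMap_prod_ne_zero _ _), ← map_mul,
    ← map_mul] at h
  have h1 := congrArg (Polynomial.map φ) (FaithfulSMul.algebraMap_injective _ _ h)
  rw [Polynomial.map_mul, Polynomial.map_mul, map_prod_eq_revPoly p, map_prod_eq_revPoly p,
    map_prod_eq_revPoly p, map_prod_eq_revPoly p, ← revPoly_add,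
    ← revPoly_add] at h1
  refine revPoly_injective ?_ ?_ h1
  · intro b hb
    rcases Multiset.mem_add.1 hb with hb | hb
    exacts [hne _ h0 b hb, hne _ h0' b hb]
  · intro b hb
    rcases Multiset.mem_add.1 hb with hb | hb
    exacts [hne _ h0' b hb, hne _ h0 b hb]

end ZetaFactor

end

section

section SubProducts

variable {E Γ : Type*} [Field E] [LinearOrderedCommGroupWithZero Γ] {ν : E →* Γ} {g : Γ} {m m' : ℕ}
  {s s' : Multiset E}

open Classical in
theorem filter_subProducts (hg : 1 < g) (hm : 0 < m) (hmm : m ≤ m')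
    (hs : ∀ b ∈ s, ν b = g ^ m') (I : Finset ℕ) : (subProducts s I).filter (fun x => ν x = g ^ m) =
      if m = m' ∧ 1 ∈ I then s else 0 := by
  let φ : Multiset E →+ Multiset E :=
    { toFun := Multiset.filter (fun x => ν x = g ^ m)
      map_zero' := Multiset.filter_zero _
      map_add' := Multiset.filter_add _ }
  have hν : ∀ i, ∀ x ∈ (s.powersetCard i).map Multiset.prod, ν x = g ^ (m' * i) := by
    intro i x hx
    obtain ⟨t, ht, rfl⟩ := Multiset.mem_map.1 hx
    obtain ⟨hts, hcard⟩ := Multiset.mem_powersetCard.1 ht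
    rw [map_multiset_prod, Multiset.map_congr rfl fun b hb => hs b (Multiset.mem_of_le hts hb),
      Multiset.map_const', Multiset.prod_replicate, hcard, pow_mul]
  have hφ : ∀ i, φ ((s.powersetCard i).map Multiset.prod) =
      if m = m' ∧ i = 1 then s else 0 := by
    intro i
    by_cases h : m = m' ∧ i = 1
    · obtain ⟨rfl, rfl⟩ := h
      rw [if_pos ⟨rfl, rfl⟩]
      have h1 : (s.powersetCard 1).map Multiset.prod = s := by
        rw [Multiset.powersetCard_one, Multiset.map_map]
        exact (Multiset.map_congr rfl fun x _ => Multiset.prod_singleton x).trans (Multiset.map_id s)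
      rw [h1]
      exact Multiset.filter_eq_self.2 hs
    · rw [if_neg h]
      refine Multiset.filter_eq_nil.2 fun x hx hxm => h ?_
      rw [hν i x hx] at hxm
      have h2 := pow_right_injective₀ (zero_lt_one.trans hg) hg.ne' hxm
      have hi : i ≠ 0 := by
        rintro rfl
        omega
      have h3 : i = 1 := by
        by_contra h1
        have : 2 ≤ i := by omega
        nlinarith
      subst h3
      exact ⟨by omega, rfl⟩
  change φ (subProducts s I) = _
  rw [subProducts, map_sum, Finset.sum_congr rfl fun i _ => hφ i]
  by_cases hmm' : m = m'
  · simp [hmm', Finset.sum_ite_eq']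
  · simp [hmm']

theorem filter_subProducts_odd (hg : 1 < g) (hm : 0 < m) (hs : ∀ b ∈ s, ν b = g ^ m) :
    (subProducts s {i ∈ Finset.range (Multiset.card s + 1) | Odd i}).filter
      (fun x => ν x = g ^ m) = s := by
  rw [filter_subProducts hg hm le_rfl hs]
  split_ifs with h
  · rfl
  · symm
    rw [← Multiset.card_eq_zero]
    by_contra h0
    exact h ⟨rfl, Finset.mem_filter.2 ⟨Finset.mem_range.2 (by omega), odd_one⟩⟩

theorem filter_subProducts_even (hg : 1 < g) (hm : 0 < m) (hmm : m ≤ m')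
    (hs : ∀ b ∈ s, ν b = g ^ m') (N : ℕ) : (subProducts s {i ∈ Finset.range N | ¬ Odd i}).filter
      (fun x => ν x = g ^ m) = 0 := by
  rw [filter_subProducts hg hm hmm hs, if_neg]
  rintro ⟨-, h⟩
  exact (Finset.mem_filter.1 h).2 odd_one

theorem filter_subProducts_of_lt (hg : 1 < g) (hm : 0 < m) (hmm : m < m')
    (hs : ∀ b ∈ s, ν b = g ^ m') (I : Finset ℕ) : (subProducts s I).filter
      (fun x => ν x = g ^ m) = 0 := by
  rw [filter_subProducts hg hm hmm.le hs, if_neg fun h => hmm.ne h.1]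

/-- A multiset of elements of the same valuation can be read off from its products of odd and of
even length. -/
theorem eq_of_subProducts_add_eq (hg : 1 < g) (hm : 0 < m) (hm' : 0 < m')
    (hs : ∀ b ∈ s, ν b = g ^ m) (hs' : ∀ b ∈ s', ν b = g ^ m')
    (h : subProducts s {i ∈ Finset.range (Multiset.card s + 1) | Odd i} +
        subProducts s' {i ∈ Finset.range (Multiset.card s' + 1) | ¬ Odd i} =
      subProducts s' {i ∈ Finset.range (Multiset.card s' + 1) | Odd i} +
        subProducts s {i ∈ Finset.range (Multiset.card s + 1) | ¬ Odd i}) : s = s' := by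
  have key : ∀ {m : ℕ}, 0 < m → (∀ b ∈ s, ν b = g ^ m) → (∀ b ∈ s', ν b = g ^ m) → s = s' := by
    intro m hm hs hs'
    have h1 := congrArg (Multiset.filter fun x => ν x = g ^ m) h
    rwa [Multiset.filter_add, Multiset.filter_add, filter_subProducts_odd hg hm hs,
      filter_subProducts_odd hg hm hs', filter_subProducts_even hg hm le_rfl hs,
      filter_subProducts_even hg hm le_rfl hs', add_zero, add_zero] at h1
  rcases lt_trichotomy m m' with hlt | rfl | hlt
  · have h1 := congrArg (Multiset.filter fun x => ν x = g ^ m) h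
    rw [Multiset.filter_add, Multiset.filter_add, filter_subProducts_odd hg hm hs,
      filter_subProducts_of_lt hg hm hlt hs', filter_subProducts_of_lt hg hm hlt hs',
      filter_subProducts_even hg hm le_rfl hs, add_zero, add_zero] at h1
    exact key hm' (by simp [h1]) hs'
  · exact key hm hs hs'
  · have h1 := congrArg (Multiset.filter fun x => ν x = g ^ m') h
    rw [Multiset.filter_add, Multiset.filter_add, filter_subProducts_odd hg hm' hs',
      filter_subProducts_of_lt hg hm' hlt hs, filter_subProducts_of_lt hg hm' hlt hs,
      filter_subProducts_even hg hm' le_rfl hs', add_zero, add_zero] at h1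
    exact key hm hs (by simp [← h1])

end SubProducts

end

section
open Module Polynomial

section Purity

theorem OL.finite {Fq A Q L : Type*} [Field Fq] [CommRing A] [Algebra Fq A] [Field Q]
    [Algebra Fq Q] [Algebra A Q] [IsScalarTower Fq A Q] [Field L] [Algebra Fq L] [Finite L]
    (inf : InftyPoint Fq A Q) :
    letI : Algebra inf.O (OL L inf) := (OtoOL L inf).toAlgebra
    Module.Finite inf.O (OL L inf) := by
  let : Algebra inf.O (OL L inf) := (OtoOL L inf).toAlgebra
  refine Module.Finite.of_fg_top (Submodule.fg_def.2
    ⟨Set.range (LtoOL L inf), Set.finite_range _, ?_⟩)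
  rw [eq_top_iff]
  rintro z -
  induction z using OL.induction with
  | h0 => exact zero_mem _
  | hmk a l => exact Submodule.smul_mem _ a (Submodule.subset_span ⟨l, rfl⟩)
  | hadd r s hr hs => exact add_mem hr hs

/-- A surjective endomorphism of a finite module is annihilated by a polynomial with constant
coefficient `1`. -/
theorem exists_aeval_eq_zero_of_surjective {R N : Type*} [CommRing R] [AddCommGroup N] [Module R N]
    [Module.Finite R N] (T : End R N) (hT : Function.Surjective T) :
    ∃ q r : R[X], q = 1 + X * r ∧ aeval T q = 0 := by
  obtain ⟨q, hq, h⟩ := Submodule.exists_sub_one_mem_and_smul_eq_zero_of_fg_of_le_smul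
    (Ideal.span {(X : R[X])}) (⊤ : Submodule R[X] (AEval' T)) Module.Finite.fg_top (by
      rintro m -
      obtain ⟨x, rfl⟩ := (AEval'.of T).surjective m
      obtain ⟨y, rfl⟩ := hT x
      rw [← AEval'.X_smul_of]
      exact Submodule.smul_mem_smul (Ideal.mem_span_singleton_self _) trivial)
  obtain ⟨r, hr⟩ := Ideal.mem_span_singleton.1 hq
  refine ⟨q, r, by rw [← hr]; ring, LinearMap.ext fun x => ?_⟩
  have h1 := h (AEval'.of T x) trivial
  rw [AEval'.of, ← AEval.of_aeval_smul] at h1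
  exact (AEval'.of T).map_eq_zero_iff.1 h1

variable {Fq A Q L : Type*}
  [Field Fq] [Fintype Fq] [CommRing A] [Algebra Fq A]
  [Field Q] [Algebra Fq Q] [Algebra A Q] [IsScalarTower Fq A Q] [IsDedekindDomain A]
  [IsFractionRing A Q] [Field L] [Finite L] [Algebra Fq L]
  {inf : InftyPoint Fq A Q}

/-- An automorphism of the fibre at `∞` of a bundle is annihilated by a monic polynomial and by
a polynomial with constant coefficient `1`, both with coefficients in the local ring at `∞`. -/
theorem Bundle.exists_aeval_eq_zero (E : Bundle.{w} L inf) (T : End (QL Fq Q L) E.V)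
    (hT : ∀ x ∈ E.N, T x ∈ E.N) (hsurj : ∀ y ∈ E.N, ∃ x ∈ E.N, T x = y) :
    (∃ h : inf.O[X], h.Monic ∧ aeval T (h.map inf.O.subtype) = 0) ∧
    ∃ q r : inf.O[X], q = 1 + X * r ∧ aeval T (q.map inf.O.subtype) = 0 := by
  let : Algebra inf.O (OL L inf) := (OtoOL L inf).toAlgebra
  let : Module inf.O E.N := Module.compHom _ (OtoOL L inf)
  have : IsScalarTower inf.O (OL L inf) E.N := IsScalarTower.of_compHom _ _ _
  have := OL.finite (L := L) inf
  have : Module.Finite (OL L inf) E.N := Module.Finite.iff_fg.2 E.N_fg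
  have : Module.Finite inf.O E.N := Module.Finite.trans (OL L inf) _
  have hsm : ∀ (a : inf.O) (x : E.N), ((a • x : E.N) : E.V) = (a : Q) • (x : E.V) := by
    intro a x
    change (algebraMap Q (QL Fq Q L) a) • (x : E.V) = _
    rw [algebraMap_smul]
  let S : End inf.O E.N :=
    { toFun := fun x => ⟨T x, hT x x.2⟩
      map_add' := fun x y => Subtype.ext (map_add T _ _)
      map_smul' := fun a x => Subtype.ext (by
        change T ((a • x : E.N) : E.V) = ((a • _ : E.N) : E.V)
        rw [hsm, hsm]
        exact LinearMap.map_smul_of_tower T _ _) }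
  have hS : ∀ n x, ((S ^ n) x : E.V) = (T ^ n) x := by
    intro n
    induction n with
    | zero => intro x; rfl
    | succ n ih =>
      intro x
      rw [pow_succ', pow_succ', End.mul_apply, End.mul_apply, ← ih]
      rfl
  have key : ∀ (p : inf.O[X]) (x : E.N), ((aeval S p x : E.N) : E.V) =
      aeval T (p.map inf.O.subtype) (x : E.V) := by
    intro p x
    induction p using Polynomial.induction_on' with
    | add p q hp hq =>
      rw [map_add, LinearMap.add_apply, Polynomial.map_add, map_add, LinearMap.add_apply, ← hp,
        ← hq]
      rfl
    | monomial n a =>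
      rw [map_monomial, aeval_monomial, aeval_monomial, ← Algebra.smul_def, ← Algebra.smul_def,
        LinearMap.smul_apply, LinearMap.smul_apply, hsm, hS]
      rfl
  have hzero : ∀ p : inf.O[X], aeval S p = 0 → aeval T (p.map inf.O.subtype) = 0 := by
    intro p hp
    refine LinearMap.ext fun x => ?_
    obtain ⟨n, hn⟩ := E.exists_unif_pow_smul_mem_N x
    have h1 := key p ⟨_, hn⟩
    rw [hp] at h1
    have h2 : inf.unif ^ n • aeval T (p.map inf.O.subtype) x = 0 := by
      rw [← LinearMap.map_smul_of_tower]
      exact h1.symm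
    exact (smul_eq_zero.1 h2).resolve_left (pow_ne_zero _ inf.unif_ne_zero)
  constructor
  · obtain ⟨h, hm, h0⟩ := LinearMap.exists_monic_and_aeval_eq_zero inf.O S
    exact ⟨h, hm, hzero h h0⟩
  · obtain ⟨q, r, hqr, h0⟩ := exists_aeval_eq_zero_of_surjective S fun y => by
      obtain ⟨x, hx, hxy⟩ := hsurj y y.2
      exact ⟨⟨x, hx⟩, Subtype.ext hxy⟩
    exact ⟨q, r, hqr, hzero q h0⟩

/-- If a valuation ring contains the image of a ring, then the common roots of a monic polynomial
and a polynomial with constant coefficient `1` have valuation `1`. -/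
theorem valuation_eq_one_of_eval {R E : Type*} [CommRing R] [Field E] (W : ValuationSubring E)
    (f : R →+* E) (hf : ∀ a, f a ∈ W) {b : E} {h q r : R[X]} (hm : h.Monic)
    (hb : h.eval₂ f b = 0) (hq : q = 1 + X * r) (hqb : q.eval₂ f b = 0) : W.valuation b = 1 := by
  let g : R →+* W := f.codRestrict W.toSubring hf
  have hg : ∀ p : R[X], p.eval₂ f b = (p.map g).eval₂ (algebraMap W E) b := by
    intro p
    rw [eval₂_map]
    rfl
  obtain ⟨y, rfl⟩ := IsIntegrallyClosed.algebraMap_eq_of_integral (R := W)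
    (show IsIntegral W b from ⟨h.map g, hm.map g, by rw [← hg, hb]⟩)
  rw [hg, hq, eval₂_at_apply, Polynomial.map_add, Polynomial.map_mul, Polynomial.map_one,
    map_X, eval_add, eval_mul, eval_one, eval_X] at hqb
  have h1 : 1 + y * (r.map g).eval y = 0 := Subtype.ext hqb
  refine (W.valuation_eq_one_iff y).1 (IsUnit.of_mul_eq_one (-(r.map g).eval y) ?_)
  linear_combination -h1

end Purity

end

section
open Module Polynomial

theorem charpoly_map_eq_of_conj {R S B n : Type*} [CommRing R] [CommRing S] [CommRing B]
    [Fintype n] [DecidableEq n] (f : R →+* B) (j : S →+* B) {M : Matrix n n R} {N : Matrix n n S}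
    (D D' : Matrix n n B) (hD : D * D' = 1) (hD' : D' * D = 1)
    (h : M.map f * D = D * N.map j) : M.charpoly.map f = N.charpoly.map j := by
  have h1 : M.map f = D * N.map j * D' := by
    rw [← h, Matrix.mul_assoc, hD, Matrix.mul_one]
  rw [← Matrix.charpoly_map, ← Matrix.charpoly_map, h1]
  rw [← Matrix.inv_eq_right_inv hD]
  exact Matrix.charpoly_units_conj ⟨D, D', hD, hD'⟩ _

theorem charpoly_toMatrix_eq_charpoly_toMatrix {R V n n' : Type*} [CommRing R] [AddCommGroup V]
    [Module R V] [Fintype n] [DecidableEq n] [Fintype n'] [DecidableEq n'] (b : Basis n R V)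
    (b' : Basis n' R V) (g : End R V) :
    (LinearMap.toMatrix b b g).charpoly = (LinearMap.toMatrix b' b' g).charpoly := by
  have := Module.Finite.of_basis b
  have := Module.Free.of_basis b
  exact (LinearMap.charpoly_toMatrix g b).trans (LinearMap.charpoly_toMatrix g b').symm

namespace AbelianTauSheaf

variable {Fq Q : Type*} {A : Type uA} {L : Type uL}
  [Field Fq] [Fintype Fq] [CommRing A] [Algebra Fq A] [Algebra.FiniteType Fq A]
  [Field Q] [Algebra Fq Q] [Algebra A Q] [IsScalarTower Fq A Q] [IsDedekindDomain A]
  [IsFractionRing A Q] [Field L] [Finite L] [Algebra Fq L]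
  {inf : InftyPoint Fq A Q} {c : CharMap Fq A L}
  {F F' : AbelianTauSheaf.{w} inf c} {v : IsDedekindDomain.HeightOneSpectrum A}

theorem unif_pow_smul_frobenius_mem_iff (hc : c.NeInfty) {k l : ℕ}
    (h : ∀ (n i : ℤ) (x : (F.E 0).V),
      x ∈ F.lattice (i + n * l) ↔ inf.unif ^ (n * k) • x ∈ F.lattice i) (x : (F.E 0).V) :
    inf.unif ^ (finrank Fq L * k) • (F.frobeniusMap 0 ^ l) x ∈ (F.E 0).N ↔ x ∈ (F.E 0).N := by
  have h0 : ∀ y : (F.E 0).V, y ∈ F.lattice 0 ↔ y ∈ (F.E 0).N := fun y => by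
    rw [mem_lattice, theta_zero]
  have h1 : (F.frobeniusMap 0 ^ l) x = (F.phi 0)^[finrank Fq L * l] x := by
    rw [Function.iterate_mul, Module.End.pow_apply]
    exact congrFun (congrArg (fun g => g^[l]) (funext (F.frobeniusMap_apply 0))) x
  have h2 := h (finrank Fq L) 0 ((F.phi 0)^[finrank Fq L * l] x)
  rw [← h0, ← h0, h1, ← F.phi_iterate_mem_lattice_iff hc (finrank Fq L * l) 0 x, Nat.cast_mul, h2,
    ← Nat.cast_mul, zpow_natCast]

/-- The polynomials at `∞` which annihilate `z ^ (e * k) * π ^ l`. -/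
theorem exists_eval_roots_eq_zero (hc : c.NeInfty) : ∃ k l : ℕ, 0 < k ∧ 0 < l ∧
    ∃ h q r : inf.O[X], h.Monic ∧ q = 1 + X * r ∧ ∀ v, c.NePlace v →
    ∀ {E : Type*} [Field E] (φ : Qv A v →+* E) (b : E), b ∈ ((F.chi v).map φ).roots →
      h.eval₂ ((φ.comp (algebraMap Q _)).comp inf.O.subtype)
        (φ (algebraMap Q _ (inf.unif ^ (finrank Fq L * k))) * b ^ l) = 0 ∧ 
      q.eval₂ ((φ.comp (algebraMap Q _)).comp inf.O.subtype)
        (φ (algebraMap Q _ (inf.unif ^ (finrank Fq L * k))) * b ^ l) = 0 := by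
  obtain ⟨k, l, hk, hl, -, hper⟩ := F.exists_period
  have hmem := F.unif_pow_smul_frobenius_mem_iff hc hper
  have hz : inf.unif ^ (finrank Fq L * k) ≠ 0 := pow_ne_zero _ inf.unif_ne_zero
  let P : Q[X] := C (inf.unif ^ (finrank Fq L * k)) * X ^ l
  have hP : ∀ x, aeval (F.frobeniusMap 0) P x =
      inf.unif ^ (finrank Fq L * k) • (F.frobeniusMap 0 ^ l) x := by
    intro x
    rw [map_mul, aeval_C, aeval_X_pow, ← Algebra.smul_def]
    rfl
  have hsurj : Function.Surjective (F.frobeniusMap 0) := by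
    rw [show ⇑(F.frobeniusMap 0) = (F.phi 0)^[finrank Fq L] from funext (F.frobeniusMap_apply 0)]
    exact F.phi_surjective.iterate _
  obtain ⟨⟨h, hm, h0⟩, q, r, hqr, hq0⟩ := (F.E 0).exists_aeval_eq_zero
    (aeval (F.frobeniusMap 0) P) (fun x hx => by rw [hP]; exact (hmem x).2 hx) (fun y hy => by
      obtain ⟨x, hx⟩ := hsurj.iterate l ((inf.unif ^ (finrank Fq L * k))⁻¹ • y)
      have h1 : aeval (F.frobeniusMap 0) P x = y := by
        rw [hP, Module.End.pow_apply, hx, smul_smul, mul_inv_cancel₀ hz, one_smul]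
      exact ⟨x, (hmem x).1 (by rwa [← hP, h1]), h1⟩)
  refine ⟨k, l, hk, hl, h, q, r, hm, hqr, fun v hv E _ φ b hb => ?_⟩
  have := F.finite_V v hv
  have key : ∀ p : inf.O[X], aeval (aeval (F.frobeniusMap 0) P) (p.map inf.O.subtype) = 0 →
      p.eval₂ ((φ.comp (algebraMap Q _)).comp inf.O.subtype)
        (φ (algebraMap Q _ (inf.unif ^ (finrank Fq L * k))) * b ^ l) = 0 := by
    intro p hp
    rw [← aeval_comp, ← F.aeval_piV_eq_zero_iff v hv] at hp
    have h1 := Polynomial.map_dvd φ (charpoly_dvd_pow _ _ hp)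
    rw [chi_eq F v hv] at hb
    have h2 := (isRoot_of_mem_roots hb).dvd h1
    rw [Polynomial.map_pow, IsRoot.def, eval_pow] at h2
    have h3 := eq_zero_of_pow_eq_zero h2
    rw [Polynomial.map_map, eval_map, eval₂_comp, eval₂_map] at h3
    rw [← h3]
    congr 1
    simp only [P, eval₂_mul, eval₂_C, eval₂_X_pow, RingHom.comp_apply]
  exact ⟨key h h0, key q hq0⟩

/-- All roots of `χ_v` have the same valuation, at a suitable place over `∞`. -/
theorem exists_valuation_roots (hc : c.NeInfty) : ∃ k l : ℕ, 0 < k ∧ 0 < l ∧ ∀ v, c.NePlace v →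
    ∀ {E : Type uE} [Field E] (φ : Qv A v →+* E) (W : ValuationSubring E),
      (∀ a : inf.O, φ (algebraMap Q _ a) ∈ W) → ∀ b ∈ ((F.chi v).map φ).roots,
      W.valuation b ^ l = (W.valuation (φ (algebraMap Q _ inf.unif)))⁻¹ ^ (finrank Fq L * k) := by
  obtain ⟨k, l, hk, hl, h, q, r, hm, hqr, hE⟩ := F.exists_eval_roots_eq_zero hc
  refine ⟨k, l, hk, hl, fun v hv E _ φ W hW b hb => ?_⟩
  obtain ⟨h1, h2⟩ := hE v hv φ b hb
  have h3 := valuation_eq_one_of_eval W ((φ.comp (algebraMap Q _)).comp inf.O.subtype) hW hm h1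
    hqr h2
  rw [map_mul, map_pow, map_pow, map_pow, map_pow] at h3
  rw [inv_pow]
  exact eq_inv_of_mul_eq_one_right h3

theorem chi_eq_chi_iff (hv : c.NePlace v) : F.chi v = F'.chi v ↔
    ∀ (r r' : ℕ) (b : Basis (Fin r) (QL Fq Q L) (F.E 0).V)
      (b' : Basis (Fin r') (QL Fq Q L) (F'.E 0).V),
      (LinearMap.toMatrix b b (F.frobeniusMap 0)).charpoly =
        (LinearMap.toMatrix b' b' (F'.frobeniusMap 0)).charpoly := by
  let := inf.fieldQL (L := L)
  obtain ⟨B, _, f, j, hfj, hcomp⟩ := exists_comparison (Fq := Fq) (Q := Q) (L := L) v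
  have key : ∀ (F : AbelianTauSheaf.{w} inf c) (r : ℕ)
      (b : Basis (Fin r) (QL Fq Q L) (F.E 0).V), (F.chi v).map f =
      (LinearMap.toMatrix b b (F.frobeniusMap 0)).charpoly.map j := by
    intro F r b0
    obtain ⟨bU, b, D, D', hD, hD', h⟩ := hcomp inf c F hv
    have := F.finite_V v hv
    rw [chi_eq F v hv, ← LinearMap.charpoly_toMatrix _ bU,
      charpoly_toMatrix_eq_charpoly_toMatrix b0 b]
    exact charpoly_map_eq_of_conj f j D D' hD hD' h
  refine ⟨fun h r r' b b' => map_injective j j.injective ?_, fun h => 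
    map_injective f f.injective ?_⟩
  · rw [← key, ← key, h]
  · obtain ⟨-, b, -⟩ := hcomp inf c F hv
    obtain ⟨-, b', -⟩ := hcomp inf c F' hv
    rw [key F _ b, key F' _ b', h]

theorem zeta_eq_alternatingZeta : F.zeta v = alternatingZeta (F.piV v) F.r := rfl

theorem chi_eq_chi_iff_zeta_eq_zeta (hc : c.NeInfty) (hv : c.NePlace v) :
    F.chi v = F'.chi v ↔ F.zeta v = F'.zeta v := by
  have := F.finite_V v hv
  have := F'.finite_V v hv
  obtain ⟨p, _⟩ := CharP.exists Fq
  have : Fact p.Prime := ⟨CharP.char_is_prime Fq p⟩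
  have : CharP Q p := charP_of_injective_algebraMap (algebraMap Fq Q).injective p
  have : CharP (Qv A v) p := charP_of_injective_algebraMap (algebraMap Q (Qv A v)).injective p
  let E := AlgebraicClosure (Qv A v)
  let φ : Qv A v →+* E := algebraMap _ _
  have : CharP E p := charP_of_injective_algebraMap φ.injective p
  have hcard : ∀ F : AbelianTauSheaf.{w} inf c, Multiset.card ((F.chi v).map φ).roots = F.r := by
    intro F
    have := F.finite_V v hv
    rw [splits_iff_card_roots.1 (IsAlgClosed.splits _), natDegree_map, chi_eq F v hv,
      LinearMap.charpoly_natDegree, finrank_V F v hv]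
  constructor
  · intro h
    have hr : F.r = F'.r := by rw [← hcard F, ← hcard F', h]
    rw [zeta_eq_alternatingZeta, zeta_eq_alternatingZeta, hr]
    rw [chi_eq F v hv, chi_eq F' v hv] at h
    exact alternatingZeta_congr p h _
  · intro h
    obtain ⟨k, l, hk, hl, hval⟩ := F.exists_valuation_roots hc
    obtain ⟨k', l', hk', hl', hval'⟩ := F'.exists_valuation_roots hc
    have := inf.isDVR
    obtain ⟨W, hW, hloc⟩ := IsLocalRing.exists_factor_valuationRing
      ((φ.comp (algebraMap Q _)).comp inf.O.subtype)
    specialize hval v hv φ W hW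
    specialize hval' v hv φ W hW
    have he : 0 < finrank Fq L := finrank_pos
    have hz0 : φ (algebraMap Q _ inf.unif) ≠ 0 := by
      rw [Ne, map_eq_zero, map_eq_zero]
      exact inf.unif_ne_zero
    have hz : 1 < (W.valuation (φ (algebraMap Q _ inf.unif)))⁻¹ := by
      rw [one_lt_inv₀ (zero_lt_iff.2 ((_root_.map_ne_zero _).2 hz0))]
      refine (W.valuation_lt_one_iff ⟨_, hW inf.unifO⟩).1 ?_
      rw [IsLocalRing.mem_maximalIdeal]
      exact fun hu => inf.irreducible_unifO.not_isUnit (hloc.map_nonunit _ hu)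
    have hne : ∀ (F : AbelianTauSheaf.{w} inf c) {k l : ℕ}, 0 < l →
        (∀ b ∈ ((F.chi v).map φ).roots, W.valuation b ^ l =
          (W.valuation (φ (algebraMap Q _ inf.unif)))⁻¹ ^ (finrank Fq L * k)) →
        ∀ b ∈ ((F.chi v).map φ).roots, b ≠ 0 := by
      rintro F k l hl hv b hb rfl
      have := hv 0 hb
      rw [map_zero, zero_pow hl.ne'] at this
      exact pow_ne_zero _ (zero_lt_one.trans hz).ne' this.symm
    rw [zeta_eq_alternatingZeta, zeta_eq_alternatingZeta] at h
    have hs := subProducts_add_eq p φ h (by rw [← chi_eq F v hv]; exact hne F hl hval)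
      (by rw [← chi_eq F' v hv]; exact hne F' hl' hval')
    rw [← chi_eq F v hv, ← chi_eq F' v hv, ← hcard F, ← hcard F'] at hs
    have hroots := eq_of_subProducts_add_eq
      (ν := (powMonoidHom (l * l')).comp W.valuation.toMonoidWithZeroHom.toMonoidHom) hz
      (Nat.mul_pos (Nat.mul_pos he hk) hl') (Nat.mul_pos (Nat.mul_pos he hk') hl)
      (fun b hb => by
        change W.valuation b ^ (l * l') = _
        rw [pow_mul, hval b hb, ← pow_mul])
      (fun b hb => by
        change W.valuation b ^ (l * l') = _
        rw [mul_comm l, pow_mul, hval' b hb, ← pow_mul]) hs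
    have hprod : ∀ F : AbelianTauSheaf.{w} inf c, (F.chi v).map φ =
        (((F.chi v).map φ).roots.map fun b => X - C b).prod := by
      intro F
      have := F.finite_V v hv
      refine (IsAlgClosed.splits _).eq_prod_roots_of_monic (Monic.map φ ?_)
      rw [chi_eq F v hv]
      exact LinearMap.charpoly_monic _
    refine map_injective φ φ.injective ?_
    rw [hprod F, hprod F', hroots]

theorem chi_eq_chi_iff_zeta_eq_zeta_at {v w : IsDedekindDomain.HeightOneSpectrum A}
    (hc : c.NeInfty) (hv : c.NePlace v) (hw : c.NePlace w) :
    F.chi v = F'.chi v ↔ F.zeta w = F'.zeta w := by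
  rw [chi_eq_chi_iff hv, ← chi_eq_chi_iff hw, chi_eq_chi_iff_zeta_eq_zeta hc hw]

end AbelianTauSheaf

end

end TauSheaf

end

theorem mainTheorem10 {Fq A Q L : Type*} [Field Fq] [Fintype Fq]
    [CommRing A] [IsDedekindDomain A] [Algebra Fq A] [Algebra.FiniteType Fq A]
    [Field Q] [Algebra A Q] [IsFractionRing A Q] [Algebra Fq Q] [IsScalarTower Fq A Q]
    [Field L] [Finite L] [Algebra Fq L]
    (inf : TauSheaf.InftyPoint Fq A Q) (c : TauSheaf.CharMap Fq A L)
    (F F' : TauSheaf.AbelianTauSheaf inf c)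
    (v : IsDedekindDomain.HeightOneSpectrum A) (hv : c.NePlace v)
    (hweight : c.NeInfty ∨ F.weight = F'.weight) :
    -- first list of conditions
    (F.QuasiIsogenousToQuotient F' → F.TateIsoQuotient F' v) ∧
    (F.TateIsoQuotient F' v → F'.chi v ∣ F.chi v) ∧
    (F.TateIsoQuotient F' v →
      minpoly Q F'.frobenius ∣ minpoly Q F.frobenius ∧ F'.r ≤ F.r) ∧
    ((F.piV v).IsSemisimple → (F'.piV v).IsSemisimple →
      F'.chi v ∣ F.chi v → F.TateIsoQuotient F' v) ∧
    (Irreducible (minpoly Q F.frobenius) →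
      (minpoly Q F'.frobenius ∣ minpoly Q F.frobenius ∧ F'.r ≤ F.r →
        F'.chi v ∣ F.chi v ∧ F.TateIsoQuotient F' v) ∧
      ((F'.piV v).IsSemisimple → F'.chi v ∣ F.chi v → F.TateIsoQuotient F' v)) ∧
    (c.NeInfty → F.TateIsoQuotient F' v → F.QuasiIsogenousToQuotient F') ∧
    -- second list of conditions
    (F.QuasiIsogenous F' ↔ F.TateIso F' v) ∧
    (F.TateIso F' v → F.chi v = F'.chi v) ∧
    (F.TateIso F' v → minpoly Q F.frobenius = minpoly Q F'.frobenius ∧ F.r = F'.r) ∧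
    (F.TateIso F' v → F.QEndIso F') ∧
    (F.QEndIso F' → F.QEndIsoAt F' v) ∧
    (c.NeInfty → ∀ w : IsDedekindDomain.HeightOneSpectrum A, c.NePlace w →
      (F.chi v = F'.chi v ↔ F.zeta w = F'.zeta w)) ∧
    ((F.piV v).IsSemisimple → (F'.piV v).IsSemisimple →
      (F.chi v = F'.chi v → F.TateIso F' v) ∧
      (F.QEndIsoAt F' v → F.chi v = F'.chi v)) ∧
    (Irreducible (minpoly Q F.frobenius) → Irreducible (minpoly Q F'.frobenius) →
      (F.chi v = F'.chi v → F.TateIso F' v) ∧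
      (minpoly Q F.frobenius = minpoly Q F'.frobenius ∧ F.r = F'.r → F.chi v = F'.chi v) ∧
      (F.QEndIsoAt F' v →
        minpoly Q F.frobenius = minpoly Q F'.frobenius ∧ F.r = F'.r)) := by

  have hQ : F.TateIsoQuotient F' v ↔ F.PhiSurj F' :=
    (F.tateIsoQuotient_iff F' v hv).trans (F.tateSurj_iff_phiSurj F' v hv)
  have hT := F.tateIsoQuotient_iff F' v hv
  have hI := F.tateIso_iff F' v hv
  have hP := F.tateSurj_iff_phiSurj F' v hv
  refine ⟨fun h => hQ.2 (F.phiSurj_of_quasiIsogenousToQuotient F' h),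
    fun h => (hT.1 h).chi_dvd hv,
    fun h => ⟨(hT.1 h).minpoly_dvd hv, (hT.1 h).r_le hv⟩,
    fun hs hs' h => hT.2 (TauSheaf.AbelianTauSheaf.tateSurj_of_chi_dvd hv hs hs' h),
    fun hm => ⟨fun h => ?_, fun hs' h => ?_⟩,
    fun hc h => (hQ.1 h).quasiIsogenousToQuotient hc,
    ⟨fun h => ?_, fun h => ?_⟩,
    fun h => TauSheaf.AbelianTauSheaf.chi_eq_of_tateSurj hv (hI.1 h).1 (hI.1 h).2,
    fun h => ⟨?_, (hI.1 h).2⟩,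
    fun h => (hP.1 (hI.1 h).1).qendIso (hI.1 h).2,
    fun h => h.at,
    fun hc w hw => ?_,
    fun hs hs' => ⟨fun h => ?_, fun h => ?_⟩,
    fun hm hm' => ⟨fun h => ?_, fun h => ?_, fun h => ?_⟩⟩
  · have := TauSheaf.AbelianTauSheaf.tateSurj_of_minpoly_dvd hv hm h.1 h.2
    exact ⟨this.chi_dvd hv, hT.2 this⟩
  · exact hT.2 (TauSheaf.AbelianTauSheaf.tateSurj_of_minpoly_dvd hv hm
      (TauSheaf.AbelianTauSheaf.minpoly_dvd_of_chi_dvd hv hs' h)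
      (TauSheaf.AbelianTauSheaf.r_le_of_chi_dvd hv h))
  · obtain ⟨h1, h2, -⟩ := (F.quasiIsogenous_iff F').1 h
    exact hI.2 ⟨hP.2 h1, h2⟩
  · obtain ⟨h1, h2⟩ := hI.1 h
    exact (F.quasiIsogenous_iff F').2 ⟨hP.1 h1, h2, (hP.1 h1).d_eq h2 hweight⟩
  · obtain ⟨h1, h2⟩ := hI.1 h
    exact Polynomial.eq_of_monic_of_associated (minpoly.monic (Algebra.IsIntegral.isIntegral _))
      (minpoly.monic (Algebra.IsIntegral.isIntegral _))
      (associated_of_dvd_dvd ((h1.symm hv h2).minpoly_dvd hv) (h1.minpoly_dvd hv))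
  · exact TauSheaf.AbelianTauSheaf.chi_eq_chi_iff_zeta_eq_zeta_at hc hv hw
  · exact hI.2 ⟨TauSheaf.AbelianTauSheaf.tateSurj_of_chi_dvd hv hs hs' h.symm.dvd,
      le_antisymm (TauSheaf.AbelianTauSheaf.r_le_of_chi_dvd hv h.dvd)
        (TauSheaf.AbelianTauSheaf.r_le_of_chi_dvd hv h.symm.dvd)⟩
  · have h1 := h.tateSurj hv hs hs'
    exact TauSheaf.AbelianTauSheaf.chi_eq_of_tateSurj hv h1
      (le_antisymm ((h.symm.tateSurj hv hs' hs).r_le hv) (h1.r_le hv))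
  · exact hI.2 ⟨TauSheaf.AbelianTauSheaf.tateSurj_of_minpoly_dvd hv hm
      (TauSheaf.AbelianTauSheaf.minpoly_dvd_of_chi_dvd_of_irreducible hv hm' h.symm.dvd)
      (TauSheaf.AbelianTauSheaf.r_le_of_chi_dvd hv h.symm.dvd),
      le_antisymm (TauSheaf.AbelianTauSheaf.r_le_of_chi_dvd hv h.dvd)
        (TauSheaf.AbelianTauSheaf.r_le_of_chi_dvd hv h.symm.dvd)⟩
  · exact TauSheaf.AbelianTauSheaf.chi_eq_of_tateSurj hv
      (TauSheaf.AbelianTauSheaf.tateSurj_of_minpoly_dvd hv hm h.1.symm.dvd h.2.symm.le) h.2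
  · exact ⟨h.minpoly_eq, le_antisymm (h.r_le hm) (h.symm.r_le hm')⟩
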